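/- **Generalized Levinson's theorem.** Let $m>1$ be real and let $\epsilon(k)=\mathrm{sign}(k)|k|^m$ (antisymmetric dispersion) or $\epsilon(k)=|k|^m$ (symmetric dispersion), $k\in\mathbb R$. Let $N\ge 0$ and let $v=(V_1,\dots,V_N):\mathbb R\to\mathbb C^N$ be analytic at $k=0$ and such that, for some constants $C,p,q,\alpha$ with $2p<m-1$ and $\alpha>0$, $\|v(k)\|\le C(1+|k|)^p$ for all $k$ and $\|v(k)-v(l)\|\le C(1+|k|)^q|k-l|^\alpha$ whenever $|k-l|\le 1$. For $\omega$ outside the range of $\epsilon$ put $$K(\omega)=\int_{\mathbb R}\frac{v(k)v(k)^\dagger}{\omega-\epsilon(k)}\,dk,\qquad \mathbf J(\omega)=\begin{cases}K(\omega)+K^R-\omega\mathbb 1_N&\text{(}N\text{ emitters, }K^R\in\mathbb C^{N\times N}\text{ arbitrary)},\\ K(\omega)-U^{-1}&\text{(separable potential, }U\in\mathbb C^{N\times N}\text{ invertible)},\end{cases}$$ and $J(\omega)=\det\mathbf J(\omega)$; for a separable potential write $K^R=-U^{-1}$. The *bound states* are the zeros of $J$ outside the range of $\epsilon$, and $N_B$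 is their number, counted with multiplicity as zeros of $J$. The system is *critical* if there are $N\times N$ matrices $\delta K_n\to 0$ and complex numbers $E_n\to 0$ outside the range of $\epsilon$ with $\det(\mathbf J(E_n)+\delta K_n)=0$ for all $n$. The continuum is $(-\infty,0)\cup(0,\infty)$ for antisymmetric and $(0,\infty)$ for symmetric dispersion. For $E$ in it let $\mathbf J(E\pm i0)=\lim_{\eta\to0^+}\mathbf J(E\pm i\eta)$ and $J(E\pm i0)=\det\mathbf J(E\pm i0)$. For antisymmetric dispersion let $S(E)=J(E-i0)/J(E+i0)$. For symmetric dispersion let $\mathbf S(E)$ be the $2\times2$ matrix with entries $$S_{\alpha\beta}(E)=\delta_{\alpha\beta}+2\pi i\,\tfrac{1}{m}E^{1/m-1}\,v_\beta(E^{1/m})^\dagger\,\mathbf J(E+i0)^{-1}\,v_\alpha(E^{1/m}),\qquad v_{\mathrm e/\mathrm o}(k)=\tfrac{1}{\sqrt2}\,(v(k)\pm v(-k)),\quad \alpha,\beta\in\{\mathrm e,\mathrm o\},$$ and let $S(E)=\det\mathbf S(E)$. Let $\mathcal N$ be the set of integers $0\le n\le (m-1)/2$ such that the $n$-th Taylor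 coefficient of $v$ at $0$ is not in the complex linear span of the Taylor coefficients of lower order. Let $D=|\mathcal N|$, $n_{\mathrm A}=\sum_{n\in\mathcal N}(2n+1)$, and let $n_{\mathrm e}$, $n_{\mathrm o}$ be the same sum restricted to the even, respectively odd, $n\in\mathcal N$. Put $n_{\mathrm R}=Dm-n_{\mathrm A}$ for antisymmetric and $n_{\mathrm R}=Dm-n_{\mathrm e}-n_{\mathrm o}$ for symmetric dispersion. Put $\Delta N=N-N_B$ for emitters and $\Delta N=-N_B$ for separable potentials. Suppose that the system is not critical, that it has no bound states in the continuum ($J(E+i0)\neq0$ for every $E$ in the continuum), and that $S(E)\ne0$ for every $E$ in the continuum. Then there are finitely many bound states; there is a real function $\delta$, continuous on the continuum, with $S(E)=|S(E)|e^{2i\delta(E)}$; and every such $\delta$ has finite limits at the ends of the intervals that make up the continuum, and its total change $$\Delta\delta=\begin{cases}[\delta(0^-)-\delta(-\infty)]+[\delta(+\infty)-\delta(0^+)]&\text{(antisymmetric)},\\ \delta(+\infty)-\delta(0^+)&\text{(symmetric)}\end{cases}$$ satisfies $$\Delta\delta=\pi\,\Delta N+\pi\,\frac{n_{\mathrm R}}{m}.$$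 -/

import Mathlib

open Filter Topology MeasureTheory Set

noncomputable section

namespace WaveguideScattering

/-- Antisymmetric dispersion `ε(k) = sign(k) |k| ^ m`. -/
def antiDispersion (m k : ℝ) : ℝ := Real.sign k * |k| ^ m

/-- Symmetric dispersion `ε(k) = |k| ^ m`. -/
def symDispersion (m k : ℝ) : ℝ := |k| ^ m

variable {N : ℕ}

/-- The coupling vector `v(k) = (V_1(k), …, V_N(k))`: analytic at `k = 0`, locally Hölder continuous
with polynomially bounded constants, and of growth `O(|k| ^ p)` with `2 p < m - 1`, which makes the
self-energy integral absolutely convergent. -/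
def AdmissibleCoupling (m : ℝ) (v : ℝ → EuclideanSpace ℂ (Fin N)) : Prop :=
  AnalyticAt ℝ v 0 ∧
    ∃ C p q α : ℝ, 2 * p < m - 1 ∧ 0 < α ∧
      (∀ k, ‖v k‖ ≤ C * (1 + |k|) ^ p) ∧
      ∀ k l, |k - l| ≤ 1 → ‖v k - v l‖ ≤ C * (1 + |k|) ^ q * |k - l| ^ α

/-- The localized scatterer: `N` emitters with complex interaction matrix `K^R`, or a separable
potential `U(k, k') = ∑ V_i(k)^* U_ij V_j(k')` with invertible matrix `U`. -/
inductive Scatterer (N : ℕ) : Type where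
  | emitters (KR : Matrix (Fin N) (Fin N) ℂ) : Scatterer N
  | separable (U : Matrix.GeneralLinearGroup (Fin N) ℂ) : Scatterer N

/-- The matrix `K^R`; for a separable potential it is `-U⁻¹`. -/
def Scatterer.KR : Scatterer N → Matrix (Fin N) (Fin N) ℂ
  | .emitters KR => KR
  | .separable U => -(U⁻¹ : Matrix.GeneralLinearGroup (Fin N) ℂ).val

/-- The term `ω 𝟙`, present for emitters only. -/
def Scatterer.energyTerm : Scatterer N → ℂ → Matrix (Fin N) (Fin N) ℂ
  | .emitters _, ω => ω • (1 : Matrix (Fin N) (Fin N) ℂ)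
  | .separable _, _ => 0

/-- The number of bound states before the coupling `v` is turned on. -/
def Scatterer.bareBoundStates : Scatterer N → ℕ
  | .emitters _ => N
  | .separable _ => 0

/-- The self-energy `K(ω) = ∫ |v(k)⟩⟨v(k)| / (ω - ε(k)) dk`. -/
def selfEnergy (ε : ℝ → ℝ) (v : ℝ → EuclideanSpace ℂ (Fin N)) (ω : ℂ) :
    Matrix (Fin N) (Fin N) ℂ :=
  Matrix.of fun i j => ∫ k : ℝ, v k i * (starRingEnd ℂ) (v k j) / (ω - (ε k : ℂ))

/-- The J-matrix: `K(ω) + K^R - ω 𝟙` for emitters, `K(ω) + K^R` for separable potentials. -/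
def JMatrix (ε : ℝ → ℝ) (v : ℝ → EuclideanSpace ℂ (Fin N)) (X : Scatterer N) (ω : ℂ) :
    Matrix (Fin N) (Fin N) ℂ :=
  selfEnergy ε v ω + X.KR - X.energyTerm ω

/-- The Jost function. -/
def jost (ε : ℝ → ℝ) (v : ℝ → EuclideanSpace ℂ (Fin N)) (X : Scatterer N) (ω : ℂ) : ℂ :=
  (JMatrix ε v X ω).det

/-- Bound-state energies: the complex energies off the spectrum of the free particle (the whole
real line, resp. `[0, ∞)`) at which the J-matrix is singular. -/
def boundStates (ε : ℝ → ℝ) (v : ℝ → EuclideanSpace ℂ (Fin N)) (X : Scatterer N) : Set ℂ :=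
  {ω | ω ∉ range (fun k : ℝ => (ε k : ℂ)) ∧ jost ε v X ω = 0}

/-- The number `N_B` of bound states, each energy counted with its multiplicity as a zero of the
Jost function. -/
def boundStateCount (ε : ℝ → ℝ) (v : ℝ → EuclideanSpace ℂ (Fin N)) (X : Scatterer N) : ℕ :=
  ∑ᶠ ω ∈ boundStates ε v X, analyticOrderNatAt (jost ε v X) ω

/-- The change `ΔN` of the number of bound states when the coupling is turned on. -/
def deltaN (ε : ℝ → ℝ) (v : ℝ → EuclideanSpace ℂ (Fin N)) (X : Scatterer N) : ℤ :=
  (X.bareBoundStates : ℤ) - (boundStateCount ε v X : ℤ)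

/-- A system is critical if perturbations `δK_n` of `K^R`, with operator norm tending to zero,
generate bound states whose energies tend to zero. -/
def IsCritical (ε : ℝ → ℝ) (v : ℝ → EuclideanSpace ℂ (Fin N)) (X : Scatterer N) : Prop :=
  ∃ (δK : ℕ → Matrix (Fin N) (Fin N) ℂ) (E : ℕ → ℂ),
    Tendsto (fun n => ‖Matrix.toEuclideanCLM (𝕜 := ℂ) (δK n)‖) atTop (𝓝 0) ∧
    Tendsto E atTop (𝓝 0) ∧
    ∀ n, E n ∉ range (fun k : ℝ => (ε k : ℂ)) ∧ (JMatrix ε v X (E n) + δK n).det = 0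

/-- The boundary value `J(E + i0)` of the J-matrix. -/
def JPlus (ε : ℝ → ℝ) (v : ℝ → EuclideanSpace ℂ (Fin N)) (X : Scatterer N) (E : ℝ) :
    Matrix (Fin N) (Fin N) ℂ :=
  limUnder (𝓝[>] (0 : ℝ)) fun η : ℝ => JMatrix ε v X ((E : ℂ) + (η : ℂ) * Complex.I)

/-- The boundary value `J(E - i0)` of the J-matrix. -/
def JMinus (ε : ℝ → ℝ) (v : ℝ → EuclideanSpace ℂ (Fin N)) (X : Scatterer N) (E : ℝ) :
    Matrix (Fin N) (Fin N) ℂ :=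
  limUnder (𝓝[>] (0 : ℝ)) fun η : ℝ => JMatrix ε v X ((E : ℂ) - (η : ℂ) * Complex.I)

/-- A bound state at an energy `E` inside the continuum: the J-matrix, evaluated on the physical
side `E + i0` of the branch cut, is singular. -/
def IsBoundStateInContinuum (ε : ℝ → ℝ) (v : ℝ → EuclideanSpace ℂ (Fin N)) (X : Scatterer N)
    (E : ℝ) : Prop :=
  (JPlus ε v X E).det = 0

/-- The transmission coefficient `S(E) = J(E - i0) / J(E + i0)` for antisymmetric dispersion. -/
def antiS (m : ℝ) (v : ℝ → EuclideanSpace ℂ (Fin N)) (X : Scatterer N) (E : ℝ) : ℂ :=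
  (JMinus (antiDispersion m) v X E).det / (JPlus (antiDispersion m) v X E).det

/-- The couplings to the even (`0`) and odd (`1`) parity states `(|k⟩ ± |-k⟩) / √2`. -/
def parityCoupling (v : ℝ → EuclideanSpace ℂ (Fin N)) (k : ℝ) (a : Fin 2) : Fin N → ℂ :=
  fun i => (v k i + (-1) ^ (a : ℕ) * v (-k) i) / (Real.sqrt 2 : ℂ)

/-- The `2 × 2` S-matrix for symmetric dispersion in the parity basis,
`S_{αβ}(E) = δ_{αβ} + 2πi ρ(E) ⟨v_β(k_E)| J(E + i0)⁻¹ |v_α(k_E)⟩`,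
with `k_E = E ^ (1/m)` and density of states `ρ(E) = E ^ (1/m - 1) / m`. -/
def symSMatrix (m : ℝ) (v : ℝ → EuclideanSpace ℂ (Fin N)) (X : Scatterer N) (E : ℝ) :
    Matrix (Fin 2) (Fin 2) ℂ :=
  Matrix.of fun a b =>
    (1 : Matrix (Fin 2) (Fin 2) ℂ) a b +
      2 * (Real.pi : ℂ) * Complex.I * ((|E| ^ (1 / m - 1) / m : ℝ) : ℂ) *
        (star (parityCoupling v (|E| ^ (1 / m)) b) ⬝ᵥ
          ((JPlus (symDispersion m) v X E)⁻¹.mulVec (parityCoupling v (|E| ^ (1 / m)) a)))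

open Classical in
/-- The integer set `𝒩` obtained by Gram–Schmidt orthogonalization of the Taylor coefficients of
`v` at `0`: the orders `n ≤ n_c = (m - 1) / 2` whose Taylor coefficient has a non-zero component
orthogonal to all the coefficients of lower order. -/
def integerSet (m : ℝ) (v : ℝ → EuclideanSpace ℂ (Fin N)) : Finset ℕ :=
  (Finset.range (⌊(m - 1) / 2⌋₊ + 1)).filter fun n =>
    iteratedDeriv n v 0 ∉ Submodule.span ℂ ((fun j => iteratedDeriv j v 0) '' Iio n)

/-- `∑ (2 n + 1)` over a finite set of orders: `n_A` for `𝒩`, and `n_e`, `n_o` for its subsets of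
even and odd integers. -/
def orderSum (s : Finset ℕ) : ℕ := ∑ n ∈ s, (2 * n + 1)

/-- `n_R = D m - n_A`, with `D = #𝒩`. -/
def antiNR (m : ℝ) (v : ℝ → EuclideanSpace ℂ (Fin N)) : ℝ :=
  (integerSet m v).card * m - orderSum (integerSet m v)

/-- `n_R = D m - n_e - n_o`, with `D = #𝒩`. -/
def symNR (m : ℝ) (v : ℝ → EuclideanSpace ℂ (Fin N)) : ℝ :=
  (integerSet m v).card * m - orderSum ((integerSet m v).filter fun n => Even n)
    - orderSum ((integerSet m v).filter fun n => Odd n)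

/-- `δ` is a scattering phase of `S` on the set `s` of energies: it is continuous and
`S(E) = |S(E)| exp(2 i δ(E))`. -/
def IsScatteringPhase (S : ℝ → ℂ) (s : Set ℝ) (δ : ℝ → ℝ) : Prop :=
  ContinuousOn δ s ∧
    ∀ E ∈ s, S E = (‖S E‖ : ℂ) * Complex.exp (2 * Complex.I * (δ E : ℂ))

/-- `δ` has limits along `l₁` and `l₂`, and their difference is `Δ`. -/
def HasPhaseChange (δ : ℝ → ℝ) (l₁ l₂ : Filter ℝ) (Δ : ℝ) : Prop :=
  ∃ a b : ℝ, Tendsto δ l₁ (𝓝 a) ∧ Tendsto δ l₂ (𝓝 b) ∧ b - a = Δ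

/-- The total winding phase of `S` over `(-∞, 0)` and `(0, ∞)` exists and equals `Δ`. -/
def HasTotalWindingAnti (S : ℝ → ℂ) (Δ : ℝ) : Prop :=
  (∃ δ, IsScatteringPhase S (Iio 0 ∪ Ioi 0) δ) ∧
    ∀ δ, IsScatteringPhase S (Iio 0 ∪ Ioi 0) δ →
      ∃ Δ₁ Δ₂ : ℝ, HasPhaseChange δ atBot (𝓝[<] 0) Δ₁ ∧
        HasPhaseChange δ (𝓝[>] 0) atTop Δ₂ ∧ Δ₁ + Δ₂ = Δ

/-- The total winding phase of `S` over `(0, ∞)` exists and equals `Δ`. -/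
def HasTotalWindingSym (S : ℝ → ℂ) (Δ : ℝ) : Prop :=
  (∃ δ, IsScatteringPhase S (Ioi 0) δ) ∧
    ∀ δ, IsScatteringPhase S (Ioi 0) δ → HasPhaseChange δ (𝓝[>] 0) atTop Δ

end WaveguideScattering

end

open WaveguideScattering

open WaveguideScattering Bornology

/-! Put ω = e^w. The complement of [0, ∞) becomes the strip 0 < Im w < 2π. For antisymmetric
dispersion the upper half-plane becomes the strip 0 < Im w < π, and so does the lower one after ω ↦
-ω, k ↦ -k. The edges of the strip carry the boundary values J(E ± i0), the right end is ω → ∞, and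
the left end is the threshold ω → 0. For antisymmetric dispersion S(E) is by definition a quotient
of edge values. For symmetric dispersion the jump of J across the cut is 2πi ρ(E) (v_e v_e† + v_o
v_o†), and the identity det(A + UV) = det A det(1 + V A⁻¹ U) turns det S into the quotient of the
values of det J on the two edges. A scattering phase is therefore half the difference of the phases
of det J on two edges.

The winding then follows from an argument principle on a strip of width L (`strip_phases`). Let G be
holomorphic inside, continuous and nonzero up to the edges, with the phase of e^{aw} at the right
end and of e^{bw} at the left end, up to constants. From left to right, the phase on the upper edge
minus the phase on the lower edge changes by (a - b) L - 2π (number of zeros). The width is 2π in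
all, once 2π or twice π. So half the change is π (a - b) - π N_B, and only a and b remain to be
found.

The exponent a is easy: the self-energy tends to 0 at infinity, so det J behaves like (-ω)^N for
emitters and tends to det(-U⁻¹) for separable potentials. Hence a = N or a = 0.

The exponent b is the threshold analysis (`phaseLike_leftEnd_det`). In coordinates adapted to the
Taylor coefficients of v, one component vanishes exactly to order n for each n in 𝒩, and the others
vanish to a higher order that causes no divergence. An entry with components of orders i and j
diverges like ω^{-(1 - (i + j + 1)/m)}, with a logarithm in borderline cases. Multiplying row and
column n by ω^{(1 - (2n + 1)/m)/2} therefore gives a finite limit matrix. Its block over 𝒩 is, up to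
nonzero scalings, a moment matrix ∫ k^{i+j} h(k) dk whose weight has positive real part after
multiplication by a constant, so it is invertible (`eq_zero_of_moment_form_eq_zero`). If the whole
limit were singular, a small change of the complementary block would make J singular
(`exists_singular_perturbation`), and the system would be critical. Hence b = -∑_{n ∈ 𝒩} (1 - (2n +
1)/m) = -n_R/m, and the theorem follows.

The analytic input is the transform ∫ f(k)/(ω - k^m) dk over k > 0. With k^m = e^s it is a
convolution with the kernel 1/(e^w - 1) (`logCauchy`). Subtracting the value of the density at the
singularity gives a formula that is continuous up to the edges, where the Hölder continuity of v is
used, and dominated convergence yields the behaviour at both ends. -/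

/-! ### Continuous phases on a strip -/

/-- The closed horizontal strip `0 ≤ Im w ≤ L`. -/
def closedStrip (L : ℝ) : Set ℂ := Complex.im ⁻¹' Icc 0 L

/-- The open horizontal strip `0 < Im w < L`. -/
def openStrip (L : ℝ) : Set ℂ := Complex.im ⁻¹' Ioo 0 L

/-- The left end of the closed strip. -/
def leftEnd (L : ℝ) : Filter ℂ := comap Complex.re atBot ⊓ 𝓟 (closedStrip L)

/-- The right end of the closed strip. -/
def rightEnd (L : ℝ) : Filter ℂ := comap Complex.re atTop ⊓ 𝓟 (closedStrip L)

/-- The plane is simply connected, so a map into the punctured plane lifts through the covering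
`exp`. -/
theorem exists_log_of_continuous {h : ℂ → ℂ} (hc : Continuous h) (h0 : ∀ w, h w ≠ 0) :
    ∃ g : ℂ → ℂ, Continuous g ∧ ∀ w, Complex.exp (g w) = h w := by
  obtain ⟨F, ⟨-, hF⟩, -⟩ := Complex.isCoveringMap_exp.existsUnique_continuousMap_lifts
    (f := ⟨fun w => (⟨h w, h0 w⟩ : {z : ℂ // z ≠ 0}), by fun_prop⟩) 0
    (Complex.log (h 0)) (by ext; simp [Complex.exp_log (h0 0)])
  refine ⟨F, F.continuous, fun w => ?_⟩
  have := congrFun hF w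
  simpa using congrArg Subtype.val this

/-- Convergence of e^{iu} fixes the limit of u only modulo 2π. On a connected member of the filter,
the multiple of 2π by which u differs from a continuous branch of the argument cannot jump, so u
itself converges. This is why the ends of the strip need a basis of connected sets. -/
theorem tendsto_of_tendsto_exp_mul_I {X : Type*} [TopologicalSpace X] {l : Filter X} [l.NeBot]
    (hl : ∀ s ∈ l, ∃ t ∈ l, t ⊆ s ∧ IsPreconnected t) {u : X → ℝ} (hu : Continuous u) {κ : ℂ}
    (h : Tendsto (fun w => Complex.exp (u w * Complex.I)) l (𝓝 κ)) :
    ∃ c : ℝ, Tendsto u l (𝓝 c) := by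
  have hκ : ‖κ‖ = 1 := by
    refine tendsto_nhds_unique h.norm ?_
    simp [Complex.norm_exp_ofReal_mul_I]
  have hκe : Complex.exp (Complex.arg κ * Complex.I) = κ := by
    have := Complex.norm_mul_exp_arg_mul_I κ
    rwa [hκ, Complex.ofReal_one, one_mul] at this
  set v : X → ℝ := fun w => u w - Complex.arg κ with hv
  have hvc : Continuous v := by fun_prop
  have hv1 : Tendsto (fun w => Complex.exp (v w * Complex.I)) l (𝓝 1) := by
    have : ∀ w, Complex.exp (v w * Complex.I) =
        Complex.exp (u w * Complex.I) / κ := by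
      intro w
      rw [← hκe, ← Complex.exp_sub]; congr 1; simp only [hv]; push_cast; ring
    simp_rw [this]
    have h2 := h.div_const κ
    rwa [div_self] at h2
    rintro rfl; simp at hκ
  have hslit : ∀ᶠ w in l, Complex.exp (v w * Complex.I) ∈ Complex.slitPlane :=
    hv1.eventually (Complex.isOpen_slitPlane.mem_nhds Complex.one_mem_slitPlane)
  obtain ⟨t, htl, hts, htc⟩ := hl _ hslit
  -- After rotation by arg κ the limit is 1, where the principal argument is continuous. So ε tends
  -- to 0, while (v - ε)/2π is integer valued.
  set ε : X → ℝ := fun w => Complex.arg (Complex.exp (v w * Complex.I)) with hε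
  have hε0 : Tendsto ε l (𝓝 0) := by
    have : ContinuousAt Complex.arg 1 := Complex.continuousAt_arg Complex.one_mem_slitPlane
    have := this.tendsto.comp hv1
    rw [Complex.arg_one] at this
    exact this
  have hint : ∀ w, ∃ n : ℤ, v w = ε w + n * (2 * Real.pi) := by
    intro w
    have h1 := Complex.norm_mul_exp_arg_mul_I (Complex.exp (v w * Complex.I))
    rw [Complex.norm_exp_ofReal_mul_I, Complex.ofReal_one, one_mul] at h1
    obtain ⟨n, hn⟩ := Complex.exp_eq_exp_iff_exists_int.1 h1.symm
    refine ⟨n, ?_⟩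
    have := congrArg Complex.im hn
    simpa [hε] using this
  have hcont : ContinuousOn (fun w => (v w - ε w) / (2 * Real.pi)) t := by
    refine ContinuousOn.div_const (hvc.continuousOn.sub ?_) _
    intro w hw
    refine ContinuousAt.continuousWithinAt ?_
    refine (Complex.continuousAt_arg (hts hw)).comp (f := fun w => Complex.exp (v w * Complex.I)) ?_
    have : Continuous fun w => Complex.exp (v w * Complex.I) := by fun_prop
    exact this.continuousAt
  have : DiscreteTopology (range ((↑) : ℤ → ℝ)) :=
    Int.isClosedEmbedding_coe_real.isEmbedding.toHomeomorph.symm.isEmbedding.discreteTopology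
  have hmaps : MapsTo (fun w => (v w - ε w) / (2 * Real.pi)) t (range ((↑) : ℤ → ℝ)) := by
    intro w _
    obtain ⟨n, hn⟩ := hint w
    refine ⟨n, ?_⟩
    simp only []
    rw [hn]; field_simp; ring
  obtain ⟨w₀, hw₀⟩ := l.nonempty_of_mem htl
  refine ⟨0 + (v w₀ - ε w₀) + Complex.arg κ, ?_⟩
  refine ((hε0.add_const (v w₀ - ε w₀)).add_const (Complex.arg κ)).congr' ?_
  filter_upwards [htl] with w hw
  have := htc.constant_of_mapsTo ⟨this⟩ hcont hmaps hw hw₀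
  have h2 : v w - ε w = v w₀ - ε w₀ := by
    field_simp at this; exact this
  rw [← h2]; simp only [hv]; ring

theorem convex_closedStrip_inter {L : ℝ} {I : Set ℝ} (hI : Convex ℝ I) :
    Convex ℝ (Complex.re ⁻¹' I ∩ closedStrip L) :=
  (hI.linear_preimage Complex.reLm).inter ((convex_Icc 0 L).linear_preimage Complex.imLm)

theorem leftEnd_basis {L : ℝ} (s : Set ℂ) (hs : s ∈ leftEnd L) :
    ∃ t ∈ leftEnd L, t ⊆ s ∧ IsPreconnected t := by
  rw [leftEnd, mem_inf_principal, mem_comap] at hs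
  obtain ⟨t, ht, hts⟩ := hs
  obtain ⟨a, ha⟩ := mem_atBot_sets.1 ht
  refine ⟨Complex.re ⁻¹' Iic a ∩ closedStrip L, ?_, ?_,
    (convex_closedStrip_inter (convex_Iic a)).isPreconnected⟩
  · exact inter_mem_inf (preimage_mem_comap (Iic_mem_atBot a)) (mem_principal_self _)
  · rintro w ⟨h1, h2⟩
    exact hts (ha _ h1) h2

theorem rightEnd_basis {L : ℝ} (s : Set ℂ) (hs : s ∈ rightEnd L) :
    ∃ t ∈ rightEnd L, t ⊆ s ∧ IsPreconnected t := by
  rw [rightEnd, mem_inf_principal, mem_comap] at hs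
  obtain ⟨t, ht, hts⟩ := hs
  obtain ⟨a, ha⟩ := mem_atTop_sets.1 ht
  refine ⟨Complex.re ⁻¹' Ici a ∩ closedStrip L, ?_, ?_,
    (convex_closedStrip_inter (convex_Ici a)).isPreconnected⟩
  · exact inter_mem_inf (preimage_mem_comap (Ici_mem_atTop a)) (mem_principal_self _)
  · rintro w ⟨h1, h2⟩
    exact hts (ha _ h1) h2

theorem tendsto_line_leftEnd {L y : ℝ} (hy : y ∈ Icc 0 L) :
    Tendsto (fun x : ℝ => (x : ℂ) + y * Complex.I) atBot (leftEnd L) := by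
  refine tendsto_inf.2 ⟨tendsto_comap_iff.2 ?_, tendsto_principal.2 (Eventually.of_forall ?_)⟩
  · refine tendsto_id.congr fun x => ?_
    simp
  · intro x; simpa [closedStrip] using hy

theorem tendsto_line_rightEnd {L y : ℝ} (hy : y ∈ Icc 0 L) :
    Tendsto (fun x : ℝ => (x : ℂ) + y * Complex.I) atTop (rightEnd L) := by
  refine tendsto_inf.2 ⟨tendsto_comap_iff.2 ?_, tendsto_principal.2 (Eventually.of_forall ?_)⟩
  · refine tendsto_id.congr fun x => ?_
    simp
  · intro x; simpa [closedStrip] using hy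

theorem leftEnd_neBot {L : ℝ} (hL : 0 ≤ L) : (leftEnd L).NeBot :=
  (tendsto_line_leftEnd (left_mem_Icc.2 hL)).neBot

theorem rightEnd_neBot {L : ℝ} (hL : 0 ≤ L) : (rightEnd L).NeBot :=
  (tendsto_line_rightEnd (left_mem_Icc.2 hL)).neBot

/-- `G` has continuous phases along the two edges of the strip of width `L`; these have limits at
both ends, and the phase difference between the edges grows by `T` from the left to the right. -/
def HasStripPhases (L : ℝ) (G : ℂ → ℂ) (T : ℝ) : Prop :=
  ∃ (θ₀ θ₁ : ℝ → ℝ) (a₀ b₀ a₁ b₁ : ℝ), Continuous θ₀ ∧ Continuous θ₁ ∧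
    (∀ x : ℝ, G x = ‖G x‖ * Complex.exp (θ₀ x * Complex.I)) ∧
    (∀ x : ℝ, G (x + L * Complex.I) =
      ‖G (x + L * Complex.I)‖ * Complex.exp (θ₁ x * Complex.I)) ∧
    Tendsto θ₀ atBot (𝓝 a₀) ∧ Tendsto θ₀ atTop (𝓝 b₀) ∧
    Tendsto θ₁ atBot (𝓝 a₁) ∧ Tendsto θ₁ atTop (𝓝 b₁) ∧
    (b₁ - b₀) - (a₁ - a₀) = T

/-- Along the filter `l`, the phase of `G` approaches that of `exp (a w)` up to a constant. -/
def PhaseLike (G : ℂ → ℂ) (a : ℝ) (l : Filter ℂ) : Prop :=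
  ∃ κ : ℂ, κ ≠ 0 ∧
    Tendsto (fun w => G w / ‖G w‖ * Complex.exp (-(a * w.im) * Complex.I)) l (𝓝 κ)

/-- The retraction of the plane onto the closed strip. -/
noncomputable def stripProj (L : ℝ) (w : ℂ) : ℂ := w.re + (max 0 (min w.im L) : ℝ) * Complex.I

theorem continuous_stripProj (L : ℝ) : Continuous (stripProj L) := by
  unfold stripProj; fun_prop

theorem stripProj_mem {L : ℝ} (hL : 0 ≤ L) (w : ℂ) : stripProj L w ∈ closedStrip L := by
  simp [stripProj, closedStrip, hL]

theorem stripProj_of_mem {L : ℝ} {w : ℂ} (hw : w ∈ closedStrip L) : stripProj L w = w := by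
  obtain ⟨h1, h2⟩ := hw
  rw [stripProj, min_eq_left h2, max_eq_right h1, Complex.re_add_im]

/-- Composition with the retraction onto the strip gives a nowhere zero function on the whole plane,
hence a continuous logarithm g. At an end with exponent d, Im g - d Im w converges because its
exponential does. Comparing Im w = 0 with Im w = L cancels the unknown limit and leaves d L. -/
theorem hasStripPhases_of_ne_zero {L : ℝ} (hL : 0 < L) {G : ℂ → ℂ}
    (hc : ContinuousOn G (closedStrip L)) (h0 : ∀ w ∈ closedStrip L, G w ≠ 0) {a b : ℝ}
    (hr : PhaseLike G a (rightEnd L)) (hl : PhaseLike G b (leftEnd L)) :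
    HasStripPhases L G ((a - b) * L) := by
  obtain ⟨g, hg, hge⟩ := exists_log_of_continuous
    (h := fun w => G (stripProj L w))
    (hc.comp_continuous (continuous_stripProj L) (stripProj_mem hL.le))
    (fun w => h0 _ (stripProj_mem hL.le w))
  have hph : ∀ w ∈ closedStrip L, G w / ‖G w‖ = Complex.exp ((g w).im * Complex.I) := by
    intro w hw
    have h1 : G w = Complex.exp (g w) := by rw [hge, stripProj_of_mem hw]
    rw [h1, Complex.norm_exp, div_eq_iff (by simp), Complex.ofReal_exp, ← Complex.exp_add]
    congr 1
    nth_rewrite 1 [← Complex.re_add_im (g w)]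
    ring
  have key : ∀ (l : Filter ℂ) [l.NeBot] (d : ℝ),
      (∀ s ∈ l, ∃ t ∈ l, t ⊆ s ∧ IsPreconnected t) → closedStrip L ∈ l → PhaseLike G d l →
      ∃ c : ℝ, Tendsto (fun w => (g w).im - d * w.im) l (𝓝 c) := by
    rintro l _ d hb hS ⟨κ, -, hκ⟩
    refine tendsto_of_tendsto_exp_mul_I (κ := κ) hb
      ((Complex.continuous_im.comp hg).sub (by fun_prop)) (hκ.congr' ?_)
    filter_upwards [hS] with w hw
    rw [hph w hw, ← Complex.exp_add]
    congr 1; push_cast; ring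
  have := leftEnd_neBot hL.le
  have := rightEnd_neBot hL.le
  obtain ⟨c₁, h₁⟩ := key (rightEnd L) a rightEnd_basis (mem_inf_of_right (mem_principal_self _)) hr
  obtain ⟨c₂, h₂⟩ := key (leftEnd L) b leftEnd_basis (mem_inf_of_right (mem_principal_self _)) hl
  have m0 : (0 : ℝ) ∈ Icc 0 L := left_mem_Icc.2 hL.le
  have m1 : L ∈ Icc 0 L := right_mem_Icc.2 hL.le
  have hline : ∀ y ∈ Icc 0 L, ∀ x : ℝ, G (x + y * Complex.I) =
      ‖G (x + y * Complex.I)‖ * Complex.exp ((g (x + y * Complex.I)).im * Complex.I) := by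
    intro y hy x
    have hm : (x : ℂ) + y * Complex.I ∈ closedStrip L := by simpa [closedStrip] using hy
    rw [← hph _ hm, mul_div_cancel₀]
    simpa using h0 _ hm
  have hlim : ∀ {l : Filter ℝ} {k : Filter ℂ} {y c d : ℝ},
      Tendsto (fun x : ℝ => (x : ℂ) + y * Complex.I) l k →
      Tendsto (fun w => (g w).im - d * w.im) k (𝓝 c) →
      Tendsto (fun x : ℝ => (g (x + y * Complex.I)).im) l (𝓝 (c + d * y)) := by
    intro l k y c d h1 h2
    have := (h2.comp h1).add_const (d * y)
    refine this.congr fun x => ?_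
    simp
  refine ⟨fun x => (g (x + (0 : ℝ) * Complex.I)).im, fun x => (g (x + L * Complex.I)).im,
    c₂ + b * 0, c₁ + a * 0, c₂ + b * L, c₁ + a * L, ?_, ?_, ?_, hline L m1,
    hlim (tendsto_line_leftEnd m0) h₂, hlim (tendsto_line_rightEnd m0) h₁,
    hlim (tendsto_line_leftEnd m1) h₂, hlim (tendsto_line_rightEnd m1) h₁, by ring⟩
  · exact Complex.continuous_im.comp (hg.comp (by fun_prop))
  · exact Complex.continuous_im.comp (hg.comp (by fun_prop))
  · intro x
    have := hline 0 m0 x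
    simpa using this

theorem ofReal_add_mul_I_eq_norm_mul_exp_arctan {p : ℝ} (hp : 0 < p) (q : ℝ) :
    (p : ℂ) + q * Complex.I =
      ‖(p : ℂ) + q * Complex.I‖ * Complex.exp (Real.arctan (q / p) * Complex.I) := by
  have h1 := Complex.norm_mul_exp_arg_mul_I ((p : ℂ) + q * Complex.I)
  have h2 : Complex.arg ((p : ℂ) + q * Complex.I) = Real.arctan (q / p) := by
    have hlt : |Complex.arg ((p : ℂ) + q * Complex.I)| < Real.pi / 2 :=
      Complex.abs_arg_lt_pi_div_two_iff.2 (Or.inl (by simpa using hp))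
    have ht : Real.tan (Complex.arg ((p : ℂ) + q * Complex.I)) = q / p := by
      rw [Complex.tan_arg]; simp
    rw [← ht, Real.arctan_tan (by linarith [(abs_lt.1 hlt).1]) (abs_lt.1 hlt).2]
  rw [← h2]; exact h1.symm

/-- The zero lies above the lower edge and below the upper one: the phase of w - z rises by π along
the former and falls by π along the latter. -/
theorem hasStripPhases_sub {L : ℝ} {z : ℂ} (hz : z ∈ openStrip L) :
    HasStripPhases L (fun w => w - z) (-(2 * Real.pi)) := by
  obtain ⟨hz0, hz1⟩ : 0 < z.im ∧ z.im < L := hz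
  have hz1' : 0 < L - z.im := sub_pos.2 hz1
  have t1 : ∀ {p : ℝ}, 0 < p → Tendsto (fun x : ℝ => Real.arctan ((x - z.re) / p)) atBot
      (𝓝 (-(Real.pi / 2))) := fun {p} hp =>
    (Real.tendsto_arctan_atBot.mono_right nhdsWithin_le_nhds).comp
      ((tendsto_atBot_add_const_right _ (-z.re) tendsto_id).atBot_div_const hp)
  have t2 : ∀ {p : ℝ}, 0 < p → Tendsto (fun x : ℝ => Real.arctan ((x - z.re) / p)) atTop
      (𝓝 (Real.pi / 2)) := fun {p} hp =>
    (Real.tendsto_arctan_atTop.mono_right nhdsWithin_le_nhds).comp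
      ((tendsto_atTop_add_const_right _ (-z.re) tendsto_id).atTop_div_const hp)
  refine ⟨fun x => Real.arctan ((x - z.re) / z.im) - Real.pi / 2,
    fun x => Real.pi / 2 - Real.arctan ((x - z.re) / (L - z.im)), _, _, _, _, ?_, ?_, ?_, ?_,
    (t1 hz0).sub_const _, (t2 hz0).sub_const _, (t1 hz1').const_sub _, (t2 hz1').const_sub _, ?_⟩
  · fun_prop
  · fun_prop
  · intro x
    have h := ofReal_add_mul_I_eq_norm_mul_exp_arctan hz0 (x - z.re)
    have e : (x : ℂ) - z = -Complex.I * ((z.im : ℂ) + ((x - z.re : ℝ) : ℂ) * Complex.I) := by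
      apply Complex.ext <;> simp
    have e2 : Complex.exp (-(Real.pi / 2 * Complex.I)) = -Complex.I := by
      rw [Complex.exp_neg, Complex.exp_pi_div_two_mul_I, Complex.inv_I]
    have e3 : Complex.exp (((Real.arctan ((x - z.re) / z.im) - Real.pi / 2 : ℝ) : ℂ) * Complex.I) =
        Complex.exp (Real.arctan ((x - z.re) / z.im) * Complex.I) * -Complex.I := by
      rw [← e2, ← Complex.exp_add]; congr 1; push_cast; ring
    simp only []
    rw [e, norm_mul, norm_neg, Complex.norm_I, one_mul, e3]
    nth_rewrite 1 [h]
    ring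
  · intro x
    have h := ofReal_add_mul_I_eq_norm_mul_exp_arctan hz1' (-(x - z.re))
    have e : (x : ℂ) + L * Complex.I - z =
        Complex.I * (((L - z.im : ℝ) : ℂ) + ((-(x - z.re) : ℝ) : ℂ) * Complex.I) := by
      apply Complex.ext <;> simp
    have e3 : Complex.exp (((Real.pi / 2 - Real.arctan ((x - z.re) / (L - z.im)) : ℝ) : ℂ) *
        Complex.I) = Complex.exp (Real.pi / 2 * Complex.I) *
          Complex.exp (Real.arctan (-(x - z.re) / (L - z.im)) * Complex.I) := by
      rw [← Complex.exp_add, neg_div, Real.arctan_neg]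
      congr 1; push_cast; ring
    rw [Complex.exp_pi_div_two_mul_I] at e3
    simp only []
    rw [e, norm_mul, Complex.norm_I, one_mul, e3]
    nth_rewrite 1 [h]
    ring
  · ring

theorem HasStripPhases.mul {L : ℝ} {G₁ G₂ G : ℂ → ℂ} {T₁ T₂ : ℝ} (h₁ : HasStripPhases L G₁ T₁)
    (h₂ : HasStripPhases L G₂ T₂) (hb : ∀ x : ℝ, G x = G₁ x * G₂ x)
    (ht : ∀ x : ℝ, G (x + L * Complex.I) = G₁ (x + L * Complex.I) * G₂ (x + L * Complex.I)) :
    HasStripPhases L G (T₁ + T₂) := by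
  obtain ⟨θ₀, θ₁, a₀, b₀, a₁, b₁, hc0, hc1, e0, e1, l1, l2, l3, l4, hT⟩ := h₁
  obtain ⟨θ₀', θ₁', a₀', b₀', a₁', b₁', hc0', hc1', e0', e1', l1', l2', l3', l4', hT'⟩ := h₂
  refine ⟨fun x => θ₀ x + θ₀' x, fun x => θ₁ x + θ₁' x, _, _, _, _, hc0.add hc0', hc1.add hc1',
    fun x => ?_, fun x => ?_, l1.add l1', l2.add l2', l3.add l3', l4.add l4', by
      rw [← hT, ← hT']; ring⟩
  · rw [hb, norm_mul, Complex.ofReal_mul, Complex.ofReal_add, add_mul, Complex.exp_add]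
    nth_rewrite 1 [e0 x, e0' x]
    ring
  · rw [ht, norm_mul, Complex.ofReal_mul, Complex.ofReal_add, add_mul, Complex.exp_add]
    nth_rewrite 1 [e1 x, e1' x]
    ring

/-! ### The argument principle on a strip -/

theorem isOpen_openStrip (L : ℝ) : IsOpen (openStrip L) :=
  isOpen_Ioo.preimage Complex.continuous_im

theorem isPreconnected_openStrip (L : ℝ) : IsPreconnected (openStrip L) :=
  ((convex_Ioo 0 L).linear_preimage Complex.imLm).isPreconnected

theorem openStrip_subset (L : ℝ) : openStrip L ⊆ closedStrip L :=
  preimage_mono Ioo_subset_Icc_self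

theorem mem_closedStrip_cases {L : ℝ} {w : ℂ} (hw : w ∈ closedStrip L) :
    w ∈ openStrip L ∨ w = (w.re : ℂ) ∨ w = w.re + L * Complex.I := by
  obtain ⟨h0, h1⟩ := hw
  rcases h0.eq_or_lt with h0 | h0
  · right; left; apply Complex.ext <;> simp [← h0]
  rcases h1.eq_or_lt with h1 | h1
  · right; right; apply Complex.ext <;> simp [h1]
  · exact Or.inl ⟨h0, h1⟩

theorem PhaseLike.eventually_ne_zero {G : ℂ → ℂ} {a : ℝ} {l : Filter ℂ} (h : PhaseLike G a l) :
    ∀ᶠ w in l, G w ≠ 0 := by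
  obtain ⟨κ, hκ, hl⟩ := h
  filter_upwards [hl.eventually_ne hκ] with w hw h0
  simp [h0] at hw

section zeros

variable {L : ℝ} {G : ℂ → ℂ} {a b : ℝ}

theorem exists_re_bound_of_phaseLike (hr : PhaseLike G a (rightEnd L))
    (hl : PhaseLike G b (leftEnd L)) :
    ∃ R : ℝ, ∀ w ∈ closedStrip L, R ≤ |w.re| → G w ≠ 0 := by
  have h1 := hr.eventually_ne_zero
  have h2 := hl.eventually_ne_zero
  rw [rightEnd, eventually_inf_principal, eventually_comap, eventually_atTop] at h1
  rw [leftEnd, eventually_inf_principal, eventually_comap, eventually_atBot] at h2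
  obtain ⟨R₁, h1⟩ := h1
  obtain ⟨R₂, h2⟩ := h2
  refine ⟨max R₁ (-R₂), fun w hw hR => ?_⟩
  obtain ⟨hR1, hR2⟩ := max_le_iff.1 hR
  rcases le_total 0 w.re with h | h
  · rw [abs_of_nonneg h] at hR1
    exact h1 _ hR1 w rfl hw
  · rw [abs_of_nonpos h] at hR2
    exact h2 w.re (by linarith) w rfl hw

theorem exists_mem_openStrip_re {L : ℝ} (hL : 0 < L) (R : ℝ) : ∃ w ∈ openStrip L, R ≤ |w.re| :=
  ⟨(R : ℂ) + (L / 2 : ℝ) * Complex.I, by constructor <;> simp <;> linarith,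
    by simpa using le_abs_self R⟩

/-- By the identity theorem, accumulating zeros would force G to vanish on the whole connected
strip, but the phase conditions exclude zeros far out. -/
theorem not_frequently_eq_zero (hL : 0 < L) (hd : DifferentiableOn ℂ G (openStrip L))
    (hr : PhaseLike G a (rightEnd L)) (hl : PhaseLike G b (leftEnd L)) {z : ℂ}
    (hz : z ∈ openStrip L) : ¬ ∃ᶠ w in 𝓝[≠] z, G w = 0 := by
  intro h
  obtain ⟨R, hR⟩ := exists_re_bound_of_phaseLike hr hl
  obtain ⟨w, hw, hwR⟩ := exists_mem_openStrip_re hL R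
  exact hR w (openStrip_subset L hw) hwR
    ((hd.analyticOnNhd (isOpen_openStrip L)).eqOn_zero_of_preconnected_of_frequently_eq_zero
      (isPreconnected_openStrip L) hz h hw)

/-- The zeros lie in a compact rectangle. An accumulation point would be a zero, impossible in the
interior by the identity theorem and on the edges by hypothesis. -/
theorem finite_zeros_openStrip (hL : 0 < L) (hc : ContinuousOn G (closedStrip L))
    (hd : DifferentiableOn ℂ G (openStrip L)) (hb : ∀ x : ℝ, G x ≠ 0)
    (ht : ∀ x : ℝ, G (x + L * Complex.I) ≠ 0)
    (hr : PhaseLike G a (rightEnd L)) (hl : PhaseLike G b (leftEnd L)) :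
    {w | w ∈ openStrip L ∧ G w = 0}.Finite := by
  by_contra hinf
  obtain ⟨R, hR⟩ := exists_re_bound_of_phaseLike hr hl
  have hK : IsCompact (Icc (-R) R ×ℂ Icc 0 L) := isCompact_Icc.reProdIm isCompact_Icc
  have hsub : {w | w ∈ openStrip L ∧ G w = 0} ⊆ Icc (-R) R ×ℂ Icc 0 L := by
    rintro w ⟨hw, h0⟩
    refine ⟨?_, openStrip_subset L hw⟩
    by_contra hcon
    refine hR w (openStrip_subset L hw) ?_ h0
    by_contra hlt
    exact hcon (abs_le.1 (not_le.1 hlt).le)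
  obtain ⟨z, hzK, hz⟩ := Set.Infinite.exists_accPt_of_subset_isCompact hinf hK hsub
  have hfr : ∃ᶠ w in 𝓝[≠] z, w ∈ openStrip L ∧ G w = 0 := accPt_iff_frequently_nhdsNE.1 hz
  have hzS : z ∈ closedStrip L := hzK.2
  have hz0 : G z = 0 := by
    have h1 : Tendsto G (𝓝[closedStrip L] z) (𝓝 (G z)) := hc z hzS
    by_contra hne
    have h2 := h1.eventually_ne hne
    rw [eventually_nhdsWithin_iff] at h2
    have h3 : ∃ᶠ w in 𝓝 z, w ∈ openStrip L ∧ G w = 0 :=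
      hfr.filter_mono nhdsWithin_le_nhds
    obtain ⟨w, ⟨hw1, hw2⟩, hw3⟩ := (h3.and_eventually h2).exists
    exact hw3 (openStrip_subset L hw1) hw2
  rcases mem_closedStrip_cases hzS with h | h | h
  · exact not_frequently_eq_zero hL hd hr hl h (hfr.mono fun _ h => h.2)
  · rw [h] at hz0; exact hb _ hz0
  · rw [h] at hz0; exact ht _ hz0

theorem analyticOrderAt_ne_top_openStrip (hL : 0 < L) (hd : DifferentiableOn ℂ G (openStrip L))
    (hr : PhaseLike G a (rightEnd L)) (hl : PhaseLike G b (leftEnd L)) {z : ℂ}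
    (hz : z ∈ openStrip L) : analyticOrderAt G z ≠ ⊤ := by
  intro h
  rw [analyticOrderAt_eq_top] at h
  exact not_frequently_eq_zero hL hd hr hl hz (h.filter_mono nhdsWithin_le_nhds).frequently

/-- The imaginary part stays bounded in the strip, so w - z is asymptotically its real part, whose
sign is σ. -/
theorem tendsto_norm_div_sub {l : Filter ℂ} {t : Filter ℝ} (z : ℂ) {σ : ℝ}
    (hcob : Tendsto (fun x : ℝ => x - z.re) t (cobounded ℝ))
    (hl : l ≤ comap Complex.re t ⊓ 𝓟 (closedStrip L))
    (hσ : ∀ᶠ x in t, |x - z.re| = σ * (x - z.re)) :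
    Tendsto (fun w : ℂ => (‖w - z‖ : ℂ) / (w - z)) l (𝓝 σ) := by
  have hre : Tendsto Complex.re l t := tendsto_comap.mono_left (hl.trans inf_le_left)
  have hS : closedStrip L ∈ l := hl (mem_inf_of_right (mem_principal_self _))
  have hinv : Tendsto (fun w : ℂ => (w.re - z.re)⁻¹) l (𝓝 0) :=
    (tendsto_inv₀_cobounded.comp hcob).comp hre
  have hq : Tendsto (fun w : ℂ => (w.re - z.re)⁻¹ * (w.im - z.im)) l (𝓝 0) := by
    refine hinv.zero_mul_isBoundedUnder_le ⟨|L| + |z.im|, ?_⟩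
    rw [eventually_map]
    filter_upwards [hS] with w hw
    obtain ⟨h1, h2⟩ := hw
    refine (abs_sub _ _).trans (add_le_add_left ?_ _)
    rw [abs_of_nonneg h1]; exact h2.trans (le_abs_self L)
  have hu : Tendsto (fun w : ℂ => 1 + (((w.re - z.re)⁻¹ * (w.im - z.im) : ℝ) : ℂ) * Complex.I) l
      (𝓝 1) := by
    have := (((Complex.continuous_ofReal.tendsto 0).comp hq).mul_const Complex.I).const_add 1
    simpa using this
  have h3 : Tendsto (fun w : ℂ => (σ : ℂ) *
      ((‖1 + (((w.re - z.re)⁻¹ * (w.im - z.im) : ℝ) : ℂ) * Complex.I‖ : ℂ) /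
        (1 + (((w.re - z.re)⁻¹ * (w.im - z.im) : ℝ) : ℂ) * Complex.I))) l (𝓝 σ) := by
    have := (((Complex.continuous_ofReal.tendsto _).comp hu.norm).div hu one_ne_zero).const_mul
      (σ : ℂ)
    simpa using this
  have hne : ∀ᶠ x in t, x - z.re ≠ 0 :=
    hcob.eventually (eventually_ne_cobounded 0)
  refine h3.congr' ?_
  filter_upwards [hre.eventually hσ, hre.eventually hne] with w hw hw0
  have e : w - z = ((w.re - z.re : ℝ) : ℂ) *
      (1 + (((w.re - z.re)⁻¹ * (w.im - z.im) : ℝ) : ℂ) * Complex.I) := by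
    rw [mul_add, ← mul_assoc, ← Complex.ofReal_mul, mul_inv_cancel_left₀ hw0]
    apply Complex.ext <;> simp
  have hne' : ((w.re - z.re : ℝ) : ℂ) ≠ 0 := by exact_mod_cast hw0
  conv_rhs => rw [e, norm_mul, Complex.norm_real, Real.norm_eq_abs, hw]
  generalize (1 + (((w.re - z.re)⁻¹ * (w.im - z.im) : ℝ) : ℂ) * Complex.I) = u
  rw [Complex.ofReal_mul, Complex.ofReal_mul, mul_comm (σ : ℂ) ((w.re - z.re : ℝ) : ℂ), mul_assoc,
    mul_div_mul_left _ _ hne', mul_div_assoc]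

theorem tendsto_norm_div_sub_rightEnd (z : ℂ) :
    Tendsto (fun w : ℂ => (‖w - z‖ : ℂ) / (w - z)) (rightEnd L) (𝓝 1) := by
  have := tendsto_norm_div_sub (L := L) (l := rightEnd L) z (σ := 1)
    ((tendsto_atTop_add_const_right _ (-z.re) tendsto_id).mono_right
      (by rw [IsOrderBornology.cobounded_eq]; exact le_sup_right)) le_rfl (by
    filter_upwards [eventually_ge_atTop z.re] with x hx
    rw [abs_of_nonneg (by linarith), one_mul])
  simpa using this

theorem tendsto_norm_div_sub_leftEnd (z : ℂ) :
    Tendsto (fun w : ℂ => (‖w - z‖ : ℂ) / (w - z)) (leftEnd L) (𝓝 (-1)) := by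
  have := tendsto_norm_div_sub (L := L) (l := leftEnd L) z (σ := -1)
    ((tendsto_atBot_add_const_right _ (-z.re) tendsto_id).mono_right
      (by rw [IsOrderBornology.cobounded_eq]; exact le_sup_left)) le_rfl (by
    filter_upwards [eventually_le_atBot z.re] with x hx
    rw [abs_of_nonpos (by linarith)]; ring)
  simpa using this

/-- At an end, the unit vector of w - z tends to a constant, so removing this factor changes κ but
not the exponent. -/
theorem PhaseLike.of_sub_mul {G₁ : ℂ → ℂ} {l : Filter ℂ} {z κ₀ : ℂ} (hκ₀ : κ₀ ≠ 0)
    (h : PhaseLike G a l) (hG : ∀ w, G w = (w - z) * G₁ w)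
    (hz : Tendsto (fun w : ℂ => (‖w - z‖ : ℂ) / (w - z)) l (𝓝 κ₀)) : PhaseLike G₁ a l := by
  have hne := h.eventually_ne_zero
  obtain ⟨κ, hκ, hl⟩ := h
  refine ⟨κ * κ₀, mul_ne_zero hκ hκ₀, (hl.mul hz).congr' ?_⟩
  filter_upwards [hne] with w hw
  rw [hG] at hw
  obtain ⟨h1, h2⟩ := mul_ne_zero_iff.1 hw
  have h3 : (‖w - z‖ : ℂ) ≠ 0 := by simpa using h1
  have h4 : (‖G₁ w‖ : ℂ) ≠ 0 := by simpa using h2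
  rw [hG, norm_mul]
  push_cast
  field_simp

/-- Induction on the number of zeros with multiplicity. Dividing by w - z for a zero z lowers the
number by one and keeps both exponents, and the factor w - z accounts for -2π. -/
theorem strip_phases_aux (hL : 0 < L) (n : ℕ) : ∀ (G : ℂ → ℂ),
    ContinuousOn G (closedStrip L) → DifferentiableOn ℂ G (openStrip L) →
    (∀ x : ℝ, G x ≠ 0) → (∀ x : ℝ, G (x + L * Complex.I) ≠ 0) →
    PhaseLike G a (rightEnd L) → PhaseLike G b (leftEnd L) →
    ∑ᶠ w ∈ openStrip L, analyticOrderNatAt G w = n →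
    HasStripPhases L G ((a - b) * L - 2 * Real.pi * n) := by
  have hfin : ∀ (G : ℂ → ℂ),
    ContinuousOn G (closedStrip L) → DifferentiableOn ℂ G (openStrip L) →
    (∀ x : ℝ, G x ≠ 0) → (∀ x : ℝ, G (x + L * Complex.I) ≠ 0) →
    PhaseLike G a (rightEnd L) → PhaseLike G b (leftEnd L) →
    (openStrip L ∩ Function.support (analyticOrderNatAt G)).Finite := by
    intro G hc hd hb ht hr hl
    refine (finite_zeros_openStrip hL hc hd hb ht hr hl).subset ?_
    rintro w ⟨hw, hs⟩
    exact ⟨hw, apply_eq_zero_of_analyticOrderNatAt_ne_zero hs⟩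
  have hpos : ∀ (G : ℂ → ℂ), DifferentiableOn ℂ G (openStrip L) →
    PhaseLike G a (rightEnd L) → PhaseLike G b (leftEnd L) → ∀ z ∈ openStrip L,
    G z = 0 → analyticOrderNatAt G z ≠ 0 := by
    intro G hd hr hl z hz h0 h
    have h1 := Nat.cast_analyticOrderNatAt (analyticOrderAt_ne_top_openStrip hL hd hr hl hz)
    rw [h] at h1
    have h2 := (hd.analyticOnNhd (isOpen_openStrip L) z hz).analyticOrderAt_eq_zero.1 h1.symm
    exact h2 h0
  induction n with
  | zero =>
    intro G hc hd hb ht hr hl hn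
    have h0 : ∀ w ∈ closedStrip L, G w ≠ 0 := by
      intro w hw
      rcases mem_closedStrip_cases hw with h | h | h
      · intro h0
        rw [finsum_mem_eq_sum _ (hfin G hc hd hb ht hr hl), Finset.sum_eq_zero_iff] at hn
        have h1 := hpos G hd hr hl w h h0
        exact h1 (hn w (by simp only [Finite.mem_toFinset]; exact ⟨h, h1⟩))
      · rw [h]; exact hb _
      · rw [h]; exact ht _
    simpa using hasStripPhases_of_ne_zero hL hc h0 hr hl
  | succ n ih =>
    intro G hc hd hb ht hr hl hn
    obtain ⟨z, hz, hz0⟩ : ∃ z ∈ openStrip L, G z = 0 := by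
      by_contra hno
      push Not at hno
      have : ∑ᶠ w ∈ openStrip L, analyticOrderNatAt G w = 0 := by
        refine finsum_mem_eq_zero_of_forall_eq_zero fun w hw => ?_
        by_contra h
        exact hno w hw (apply_eq_zero_of_analyticOrderNatAt_ne_zero h)
      omega
    have hzn : openStrip L ∈ 𝓝 z := (isOpen_openStrip L).mem_nhds hz
    -- `dslope` is the quotient G w / (w - z) completed by the derivative at z. It is again
    -- continuous on the closed strip and holomorphic inside.
    have hmul : ∀ w, G w = (w - z) * dslope G z w := by
      intro w
      have := sub_smul_dslope G z w
      rw [hz0, sub_zero, smul_eq_mul] at this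
      exact this.symm
    have hc1 : ContinuousOn (dslope G z) (closedStrip L) :=
      (continuousOn_dslope (mem_of_superset hzn (openStrip_subset L))).2
        ⟨hc, hd.differentiableAt hzn⟩
    have hd1 : DifferentiableOn ℂ (dslope G z) (openStrip L) :=
      (Complex.differentiableOn_dslope hzn).2 hd
    have hb1 : ∀ x : ℝ, dslope G z x ≠ 0 := fun x h => hb x (by rw [hmul, h, mul_zero])
    have ht1 : ∀ x : ℝ, dslope G z (x + L * Complex.I) ≠ 0 :=
      fun x h => ht x (by rw [hmul, h, mul_zero])
    have hr1 := hr.of_sub_mul one_ne_zero hmul (tendsto_norm_div_sub_rightEnd z)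
    have hl1 := hl.of_sub_mul (neg_ne_zero.2 one_ne_zero) hmul (tendsto_norm_div_sub_leftEnd z)
    have hsub : ∀ w, analyticOrderNatAt (fun w => w - z) w = if w = z then 1 else 0 := by
      intro w
      split_ifs with h
      · subst h
        have := analyticOrderAt_id_sub_const_self (𝕜 := ℂ) (c := w)
        exact (congrArg ENat.toNat this).trans (by simp)
      · have := analyticOrderAt_id_sub_const_of_ne (𝕜 := ℂ) h
        exact (congrArg ENat.toNat this).trans (by simp)
    have hord : ∀ w ∈ openStrip L, analyticOrderNatAt G w =
        (if w = z then 1 else 0) + analyticOrderNatAt (dslope G z) w := by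
      intro w hw
      have hG : G = (fun w => w - z) * dslope G z := funext hmul
      have ha1 := hd1.analyticOnNhd (isOpen_openStrip L) w hw
      have ha0 : AnalyticAt ℂ (fun w => w - z) w := by fun_prop
      have h1 := analyticOrderAt_ne_top_openStrip hL hd1 hr1 hl1 hw
      have h0 : analyticOrderAt (fun w => w - z) w ≠ ⊤ := by
        by_cases h : w = z
        · subst h
          have := analyticOrderAt_id_sub_const_self (𝕜 := ℂ) (c := w)
          exact fun hcon => by simpa using this.symm.trans hcon
        · have := analyticOrderAt_id_sub_const_of_ne (𝕜 := ℂ) h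
          exact fun hcon => by simpa using this.symm.trans hcon
      rw [← hsub]
      conv_lhs => rw [hG]
      exact analyticOrderNatAt_mul ha0 ha1 h0 h1
    have hsum : ∑ᶠ w ∈ openStrip L, analyticOrderNatAt (dslope G z) w = n := by
      rw [finsum_mem_congr rfl hord, finsum_mem_add_distrib' ?_ (hfin _ hc1 hd1 hb1 ht1 hr1 hl1)] at hn
      · have : ∑ᶠ w ∈ openStrip L, (if w = z then 1 else 0) = 1 := by
          rw [finsum_eq_single _ z (fun w h => by simp [h])]
          simp [hz]
        omega
      · refine (finite_singleton z).subset ?_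
        rintro w ⟨-, h⟩
        by_contra h'
        simp [show w ≠ z from h'] at h
    have := (hasStripPhases_sub hz).mul (ih _ hc1 hd1 hb1 ht1 hr1 hl1 hsum)
      (fun x => hmul x) (fun x => hmul _)
    convert this using 1
    push_cast; ring

theorem strip_phases (hL : 0 < L) (hc : ContinuousOn G (closedStrip L))
    (hd : DifferentiableOn ℂ G (openStrip L))
    (hb : ∀ x : ℝ, G x ≠ 0) (ht : ∀ x : ℝ, G (x + L * Complex.I) ≠ 0)
    (hr : PhaseLike G a (rightEnd L)) (hl : PhaseLike G b (leftEnd L)) :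
    HasStripPhases L G ((a - b) * L -
      2 * Real.pi * (∑ᶠ w ∈ openStrip L, analyticOrderNatAt G w : ℕ)) :=
  strip_phases_aux hL _ G hc hd hb ht hr hl rfl

end zeros

/-! ### The logarithmic Hilbert transform -/

/-- The kernel `1 / (e ^ w - 1)`. -/
noncomputable def expKernel (w : ℂ) : ℂ := (Complex.exp w - 1)⁻¹

/-- The weight `e ^ (-β s) + e ^ (-γ s)`. -/
noncomputable def expWeight (β γ s : ℝ) : ℝ := Real.exp (-(β * s)) + Real.exp (-(γ * s))

/-- The cutoff that isolates the singularity of the kernel. -/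
noncomputable def unitCutoff (u : ℝ) : ℂ := (Icc (-1) 1 : Set ℝ).indicator 1 u

/-- The integral of `expKernel (u + i y)` over `-1 ≤ u ≤ 1`, continued to the edges `y = 0`
and `y = 2 π`. -/
noncomputable def kernelIntegral (y : ℝ) : ℂ :=
  Complex.log (1 - Complex.exp (-1 - y * Complex.I)) -
    Complex.log (1 - Complex.exp (-1 + y * Complex.I)) - 1 + (y - Real.pi) * Complex.I

/-- The regularized integral `∫ φ (-u) / (e ^ (u + i y) - 1) du`. -/
noncomputable def logHilbert (φ : ℝ → ℂ) (y : ℝ) : ℂ :=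
  (∫ u : ℝ, (φ (-u) - unitCutoff u * φ 0) * expKernel (u + y * Complex.I)) +
    φ 0 * kernelIntegral y

/-- The regularized integral `∫ φ s / (e ^ (w - s) - 1) ds`. -/
noncomputable def logCauchy (φ : ℝ → ℂ) (w : ℂ) : ℂ := logHilbert (fun s => φ (w.re + s)) w.im

/-- Bounds on `φ` that make `logHilbert φ` well defined. -/
structure LocTame (α β γ C : ℝ) (φ : ℝ → ℂ) : Prop where
  continuous : Continuous φ
  norm_le : ∀ s, ‖φ s‖ ≤ C * expWeight β γ s
  norm_sub_le : ∀ u, |u| ≤ 1 → ‖φ u - φ 0‖ ≤ C * |u| ^ α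

/-- The dominating function of the integrand of `logHilbert`. -/
noncomputable def kernelBound (α β γ u : ℝ) : ℝ :=
  (if |u| ≤ 1 then |u| ^ α else expWeight β γ (-u)) * |Real.exp u - 1|⁻¹

/-- The bound does not depend on y, so a single dominating function serves all horizontal lines, the
two edges included. -/
theorem norm_expKernel_le (u y : ℝ) (hu : u ≠ 0) :
    ‖expKernel (u + y * Complex.I)‖ ≤ |Real.exp u - 1|⁻¹ := by
  rw [expKernel, norm_inv]
  have h0 : 0 < |Real.exp u - 1| := abs_pos.2 (sub_ne_zero.2 (by simpa using hu))
  refine inv_anti₀ h0 ?_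
  have := abs_norm_sub_norm_le (Complex.exp (u + y * Complex.I)) 1
  simpa [Complex.norm_exp] using this

theorem exp_ne_one_of_re_ne_zero {w : ℂ} (hw : w.re ≠ 0) : Complex.exp w ≠ 1 := by
  intro h
  have := congrArg norm h
  rw [Complex.norm_exp, norm_one] at this
  exact hw (by simpa using this)

theorem half_abs_le_abs_exp_sub_one {u : ℝ} (hu : |u| ≤ 1) : |u| / 2 ≤ |Real.exp u - 1| := by
  rcases le_total 0 u with h | h
  · rw [abs_of_nonneg h]
    have := Real.add_one_le_exp u
    rw [abs_of_nonneg (by linarith)]; linarith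
  · rw [abs_of_nonpos h] at hu ⊢
    have h1 := Real.add_one_le_exp (-u)
    have h2 : Real.exp u * Real.exp (-u) = 1 := by rw [← Real.exp_add]; simp
    have h3 : Real.exp u ≤ 1 := Real.exp_le_one_iff.2 h
    rw [abs_of_nonpos (by linarith)]
    have h4 : Real.exp u * (-u + 1) ≤ 1 := by
      exact (mul_le_mul_of_nonneg_left h1 (Real.exp_pos u).le).trans_eq h2
    nlinarith

/-- Near 0 the kernel is of size 1/|u| and the Hölder factor makes it |u|^{α-1}. For u > 1 the
kernel decays like e^{-u} against growth e^{βu} and e^{γu}. For u < -1 the kernel is bounded and the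
density decays. This is where α > 0 and 0 < β, γ < 1 enter. -/
theorem kernelBound_le {α β γ u : ℝ} : kernelBound α β γ u ≤
    2 * ((Icc (-1) 1 : Set ℝ).indicator (fun u => |u| ^ (α - 1)) u +
      (Ioi 0 : Set ℝ).indicator (fun u => Real.exp ((β - 1) * u) + Real.exp ((γ - 1) * u)) u +
      (Iio 0 : Set ℝ).indicator (fun u => Real.exp (β * u) + Real.exp (γ * u)) u) := by
  have n1 : 0 ≤ (Icc (-1) 1 : Set ℝ).indicator (fun u : ℝ => |u| ^ (α - 1)) u :=
    indicator_nonneg (fun _ _ => by positivity) _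
  have n2 : 0 ≤ (Ioi 0 : Set ℝ).indicator
      (fun u => Real.exp ((β - 1) * u) + Real.exp ((γ - 1) * u)) u :=
    indicator_nonneg (fun _ _ => by positivity) _
  have n3 : 0 ≤ (Iio 0 : Set ℝ).indicator
      (fun u => Real.exp (β * u) + Real.exp (γ * u)) u :=
    indicator_nonneg (fun _ _ => by positivity) _
  unfold kernelBound
  split_ifs with h
  · have : |u| ^ α * |Real.exp u - 1|⁻¹ ≤ 2 * |u| ^ (α - 1) := by
      rcases eq_or_ne u 0 with rfl | h0
      · simp; positivity
      · have hp : 0 < |u| := abs_pos.2 h0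
        rw [Real.rpow_sub_one hp.ne', ← mul_div_assoc, mul_comm 2, mul_div_assoc]
        refine mul_le_mul_of_nonneg_left ?_ (by positivity)
        rw [inv_le_comm₀ (abs_pos.2 (sub_ne_zero.2 (by simpa using h0))) (by positivity), inv_div]
        exact half_abs_le_abs_exp_sub_one h
    rw [indicator_of_mem (show u ∈ Icc (-1) 1 from abs_le.1 h)] at n1 ⊢
    linarith
  · rw [not_le, lt_abs] at h
    have he1 : 2 < Real.exp 1 := by linarith [Real.exp_one_gt_d9]
    rcases h with h | h
    · rw [indicator_of_mem (show u ∈ Ioi 0 from lt_trans one_pos h)] at n2 ⊢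
      have h1 : Real.exp 1 < Real.exp u := Real.exp_lt_exp.2 h
      have h2 : |Real.exp u - 1|⁻¹ ≤ 2 * Real.exp (-u) := by
        rw [abs_of_pos (by linarith), Real.exp_neg, ← div_eq_mul_inv, inv_eq_one_div,
          div_le_div_iff₀ (by linarith) (by positivity)]
        linarith
      have h3 : expWeight β γ (-u) * |Real.exp u - 1|⁻¹ ≤
          expWeight β γ (-u) * (2 * Real.exp (-u)) :=
        mul_le_mul_of_nonneg_left h2 (by unfold expWeight; positivity)
      have h4 : expWeight β γ (-u) * (2 * Real.exp (-u)) =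
          2 * (Real.exp ((β - 1) * u) + Real.exp ((γ - 1) * u)) := by
        unfold expWeight
        rw [show (β - 1) * u = -(β * -u) + -u by ring, show (γ - 1) * u = -(γ * -u) + -u by ring,
          Real.exp_add, Real.exp_add]
        ring
      linarith
    · have hu0 : u < 0 := by linarith
      rw [indicator_of_mem (show u ∈ Iio 0 from hu0)] at n3 ⊢
      have h1 : Real.exp u < Real.exp (-1) := Real.exp_lt_exp.2 (by linarith)
      have h1' : Real.exp (-1) < 1 / 2 := by
        rw [Real.exp_neg, inv_eq_one_div]; exact one_div_lt_one_div_of_lt two_pos he1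
      have h2 : |Real.exp u - 1|⁻¹ ≤ 2 := by
        rw [abs_of_neg (by linarith), inv_le_comm₀ (by linarith) two_pos]
        linarith
      have h3 : expWeight β γ (-u) * |Real.exp u - 1|⁻¹ ≤ expWeight β γ (-u) * 2 :=
        mul_le_mul_of_nonneg_left h2 (by unfold expWeight; positivity)
      have h4 : expWeight β γ (-u) * 2 = 2 * (Real.exp (β * u) + Real.exp (γ * u)) := by
        unfold expWeight
        rw [mul_neg, mul_neg, neg_neg, neg_neg]; ring
      linarith

theorem kernelBound_nonneg (α β γ u : ℝ) : 0 ≤ kernelBound α β γ u := by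
  unfold kernelBound expWeight
  split_ifs <;> positivity

theorem measurable_kernelBound (α β γ : ℝ) : Measurable (kernelBound α β γ) := by
  unfold kernelBound expWeight
  refine Measurable.mul (Measurable.ite ?_ (by fun_prop) (by fun_prop)) (by fun_prop)
  exact measurableSet_le (by fun_prop) (by fun_prop)

theorem integrableOn_abs_rpow {r : ℝ} (hr : -1 < r) :
    IntegrableOn (fun u : ℝ => |u| ^ r) (Icc (-1) 1) := by
  have h1 : IntegrableOn (fun u : ℝ => |u| ^ r) (Ioc 0 1) := by
    have := (intervalIntegrable_iff_integrableOn_Ioc_of_le zero_le_one).1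
      (intervalIntegral.intervalIntegrable_rpow' (a := 0) (b := 1) hr)
    refine this.congr_fun (fun u hu => ?_) measurableSet_Ioc
    simp only []
    rw [abs_of_pos hu.1]
  have h2 : IntegrableOn (fun u : ℝ => |u| ^ r) (Ico (-1) 0) := by
    have := h1.comp_neg
    simpa using this
  have : Icc (-1 : ℝ) 1 = Ico (-1) 0 ∪ {0} ∪ Ioc 0 1 := by
    ext x; simp only [mem_Icc, mem_union, mem_Ico, mem_singleton_iff, mem_Ioc]
    constructor
    · rintro ⟨a, b⟩
      rcases lt_trichotomy x 0 with h | h | h <;> grind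
    · grind
  rw [this]
  exact (h2.union (by simp)).union h1

theorem integrable_kernelBound {α β γ : ℝ} (hα : 0 < α) (hβ : β ∈ Ioo 0 1) (hγ : γ ∈ Ioo 0 1) :
    Integrable (kernelBound α β γ) := by
  refine Integrable.mono' (g := fun u =>
    2 * ((Icc (-1) 1 : Set ℝ).indicator (fun u => |u| ^ (α - 1)) u +
      (Ioi 0 : Set ℝ).indicator (fun u => Real.exp ((β - 1) * u) + Real.exp ((γ - 1) * u)) u +
      (Iio 0 : Set ℝ).indicator (fun u => Real.exp (β * u) + Real.exp (γ * u)) u)) ?_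
    (measurable_kernelBound α β γ).aestronglyMeasurable
    (Eventually.of_forall fun u => ?_)
  · refine (((integrableOn_abs_rpow (by linarith)).integrable_indicator measurableSet_Icc).add
      ?_ |>.add ?_).const_mul 2
    · exact (IntegrableOn.add (integrableOn_exp_mul_Ioi (by linarith [hβ.2]) 0)
        (integrableOn_exp_mul_Ioi (by linarith [hγ.2]) 0)).integrable_indicator measurableSet_Ioi
    · exact (IntegrableOn.add ((integrableOn_exp_mul_Iic hβ.1 0).mono_set Iio_subset_Iic_self)
        ((integrableOn_exp_mul_Iic hγ.1 0).mono_set Iio_subset_Iic_self)).integrable_indicator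
        measurableSet_Iio
  · rw [Real.norm_of_nonneg (kernelBound_nonneg ..)]
    exact kernelBound_le

theorem ae_ne_zero : ∀ᵐ u : ℝ, u ≠ 0 := by
  simp [ae_iff]

theorem expWeight_pos (β γ s : ℝ) : 0 < expWeight β γ s := by unfold expWeight; positivity

theorem unitCutoff_of_le {u : ℝ} (h : |u| ≤ 1) : unitCutoff u = 1 := by
  rw [unitCutoff, indicator_of_mem (show u ∈ Icc (-1) 1 from abs_le.1 h)]; rfl

theorem unitCutoff_of_not_le {u : ℝ} (h : ¬ |u| ≤ 1) : unitCutoff u = 0 :=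
  indicator_of_notMem (s := Icc (-1) 1) (fun hu => h (abs_le.2 hu)) _

theorem measurable_unitCutoff : Measurable unitCutoff :=
  measurable_one.indicator measurableSet_Icc

theorem measurable_expKernel : Measurable expKernel := by
  unfold expKernel; fun_prop

theorem LocTame.norm_integrand_le {α β γ C : ℝ} {φ : ℝ → ℂ} (h : LocTame α β γ C φ) (y u : ℝ)
    (hu : u ≠ 0) : ‖(φ (-u) - unitCutoff u * φ 0) * expKernel (u + y * Complex.I)‖ ≤
      C * kernelBound α β γ u := by
  rw [norm_mul, kernelBound, ← mul_assoc]
  refine mul_le_mul ?_ (norm_expKernel_le u y hu) (norm_nonneg _) ?_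
  · split_ifs with h1
    · rw [unitCutoff_of_le h1, one_mul]
      have := h.norm_sub_le (-u) (by rwa [abs_neg])
      rwa [abs_neg] at this
    · rw [unitCutoff_of_not_le h1, zero_mul, sub_zero]
      exact h.norm_le _
  · split_ifs with h1
    · exact (norm_nonneg _).trans (by simpa using h.norm_sub_le u h1)
    · exact (norm_nonneg _).trans (h.norm_le _)

theorem aestronglyMeasurable_logHilbert_integrand {φ : ℝ → ℂ} (hφ : Continuous φ) (y : ℝ) :
    AEStronglyMeasurable
      (fun u : ℝ => (φ (-u) - unitCutoff u * φ 0) * expKernel (u + y * Complex.I)) := by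
  refine Measurable.aestronglyMeasurable ?_
  refine Measurable.mul (Measurable.sub (hφ.comp continuous_neg).measurable
    (measurable_unitCutoff.mul_const _)) ?_
  exact measurable_expKernel.comp (by fun_prop)

theorem LocTame.integrable_integrand {α β γ C : ℝ} (hα : 0 < α) (hβ : β ∈ Ioo 0 1)
    (hγ : γ ∈ Ioo 0 1) {φ : ℝ → ℂ} (h : LocTame α β γ C φ) (y : ℝ) :
    Integrable fun u : ℝ => (φ (-u) - unitCutoff u * φ 0) * expKernel (u + y * Complex.I) := by
  refine ((integrable_kernelBound hα hβ hγ).const_mul C).mono'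
    (aestronglyMeasurable_logHilbert_integrand h.continuous y) ?_
  filter_upwards [ae_ne_zero] with u hu using h.norm_integrand_le y u hu

theorem one_sub_exp_mem_slitPlane {w : ℂ} (hw : w.re < 0) :
    1 - Complex.exp w ∈ Complex.slitPlane := by
  refine Complex.mem_slitPlane_iff.2 (Or.inl ?_)
  have h1 : (Complex.exp w).re ≤ ‖Complex.exp w‖ := Complex.re_le_norm _
  rw [Complex.norm_exp] at h1
  have h2 : Real.exp w.re < 1 := by rw [← Real.exp_zero]; exact Real.exp_lt_exp.2 hw
  simp; linarith

theorem continuous_kernelIntegral : Continuous kernelIntegral := by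
  unfold kernelIntegral
  refine Continuous.add (Continuous.sub (Continuous.sub ?_ ?_) continuous_const) (by fun_prop)
  · exact Continuous.clog (by fun_prop) fun y => one_sub_exp_mem_slitPlane (by simp)
  · exact Continuous.clog (by fun_prop) fun y => one_sub_exp_mem_slitPlane (by simp)

/-! ### Dominated convergence for the regularized transform -/

section limits

variable {X : Type*} {l : Filter X} [l.IsCountablyGenerated] {α β γ C : ℝ}

theorem tendsto_logHilbert (hα : 0 < α) (hβ : β ∈ Ioo 0 1) (hγ : γ ∈ Ioo 0 1)
    {φ : X → ℝ → ℂ} {φ₀ : ℝ → ℂ} {y : X → ℝ} {y₀ : ℝ}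
    (hφ : ∀ᶠ i in l, LocTame α β γ C (φ i)) (hlim : ∀ u, Tendsto (fun i => φ i u) l (𝓝 (φ₀ u)))
    (hy : Tendsto y l (𝓝 y₀)) :
    Tendsto (fun i => logHilbert (φ i) (y i)) l (𝓝 (logHilbert φ₀ y₀)) := by
  refine Tendsto.add ?_ ((hlim 0).mul ((continuous_kernelIntegral.tendsto y₀).comp hy))
  refine tendsto_integral_filter_of_dominated_convergence (fun u => C * kernelBound α β γ u)
    ?_ ?_ ((integrable_kernelBound hα hβ hγ).const_mul C) ?_
  · filter_upwards [hφ] with i hi using aestronglyMeasurable_logHilbert_integrand hi.continuous _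
  · filter_upwards [hφ] with i hi
    filter_upwards [ae_ne_zero] with u hu using hi.norm_integrand_le _ u hu
  · filter_upwards [ae_ne_zero] with u hu
    refine ((hlim (-u)).sub ((hlim 0).const_mul _)).mul ?_
    have : ContinuousAt (fun t : ℝ => expKernel (u + t * Complex.I)) y₀ := by
      unfold expKernel
      refine ContinuousAt.inv₀ (by fun_prop) (sub_ne_zero.2 (exp_ne_one_of_re_ne_zero ?_))
      simpa using hu
    exact this.tendsto.comp hy

/-- The heights y need not converge: the kernel is bounded at each u ≠ 0 uniformly in y, and
`kernelIntegral` is bounded on compact sets. -/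
theorem tendsto_logHilbert_zero (hα : 0 < α) (hβ : β ∈ Ioo 0 1) (hγ : γ ∈ Ioo 0 1)
    {φ : X → ℝ → ℂ} {y : X → ℝ} {K : Set ℝ} (hK : IsCompact K)
    (hφ : ∀ᶠ i in l, LocTame α β γ C (φ i)) (hlim : ∀ u, Tendsto (fun i => φ i u) l (𝓝 0))
    (hy : ∀ᶠ i in l, y i ∈ K) :
    Tendsto (fun i => logHilbert (φ i) (y i)) l (𝓝 0) := by
  obtain ⟨M, hM⟩ := hK.exists_bound_of_continuousOn continuous_kernelIntegral.continuousOn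
  rw [← add_zero (0 : ℂ)]
  refine Tendsto.add ?_ ?_
  · have := tendsto_integral_filter_of_dominated_convergence (l := l) (μ := volume)
      (F := fun i u => (φ i (-u) - unitCutoff u * φ i 0) * expKernel (u + y i * Complex.I))
      (f := fun _ => 0) (fun u => C * kernelBound α β γ u)
      ?_ ?_ ((integrable_kernelBound hα hβ hγ).const_mul C) ?_
    · simpa using this
    · filter_upwards [hφ] with i hi using aestronglyMeasurable_logHilbert_integrand hi.continuous _
    · filter_upwards [hφ] with i hi
      filter_upwards [ae_ne_zero] with u hu using hi.norm_integrand_le _ u hu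
    · filter_upwards [ae_ne_zero] with u hu
      refine Tendsto.zero_mul_isBoundedUnder_le ?_ ⟨|Real.exp u - 1|⁻¹, ?_⟩
      · simpa using (hlim (-u)).sub ((hlim 0).const_mul (unitCutoff u))
      · rw [eventually_map]
        exact Eventually.of_forall fun i => norm_expKernel_le u _ hu
  · refine (hlim 0).zero_mul_isBoundedUnder_le ⟨M, ?_⟩
    rw [eventually_map]
    filter_upwards [hy] with i hi using hM _ hi

end limits

/-! ### Densities with weighted Hölder bounds; β governs s → -∞ and γ governs s → +∞ -/

/-- Weighted Hölder bounds on `φ`. -/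
structure Tame (α β γ C : ℝ) (φ : ℝ → ℂ) : Prop where
  norm_le : ∀ s, ‖φ s‖ ≤ C * expWeight β γ s
  norm_sub_le : ∀ s u, |u| ≤ 1 → ‖φ (s + u) - φ s‖ ≤ C * expWeight β γ s * |u| ^ α

/-- The conditions on the exponents under which `logCauchy` is defined. -/
structure TameExponents (α β γ : ℝ) : Prop where
  hα : 0 < α
  hα1 : α ≤ 1
  hβ : β ∈ Ioo 0 1
  hγ : γ ∈ Ioo 0 1
  hγβ : γ ≤ β

section tame

variable {α β γ C : ℝ} {φ ψ : ℝ → ℂ}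

theorem Tame.nonneg (h : Tame α β γ C φ) : 0 ≤ C :=
  nonneg_of_mul_nonneg_left ((norm_nonneg _).trans (h.norm_le 0)) (expWeight_pos β γ 0)

theorem Tame.continuous (hE : TameExponents α β γ) (h : Tame α β γ C φ) : Continuous φ := by
  refine continuous_iff_continuousAt.2 fun s => ?_
  have h1 : Tendsto (fun t => C * expWeight β γ s * |t - s| ^ α) (𝓝 s) (𝓝 0) := by
    have : Continuous fun t => C * expWeight β γ s * |t - s| ^ α := by
      refine continuous_const.mul (Continuous.rpow_const (by fun_prop) fun _ => Or.inr hE.hα.le)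
    have := this.tendsto s
    simpa [Real.zero_rpow hE.hα.ne'] using this
  rw [ContinuousAt, tendsto_iff_norm_sub_tendsto_zero]
  refine squeeze_zero' (Eventually.of_forall fun _ => norm_nonneg _) ?_ h1
  filter_upwards [Metric.closedBall_mem_nhds s one_pos] with t ht
  have := h.norm_sub_le s (t - s) (by simpa [Real.dist_eq] using ht)
  simpa using this

theorem expWeight_add_le (hE : TameExponents α β γ) (x s : ℝ) :
    expWeight β γ (x + s) ≤ Real.exp |x| * expWeight β γ s := by
  have key : ∀ δ ∈ Ioo (0 : ℝ) 1, Real.exp (-(δ * (x + s))) ≤ Real.exp |x| * Real.exp (-(δ * s)) := by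
    intro δ hδ
    rw [← Real.exp_add]
    refine Real.exp_le_exp.2 ?_
    have : -(δ * x) ≤ |x| := by
      refine (neg_le_abs _).trans ?_
      rw [abs_mul, abs_of_pos hδ.1]
      exact mul_le_of_le_one_left (abs_nonneg _) hδ.2.le
    linarith
  unfold expWeight
  rw [mul_add (Real.exp _)]
  exact add_le_add (key β hE.hβ) (key γ hE.hγ)

theorem expWeight_zero (β γ : ℝ) : expWeight β γ 0 = 2 := by norm_num [expWeight]

theorem Tame.locTame_shift (hE : TameExponents α β γ) (h : Tame α β γ C φ) {x R : ℝ}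
    (hx : |x| ≤ R) : LocTame α β γ (2 * C * Real.exp R) fun s => φ (x + s) := by
  have hR : Real.exp |x| ≤ Real.exp R := Real.exp_le_exp.2 hx
  have hC := h.nonneg
  have hm : Real.exp |x| * C ≤ Real.exp R * C := mul_le_mul_of_nonneg_right hR hC
  refine ⟨(h.continuous hE).comp (by fun_prop), fun s => ?_, fun u hu => ?_⟩
  · refine (h.norm_le _).trans ?_
    have h1 := mul_le_mul_of_nonneg_left (expWeight_add_le hE x s) hC
    have h2 := expWeight_pos β γ s
    have h3 := mul_le_mul_of_nonneg_right hm h2.le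
    have h4 : 0 ≤ Real.exp R * C * expWeight β γ s := by positivity
    linarith
  · rw [add_zero]
    refine (h.norm_sub_le x u hu).trans (mul_le_mul_of_nonneg_right ?_ (by positivity))
    have h1 := mul_le_mul_of_nonneg_left (expWeight_add_le hE x 0) hC
    rw [expWeight_zero, add_zero] at h1
    linarith

/-- Continuity holds on the whole plane, in particular across the edges Im w = 0 and Im w = 2π,
where the integral itself is singular. This gives the boundary values E ± i0. -/
theorem continuous_logCauchy (hE : TameExponents α β γ) (h : Tame α β γ C φ) :
    Continuous (logCauchy φ) := by
  refine continuous_iff_continuousAt.2 fun w => ?_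
  refine tendsto_logHilbert (C := 2 * C * Real.exp (|w.re| + 1)) hE.hα hE.hβ hE.hγ ?_ ?_
    (Complex.continuous_im.tendsto w)
  · have : Tendsto (fun z : ℂ => |z.re|) (𝓝 w) (𝓝 |w.re|) :=
      (continuous_abs.comp Complex.continuous_re).tendsto w
    filter_upwards [this.eventually (Iio_mem_nhds (lt_add_one _))] with z hz
    exact h.locTame_shift hE (le_of_lt hz)
  · intro u
    have : Continuous fun z : ℂ => φ (z.re + u) := (h.continuous hE).comp (by fun_prop)
    exact this.tendsto w

theorem Tame.tendsto_atTop (hE : TameExponents α β γ) (h : Tame α β γ C φ) :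
    Tendsto φ atTop (𝓝 0) := by
  have key : ∀ δ ∈ Ioo (0 : ℝ) 1, Tendsto (fun s => Real.exp (-(δ * s))) atTop (𝓝 0) := by
    intro δ hδ
    exact Real.tendsto_exp_neg_atTop_nhds_zero.comp (tendsto_id.const_mul_atTop hδ.1)
  have h2 := ((key β hE.hβ).add (key γ hE.hγ)).const_mul C
  rw [add_zero, mul_zero] at h2
  exact squeeze_zero_norm h.norm_le h2

theorem eventually_rightEnd_re {L : ℝ} {p : ℝ → Prop} (hp : ∀ᶠ x in atTop, p x) :
    ∀ᶠ w in rightEnd L, p w.re :=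
  (tendsto_comap.mono_left inf_le_left).eventually hp

theorem eventually_leftEnd_re {L : ℝ} {p : ℝ → Prop} (hp : ∀ᶠ x in atBot, p x) :
    ∀ᶠ w in leftEnd L, p w.re :=
  (tendsto_comap.mono_left inf_le_left).eventually hp

theorem tendsto_re_rightEnd {L : ℝ} : Tendsto Complex.re (rightEnd L) atTop :=
  tendsto_comap.mono_left inf_le_left

theorem tendsto_re_leftEnd {L : ℝ} : Tendsto Complex.re (leftEnd L) atBot :=
  tendsto_comap.mono_left inf_le_left

theorem closedStrip_mem_leftEnd {L : ℝ} : closedStrip L ∈ leftEnd L :=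
  mem_inf_of_right (mem_principal_self _)

theorem closedStrip_mem_rightEnd {L : ℝ} : closedStrip L ∈ rightEnd L :=
  mem_inf_of_right (mem_principal_self _)

instance {L : ℝ} : (leftEnd L).IsCountablyGenerated := by unfold leftEnd; infer_instance

instance {L : ℝ} : (rightEnd L).IsCountablyGenerated := by unfold rightEnd; infer_instance

/-- For Re w ≥ 0 translating the density only decreases the weight, so one dominating function
works, and the translates tend to 0 pointwise. -/
theorem tendsto_logCauchy_rightEnd (hE : TameExponents α β γ) (h : Tame α β γ C φ) (L : ℝ) :
    Tendsto (logCauchy φ) (rightEnd L) (𝓝 0) := by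
  have hC := h.nonneg
  refine tendsto_logHilbert_zero (C := 2 * C) hE.hα hE.hβ hE.hγ
    (isCompact_Icc (a := 0) (b := L)) ?_ ?_ closedStrip_mem_rightEnd
  · filter_upwards [eventually_rightEnd_re (eventually_ge_atTop 0)] with w hw
    have hmono : ∀ s, expWeight β γ (w.re + s) ≤ expWeight β γ s := by
      intro s
      unfold expWeight
      refine add_le_add (Real.exp_le_exp.2 ?_) (Real.exp_le_exp.2 ?_)
      · nlinarith [mul_nonneg hE.hβ.1.le hw]
      · nlinarith [mul_nonneg hE.hγ.1.le hw]
    refine ⟨(h.continuous hE).comp (by fun_prop), fun s => ?_, fun u hu => ?_⟩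
    · refine (h.norm_le _).trans ?_
      have := mul_le_mul_of_nonneg_left (hmono s) hC
      have h3 := mul_nonneg hC (expWeight_pos β γ s).le
      linarith
    · rw [add_zero]
      refine (h.norm_sub_le _ u hu).trans (mul_le_mul_of_nonneg_right ?_ (by positivity))
      have := mul_le_mul_of_nonneg_left (hmono 0) hC
      rw [add_zero, expWeight_zero] at this
      linarith
  · intro u
    exact (h.tendsto_atTop hE).comp (tendsto_atTop_add_const_right _ u tendsto_re_rightEnd)

/-- The model density `e ^ (-β s)`. -/
noncomputable def expModel (β s : ℝ) : ℂ := Complex.exp (-(β * s))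

theorem norm_expModel (β s : ℝ) : ‖expModel β s‖ = Real.exp (-(β * s)) := by
  simp [expModel, Complex.norm_exp]

theorem expModel_add (β s t : ℝ) : expModel β (s + t) = expModel β s * expModel β t := by
  rw [expModel, expModel, expModel, ← Complex.exp_add]; congr 1; push_cast; ring

theorem abs_exp_sub_one_le_three {t : ℝ} (ht : |t| ≤ 1) : |Real.exp t - 1| ≤ 3 * |t| := by
  have := Real.abs_exp_sub_one_le ht
  linarith [abs_nonneg t]

theorem norm_expModel_sub_one_le (hE : TameExponents α β γ) {u : ℝ} (hu : |u| ≤ 1) :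
    ‖expModel β u - 1‖ ≤ 3 * |u| ^ α := by
  have h1 : expModel β u - 1 = ((Real.exp (-(β * u)) - 1 : ℝ) : ℂ) := by
    simp [expModel]
  rw [h1, Complex.norm_real, Real.norm_eq_abs]
  have hb : |-(β * u)| ≤ |u| := by
    rw [abs_neg, abs_mul, abs_of_pos hE.hβ.1]
    exact mul_le_of_le_one_left (abs_nonneg _) hE.hβ.2.le
  refine (abs_exp_sub_one_le_three (hb.trans hu)).trans ?_
  have : |u| ≤ |u| ^ α := by
    rcases (abs_nonneg u).eq_or_lt with h | h
    · rw [← h, Real.zero_rpow hE.hα.ne']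
    · conv_lhs => rw [← Real.rpow_one |u|]
      exact Real.rpow_le_rpow_of_exponent_ge h hu hE.hα1
  linarith

theorem tame_expModel (hE : TameExponents α β γ) : Tame α β γ 3 (expModel β) := by
  refine ⟨fun s => ?_, fun s u hu => ?_⟩
  · rw [norm_expModel]; unfold expWeight
    linarith [Real.exp_pos (-(β * s)), Real.exp_pos (-(γ * s))]
  · rw [expModel_add, ← mul_sub_one, norm_mul, norm_expModel]
    have h1 := norm_expModel_sub_one_le hE hu
    have h2 : Real.exp (-(β * s)) ≤ expWeight β γ s := by
      unfold expWeight; linarith [Real.exp_pos (-(γ * s))]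
    calc _ ≤ expWeight β γ s * (3 * |u| ^ α) :=
          mul_le_mul h2 h1 (norm_nonneg _) (expWeight_pos _ _ _).le
      _ = _ := by ring

theorem Tame.const_mul (h : Tame α β γ C φ) (c : ℂ) : Tame α β γ (‖c‖ * C) fun s => c * φ s := by
  refine ⟨fun s => ?_, fun s u hu => ?_⟩
  · rw [norm_mul, mul_assoc]
    exact mul_le_mul_of_nonneg_left (h.norm_le s) (norm_nonneg _)
  · rw [← mul_sub, norm_mul, mul_assoc, mul_assoc, ← mul_assoc C]
    exact mul_le_mul_of_nonneg_left (h.norm_sub_le s u hu) (norm_nonneg _)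

theorem Tame.add {C' : ℝ} (h : Tame α β γ C φ) (h' : Tame α β γ C' ψ) :
    Tame α β γ (C + C') fun s => φ s + ψ s := by
  refine ⟨fun s => ?_, fun s u hu => ?_⟩
  · rw [add_mul]
    exact (norm_add_le _ _).trans (add_le_add (h.norm_le s) (h'.norm_le s))
  · rw [add_sub_add_comm, add_mul, add_mul]
    exact (norm_add_le _ _).trans (add_le_add (h.norm_sub_le s u hu) (h'.norm_sub_le s u hu))

theorem logHilbert_const_mul (c : ℂ) (φ : ℝ → ℂ) (y : ℝ) :
    logHilbert (fun s => c * φ s) y = c * logHilbert φ y := by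
  unfold logHilbert
  rw [mul_add, ← integral_const_mul]
  congr 1
  · congr 1; ext u; ring
  · ring

theorem logCauchy_const_mul (c : ℂ) (φ : ℝ → ℂ) (w : ℂ) :
    logCauchy (fun s => c * φ s) w = c * logCauchy φ w :=
  logHilbert_const_mul c _ _

theorem logHilbert_add {C' : ℝ} (hE : TameExponents α β γ) (h : LocTame α β γ C φ)
    (h' : LocTame α β γ C' ψ) (y : ℝ) :
    logHilbert (fun s => φ s + ψ s) y = logHilbert φ y + logHilbert ψ y := by
  unfold logHilbert
  have e : ∀ u : ℝ, (φ (-u) + ψ (-u) - unitCutoff u * (φ 0 + ψ 0)) * expKernel (u + y * Complex.I) =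
      (φ (-u) - unitCutoff u * φ 0) * expKernel (u + y * Complex.I) +
      (ψ (-u) - unitCutoff u * ψ 0) * expKernel (u + y * Complex.I) := fun u => by ring
  simp_rw [e]
  rw [integral_add (h.integrable_integrand hE.hα hE.hβ hE.hγ y)
    (h'.integrable_integrand hE.hα hE.hβ hE.hγ y)]
  ring

theorem logCauchy_add {C' : ℝ} (hE : TameExponents α β γ) (h : Tame α β γ C φ)
    (h' : Tame α β γ C' ψ) (w : ℂ) :
    logCauchy (fun s => φ s + ψ s) w = logCauchy φ w + logCauchy ψ w :=
  logHilbert_add hE (h.locTame_shift hE le_rfl) (h'.locTame_shift hE le_rfl) _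

theorem exists_logCauchy_sum {ι : Type*} (s : Finset ι) (c : ι → ℂ) (φ : ι → ℝ → ℂ) (C : ι → ℝ)
    (hE : TameExponents α β γ) (h : ∀ i ∈ s, Tame α β γ (C i) (φ i)) :
    (∃ C', Tame α β γ C' fun x => ∑ i ∈ s, c i * φ i x) ∧
    ∀ w, logCauchy (fun x => ∑ i ∈ s, c i * φ i x) w = ∑ i ∈ s, c i * logCauchy (φ i) w := by
  classical
  induction s using Finset.induction_on with
  | empty =>
    refine ⟨⟨0, ?_, ?_⟩, fun w => ?_⟩
    · simp
    · simp
    · simp [logCauchy, logHilbert]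
  | insert a s ha ih =>
    obtain ⟨⟨C', h1⟩, h2⟩ := ih fun i hi => h i (Finset.mem_insert_of_mem hi)
    have h3 := (h a (Finset.mem_insert_self a s)).const_mul (c a)
    simp_rw [Finset.sum_insert ha]
    refine ⟨⟨_, h3.add h1⟩, fun w => ?_⟩
    rw [logCauchy_add hE h3 h1, h2, logCauchy_const_mul]

theorem logCauchy_expModel (β : ℝ) (w : ℂ) :
    logCauchy (expModel β) w = expModel β w.re * logHilbert (expModel β) w.im := by
  unfold logCauchy
  simp_rw [expModel_add]
  exact logHilbert_const_mul _ _ _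

/-- Translated by Re w and divided by e^{-β Re w}, the density converges pointwise to ℓ e^{-βs}.
Since γ ≤ β, the rescaled translates obey bounds uniform in Re w ≤ 0, and dominated convergence
applies to the difference. -/
theorem tendsto_leftEnd_sub (hE : TameExponents α β γ) (h : Tame α β γ C φ) {ℓ : ℂ}
    (hl : Tendsto (fun s => φ s / expModel β s) atBot (𝓝 ℓ)) (L : ℝ) :
    Tendsto (fun w => (expModel β w.re)⁻¹ * logCauchy φ w - ℓ * logHilbert (expModel β) w.im)
      (leftEnd L) (𝓝 0) := by
  have hC := h.nonneg
  have hM := tame_expModel hE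
  have hne : ∀ s, expModel β s ≠ 0 := fun s => Complex.exp_ne_zero _
  have hloc : ∀ w : ℂ, w.re ≤ 0 → LocTame α β γ (2 * C)
      fun s => (expModel β w.re)⁻¹ * φ (w.re + s) := by
    intro w hw
    have hinv : ‖(expModel β w.re)⁻¹‖ = Real.exp (β * w.re) := by
      rw [norm_inv, norm_expModel, Real.exp_neg, inv_inv]
    have hmono : ∀ s, Real.exp (β * w.re) * expWeight β γ (w.re + s) ≤ expWeight β γ s := by
      intro s
      unfold expWeight
      rw [mul_add, ← Real.exp_add, ← Real.exp_add]
      refine add_le_add (Real.exp_le_exp.2 ?_) (Real.exp_le_exp.2 ?_)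
      · linarith
      · nlinarith [mul_nonneg (sub_nonneg.2 hE.hγβ) (neg_nonneg.2 hw)]
    refine ⟨continuous_const.mul ((h.continuous hE).comp (by fun_prop)), fun s => ?_, fun u hu => ?_⟩
    · rw [norm_mul, hinv]
      have h1 := mul_le_mul_of_nonneg_left (h.norm_le (w.re + s)) (Real.exp_pos (β * w.re)).le
      have h2 := mul_le_mul_of_nonneg_left (hmono s) hC
      have h3 := mul_nonneg hC (expWeight_pos β γ s).le
      linarith
    · rw [← mul_sub, norm_mul, hinv, add_zero]
      have h1 := mul_le_mul_of_nonneg_left (h.norm_sub_le w.re u hu) (Real.exp_pos (β * w.re)).le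
      refine h1.trans ?_
      rw [← mul_assoc]
      refine mul_le_mul_of_nonneg_right ?_ (by positivity)
      have h2 := mul_le_mul_of_nonneg_left (hmono 0) hC
      rw [add_zero, expWeight_zero] at h2
      linarith
  have hdiff : ∀ w : ℂ, w.re ≤ 0 →
      (expModel β w.re)⁻¹ * logCauchy φ w - ℓ * logHilbert (expModel β) w.im =
      logHilbert (fun s => (expModel β w.re)⁻¹ * φ (w.re + s) + -ℓ * expModel β s) w.im := by
    intro w hw
    have h1 := (hM.const_mul (-ℓ)).locTame_shift hE (x := 0) (R := 0) (by simp)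
    simp only [zero_add] at h1
    rw [logHilbert_add hE (hloc w hw) h1, logHilbert_const_mul, logHilbert_const_mul]
    unfold logCauchy
    ring
  refine Tendsto.congr' (f₁ := fun w : ℂ =>
      logHilbert (fun s => (expModel β w.re)⁻¹ * φ (w.re + s) + -ℓ * expModel β s) w.im) ?_ ?_
  · filter_upwards [eventually_leftEnd_re (eventually_le_atBot 0)] with w hw using (hdiff w hw).symm
  · have h1 := (hM.const_mul (-ℓ)).locTame_shift hE (x := 0) (R := 0) (by simp)
    simp only [zero_add] at h1
    refine tendsto_logHilbert_zero (C := 2 * C + (2 * (‖-ℓ‖ * 3) * Real.exp 0)) hE.hα hE.hβ hE.hγ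
      (isCompact_Icc (a := 0) (b := L)) ?_ ?_ closedStrip_mem_leftEnd
    · filter_upwards [eventually_leftEnd_re (eventually_le_atBot 0)] with w hw
      have h2 := hloc w hw
      refine ⟨h2.continuous.add h1.continuous, fun s => ?_, fun u hu => ?_⟩
      · rw [add_mul]
        exact (norm_add_le _ _).trans (add_le_add (h2.norm_le s) (h1.norm_le s))
      · rw [add_sub_add_comm, add_mul]
        exact (norm_add_le _ _).trans (add_le_add (h2.norm_sub_le u hu) (h1.norm_sub_le u hu))
    · intro u
      have h2 : Tendsto (fun w : ℂ => φ (w.re + u) / expModel β (w.re + u)) (leftEnd L) (𝓝 ℓ) :=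
        hl.comp (tendsto_atBot_add_const_right _ u tendsto_re_leftEnd)
      have h3 := (h2.mul_const (expModel β u)).add_const (-ℓ * expModel β u)
      rw [neg_mul, add_neg_cancel] at h3
      refine h3.congr fun w => ?_
      rw [expModel_add]
      have := hne w.re; have := hne u
      field_simp

end tame

/-! ### The closed form of the kernel integral -/

theorem cos_lt_one_of_mem_Ioo {y : ℝ} (hy : y ∈ Ioo 0 (2 * Real.pi)) : Real.cos y < 1 := by
  refine lt_of_le_of_ne (Real.cos_le_one y) fun h => ?_
  rw [Real.cos_eq_one_iff_of_lt_of_lt (by linarith [hy.1, Real.pi_pos]) hy.2] at h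
  exact hy.1.ne' h

theorem one_sub_exp_mem_slitPlane' {w : ℂ} (hw : w.re ≤ 0) (hw' : Real.cos w.im < 1) :
    1 - Complex.exp w ∈ Complex.slitPlane := by
  refine Complex.mem_slitPlane_iff.2 (Or.inl ?_)
  have h2 : Real.exp w.re ≤ 1 := Real.exp_le_one_iff.2 hw
  have h3 := Real.exp_pos w.re
  rw [Complex.sub_re, Complex.one_re, Complex.exp_re]
  rcases le_total (Real.cos w.im) 0 with h | h <;> nlinarith

theorem one_sub_exp_mul_I (y : ℝ) : 1 - Complex.exp (y * Complex.I) =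
    ((2 * Real.sin (y / 2) : ℝ) : ℂ) * Complex.exp (((y - Real.pi) / 2 : ℝ) * Complex.I) := by
  have h1 : Complex.exp (((y - Real.pi) / 2 : ℝ) * Complex.I) =
      Complex.exp ((y / 2 : ℝ) * Complex.I) * -Complex.I := by
    have : Complex.exp (-(Real.pi / 2 * Complex.I)) = -Complex.I := by
      rw [Complex.exp_neg, Complex.exp_pi_div_two_mul_I, Complex.inv_I]
    rw [← this, ← Complex.exp_add]; congr 1; push_cast; ring
  have h2 : Complex.exp (y * Complex.I) = Complex.exp ((y / 2 : ℝ) * Complex.I) *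
      Complex.exp ((y / 2 : ℝ) * Complex.I) := by
    rw [← Complex.exp_add]; congr 1; push_cast; ring
  rw [h1, h2, Complex.exp_mul_I, ← Complex.ofReal_cos, ← Complex.ofReal_sin]
  have h3 := Real.sin_sq_add_cos_sq (y / 2)
  generalize Real.sin (y / 2) = a at h3 ⊢
  generalize Real.cos (y / 2) = b at h3 ⊢
  apply Complex.ext
  · simp; linear_combination -h3
  · simp; ring

theorem log_one_sub_exp_mul_I {y : ℝ} (hy : y ∈ Ioo 0 (2 * Real.pi)) :
    Complex.log (1 - Complex.exp (y * Complex.I)) =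
      Real.log (2 * Real.sin (y / 2)) + ((y - Real.pi) / 2 : ℝ) * Complex.I := by
  have hs : 0 < 2 * Real.sin (y / 2) :=
    mul_pos two_pos (Real.sin_pos_of_pos_of_lt_pi (by linarith [hy.1]) (by linarith [hy.2]))
  rw [one_sub_exp_mul_I, Complex.log_ofReal_mul hs (Complex.exp_ne_zero _), Complex.log_exp]
  · simp; linarith [hy.1, Real.pi_pos]
  · simp; linarith [hy.2, Real.pi_pos]

theorem log_one_sub_exp_neg_mul_I {y : ℝ} (hy : y ∈ Ioo 0 (2 * Real.pi)) :
    Complex.log (1 - Complex.exp (-(y * Complex.I))) =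
      Real.log (2 * Real.sin (y / 2)) - ((y - Real.pi) / 2 : ℝ) * Complex.I := by
  have hy' : 2 * Real.pi - y ∈ Ioo 0 (2 * Real.pi) := ⟨by linarith [hy.2], by linarith [hy.1]⟩
  have h := log_one_sub_exp_mul_I hy'
  have h1 : Complex.exp ((2 * Real.pi - y : ℝ) * Complex.I) = Complex.exp (-(y * Complex.I)) := by
    rw [← Complex.exp_periodic (-(y * Complex.I))]; congr 1; push_cast; ring
  rw [h1] at h
  rw [h, show (2 * Real.pi - y) / 2 = Real.pi - y / 2 by ring, Real.sin_pi_sub]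
  push_cast; ring

theorem exp_sub_one_ne_zero_of_im {w : ℂ} (hw : w.im ∈ Ioo 0 (2 * Real.pi)) :
    Complex.exp w - 1 ≠ 0 := by
  rw [sub_ne_zero]
  intro h
  rcases eq_or_ne w.re 0 with h0 | h0
  · have := congrArg Complex.re h
    rw [Complex.exp_re, h0, Real.exp_zero, one_mul, Complex.one_re] at this
    exact (cos_lt_one_of_mem_Ioo hw).ne this
  · exact exp_ne_one_of_re_ne_zero h0 h

theorem continuous_expKernel_line {y : ℝ} (hy : y ∈ Ioo 0 (2 * Real.pi)) :
    Continuous fun u : ℝ => expKernel (u + y * Complex.I) := by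
  unfold expKernel
  exact Continuous.inv₀ (by fun_prop) fun u => exp_sub_one_ne_zero_of_im (by simpa using hy)

/-- The kernel has the primitives log(1 - e^{-w}) for Re w ≥ 0 and -w + log(1 - e^w) for Re w ≤ 0.
On their half-lines both logarithms have arguments with positive real part, so the principal branch
is safe. -/
theorem integral_expKernel {y : ℝ} (hy : y ∈ Ioo 0 (2 * Real.pi)) :
    ∫ u in (-1 : ℝ)..1, expKernel (u + y * Complex.I) = kernelIntegral y := by
  have hcos := cos_lt_one_of_mem_Ioo hy
  have hcont := continuous_expKernel_line hy
  have hne : ∀ u : ℝ, Complex.exp (u + y * Complex.I) - 1 ≠ 0 :=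
    fun u => exp_sub_one_ne_zero_of_im (by simpa using hy)
  have h1 : ∫ u in (0 : ℝ)..1, expKernel (u + y * Complex.I) =
      Complex.log (1 - Complex.exp (-((1 : ℝ) + y * Complex.I))) -
        Complex.log (1 - Complex.exp (-((0 : ℝ) + y * Complex.I))) := by
    refine intervalIntegral.integral_eq_sub_of_hasDerivAt
      (f := fun u : ℝ => Complex.log (1 - Complex.exp (-(u + y * Complex.I)))) ?_
      (hcont.intervalIntegrable _ _)
    intro u hu
    rw [uIcc_of_le zero_le_one] at hu
    have hs : 1 - Complex.exp (-(u + y * Complex.I)) ∈ Complex.slitPlane :=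
      one_sub_exp_mem_slitPlane' (by simpa using hu.1) (by simpa using hcos)
    have hd : HasDerivAt (fun u : ℝ => 1 - Complex.exp (-(u + y * Complex.I)))
        (Complex.exp (-(u + y * Complex.I))) u := by
      have := (((((hasDerivAt_id (u : ℂ)).add_const (y * Complex.I)).fun_neg).cexp).const_sub 1
        ).comp_ofReal
      simpa using this
    convert! hd.clog_real hs using 1
    rw [expKernel, inv_eq_one_div, div_eq_div_iff (hne u) (Complex.slitPlane_ne_zero hs),
      mul_sub (Complex.exp _), ← Complex.exp_add]
    simp
  have h2 : ∫ u in (-1 : ℝ)..0, expKernel (u + y * Complex.I) =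
      (-((0 : ℝ) + y * Complex.I) + Complex.log (1 - Complex.exp ((0 : ℝ) + y * Complex.I))) -
        (-((-1 : ℝ) + y * Complex.I) +
          Complex.log (1 - Complex.exp ((-1 : ℝ) + y * Complex.I))) := by
    refine intervalIntegral.integral_eq_sub_of_hasDerivAt
      (f := fun u : ℝ => -(u + y * Complex.I) + Complex.log (1 - Complex.exp (u + y * Complex.I))) ?_
      (hcont.intervalIntegrable _ _)
    intro u hu
    rw [uIcc_of_le (by norm_num)] at hu
    have hs : 1 - Complex.exp (u + y * Complex.I) ∈ Complex.slitPlane :=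
      one_sub_exp_mem_slitPlane' (by simpa using hu.2) (by simpa using hcos)
    have hd0 : HasDerivAt (fun u : ℝ => (u : ℂ) + y * Complex.I) 1 u := by
      have := ((hasDerivAt_id (u : ℂ)).add_const (y * Complex.I)).comp_ofReal
      simpa using this
    have hd : HasDerivAt (fun u : ℝ => 1 - Complex.exp (u + y * Complex.I))
        (-Complex.exp (u + y * Complex.I)) u := by
      simpa using hd0.cexp.const_sub 1
    convert! hd0.fun_neg.add (hd.clog_real hs) using 1
    have h3 := Complex.slitPlane_ne_zero hs
    rw [expKernel]
    have h4 := hne u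
    field_simp
    ring
  rw [← intervalIntegral.integral_add_adjacent_intervals (b := 0) (hcont.intervalIntegrable _ _)
    (hcont.intervalIntegrable _ _), h1, h2]
  -- At u = 0 the two logarithms have the same real part log(2 sin(y/2)) and opposite imaginary
  -- parts. The part that is singular at y = 0 and y = 2π cancels and leaves (y - π) i.
  have e1 := log_one_sub_exp_mul_I hy
  have e2 := log_one_sub_exp_neg_mul_I hy
  simp only [Complex.ofReal_zero, zero_add, e1, e2, kernelIntegral]
  rw [show -(((1 : ℝ) : ℂ) + y * Complex.I) = -1 - y * Complex.I by push_cast; ring,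
    show (((-1 : ℝ) : ℂ) + y * Complex.I) = -1 + y * Complex.I by push_cast; ring]
  push_cast
  ring

/-! ### The Cauchy integral inside the strip and its jump across the cut -/

section representation

variable {α β γ C : ℝ} {φ : ℝ → ℂ}

theorem integrable_unitCutoff_mul {y : ℝ} (hy : y ∈ Ioo 0 (2 * Real.pi)) :
    Integrable fun u : ℝ => unitCutoff u * expKernel (u + y * Complex.I) := by
  have : (fun u : ℝ => unitCutoff u * expKernel (u + y * Complex.I)) =
      (Icc (-1) 1 : Set ℝ).indicator fun u => expKernel (u + y * Complex.I) := by
    ext u; by_cases h : u ∈ Icc (-1 : ℝ) 1 <;> simp [unitCutoff, h]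
  rw [this]
  exact ((continuous_expKernel_line hy).continuousOn.integrableOn_compact
    isCompact_Icc).integrable_indicator measurableSet_Icc

theorem integral_unitCutoff_mul {y : ℝ} (hy : y ∈ Ioo 0 (2 * Real.pi)) :
    ∫ u : ℝ, unitCutoff u * expKernel (u + y * Complex.I) = kernelIntegral y := by
  have : (fun u : ℝ => unitCutoff u * expKernel (u + y * Complex.I)) =
      (Icc (-1) 1 : Set ℝ).indicator fun u => expKernel (u + y * Complex.I) := by
    ext u; by_cases h : u ∈ Icc (-1 : ℝ) 1 <;> simp [unitCutoff, h]
  rw [this, integral_indicator measurableSet_Icc, integral_Icc_eq_integral_Ioc,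
    ← intervalIntegral.integral_of_le (by norm_num), integral_expKernel hy]

theorem LocTame.integrable_mul_expKernel (hE : TameExponents α β γ) (h : LocTame α β γ C φ) {y : ℝ}
    (hy : y ∈ Ioo 0 (2 * Real.pi)) :
    Integrable fun u : ℝ => φ (-u) * expKernel (u + y * Complex.I) := by
  have h1 := (h.integrable_integrand hE.hα hE.hβ hE.hγ y).add
    ((integrable_unitCutoff_mul hy).mul_const (φ 0))
  refine h1.congr (Eventually.of_forall fun u => ?_)
  simp only [Pi.add_apply]
  ring

/-- Strictly between the edges the kernel is regular at u = 0, so the subtracted cutoff term is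
integrable and can be put back. -/
theorem LocTame.logHilbert_eq_integral (hE : TameExponents α β γ) (h : LocTame α β γ C φ) {y : ℝ}
    (hy : y ∈ Ioo 0 (2 * Real.pi)) :
    logHilbert φ y = ∫ u : ℝ, φ (-u) * expKernel (u + y * Complex.I) := by
  rw [logHilbert, ← integral_unitCutoff_mul hy, mul_comm (φ 0), ← integral_mul_const,
    ← integral_add (h.integrable_integrand hE.hα hE.hβ hE.hγ y)
      ((integrable_unitCutoff_mul hy).mul_const (φ 0))]
  congr 1; ext u; ring

theorem Tame.integrable_mul_expKernel (hE : TameExponents α β γ) (h : Tame α β γ C φ) {w : ℂ}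
    (hw : w ∈ openStrip (2 * Real.pi)) :
    Integrable fun s : ℝ => φ s * expKernel (w - s) := by
  have h1 := (h.locTame_shift hE (x := w.re) le_rfl).integrable_mul_expKernel hE (y := w.im) hw
  have h2 := h1.comp_sub_left w.re
  refine h2.congr (Eventually.of_forall fun u => ?_)
  simp only []
  congr 2
  · ring
  · apply Complex.ext <;> simp

theorem logCauchy_eq_integral (hE : TameExponents α β γ) (h : Tame α β γ C φ) {w : ℂ}
    (hw : w ∈ openStrip (2 * Real.pi)) :
    logCauchy φ w = ∫ s : ℝ, φ s * expKernel (w - s) := by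
  rw [logCauchy, (h.locTame_shift hE (x := w.re) le_rfl).logHilbert_eq_integral hE hw,
    ← integral_sub_left_eq_self (fun s : ℝ => φ s * expKernel (w - s)) volume w.re]
  refine integral_congr_ae (Eventually.of_forall fun u => ?_)
  simp only []
  congr 2
  apply Complex.ext <;> simp

/-- The Plemelj jump. The kernel and the exponentials are 2πi-periodic, so only the term linear in y
of `kernelIntegral` changes. -/
theorem logCauchy_add_two_pi (φ : ℝ → ℂ) (w : ℂ) :
    logCauchy φ (w + 2 * Real.pi * Complex.I) =
      logCauchy φ w + 2 * Real.pi * Complex.I * φ w.re := by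
  have him : (w + 2 * Real.pi * Complex.I).im = w.im + 2 * Real.pi := by simp
  have hre : (w + 2 * Real.pi * Complex.I).re = w.re := by simp
  have e1 : ∀ u : ℝ, expKernel (u + ((w.im + 2 * Real.pi : ℝ) : ℂ) * Complex.I) =
      expKernel (u + w.im * Complex.I) := by
    intro u
    rw [expKernel, expKernel, ← Complex.exp_periodic (u + w.im * Complex.I)]
    congr 3; push_cast; ring
  have e2 : kernelIntegral (w.im + 2 * Real.pi) =
      kernelIntegral w.im + 2 * Real.pi * Complex.I := by
    have p1 : Complex.exp (-1 - ((w.im + 2 * Real.pi : ℝ) : ℂ) * Complex.I) =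
        Complex.exp (-1 - w.im * Complex.I) := by
      rw [← Complex.exp_periodic (-1 - ((w.im + 2 * Real.pi : ℝ) : ℂ) * Complex.I)]
      congr 1; push_cast; ring
    have p2 : Complex.exp (-1 + ((w.im + 2 * Real.pi : ℝ) : ℂ) * Complex.I) =
        Complex.exp (-1 + w.im * Complex.I) := by
      rw [← Complex.exp_periodic (-1 + w.im * Complex.I)]
      congr 1; push_cast; ring
    rw [kernelIntegral, kernelIntegral, p1, p2]; push_cast; ring
  rw [logCauchy, logCauchy, him, hre, logHilbert, logHilbert, e2]
  simp_rw [e1]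
  simp only [add_zero]
  ring

end representation

/-! ### Holomorphy inside the strip, and power laws at the left end -/

section holomorphy

/-- Near a point off [0, ∞), |ω - e| is bounded below by a multiple of 1 + e, which dominates both
the integrand and its derivative in ω. -/
theorem differentiableOn_integral_div {g : ℝ → ℂ} {e : ℝ → ℝ} (he : ∀ s, 0 ≤ e s)
    (hem : Measurable e) (hgm : Measurable g) (hg : Integrable fun s => ‖g s‖ / (1 + e s)) :
    DifferentiableOn ℂ (fun ω : ℂ => ∫ s, g s / (ω - e s)) ((↑) '' Ici (0 : ℝ))ᶜ := by
  have hclosed : IsClosed (((↑) : ℝ → ℂ) '' Ici (0 : ℝ)) :=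
    Complex.isometry_ofReal.isClosedEmbedding.isClosedMap _ isClosed_Ici
  intro ω₀ hω₀
  obtain ⟨δ, hδ, hball⟩ := Metric.isOpen_iff.1 hclosed.isOpen_compl ω₀ hω₀
  have hδ2 : 0 < δ / 2 := half_pos hδ
  have hlow : ∀ ω ∈ Metric.ball ω₀ (δ / 2), ∀ s, δ / 2 ≤ ‖ω - e s‖ := by
    intro ω hω s
    by_contra hcon
    have h1 : ((e s : ℝ) : ℂ) ∈ Metric.ball ω₀ δ := by
      rw [Metric.mem_ball, dist_comm]
      calc dist ω₀ (e s) ≤ dist ω₀ ω + dist ω (e s) := dist_triangle _ _ _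
        _ < δ / 2 + δ / 2 := by
          refine add_lt_add ?_ ?_
          · rw [dist_comm]; exact hω
          · rw [dist_eq_norm]; exact not_le.1 hcon
        _ = δ := by ring
    exact hball h1 ⟨e s, he s, rfl⟩
  -- From |ω - e| ≥ δ/2 and e ≤ |ω| + |ω - e|, the quantity 1 + |ω| is also controlled by |ω - e|.
  set M : ℝ := (1 + ‖ω₀‖ + δ / 2) / (δ / 2) + 1 with hM
  have hM0 : 0 < M := by positivity
  have hlow2 : ∀ ω ∈ Metric.ball ω₀ (δ / 2), ∀ s, 1 + e s ≤ M * ‖ω - e s‖ := by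
    intro ω hω s
    have h1 := hlow ω hω s
    have h2 : ‖ω‖ ≤ ‖ω₀‖ + δ / 2 := by
      have := norm_sub_norm_le ω ω₀
      have h3 : ‖ω - ω₀‖ < δ / 2 := by rwa [← dist_eq_norm]
      linarith
    have h3 : e s ≤ ‖ω‖ + ‖ω - e s‖ := by
      have := norm_sub_norm_le ((e s : ℝ) : ℂ) ω
      rw [Complex.norm_real, Real.norm_of_nonneg (he s), norm_sub_rev] at this
      linarith
    have h4 : 1 + ‖ω₀‖ + δ / 2 ≤ (1 + ‖ω₀‖ + δ / 2) / (δ / 2) * ‖ω - e s‖ := by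
      rw [div_mul_eq_mul_div, le_div_iff₀ hδ2]
      exact mul_le_mul_of_nonneg_left h1 (by positivity)
    rw [hM, add_mul, one_mul]; linarith
  have hmeas : ∀ ω : ℂ, AEStronglyMeasurable (fun s => g s / (ω - e s)) := fun ω =>
    (hgm.div (measurable_const.sub (Complex.measurable_ofReal.comp hem))).aestronglyMeasurable
  have hbd : ∀ ω ∈ Metric.ball ω₀ (δ / 2), ∀ s, ‖g s‖ / ‖ω - e s‖ ≤ M * (‖g s‖ / (1 + e s)) := by
    intro ω hω s
    have h1 := lt_of_lt_of_le hδ2 (hlow ω hω s)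
    have h2 : 0 < 1 + e s := by linarith [he s]
    rw [div_le_iff₀ h1, mul_comm M, mul_assoc, div_mul_eq_mul_div, le_div_iff₀ h2]
    exact mul_le_mul_of_nonneg_left (hlow2 ω hω s) (norm_nonneg _)
  have hω₀m : ω₀ ∈ Metric.ball ω₀ (δ / 2) := Metric.mem_ball_self hδ2
  refine (hasDerivAt_integral_of_dominated_loc_of_deriv_le (μ := volume)
    (F := fun (ω : ℂ) s => g s / (ω - e s)) (F' := fun ω s => -(g s / (ω - e s) ^ 2))
    (bound := fun s => (M / (δ / 2)) * (‖g s‖ / (1 + e s))) (Metric.ball_mem_nhds ω₀ hδ2)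
    (Eventually.of_forall hmeas) ?_ ?_ ?_ (hg.const_mul _)
    ?_).2.differentiableAt.differentiableWithinAt
  · refine (hg.const_mul M).mono' (hmeas ω₀) (Eventually.of_forall fun s => ?_)
    rw [norm_div]; exact hbd ω₀ hω₀m s
  · exact ((hgm.div ((measurable_const.sub (Complex.measurable_ofReal.comp hem)).pow_const
      2)).neg).aestronglyMeasurable
  · refine Eventually.of_forall fun s ω hω => ?_
    have h1 := hlow ω hω s
    have h2 := hbd ω hω s
    rw [norm_neg, norm_div, norm_pow, sq, ← div_div, div_mul_eq_mul_div]
    exact div_le_div₀ (mul_nonneg hM0.le (div_nonneg (norm_nonneg _) (by linarith [he s]))) h2 hδ2 h1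
  · refine Eventually.of_forall fun s ω hω => ?_
    have h1 : ω - e s ≠ 0 := norm_pos_iff.1 (lt_of_lt_of_le hδ2 (hlow ω hω s))
    have := (((hasDerivAt_id ω).sub_const (e s : ℂ)).fun_inv h1).const_mul (g s)
    refine (this.congr_deriv ?_).congr_of_eventuallyEq ?_
    · simp; field_simp
    · exact Eventually.of_forall fun z => by simp [div_eq_mul_inv]

variable {α β γ C : ℝ} {φ : ℝ → ℂ}

theorem exp_mem_compl_Ici {w : ℂ} (hw : w ∈ openStrip (2 * Real.pi)) :
    Complex.exp w ∈ (((↑) : ℝ → ℂ) '' Ici (0 : ℝ))ᶜ := by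
  rintro ⟨x, hx, h⟩
  have hx0 : 0 < x := by
    refine lt_of_le_of_ne hx fun h0 => ?_
    rw [← h0] at h
    exact Complex.exp_ne_zero w (by simpa using h.symm)
  have h1 : Complex.exp (w - Real.log x) = 1 := by
    rw [Complex.exp_sub, ← Complex.ofReal_exp, Real.exp_log hx0, ← h, div_self]
    exact_mod_cast hx0.ne'
  exact exp_sub_one_ne_zero_of_im (w := w - Real.log x)
    (by simpa [openStrip] using hw) (by rw [h1, sub_self])

theorem logCauchy_eq_integral_div (hE : TameExponents α β γ) (h : Tame α β γ C φ) {w : ℂ}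
    (hw : w ∈ openStrip (2 * Real.pi)) :
    logCauchy φ w = ∫ s : ℝ, φ s * Complex.exp s / (Complex.exp w - (Real.exp s : ℝ)) := by
  rw [logCauchy_eq_integral hE h hw]
  congr 1; ext s
  rw [expKernel, Complex.exp_sub, Complex.ofReal_exp]
  have := Complex.exp_ne_zero (s : ℂ)
  rw [div_sub_one this, inv_div, mul_div_assoc]

theorem Tame.integrable_div (hE : TameExponents α β γ) (h : Tame α β γ C φ) :
    Integrable fun s => ‖φ s * Complex.exp s‖ / (1 + Real.exp s) := by
  have hc := h.continuous hE
  have hC := h.nonneg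
  have hm : Continuous fun s : ℝ => ‖φ s * Complex.exp s‖ / (1 + Real.exp s) := by
    refine Continuous.div (by fun_prop) (by fun_prop) fun s => by positivity
  have key : ∀ δ ∈ Ioo (0 : ℝ) 1, Integrable fun s =>
      Real.exp (-(δ * s)) * (Real.exp s / (1 + Real.exp s)) := by
    intro δ hδ
    refine Integrable.mono' (g := fun s => (Ioi 0 : Set ℝ).indicator (fun s => Real.exp (-δ * s)) s +
      (Iic 0 : Set ℝ).indicator (fun s => Real.exp ((1 - δ) * s)) s) ?_ ?_ ?_
    · exact ((integrableOn_exp_mul_Ioi (by linarith [hδ.1]) 0).integrable_indicator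
        measurableSet_Ioi).add ((integrableOn_exp_mul_Iic (by linarith [hδ.2]) 0).integrable_indicator
        measurableSet_Iic)
    · refine Continuous.aestronglyMeasurable ?_
      exact Continuous.mul (by fun_prop) (Continuous.div (by fun_prop) (by fun_prop)
        fun s => by positivity)
    · refine Eventually.of_forall fun s => ?_
      rw [Real.norm_of_nonneg (by positivity)]
      have hE1 := Real.exp_pos s
      rcases lt_or_ge 0 s with hs | hs
      · rw [indicator_of_mem (show s ∈ Ioi 0 from hs), indicator_of_notMem (by simpa using hs),
          add_zero, neg_mul]
        refine mul_le_of_le_one_right (Real.exp_pos _).le ?_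
        rw [div_le_one (by positivity)]; linarith
      · rw [indicator_of_notMem (by simpa using hs), indicator_of_mem (show s ∈ Iic 0 from hs),
          zero_add, show (1 - δ) * s = -(δ * s) + s by ring, Real.exp_add]
        refine mul_le_mul_of_nonneg_left ?_ (Real.exp_pos _).le
        exact div_le_self hE1.le (by linarith)
  refine (((key β hE.hβ).add (key γ hE.hγ)).const_mul C).mono' hm.aestronglyMeasurable
    (Eventually.of_forall fun s => ?_)
  rw [Real.norm_of_nonneg (by positivity), norm_mul, Complex.norm_exp, Complex.ofReal_re]
  have h1 := h.norm_le s
  unfold expWeight at h1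
  simp only [Pi.add_apply]
  rw [← add_mul, ← mul_assoc, mul_div_assoc]
  exact mul_le_mul_of_nonneg_right h1 (by positivity)

theorem differentiableOn_logCauchy (hE : TameExponents α β γ) (h : Tame α β γ C φ) :
    DifferentiableOn ℂ (logCauchy φ) (openStrip (2 * Real.pi)) := by
  have h1 := differentiableOn_integral_div (g := fun s => φ s * Complex.exp s) (e := Real.exp)
    (fun s => (Real.exp_pos s).le) Real.measurable_exp
    ((h.continuous hE).mul (by fun_prop)).measurable (h.integrable_div hE)
  refine (h1.comp Complex.differentiable_exp.differentiableOn
    (fun w hw => exp_mem_compl_Ici hw)).congr fun w hw => ?_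
  exact logCauchy_eq_integral_div hE h hw

theorem closedStrip_subset_closure {L : ℝ} (hL : 0 < L) :
    closedStrip L ⊆ closure (openStrip L) := by
  rw [openStrip, Complex.closure_preimage_im, closure_Ioo hL.ne]
  rfl

/-- The value of `e ^ (β w) * logCauchy (expModel β) w`, which does not depend on `w`. -/
noncomputable def modelConst (β : ℝ) : ℂ :=
  Complex.exp (β * (Real.pi * Complex.I)) * logCauchy (expModel β) (Real.pi * Complex.I)

/-- A real translation of w multiplies the transform of e^{-βs} by e^{-βt}, so the left side is
constant along horizontal lines. It is holomorphic, hence its derivative vanishes and it is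
constant. Continuity carries this to the edges. -/
theorem exp_mul_logCauchy_expModel (hE : TameExponents α β γ) {w : ℂ}
    (hw : w ∈ closedStrip (2 * Real.pi)) :
    Complex.exp (β * w) * logCauchy (expModel β) w = modelConst β := by
  have hT := tame_expModel hE
  set H : ℂ → ℂ := fun w => Complex.exp (β * w) * logCauchy (expModel β) w with hH
  have hshift : ∀ (w : ℂ) (t : ℝ), H (w + t) = H w := by
    intro w t
    simp only [hH]
    rw [logCauchy_expModel, logCauchy_expModel, Complex.add_re, Complex.ofReal_re, expModel_add,
      Complex.add_im, Complex.ofReal_im, add_zero, mul_add, Complex.exp_add]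
    have : Complex.exp (β * t) * expModel β t = 1 := by
      rw [expModel, ← Complex.exp_add]; simp
    linear_combination Complex.exp (β * w) * expModel β w.re * logHilbert (expModel β) w.im * this
  have hd : DifferentiableOn ℂ H (openStrip (2 * Real.pi)) :=
    (Differentiable.differentiableOn (by fun_prop)).mul (differentiableOn_logCauchy hE hT)
  have hderiv : EqOn (deriv H) 0 (openStrip (2 * Real.pi)) := by
    intro w hw
    have h1 := (hd.differentiableAt ((isOpen_openStrip _).mem_nhds hw)).hasDerivAt
    have h2 : HasDerivAt (fun t : ℝ => w + (t : ℂ)) 1 0 := by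
      have := (((hasDerivAt_id (0 : ℂ)).const_add w).comp_ofReal (z := 0))
      simpa using this
    have h3 := HasDerivAt.scomp (h := fun t : ℝ => w + (t : ℂ)) (x := (0 : ℝ)) (g₁ := H)
      (g₁' := deriv H w) (by simpa using h1) h2
    have h4 : (H ∘ fun t : ℝ => w + (t : ℂ)) = fun _ => H w := funext fun t => hshift w t
    rw [h4] at h3
    have := h3.unique (hasDerivAt_const (0 : ℝ) (H w))
    simpa using this
  have hpi : (Real.pi * Complex.I : ℂ) ∈ openStrip (2 * Real.pi) := by
    constructor <;> simp [Real.pi_pos]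
  have hopen : EqOn H (fun _ => modelConst β) (openStrip (2 * Real.pi)) := fun w hw =>
    (isOpen_openStrip _).is_const_of_deriv_eq_zero (isPreconnected_openStrip _) hd hderiv hw hpi
  have hcont : Continuous H := (by fun_prop : Continuous fun w : ℂ => Complex.exp (β * w)).mul
    (continuous_logCauchy hE hT)
  exact hopen.closure hcont continuous_const (closedStrip_subset_closure Real.two_pi_pos hw)

theorem closedStrip_mono {L L' : ℝ} (h : L ≤ L') : closedStrip L ⊆ closedStrip L' :=
  fun _ hw => ⟨hw.1, hw.2.trans h⟩

/-- The comparison with the model density e^{-βs} leaves ℓ times the transform of the model, which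
is known exactly up to `modelConst`. The factor e^{iβ Im w} restores the full exponential and has
modulus 1. -/
theorem tendsto_exp_mul_logCauchy (hE : TameExponents α β γ) (h : Tame α β γ C φ) {ℓ : ℂ}
    (hl : Tendsto (fun s => φ s / expModel β s) atBot (𝓝 ℓ)) {L : ℝ} (hL : L ≤ 2 * Real.pi) :
    Tendsto (fun w => Complex.exp (β * w) * logCauchy φ w) (leftEnd L) (𝓝 (ℓ * modelConst β)) := by
  have h1 := tendsto_leftEnd_sub hE h hl L
  have h2 : Tendsto (fun w : ℂ => Complex.exp (β * (w.im * Complex.I)) *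
      ((expModel β w.re)⁻¹ * logCauchy φ w - ℓ * logHilbert (expModel β) w.im)) (leftEnd L)
      (𝓝 0) := by
    rw [tendsto_zero_iff_norm_tendsto_zero] at h1 ⊢
    refine h1.congr fun w => ?_
    rw [norm_mul, Complex.norm_exp]; simp
  have h3 := h2.add_const (ℓ * modelConst β)
  rw [zero_add] at h3
  refine h3.congr' ?_
  filter_upwards [closedStrip_mem_leftEnd] with w hw
  rw [← exp_mul_logCauchy_expModel hE (closedStrip_mono hL hw), logCauchy_expModel]
  have e1 : Complex.exp (β * w) = Complex.exp (β * (w.im * Complex.I)) * (expModel β w.re)⁻¹ := by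
    rw [expModel, ← Complex.exp_neg, ← Complex.exp_add]
    congr 1
    conv_lhs => rw [← Complex.re_add_im w]
    ring
  have e2 : expModel β w.re ≠ 0 := Complex.exp_ne_zero _
  rw [e1]
  field_simp
  ring

end holomorphy

/-! ### Densities with a finite limit at the threshold, and the borderline difference -/

section convergent

variable {α β γ C α' β' γ' C' : ℝ} {φ : ℝ → ℂ} {ℓ : ℂ} {L : ℝ}

theorem tendsto_exp_leftEnd {r : ℝ} (hr : 0 < r) :
    Tendsto (fun w : ℂ => Complex.exp (r * w)) (leftEnd L) (𝓝 0) := by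
  rw [tendsto_zero_iff_norm_tendsto_zero]
  have : ∀ w : ℂ, ‖Complex.exp (r * w)‖ = Real.exp (r * w.re) := by
    intro w; rw [Complex.norm_exp]; simp
  simp_rw [this]
  exact Real.tendsto_exp_atBot.comp (tendsto_re_leftEnd.const_mul_atBot hr)

theorem tendsto_exp_mul_logCauchy_zero (hE : TameExponents α β γ) (h : Tame α β γ C φ)
    (hl : Tendsto (fun s => φ s / expModel β s) atBot (𝓝 ℓ)) (hL : L ≤ 2 * Real.pi) {r : ℝ}
    (hr : β < r) :
    Tendsto (fun w => Complex.exp (r * w) * logCauchy φ w) (leftEnd L) (𝓝 0) := by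
  have h1 := (tendsto_exp_leftEnd (L := L) (sub_pos.2 hr)).mul (tendsto_exp_mul_logCauchy hE h hl hL)
  rw [zero_mul] at h1
  refine h1.congr fun w => ?_
  rw [← mul_assoc, ← Complex.exp_add]
  congr 2; push_cast; ring

theorem expKernel_add_one {w : ℂ} (hw : Complex.exp w - 1 ≠ 0) :
    expKernel w + 1 = Complex.exp w * expKernel w := by
  rw [expKernel]; field_simp; ring

/-- From 1/(e^{w-s} - 1) = -1 + e^{w-s}/(e^{w-s} - 1), the transform is -∫ φ plus e^w times the
transform of φ e^{-s}. The latter grows at most like e^{-β'w} with β' < 1, so this term vanishes. -/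
theorem tendsto_logCauchy_leftEnd (hE : TameExponents α β γ) (h : Tame α β γ C φ)
    (hE' : TameExponents α' β' γ') (h' : Tame α' β' γ' C' fun s => φ s * Complex.exp (-s))
    (hl : Tendsto (fun s => φ s * Complex.exp (-s) / expModel β' s) atBot (𝓝 ℓ))
    (hL : L ≤ 2 * Real.pi) :
    Tendsto (logCauchy φ) (leftEnd L) (𝓝 (-∫ s, φ s)) := by
  have hopen : EqOn (logCauchy φ) (fun w => -(∫ s, φ s) +
      Complex.exp w * logCauchy (fun s => φ s * Complex.exp (-s)) w) (openStrip (2 * Real.pi)) := by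
    intro w hw
    have i1 := h.integrable_mul_expKernel hE hw
    have i2 := (h'.integrable_mul_expKernel hE' hw).const_mul (Complex.exp w)
    have e : ∀ s : ℝ, φ s = Complex.exp w * (φ s * Complex.exp (-s) * expKernel (w - s)) -
        φ s * expKernel (w - s) := by
      intro s
      have h1 := expKernel_add_one (w := w - s)
        (exp_sub_one_ne_zero_of_im (by simpa [openStrip] using hw))
      rw [sub_eq_add_neg w, Complex.exp_add, ← sub_eq_add_neg] at h1
      linear_combination φ s * h1
    simp only []
    rw [logCauchy_eq_integral hE h hw, logCauchy_eq_integral hE' h' hw]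
    have e2 : ∫ s, φ s = ∫ s : ℝ, (Complex.exp w * (φ s * Complex.exp (-s) * expKernel (w - s)) -
        φ s * expKernel (w - s)) := by congr 1; ext s; exact e s
    rw [e2, integral_sub i2 i1, integral_const_mul]
    ring
  have hcl := hopen.closure (continuous_logCauchy hE h)
    (continuous_const.add (Complex.continuous_exp.mul (continuous_logCauchy hE' h')))
  have h1 := (tendsto_exp_mul_logCauchy_zero hE' h' hl hL hE'.hβ.2).const_add (-∫ s, φ s)
  rw [add_zero] at h1
  refine h1.congr' ?_
  filter_upwards [closedStrip_mem_leftEnd] with w hw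
  rw [hcl (closedStrip_subset_closure Real.two_pi_pos (closedStrip_mono hL hw))]
  simp

/-- With z = e^{w-s}, shifting w by πi replaces z by -z, and 1/(z - 1) + 1/(z + 1) = 2z/(z² - 1).
The right side is the kernel at 2(w - s), hence the substitution t = 2s. -/
theorem logCauchy_sub_logCauchy_add_pi (hE : TameExponents α β γ) (h : Tame α β γ C φ)
    (hE' : TameExponents α' β' γ')
    (h' : Tame α' β' γ' C' fun t => φ (t / 2) * Complex.exp (-(t / 2)))
    {w : ℂ} (hw : w ∈ closedStrip Real.pi) :
    logCauchy φ w - logCauchy φ (w + Real.pi * Complex.I) =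
      Complex.exp w * logCauchy (fun t => φ (t / 2) * Complex.exp (-(t / 2))) (2 * w) := by
  have hopen : EqOn (fun w => logCauchy φ w - logCauchy φ (w + Real.pi * Complex.I)) (fun w =>
      Complex.exp w * logCauchy (fun t => φ (t / 2) * Complex.exp (-(t / 2))) (2 * w))
      (openStrip Real.pi) := by
    intro w hw
    have hpi := Real.pi_pos
    have hw1 : w ∈ openStrip (2 * Real.pi) := ⟨hw.1, hw.2.trans (by linarith)⟩
    have hw2 : w + Real.pi * Complex.I ∈ openStrip (2 * Real.pi) := by
      have h1 : 0 < w.im := hw.1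
      have h2 : w.im < Real.pi := hw.2
      constructor <;> simp <;> linarith
    have hw3 : 2 * w ∈ openStrip (2 * Real.pi) := by
      have h1 : 0 < w.im := hw.1
      have h2 : w.im < Real.pi := hw.2
      constructor <;> simp <;> linarith
    simp only []
    rw [logCauchy_eq_integral hE h hw1, logCauchy_eq_integral hE h hw2,
      logCauchy_eq_integral hE' h' hw3,
      ← integral_sub (h.integrable_mul_expKernel hE hw1) (h.integrable_mul_expKernel hE hw2)]
    have hsub := Measure.integral_comp_mul_left
      (fun t : ℝ => φ (t / 2) * Complex.exp (-(t / 2)) * expKernel (2 * w - t)) 2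
    have h2 : ∫ t : ℝ, φ (t / 2) * Complex.exp (-(t / 2)) * expKernel (2 * w - t) =
        2 * ∫ s : ℝ, φ s * Complex.exp (-s) * expKernel (2 * (w - s)) := by
      have e : ∀ s : ℝ, φ (2 * s / 2) * Complex.exp (-(((2 * s : ℝ) : ℂ) / 2)) *
          expKernel (2 * w - ((2 * s : ℝ) : ℂ)) = φ s * Complex.exp (-s) * expKernel (2 * (w - s)) := by
        intro s
        rw [mul_div_cancel_left₀ s two_ne_zero]
        congr 2
        · congr 2; push_cast; ring
        · push_cast; ring
      simp_rw [e] at hsub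
      rw [hsub, abs_of_pos (by norm_num), Complex.real_smul]
      push_cast; ring
    rw [h2, ← mul_assoc, ← integral_const_mul]
    congr 1; ext s
    have n1 : Complex.exp (w - s) - 1 ≠ 0 :=
      exp_sub_one_ne_zero_of_im (by simpa [openStrip] using hw1)
    have n2 : Complex.exp (2 * (w - s)) - 1 ≠ 0 :=
      exp_sub_one_ne_zero_of_im (by simpa [openStrip] using hw3)
    have e1 : Complex.exp (w + Real.pi * Complex.I - s) = -Complex.exp (w - s) := by
      rw [show w + Real.pi * Complex.I - s = (w - s) + Real.pi * Complex.I by ring,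
        Complex.exp_add, Complex.exp_pi_mul_I]; ring
    have e2 : Complex.exp (2 * (w - s)) = Complex.exp (w - s) * Complex.exp (w - s) := by
      rw [← Complex.exp_add]; congr 1; ring
    have e3 : Complex.exp w * Complex.exp (-s) = Complex.exp (w - s) := by
      rw [← Complex.exp_add]; congr 1
    have n3 : -Complex.exp (w - s) - 1 ≠ 0 := by
      rw [← e1]
      exact exp_sub_one_ne_zero_of_im (by simpa [openStrip] using hw2)
    rw [expKernel, expKernel, expKernel, e1, e2]
    rw [e2] at n2
    have e4 : Complex.exp w * 2 * (φ s * Complex.exp (-s) *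
        (Complex.exp (w - s) * Complex.exp (w - s) - 1)⁻¹) = φ s * (2 * Complex.exp (w - s) *
        (Complex.exp (w - s) * Complex.exp (w - s) - 1)⁻¹) := by rw [← e3]; ring
    rw [e4, ← mul_sub]
    congr 1
    generalize Complex.exp (w - s) = z at n1 n2 n3
    have n4 : z + 1 ≠ 0 := fun h0 => n3 (by linear_combination -h0)
    rw [show z * z - 1 = (z - 1) * (z + 1) by ring, show -z - 1 = -(z + 1) by ring]
    field_simp
    ring
  have hc := continuous_logCauchy hE h
  have hc' := continuous_logCauchy hE' h'
  exact hopen.closure (hc.sub (hc.comp (by fun_prop)))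
    (Complex.continuous_exp.mul (hc'.comp (by fun_prop)))
    (closedStrip_subset_closure Real.pi_pos hw)

/-- When φ tends to a constant, each transform may diverge logarithmically. In the difference the
new density has exponent 1/2 in the variable 2w, and the factor e^w compensates this growth exactly.
-/
theorem tendsto_logCauchy_sub_logCauchy_add_pi (hE : TameExponents α β γ) (h : Tame α β γ C φ)
    (hE' : TameExponents α' (1 / 2) γ')
    (h' : Tame α' (1 / 2) γ' C' fun t => φ (t / 2) * Complex.exp (-(t / 2)))
    (hl : Tendsto φ atBot (𝓝 ℓ)) :
    Tendsto (fun w => logCauchy φ w - logCauchy φ (w + Real.pi * Complex.I)) (leftEnd Real.pi)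
      (𝓝 (ℓ * modelConst (1 / 2))) := by
  have hl' : Tendsto (fun t : ℝ => φ (t / 2) * Complex.exp (-(t / 2)) / expModel (1 / 2) t) atBot
      (𝓝 ℓ) := by
    refine (hl.comp (tendsto_id.atBot_div_const two_pos)).congr fun t => ?_
    rw [expModel, show -(((1 / 2 : ℝ) : ℂ) * t) = -(t / 2) by push_cast; ring,
      mul_div_cancel_right₀ _ (Complex.exp_ne_zero _)]
    simp
  have h1 := tendsto_exp_mul_logCauchy hE' h' hl' le_rfl
  have h2 : Tendsto (fun w : ℂ => 2 * w) (leftEnd Real.pi) (leftEnd (2 * Real.pi)) := by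
    refine tendsto_inf.2 ⟨tendsto_comap_iff.2 ?_, tendsto_principal.2 ?_⟩
    · have := (tendsto_re_leftEnd (L := Real.pi)).const_mul_atBot two_pos
      refine this.congr fun w => ?_
      simp
    · filter_upwards [closedStrip_mem_leftEnd] with w hw
      have h1 : 0 ≤ w.im := hw.1
      have h2 : w.im ≤ Real.pi := hw.2
      constructor <;> simp <;> linarith
  refine (h1.comp h2).congr' ?_
  filter_upwards [closedStrip_mem_leftEnd] with w hw
  rw [logCauchy_sub_logCauchy_add_pi hE h hE' h' hw]
  simp only [Function.comp]
  congr 2; push_cast; ring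

end convergent

/-! ### Logarithmic divergence for a density with a constant limit -/

section logarithmic

variable {α β γ C C₀ c : ℝ} {φ : ℝ → ℂ} {ℓ : ℂ} {L : ℝ}

theorem Tame.integrableOn_Ioi (hE : TameExponents α β γ) (h : Tame α β γ C φ) (a : ℝ) :
    IntegrableOn φ (Ioi a) := by
  refine Integrable.mono' (g := fun s => C * expWeight β γ s) (Integrable.const_mul ?_ C)
    (h.continuous hE).aestronglyMeasurable (Eventually.of_forall h.norm_le)
  unfold expWeight
  have h1 := integrableOn_exp_mul_Ioi (neg_lt_zero.2 hE.hβ.1) a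
  have h2 := integrableOn_exp_mul_Ioi (neg_lt_zero.2 hE.hγ.1) a
  simp_rw [← neg_mul]
  exact h1.add h2

theorem expWeight_neg_ge_one (hE : TameExponents α β γ) {u : ℝ} (hu : 0 ≤ u) :
    1 ≤ expWeight β γ (-u) := by
  unfold expWeight
  have h1 : 1 ≤ Real.exp (-(β * -u)) :=
    Real.one_le_exp (by rw [mul_neg, neg_neg]; exact mul_nonneg hE.hβ.1.le hu)
  linarith [Real.exp_pos (-(γ * -u))]

/-- For u < -1 the kernel is -1 up to an exponentially small error, and only this part of the
integral can be large. Adding ∫ φ over s > Re w + 1 removes it. -/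
theorem exists_bound_logCauchy_add_integral (hE : TameExponents α β γ) (h : Tame α β γ C φ)
    (hb : ∀ s, ‖φ s‖ ≤ C₀)
    (hh : ∀ s ≤ 0, ∀ u, |u| ≤ 1 → ‖φ (s + u) - φ s‖ ≤ C₀ * |u| ^ α) (L : ℝ) :
    ∃ M, ∀ w ∈ closedStrip L, w.re ≤ 0 →
      ‖logCauchy φ w + ∫ s in Ioi (w.re + 1), φ s‖ ≤ M := by
  have hC₀ : 0 ≤ C₀ := (norm_nonneg _).trans (hb 0)
  obtain ⟨M, hM⟩ := (isCompact_Icc (a := 0) (b := L)).exists_bound_of_continuousOn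
    continuous_kernelIntegral.continuousOn
  set g : ℝ → ℝ := fun u => C₀ * (kernelBound α β γ u + kernelBound α β γ (-u)) with hg
  have hint := integrable_kernelBound hE.hα hE.hβ hE.hγ
  have hgi : Integrable g := (hint.add hint.comp_neg).const_mul C₀
  refine ⟨(∫ u, g u) + C₀ * M, fun w hw hre => ?_⟩
  have hT := h.locTame_shift hE (x := w.re) le_rfl
  have i1 := hT.integrable_integrand hE.hα hE.hβ hE.hγ w.im
  have i2 : Integrable ((Iio (-1) : Set ℝ).indicator fun u => φ (w.re - u)) := by
    have h1 := ((h.integrableOn_Ioi hE (w.re + 1)).integrable_indicator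
      measurableSet_Ioi).comp_sub_left w.re
    refine h1.congr (Eventually.of_forall fun u => ?_)
    beta_reduce
    by_cases hu : u < -1
    · rw [indicator_of_mem (show u ∈ Iio (-1) from hu),
        indicator_of_mem (show w.re - u ∈ Ioi (w.re + 1) by simp only [mem_Ioi]; linarith)]
    · rw [indicator_of_notMem (show u ∉ Iio (-1) from hu),
        indicator_of_notMem (show w.re - u ∉ Ioi (w.re + 1) by
          simp only [mem_Ioi]; intro hcon; exact hu (by linarith))]
  have e2 : ∫ s in Ioi (w.re + 1), φ s =
      ∫ u, (Iio (-1) : Set ℝ).indicator (fun u => φ (w.re - u)) u := by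
    rw [← integral_indicator measurableSet_Ioi, ← integral_sub_left_eq_self _ volume w.re]
    congr 1; ext u
    by_cases hu : u < -1
    · rw [indicator_of_mem (show u ∈ Iio (-1) from hu),
        indicator_of_mem (show w.re - u ∈ Ioi (w.re + 1) by simp only [mem_Ioi]; linarith)]
    · rw [indicator_of_notMem (show u ∉ Iio (-1) from hu),
        indicator_of_notMem (show w.re - u ∉ Ioi (w.re + 1) by
          simp only [mem_Ioi]; intro hcon; exact hu (by linarith))]
  rw [logCauchy, logHilbert, e2, add_right_comm, ← integral_add i1 i2]
  refine (norm_add_le _ _).trans (add_le_add ?_ ?_)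
  · refine norm_integral_le_of_norm_le hgi ?_
    filter_upwards [ae_ne_zero] with u hu
    simp only [add_zero]
    have k1 := norm_expKernel_le u w.im hu
    have p1 := kernelBound_nonneg α β γ u
    have p2 := kernelBound_nonneg α β γ (-u)
    by_cases h1 : |u| ≤ 1
    · have hu1 : ¬ u < -1 := not_lt.2 (abs_le.1 h1).1
      rw [indicator_of_notMem (show u ∉ Iio (-1) from hu1), add_zero, unitCutoff_of_le h1, one_mul,
        norm_mul, ← sub_eq_add_neg]
      have h2 := hh w.re hre (-u) (by rwa [abs_neg])
      rw [abs_neg, ← sub_eq_add_neg] at h2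
      calc _ ≤ C₀ * |u| ^ α * |Real.exp u - 1|⁻¹ :=
            mul_le_mul h2 k1 (norm_nonneg _) (by positivity)
        _ = C₀ * kernelBound α β γ u := by rw [kernelBound, if_pos h1, mul_assoc]
        _ ≤ g u := mul_le_mul_of_nonneg_left (by linarith) hC₀
    · rw [unitCutoff_of_not_le h1, zero_mul, sub_zero, ← sub_eq_add_neg]
      by_cases hu1 : u < -1
      · rw [indicator_of_mem (show u ∈ Iio (-1) from hu1), ← mul_add_one, norm_mul]
        have hne : Complex.exp (u + w.im * Complex.I) - 1 ≠ 0 :=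
          sub_ne_zero.2 (exp_ne_one_of_re_ne_zero (by simpa using hu))
        -- Kernel plus 1 is e^u times the kernel in modulus, so the remainder on u < -1 is bounded
        -- by the kernel bound at -u.
        have k2 : ‖expKernel (u + w.im * Complex.I) + 1‖ ≤ |Real.exp (-u) - 1|⁻¹ := by
          rw [expKernel_add_one hne, norm_mul, Complex.norm_exp]
          have e3 : |Real.exp (-u) - 1|⁻¹ = Real.exp u * |Real.exp u - 1|⁻¹ := by
            have h3 : Real.exp (-u) - 1 = -(Real.exp u - 1) * Real.exp (-u) := by
              rw [neg_mul, sub_mul, ← Real.exp_add]; simp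
            rw [h3, abs_mul, abs_neg, abs_of_pos (Real.exp_pos (-u)), mul_inv, ← Real.exp_neg,
              neg_neg, mul_comm]
          rw [e3]
          simpa using mul_le_mul_of_nonneg_left k1 (Real.exp_pos u).le
        calc _ ≤ C₀ * |Real.exp (-u) - 1|⁻¹ := mul_le_mul (hb _) k2 (norm_nonneg _) hC₀
          _ ≤ C₀ * kernelBound α β γ (-u) := by
            refine mul_le_mul_of_nonneg_left ?_ hC₀
            rw [kernelBound, abs_neg, if_neg h1]
            exact le_mul_of_one_le_left (by positivity) (expWeight_neg_ge_one hE (by linarith))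
          _ ≤ g u := mul_le_mul_of_nonneg_left (by linarith) hC₀
      · rw [indicator_of_notMem (show u ∉ Iio (-1) from hu1), add_zero, norm_mul]
        have hu2 : 0 ≤ u := by
          rw [abs_le] at h1; by_contra hcon; exact h1 ⟨not_lt.1 hu1, by linarith⟩
        calc _ ≤ C₀ * |Real.exp u - 1|⁻¹ := mul_le_mul (hb _) k1 (norm_nonneg _) hC₀
          _ ≤ C₀ * kernelBound α β γ u := by
            refine mul_le_mul_of_nonneg_left ?_ hC₀
            rw [kernelBound, if_neg h1]
            exact le_mul_of_one_le_left (by positivity) (expWeight_neg_ge_one hE hu2)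
          _ ≤ g u := mul_le_mul_of_nonneg_left (by linarith) hC₀
  · rw [norm_mul, add_zero]
    exact mul_le_mul (hb _) (hM _ hw) (norm_nonneg _) hC₀

/-- As φ - ℓ is exponentially small for s → -∞, the integral of φ over s > Re w + 1 is (-Re w) ℓ
plus a bounded term. -/
theorem tendsto_logCauchy_div_re (hE : TameExponents α β γ) (h : Tame α β γ C φ)
    (hb : ∀ s, ‖φ s‖ ≤ C₀)
    (hh : ∀ s ≤ 0, ∀ u, |u| ≤ 1 → ‖φ (s + u) - φ s‖ ≤ C₀ * |u| ^ α)
    (hc : 0 < c) (hr : ∀ s ≤ 0, ‖φ s - ℓ‖ ≤ C₀ * Real.exp (c * s)) (L : ℝ) :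
    Tendsto (fun w : ℂ => (((-w.re)⁻¹ : ℝ) : ℂ) * logCauchy φ w) (leftEnd L) (𝓝 (-ℓ)) := by
  obtain ⟨M, hM⟩ := exists_bound_logCauchy_add_integral hE h hb hh L
  have hcφ := h.continuous hE
  have hexp : IntegrableOn (fun s => C₀ * Real.exp (c * s)) (Iic 0) :=
    (integrableOn_exp_mul_Iic hc 0).const_mul C₀
  have hI : IntegrableOn (fun s => φ s - ℓ) (Iic 0) := by
    refine Integrable.mono' hexp (by fun_prop) ?_
    filter_upwards [ae_restrict_mem measurableSet_Iic] with s hs using hr s hs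
  have hsplit : ∀ x ≤ (-1 : ℝ), ∫ s in Ioi (x + 1), φ s =
      (∫ s in Ioi 0, φ s) + (∫ s in Ioc (x + 1) 0, (φ s - ℓ)) + (-x - 1 : ℝ) * ℓ := by
    intro x hx
    have h1 : Ioi (x + 1) = Ioi 0 ∪ Ioc (x + 1) 0 := by
      rw [union_comm, Ioc_union_Ioi_eq_Ioi (by linarith)]
    have hdisj : Disjoint (Ioi 0) (Ioc (x + 1) 0) :=
      disjoint_left.2 fun s hs hs' => not_le.2 hs hs'.2
    rw [h1, setIntegral_union hdisj measurableSet_Ioc (h.integrableOn_Ioi hE 0)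
      ((h.integrableOn_Ioi hE (x + 1)).mono_set Ioc_subset_Ioi_self)]
    have h2 : ∫ s in Ioc (x + 1) 0, φ s = ∫ s in Ioc (x + 1) 0, ((φ s - ℓ) + ℓ) := by simp
    rw [h2, integral_add (hI.mono_set Ioc_subset_Iic_self) (by simp)]
    rw [setIntegral_const, measureReal_def, Real.volume_Ioc,
      ENNReal.toReal_ofReal (by linarith), Complex.real_smul, add_assoc]
    congr 3; push_cast; ring
  set B : ℝ := M + ‖∫ s in Ioi 0, φ s‖ + (∫ s in Iic 0, C₀ * Real.exp (c * s)) + ‖ℓ‖ with hB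
  have hbound : ∀ w ∈ closedStrip L, w.re ≤ -1 → ‖logCauchy φ w + (-w.re : ℝ) * ℓ‖ ≤ B := by
    intro w hw hre
    have h1 := hM w hw (by linarith)
    rw [hsplit _ hre] at h1
    have h2 : ‖∫ s in Ioc (w.re + 1) 0, (φ s - ℓ)‖ ≤ ∫ s in Iic 0, C₀ * Real.exp (c * s) := by
      refine (norm_integral_le_of_norm_le (hexp.mono_set Ioc_subset_Iic_self) ?_).trans
        (setIntegral_mono_set hexp ?_ Ioc_subset_Iic_self.eventuallyLE)
      · filter_upwards [ae_restrict_mem measurableSet_Ioc] with s hs using hr s hs.2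
      · have hC₀ : 0 ≤ C₀ := (norm_nonneg _).trans (hb 0)
        exact Eventually.of_forall fun s => by simp only [Pi.zero_apply]; positivity
    have e : logCauchy φ w + (-w.re : ℝ) * ℓ = (logCauchy φ w + ((∫ s in Ioi 0, φ s) +
        (∫ s in Ioc (w.re + 1) 0, (φ s - ℓ)) + (-w.re - 1 : ℝ) * ℓ)) - (∫ s in Ioi 0, φ s) -
        (∫ s in Ioc (w.re + 1) 0, (φ s - ℓ)) + ℓ := by push_cast; ring
    rw [e]
    refine (norm_add_le _ _).trans (add_le_add ((norm_sub_le _ _).trans (add_le_add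
      ((norm_sub_le _ _).trans (add_le_add h1 le_rfl)) h2)) le_rfl)
  have hinv : Tendsto (fun w : ℂ => (-w.re)⁻¹) (leftEnd L) (𝓝 0) :=
    tendsto_inv_atTop_zero.comp (tendsto_neg_atBot_atTop.comp tendsto_re_leftEnd)
  have hlim : Tendsto (fun w : ℂ => (((-w.re)⁻¹ : ℝ) : ℂ) * (logCauchy φ w + (-w.re : ℝ) * ℓ))
      (leftEnd L) (𝓝 0) := by
    refine Tendsto.zero_mul_isBoundedUnder_le ?_ ⟨B, ?_⟩
    · rw [← Complex.ofReal_zero]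
      exact (Complex.continuous_ofReal.tendsto 0).comp hinv
    · rw [eventually_map]
      filter_upwards [closedStrip_mem_leftEnd,
        eventually_leftEnd_re (eventually_le_atBot (-1))] with w h1 h2 using hbound w h1 h2
  have := hlim.sub_const ℓ
  rw [zero_sub] at this
  refine this.congr' ?_
  filter_upwards [eventually_leftEnd_re (eventually_le_atBot (-1))] with w hw
  have hne : ((-w.re : ℝ) : ℂ) ≠ 0 := by
    have : (-w.re : ℝ) ≠ 0 := by linarith
    exact_mod_cast this
  rw [Complex.ofReal_inv, mul_add, ← mul_assoc, inv_mul_cancel₀ hne]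
  ring

end logarithmic

/-! ### Symbols: functions of the momentum -/

/-- Polynomially bounded functions with polynomially bounded local Hölder constants. -/
def IsSymbol (P Q α : ℝ) (f : ℝ → ℂ) : Prop :=
  ∃ C, 0 ≤ C ∧ (∀ k, ‖f k‖ ≤ C * (1 + |k|) ^ P) ∧
    ∀ k l, ‖f k - f l‖ ≤ C * (1 + |k| + |l|) ^ Q * |k - l| ^ α

/-- `f` is analytic at `0`, with expansion `f k = a k ^ d + O(k ^ (d + 1))`. -/
def HasLead (d : ℕ) (f : ℝ → ℂ) (a : ℂ) : Prop :=
  ∃ F : ℝ → ℂ, AnalyticAt ℝ F 0 ∧ F 0 = a ∧ ∀ᶠ k in 𝓝 (0 : ℝ), f k = (k : ℂ) ^ d * F k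

section lead

variable {f g : ℝ → ℂ} {a b : ℂ} {d e : ℕ}

theorem analyticAt_conj_comp (h : AnalyticAt ℝ f 0) :
    AnalyticAt ℝ (fun k => (starRingEnd ℂ) (f k)) 0 :=
  ((Complex.conjCLE : ℂ →L[ℝ] ℂ).analyticAt _).comp h

theorem analyticAt_comp_neg (h : AnalyticAt ℝ f 0) : AnalyticAt ℝ (fun k => f (-k)) 0 := by
  have h1 : AnalyticAt ℝ (fun k : ℝ => -k) 0 := by fun_prop
  exact AnalyticAt.comp (g := f) (f := fun k : ℝ => -k) (by simpa using h) h1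

theorem HasLead.mul_conj (hf : HasLead d f a) (hg : HasLead e g b) :
    HasLead (d + e) (fun k => f k * (starRingEnd ℂ) (g k)) (a * (starRingEnd ℂ) b) := by
  obtain ⟨F, hF, rfl, hf⟩ := hf
  obtain ⟨G, hG, rfl, hg⟩ := hg
  refine ⟨fun k => F k * (starRingEnd ℂ) (G k), hF.mul (analyticAt_conj_comp hG), rfl, ?_⟩
  filter_upwards [hf, hg] with k h1 h2
  rw [h1, h2, map_mul, map_pow, Complex.conj_ofReal]; ring

theorem HasLead.comp_neg (hf : HasLead d f a) : HasLead d (fun k => f (-k)) ((-1) ^ d * a) := by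
  obtain ⟨F, hF, rfl, hf⟩ := hf
  refine ⟨fun k => (-1) ^ d * F (-k), analyticAt_const.mul (analyticAt_comp_neg hF), by simp, ?_⟩
  have : Tendsto (fun k : ℝ => -k) (𝓝 0) (𝓝 0) := by
    simpa using (continuous_neg (G := ℝ)).tendsto 0
  filter_upwards [this.eventually hf] with k h1
  rw [h1]; push_cast; rw [neg_pow]; ring

theorem HasLead.add (hf : HasLead d f a) (hg : HasLead d g b) :
    HasLead d (fun k => f k + g k) (a + b) := by
  obtain ⟨F, hF, rfl, hf⟩ := hf
  obtain ⟨G, hG, rfl, hg⟩ := hg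
  refine ⟨fun k => F k + G k, hF.add hG, rfl, ?_⟩
  filter_upwards [hf, hg] with k h1 h2
  rw [h1, h2]; ring

theorem HasLead.const_mul (hf : HasLead d f a) (c : ℂ) :
    HasLead d (fun k => c * f k) (c * a) := by
  obtain ⟨F, hF, rfl, hf⟩ := hf
  refine ⟨fun k => c * F k, analyticAt_const.mul hF, rfl, ?_⟩
  filter_upwards [hf] with k h1
  rw [h1]; ring

theorem hasLead_succ_of_zero (hf : HasLead d f 0) : ∃ b, HasLead (d + 1) f b := by
  obtain ⟨F, hF, h0, hf⟩ := hf
  have h1 : ((1 : ℕ) : ℕ∞) ≤ analyticOrderAt F 0 := by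
    rw [Nat.cast_one, Order.one_le_iff_ne_zero]
    exact hF.analyticOrderAt_ne_zero.2 h0
  obtain ⟨G, hG, hFG⟩ := (natCast_le_analyticOrderAt hF).1 h1
  refine ⟨G 0, G, hG, rfl, ?_⟩
  filter_upwards [hf, hFG] with k h1 h2
  rw [h1, h2]
  simp only [sub_zero, pow_one, Complex.real_smul]; ring

theorem hasLead_zero (h : AnalyticAt ℝ f 0) : HasLead 0 f (f 0) :=
  ⟨f, h, rfl, Eventually.of_forall fun k => by simp⟩

end lead

section symbols

variable {P P' Q Q' α : ℝ} {f g : ℝ → ℂ}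

theorem IsSymbol.mul_conj (hf : IsSymbol P Q α f) (hg : IsSymbol P Q α g) :
    IsSymbol (2 * P) (Q + |P|) α fun k => f k * (starRingEnd ℂ) (g k) := by
  obtain ⟨C, hC, h1, h2⟩ := hf
  obtain ⟨D, hD, h3, h4⟩ := hg
  refine ⟨2 * (C * D), by positivity, fun k => ?_, fun k l => ?_⟩
  · have hk : 0 < 1 + |k| := by positivity
    rw [norm_mul, RCLike.norm_conj, two_mul P, Real.rpow_add hk]
    have := mul_le_mul (h1 k) (h3 k) (norm_nonneg _) (by positivity)
    have h5 : 0 ≤ C * D * ((1 + |k|) ^ P * (1 + |k|) ^ P) := by positivity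
    linarith
  · have hkl : 1 ≤ 1 + |k| + |l| := by linarith [abs_nonneg k, abs_nonneg l]
    have hb : ∀ x, (x = k ∨ x = l) → (1 + |x|) ^ P ≤ (1 + |k| + |l|) ^ |P| := by
      intro x hx
      have hx1 : 1 ≤ 1 + |x| := by linarith [abs_nonneg x]
      refine (Real.rpow_le_rpow_of_exponent_le hx1 (le_abs_self P)).trans ?_
      refine Real.rpow_le_rpow (by linarith) ?_ (abs_nonneg P)
      rcases hx with h | h <;> rw [h] <;> linarith [abs_nonneg k, abs_nonneg l]
    rw [Real.rpow_add (by linarith)]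
    have e : f k * (starRingEnd ℂ) (g k) - f l * (starRingEnd ℂ) (g l) =
        (f k - f l) * (starRingEnd ℂ) (g k) + f l * (starRingEnd ℂ) (g k - g l) := by
      rw [map_sub]; ring
    rw [e]
    refine (norm_add_le _ _).trans ?_
    rw [norm_mul, norm_mul, RCLike.norm_conj, RCLike.norm_conj]
    set T := (1 + |k| + |l|) ^ Q
    set U := (1 + |k| + |l|) ^ |P|
    set V := |k - l| ^ α
    have hT : 0 ≤ T := by positivity
    have hU : 0 ≤ U := by positivity
    have hV : 0 ≤ V := by positivity
    have k1 : ‖g k‖ ≤ D * U := (h3 k).trans (mul_le_mul_of_nonneg_left (hb k (Or.inl rfl)) hD)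
    have k2 : ‖f l‖ ≤ C * U := (h1 l).trans (mul_le_mul_of_nonneg_left (hb l (Or.inr rfl)) hC)
    have k3 := mul_le_mul (h2 k l) k1 (norm_nonneg _) (by positivity)
    have k4 := mul_le_mul k2 (h4 k l) (norm_nonneg _) (by positivity)
    calc _ ≤ C * T * V * (D * U) + C * U * (D * T * V) := add_le_add k3 k4
      _ = _ := by ring

theorem IsSymbol.comp_neg (hf : IsSymbol P Q α f) : IsSymbol P Q α fun k => f (-k) := by
  obtain ⟨C, hC, h1, h2⟩ := hf
  refine ⟨C, hC, fun k => by simpa using h1 (-k), fun k l => ?_⟩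
  have := h2 (-k) (-l)
  rwa [abs_neg, abs_neg, neg_sub_neg, abs_sub_comm] at this

theorem IsSymbol.add (hf : IsSymbol P Q α f) (hg : IsSymbol P Q α g) :
    IsSymbol P Q α fun k => f k + g k := by
  obtain ⟨C, hC, h1, h2⟩ := hf
  obtain ⟨D, hD, h3, h4⟩ := hg
  refine ⟨C + D, by positivity, fun k => ?_, fun k l => ?_⟩
  · rw [add_mul]
    exact (norm_add_le _ _).trans (add_le_add (h1 k) (h3 k))
  · rw [add_sub_add_comm, add_mul, add_mul]
    exact (norm_add_le _ _).trans (add_le_add (h2 k l) (h4 k l))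

theorem IsSymbol.const_mul (hf : IsSymbol P Q α f) (c : ℂ) :
    IsSymbol P Q α fun k => c * f k := by
  obtain ⟨C, hC, h1, h2⟩ := hf
  refine ⟨‖c‖ * C, by positivity, fun k => ?_, fun k l => ?_⟩
  · rw [norm_mul, mul_assoc]
    exact mul_le_mul_of_nonneg_left (h1 k) (norm_nonneg _)
  · rw [← mul_sub, norm_mul, mul_assoc, mul_assoc, ← mul_assoc C]
    exact mul_le_mul_of_nonneg_left (h2 k l) (norm_nonneg _)

/-- The local Hölder bound is extended to all pairs: for |k - l| ≥ 1 the growth bounds suffice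
because |k - l|^α ≥ 1. Lowering α to at most 1 is harmless for |k - l| ≤ 1. -/
theorem exists_isSymbol_of_admissible {N : ℕ} {m : ℝ} {v : ℝ → EuclideanSpace ℂ (Fin N)}
    (hv : AdmissibleCoupling m v) :
    ∃ p Q α : ℝ, 2 * p < m - 1 ∧ 0 ≤ Q ∧ 0 < α ∧ α ≤ 1 ∧
      ∀ T : EuclideanSpace ℂ (Fin N) →L[ℝ] ℂ, IsSymbol p Q α fun k => T (v k) := by
  obtain ⟨-, C, p, q, α₀, hp, hα₀, h1, h2⟩ := hv
  have hC : 0 ≤ C := by simpa using (norm_nonneg _).trans (h1 0)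
  refine ⟨p, |p| + |q|, min α₀ 1, hp, by positivity, lt_min hα₀ one_pos, min_le_right _ _,
    fun T => ⟨‖T‖ * (2 * C), by positivity, fun k => ?_, fun k l => ?_⟩⟩
  · refine (T.le_opNorm _).trans ?_
    rw [mul_assoc]
    refine mul_le_mul_of_nonneg_left ((h1 k).trans ?_) (norm_nonneg _)
    have : 0 ≤ C * (1 + |k|) ^ p := by positivity
    linarith
  · rw [← map_sub]
    refine (T.le_opNorm _).trans ?_
    rw [mul_assoc, mul_assoc]
    refine mul_le_mul_of_nonneg_left ?_ (norm_nonneg _)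
    have hkl : 1 ≤ 1 + |k| + |l| := by linarith [abs_nonneg k, abs_nonneg l]
    have hb : ∀ x, (x = k ∨ x = l) → ∀ r, |r| ≤ |p| + |q| →
        (1 + |x|) ^ r ≤ (1 + |k| + |l|) ^ (|p| + |q|) := by
      intro x hx r hr
      have hx1 : 1 ≤ 1 + |x| := by linarith [abs_nonneg x]
      refine (Real.rpow_le_rpow_of_exponent_le hx1 ((le_abs_self r).trans hr)).trans ?_
      refine Real.rpow_le_rpow (by linarith) ?_ (by positivity)
      rcases hx with h | h <;> rw [h] <;> linarith [abs_nonneg k, abs_nonneg l]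
    have hp' : |p| ≤ |p| + |q| := by linarith [abs_nonneg q]
    have hq' : |q| ≤ |p| + |q| := by linarith [abs_nonneg p]
    set U := (1 + |k| + |l|) ^ (|p| + |q|)
    have hU : 0 ≤ U := by positivity
    rcases le_total |k - l| 1 with h | h
    · refine (h2 k l h).trans ?_
      have e1 : |k - l| ^ α₀ ≤ |k - l| ^ (min α₀ 1) := by
        rcases (abs_nonneg (k - l)).eq_or_lt with h0 | h0
        · rw [← h0, Real.zero_rpow hα₀.ne', Real.zero_rpow (lt_min hα₀ one_pos).ne']
        · exact Real.rpow_le_rpow_of_exponent_ge h0 h (min_le_left _ _)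
      have e2 := mul_le_mul (mul_le_mul_of_nonneg_left (hb k (Or.inl rfl) q hq') hC) e1
        (by positivity) (by positivity)
      have e3 : 0 ≤ C * U * |k - l| ^ (min α₀ 1) := by positivity
      linarith
    · have e1 : 1 ≤ |k - l| ^ (min α₀ 1) := Real.one_le_rpow h (by positivity)
      have k1 := (h1 k).trans (mul_le_mul_of_nonneg_left (hb k (Or.inl rfl) p hp') hC)
      have k2 := (h1 l).trans (mul_le_mul_of_nonneg_left (hb l (Or.inr rfl) p hp') hC)
      have k3 := norm_sub_le (v k) (v l)
      have k4 : 2 * C * U * 1 ≤ 2 * C * U * |k - l| ^ (min α₀ 1) :=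
        mul_le_mul_of_nonneg_left e1 (by positivity)
      linarith

theorem le_three_mul_rpow {t α : ℝ} (ht : 0 ≤ t) (ht3 : t ≤ 3) (hα : 0 < α) (hα1 : α ≤ 1) :
    t ≤ 3 * t ^ α := by
  rcases ht.eq_or_lt with rfl | h
  · simp [Real.zero_rpow hα.ne']
  · have h1 : t = t ^ (1 - α) * t ^ α := by rw [← Real.rpow_add h]; simp
    conv_lhs => rw [h1]
    refine mul_le_mul_of_nonneg_right ?_ (by positivity)
    calc t ^ (1 - α) ≤ 3 ^ (1 - α) := Real.rpow_le_rpow ht ht3 (by linarith)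
      _ ≤ 3 ^ (1 : ℝ) := Real.rpow_le_rpow_of_exponent_le (by norm_num) (by linarith)
      _ = 3 := Real.rpow_one 3

/-- Near 0 the quotient is the analytic function F, hence Lipschitz; away from 0 it is a Hölder
function times a smooth one. The interval (0, 3] contains e^{b(s+u)} for s ≤ 0, |u| ≤ 1 and 0 < b ≤
1. -/
theorem exists_holder_quotient (hQ : 0 ≤ Q) (hα : 0 < α) (hα1 : α ≤ 1) (hf : IsSymbol P Q α f)
    {d : ℕ} {a : ℂ} (hd : HasLead d f a) :
    ∃ C, 0 ≤ C ∧ (∀ k ∈ Ioc (0 : ℝ) 3, ‖f k / (k : ℂ) ^ d‖ ≤ C) ∧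
      (∀ k ∈ Ioc (0 : ℝ) 3, ∀ l ∈ Ioc (0 : ℝ) 3,
        ‖f k / (k : ℂ) ^ d - f l / (l : ℂ) ^ d‖ ≤ C * |k - l| ^ α) ∧
      (∀ k ∈ Ioc (0 : ℝ) 3, ‖f k / (k : ℂ) ^ d - a‖ ≤ C * k ^ α) := by
  obtain ⟨F, hF, rfl, hfF⟩ := hd
  obtain ⟨C₀, hC₀, -, hhol⟩ := hf
  set G : ℝ → ℂ := fun k => f k / (k : ℂ) ^ d with hG
  obtain ⟨K, t, ht, hLip⟩ := (hF.contDiffAt (n := 1)).exists_lipschitzOnWith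
  obtain ⟨ρ, hρ, hball⟩ := Metric.mem_nhds_iff.1 (inter_mem ht hfF)
  have hGF : ∀ k ∈ Ioo 0 ρ, G k = F k ∧ k ∈ t := by
    intro k hk
    have h1 := hball (show k ∈ Metric.ball 0 ρ by
      rw [Metric.mem_ball, Real.dist_eq, sub_zero, abs_of_pos hk.1]; exact hk.2)
    refine ⟨?_, h1.1⟩
    have h2 : f k = (k : ℂ) ^ d * F k := h1.2
    have h3 : (k : ℂ) ≠ 0 := by exact_mod_cast hk.1.ne'
    simp only [hG]
    rw [h2]; field_simp
  have h0t : (0 : ℝ) ∈ t := (hball (Metric.mem_ball_self hρ)).1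
  have hK : (0 : ℝ) ≤ K := K.2
  have near : ∀ k ∈ Ioo 0 ρ, ∀ l ∈ Ioo 0 ρ, ‖G k - G l‖ ≤ K * |k - l| := by
    intro k hk l hl
    rw [(hGF k hk).1, (hGF l hl).1, ← dist_eq_norm, ← Real.dist_eq]
    exact hLip.dist_le_mul _ (hGF k hk).2 _ (hGF l hl).2
  have near0 : ∀ k ∈ Ioo 0 ρ, ‖G k - F 0‖ ≤ K * k := by
    intro k hk
    have := hLip.dist_le_mul _ (hGF k hk).2 _ h0t
    rwa [dist_eq_norm, Real.dist_eq, sub_zero, abs_of_pos hk.1, ← (hGF k hk).1] at this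
  -- away from zero
  set r := ρ / 2 with hr
  have hr0 : 0 < r := half_pos hρ
  obtain ⟨K₁, hK₁⟩ : ∃ K₁, LipschitzOnWith K₁ (fun k : ℝ => ((k : ℂ) ^ d)⁻¹) (Icc r 3) := by
    refine ContDiffOn.exists_lipschitzOnWith (n := 1) ?_ one_ne_zero (convex_Icc r 3) isCompact_Icc
    intro k hk
    refine ContDiffAt.contDiffWithinAt ?_
    refine ContDiffAt.inv (ContDiffAt.pow Complex.ofRealCLM.contDiff.contDiffAt d) ?_
    have : (k : ℂ) ≠ 0 := by exact_mod_cast (hr0.trans_le hk.1).ne'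
    exact pow_ne_zero d this
  have hfc : ContinuousOn f (Icc r 3) := by
    intro k _
    refine ContinuousAt.continuousWithinAt ?_
    rw [ContinuousAt, tendsto_iff_norm_sub_tendsto_zero]
    have h1 : Tendsto (fun l => C₀ * (1 + |l| + |k|) ^ Q * |l - k| ^ α) (𝓝 k) (𝓝 0) := by
      have hc : Continuous fun l => C₀ * (1 + |l| + |k|) ^ Q * |l - k| ^ α := by
        refine (continuous_const.mul (Continuous.rpow_const (by fun_prop) fun _ => Or.inr hQ)).mul
          (Continuous.rpow_const (by fun_prop) fun _ => Or.inr hα.le)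
      have := hc.tendsto k
      simpa [Real.zero_rpow hα.ne'] using this
    exact squeeze_zero (fun _ => norm_nonneg _) (fun l => hhol l k) h1
  have hgc : ContinuousOn (fun k : ℝ => ((k : ℂ) ^ d)⁻¹) (Icc r 3) := hK₁.continuousOn
  obtain ⟨A, hA⟩ := isCompact_Icc.exists_bound_of_continuousOn hfc
  obtain ⟨B, hB⟩ := isCompact_Icc.exists_bound_of_continuousOn hgc
  have hA' : ∀ k ∈ Icc r 3, ‖f k‖ ≤ |A| := fun k hk => (hA k hk).trans (le_abs_self A)
  have hB' : ∀ k ∈ Icc r 3, ‖((k : ℂ) ^ d)⁻¹‖ ≤ |B| := fun k hk => (hB k hk).trans (le_abs_self B)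
  have far : ∀ k ∈ Icc r 3, ∀ l ∈ Icc r 3,
      ‖G k - G l‖ ≤ (C₀ * 7 ^ Q * |B| + |A| * (K₁ * 3)) * |k - l| ^ α := by
    intro k hk l hl
    have hk0 := hr0.trans_le hk.1
    have hl0 := hr0.trans_le hl.1
    have e : G k - G l = (f k - f l) * ((k : ℂ) ^ d)⁻¹ +
        f l * (((k : ℂ) ^ d)⁻¹ - ((l : ℂ) ^ d)⁻¹) := by
      simp only [hG, div_eq_mul_inv]; ring
    have h1 : ‖f k - f l‖ ≤ C₀ * 7 ^ Q * |k - l| ^ α := by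
      refine (hhol k l).trans (mul_le_mul_of_nonneg_right (mul_le_mul_of_nonneg_left ?_ hC₀)
        (by positivity))
      refine Real.rpow_le_rpow (by positivity) ?_ hQ
      rw [abs_of_pos hk0, abs_of_pos hl0]; linarith [hk.2, hl.2]
    have h2 : ‖((k : ℂ) ^ d)⁻¹ - ((l : ℂ) ^ d)⁻¹‖ ≤ K₁ * 3 * |k - l| ^ α := by
      have := hK₁.dist_le_mul _ hk _ hl
      rw [dist_eq_norm, Real.dist_eq] at this
      refine this.trans ?_
      rw [mul_assoc]
      refine mul_le_mul_of_nonneg_left (le_three_mul_rpow (abs_nonneg _) ?_ hα hα1) K₁.2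
      rw [abs_le]; constructor <;> linarith [hk.2, hl.2]
    rw [e, add_mul]
    refine (norm_add_le _ _).trans (add_le_add ?_ ?_)
    · rw [norm_mul]
      calc _ ≤ C₀ * 7 ^ Q * |k - l| ^ α * |B| :=
            mul_le_mul h1 (hB' k hk) (norm_nonneg _) (by positivity)
        _ = _ := by ring
    · rw [norm_mul, mul_assoc |A|]
      exact mul_le_mul (hA' l hl) h2 (norm_nonneg _) (abs_nonneg _)
  set D : ℝ := ‖F 0‖ + K * ρ + |A| * |B| with hD
  have hD0 : 0 ≤ D := by positivity
  have hbound : ∀ k ∈ Ioc (0 : ℝ) 3, ‖G k‖ ≤ D := by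
    intro k hk
    rcases lt_or_ge k ρ with h | h
    · have h1 := near0 k ⟨hk.1, h⟩
      have h2 := norm_sub_norm_le (G k) (F 0)
      have h3 : (K : ℝ) * k ≤ K * ρ := mul_le_mul_of_nonneg_left h.le hK
      have h4 : 0 ≤ |A| * |B| := by positivity
      linarith
    · have hk' : k ∈ Icc r 3 := ⟨by linarith, hk.2⟩
      have h1 : ‖G k‖ ≤ |A| * |B| := by
        simp only [hG, div_eq_mul_inv, norm_mul]
        exact mul_le_mul (hA' k hk') (hB' k hk') (norm_nonneg _) (abs_nonneg _)
      have h4 : 0 ≤ K * ρ := by positivity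
      linarith [norm_nonneg (F 0)]
  set E : ℝ := K * 3 + (C₀ * 7 ^ Q * |B| + |A| * (K₁ * 3)) + 2 * D / r ^ α + 2 * D / ρ ^ α with hE
  have p1 : 0 ≤ C₀ * 7 ^ Q * |B| + |A| * (K₁ * 3) := by positivity
  have p2 : 0 ≤ 2 * D / r ^ α := by positivity
  have p3 : 0 ≤ 2 * D / ρ ^ α := by positivity
  have p4 : 0 ≤ (K : ℝ) * 3 := by positivity
  refine ⟨D + E, by positivity, fun k hk => (hbound k hk).trans (by linarith), ?_, ?_⟩
  · intro k hk l hl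
    have hV : 0 ≤ |k - l| ^ α := by positivity
    have h3 : |k - l| ≤ 3 := by
      rw [abs_le]; constructor <;> linarith [hk.2, hl.2, hk.1, hl.1]
    by_cases h1 : k < ρ ∧ l < ρ
    · refine (near k ⟨hk.1, h1.1⟩ l ⟨hl.1, h1.2⟩).trans ?_
      have h4 := mul_le_mul_of_nonneg_left (le_three_mul_rpow (abs_nonneg (k - l)) h3 hα hα1) hK
      have : (K : ℝ) * 3 * |k - l| ^ α ≤ (D + E) * |k - l| ^ α :=
        mul_le_mul_of_nonneg_right (by linarith) hV
      linarith
    · by_cases h2 : r ≤ k ∧ r ≤ l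
      · refine (far k ⟨h2.1, hk.2⟩ l ⟨h2.2, hl.2⟩).trans ?_
        exact mul_le_mul_of_nonneg_right (by linarith) hV
      · have h5 : r ≤ |k - l| := by
          rw [not_and_or, not_lt, not_lt] at h1
          rw [not_and_or, not_le, not_le] at h2
          rw [le_abs]
          rcases h1 with h1 | h1 <;> rcases h2 with h2 | h2
          · linarith
          · left; linarith
          · right; linarith
          · linarith
        have h6 : ‖G k - G l‖ ≤ 2 * D := by
          refine (norm_sub_le _ _).trans ?_
          linarith [hbound k hk, hbound l hl]
        have h7 : 2 * D ≤ 2 * D / r ^ α * |k - l| ^ α := by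
          rw [div_mul_eq_mul_div, le_div_iff₀ (by positivity)]
          exact mul_le_mul_of_nonneg_left (Real.rpow_le_rpow hr0.le h5 hα.le) (by positivity)
        have : 2 * D / r ^ α * |k - l| ^ α ≤ (D + E) * |k - l| ^ α :=
          mul_le_mul_of_nonneg_right (by linarith) hV
        linarith
  · intro k hk
    have hV : 0 ≤ k ^ α := Real.rpow_nonneg hk.1.le _
    rcases lt_or_ge k ρ with h | h
    · have h1 := near0 k ⟨hk.1, h⟩
      have h4 := mul_le_mul_of_nonneg_left (le_three_mul_rpow hk.1.le hk.2 hα hα1) hK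
      have : (K : ℝ) * 3 * k ^ α ≤ (D + E) * k ^ α :=
        mul_le_mul_of_nonneg_right (by linarith) hV
      linarith
    · have h6 : ‖G k - F 0‖ ≤ 2 * D := by
        refine (norm_sub_le _ _).trans ?_
        have : 0 ≤ K * ρ + |A| * |B| := by positivity
        linarith [hbound k hk]
      have h7 : 2 * D ≤ 2 * D / ρ ^ α * k ^ α := by
        rw [div_mul_eq_mul_div, le_div_iff₀ (by positivity)]
        exact mul_le_mul_of_nonneg_left (Real.rpow_le_rpow hρ.le h hα.le) (by positivity)
      have : 2 * D / ρ ^ α * k ^ α ≤ (D + E) * k ^ α :=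
        mul_le_mul_of_nonneg_right (by linarith) hV
      linarith

end symbols

/-! ### Symbols in logarithmic coordinates -/

/-- The function `k ^ (a / b) f k` in the variable `s`, where `k = e ^ (b s)`. -/
noncomputable def logPullback (a b : ℝ) (f : ℝ → ℂ) (s : ℝ) : ℂ :=
  (Real.exp (a * s) : ℂ) * f (Real.exp (b * s))

theorem le_rpow_of_le_one {t α : ℝ} (ht : 0 ≤ t) (ht1 : t ≤ 1) (hα : 0 < α) (hα1 : α ≤ 1) :
    t ≤ t ^ α := by
  rcases ht.eq_or_lt with rfl | h
  · simp [Real.zero_rpow hα.ne']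
  · simpa using Real.rpow_le_rpow_of_exponent_ge h ht1 hα1

theorem abs_exp_sub_one_le_exp_mul {x R : ℝ} (hx : |x| ≤ R) :
    |Real.exp x - 1| ≤ Real.exp R * |x| := by
  rcases le_total 0 x with h | h
  · rw [abs_of_nonneg h] at hx ⊢
    have h1 := Real.add_one_le_exp (-x)
    have h2 : Real.exp x ≤ Real.exp R := Real.exp_le_exp.2 hx
    rw [abs_of_nonneg (by linarith [Real.add_one_le_exp x])]
    have h3 : Real.exp x - 1 = Real.exp x * (1 - Real.exp (-x)) := by
      rw [mul_sub, ← Real.exp_add]; simp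
    rw [h3]
    have h4 : Real.exp (-x) ≤ 1 := Real.exp_le_one_iff.2 (by linarith)
    exact mul_le_mul h2 (by linarith) (by linarith) (Real.exp_pos _).le
  · rw [abs_of_nonpos h] at hx ⊢
    have h1 := Real.add_one_le_exp x
    have h2 : 1 ≤ Real.exp R := Real.one_le_exp (by linarith)
    rw [abs_of_nonpos (by linarith [Real.exp_le_one_iff.2 h])]
    have := mul_le_mul_of_nonneg_right h2 (show 0 ≤ -x by linarith)
    linarith

theorem one_add_exp_rpow_le {x : ℝ} (hx : -1 ≤ x) (P : ℝ) :
    (1 + Real.exp x) ^ P ≤ 4 ^ |P| * Real.exp (P * x) := by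
  have hpos := Real.exp_pos x
  have h3 : 1 ≤ 3 * Real.exp x := by
    have h1 := Real.exp_le_exp.2 hx
    have h2 : Real.exp (-1) * 3 ≥ 1 := by
      rw [Real.exp_neg, ge_iff_le, inv_mul_eq_div, le_div_iff₀ (Real.exp_pos 1)]
      linarith [Real.exp_one_lt_d9]
    linarith
  have e : Real.exp (P * x) = Real.exp x ^ P := by rw [← Real.exp_mul, mul_comm]
  rw [e]
  rcases le_total 0 P with h | h
  · rw [abs_of_nonneg h, ← Real.mul_rpow (by norm_num) hpos.le]
    exact Real.rpow_le_rpow (by linarith) (by linarith) h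
  · have h1 : (1 + Real.exp x) ^ P ≤ Real.exp x ^ P :=
      Real.rpow_le_rpow_of_nonpos hpos (by linarith) h
    have h4 : (1 : ℝ) ≤ 4 ^ |P| := Real.one_le_rpow (by norm_num) (abs_nonneg P)
    have := mul_le_mul_of_nonneg_right h4 (show 0 ≤ Real.exp x ^ P by positivity)
    linarith

section master

variable {a b P Q α γ : ℝ}

theorem norm_logPullback_le {C : ℝ} (hC : 0 ≤ C) {f : ℝ → ℂ} (hf : ∀ k, ‖f k‖ ≤ C * (1 + |k|) ^ P)
    (hb : b ∈ Ioc 0 1) {s t : ℝ} (hs : -1 ≤ s) :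
    Real.exp (a * t) * ‖f (Real.exp (b * s))‖ ≤
      C * 4 ^ |P| * Real.exp (a * t + b * P * s) := by
  have h1 := hf (Real.exp (b * s))
  rw [abs_of_pos (Real.exp_pos _)] at h1
  have h2 : -1 ≤ b * s := by nlinarith [hb.1, hb.2]
  have h3 := one_add_exp_rpow_le h2 P
  calc _ ≤ Real.exp (a * t) * (C * (4 ^ |P| * Real.exp (P * (b * s)))) :=
        mul_le_mul_of_nonneg_left (h1.trans (mul_le_mul_of_nonneg_left h3 hC)) (Real.exp_pos _).le
    _ = C * 4 ^ |P| * (Real.exp (a * t) * Real.exp (P * (b * s))) := by ring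
    _ = _ := by rw [← Real.exp_add]; ring_nf

/-- The bounds at large momenta. -/
theorem exists_tame_right (hQ : 0 ≤ Q) (hα : 0 < α) (hα1 : α ≤ 1) (hb : b ∈ Ioc 0 1)
    (hP : a + b * P < -γ) :
    ∃ α', 0 < α' ∧ α' ≤ α ∧ ∀ f, IsSymbol P Q α f → ∃ C, 0 ≤ C ∧
      (∀ s, 0 ≤ s → ‖logPullback a b f s‖ ≤ C * Real.exp (-(γ * s))) ∧
      ∀ s u, 0 ≤ s → |u| ≤ 1 →
        ‖logPullback a b f (s + u) - logPullback a b f s‖ ≤ C * Real.exp (-(γ * s)) * |u| ^ α' := by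
  set κ := -(a + b * P) with hκ
  set M := a + b * Q + b * α with hM
  -- κ is the decay rate of the values and M the growth rate of the Hölder constant. This θ makes
  -- the interpolated rate -κ (1 - θ) + M θ at most -γ.
  set θ := min 1 ((κ - γ) / (|κ + M| + 1)) with hθ
  have hκγ : 0 < κ - γ := by rw [hκ]; linarith
  have hden : 0 < |κ + M| + 1 := by positivity
  have hθ0 : 0 < θ := lt_min one_pos (div_pos hκγ hden)
  have hθ1 : θ ≤ 1 := min_le_left _ _
  have hθM : θ * (κ + M) ≤ κ - γ := by
    have h1 : θ ≤ (κ - γ) / (|κ + M| + 1) := min_le_right _ _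
    have h2 : θ * (κ + M) ≤ θ * (|κ + M| + 1) :=
      mul_le_mul_of_nonneg_left (by linarith [le_abs_self (κ + M)]) hθ0.le
    exact h2.trans ((le_div_iff₀ hden).1 h1)
  have hα'0 : 0 < α * θ := mul_pos hα hθ0
  have hα'α : α * θ ≤ α := mul_le_of_le_one_right hα.le hθ1
  refine ⟨α * θ, hα'0, hα'α, fun f hf => ?_⟩
  obtain ⟨C, hC, h1, h2⟩ := hf
  have hbP : 0 ≤ |b * P| := abs_nonneg _
  set C₁ := C * 4 ^ |P| * Real.exp |b * P| with hC₁
  have hC₁0 : 0 ≤ C₁ := by positivity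
  have hE1 : (1 : ℝ) ≤ Real.exp |b * P| := Real.one_le_exp hbP
  -- sizes
  have size : ∀ s u, 0 ≤ s → |u| ≤ 1 →
      Real.exp (a * s) * ‖f (Real.exp (b * (s + u)))‖ ≤ C₁ * Real.exp (-(κ * s)) := by
    intro s u hs hu
    refine (norm_logPullback_le hC h1 hb (by linarith [(abs_le.1 hu).1])).trans ?_
    rw [hC₁, mul_assoc (C * 4 ^ |P|), ← Real.exp_add]
    refine mul_le_mul_of_nonneg_left (Real.exp_le_exp.2 ?_) (by positivity)
    have h5 : b * P * u ≤ |b * P| := by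
      refine (le_abs_self _).trans ?_
      rw [abs_mul]; exact mul_le_of_le_one_right hbP hu
    rw [hκ]; nlinarith
  have hκγs : ∀ s, 0 ≤ s → Real.exp (-(κ * s)) ≤ Real.exp (-(γ * s)) := fun s hs =>
    Real.exp_le_exp.2 (by nlinarith)
  set C₂ := C * 5 ^ Q * 3 ^ α with hC₂
  have hC₂0 : 0 ≤ C₂ := by positivity
  set X : ℝ := (2 * C₁ + C₂) with hX
  have hX0 : 0 ≤ X := by positivity
  have diff : ∀ s u, 0 ≤ s → |u| ≤ 1 →
      Real.exp (a * s) * ‖f (Real.exp (b * (s + u))) - f (Real.exp (b * s))‖ ≤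
        X * Real.exp (-(γ * s)) * |u| ^ (α * θ) := by
    intro s u hs hu
    set D := Real.exp (a * s) * ‖f (Real.exp (b * (s + u))) - f (Real.exp (b * s))‖ with hD
    have hD0 : 0 ≤ D := by positivity
    have d1 : D ≤ X * Real.exp (-(κ * s)) := by
      have e1 := size s u hs hu
      have e2 := size s 0 hs (by simp)
      rw [add_zero] at e2
      have e3 := mul_le_mul_of_nonneg_left
        (norm_sub_le (f (Real.exp (b * (s + u)))) (f (Real.exp (b * s)))) (Real.exp_pos (a * s)).le
      have e4 : 0 ≤ C₂ * Real.exp (-(κ * s)) := by positivity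
      rw [hX, add_mul]; linarith
    have d2 : D ≤ X * (Real.exp (M * s) * |u| ^ α) := by
      have hbs : 1 ≤ Real.exp (b * s) := Real.one_le_exp (mul_nonneg hb.1.le hs)
      have hbu : |b * u| ≤ |u| := by
        rw [abs_mul, abs_of_pos hb.1]; exact mul_le_of_le_one_left (abs_nonneg _) hb.2
      have e0 : Real.exp (b * (s + u)) = Real.exp (b * s) * Real.exp (b * u) := by
        rw [← Real.exp_add]; ring_nf
      have e1 : Real.exp (b * (s + u)) ≤ 3 * Real.exp (b * s) := by
        have : Real.exp (b * u) ≤ 3 := by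
          have := Real.exp_le_exp.2 ((le_abs_self _).trans (hbu.trans hu))
          linarith [Real.exp_one_lt_d9]
        rw [e0]; nlinarith [Real.exp_pos (b * s)]
      have e2 : |Real.exp (b * (s + u)) - Real.exp (b * s)| ≤ 3 * Real.exp (b * s) * |u| := by
        have : Real.exp (b * (s + u)) - Real.exp (b * s) =
            Real.exp (b * s) * (Real.exp (b * u) - 1) := by rw [e0]; ring
        rw [this, abs_mul, abs_of_pos (Real.exp_pos _)]
        have := abs_exp_sub_one_le_three (hbu.trans hu)
        nlinarith [Real.exp_pos (b * s)]
      have e3 := h2 (Real.exp (b * (s + u))) (Real.exp (b * s))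
      rw [abs_of_pos (Real.exp_pos _), abs_of_pos (Real.exp_pos _)] at e3
      have e4 : (1 + Real.exp (b * (s + u)) + Real.exp (b * s)) ^ Q ≤ 5 ^ Q * Real.exp (b * Q * s) := by
        have : Real.exp (b * Q * s) = Real.exp (b * s) ^ Q := by rw [← Real.exp_mul]; ring_nf
        rw [this, ← Real.mul_rpow (by norm_num) (Real.exp_pos _).le]
        exact Real.rpow_le_rpow (by positivity) (by linarith) hQ
      have e5 : |Real.exp (b * (s + u)) - Real.exp (b * s)| ^ α ≤
          3 ^ α * Real.exp (b * α * s) * |u| ^ α := by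
        have : Real.exp (b * α * s) = Real.exp (b * s) ^ α := by rw [← Real.exp_mul]; ring_nf
        rw [this, ← Real.mul_rpow (by norm_num) (Real.exp_pos _).le,
          ← Real.mul_rpow (by positivity) (abs_nonneg _)]
        exact Real.rpow_le_rpow (abs_nonneg _) e2 hα.le
      have e6 : D ≤ Real.exp (a * s) * (C * (5 ^ Q * Real.exp (b * Q * s)) *
          (3 ^ α * Real.exp (b * α * s) * |u| ^ α)) := by
        refine mul_le_mul_of_nonneg_left (e3.trans ?_) (Real.exp_pos _).le
        exact mul_le_mul (mul_le_mul_of_nonneg_left e4 hC) e5 (by positivity) (by positivity)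
      have e7 : Real.exp (M * s) =
          Real.exp (a * s) * Real.exp (b * Q * s) * Real.exp (b * α * s) := by
        rw [← Real.exp_add, ← Real.exp_add, hM]; ring_nf
      have e8 : 0 ≤ 2 * C₁ * (Real.exp (M * s) * |u| ^ α) := by positivity
      have e9 : C₂ * (Real.exp (M * s) * |u| ^ α) = Real.exp (a * s) *
          (C * (5 ^ Q * Real.exp (b * Q * s)) * (3 ^ α * Real.exp (b * α * s) * |u| ^ α)) := by
        rw [e7, hC₂]; ring
      rw [hX, add_mul]; linarith
    -- Interpolation: the decaying size bound to the power 1 - θ times the growing Hölder bound to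
    -- the power θ. The price is the smaller Hölder exponent α θ.
    calc D = D ^ (1 - θ) * D ^ θ := by
          rcases hD0.eq_or_lt with h0 | h0
          · rw [← h0, Real.zero_rpow hθ0.ne', mul_zero]
          · rw [← Real.rpow_add h0]; simp
      _ ≤ (X * Real.exp (-(κ * s))) ^ (1 - θ) * (X * (Real.exp (M * s) * |u| ^ α)) ^ θ := by
          refine mul_le_mul (Real.rpow_le_rpow hD0 d1 (by linarith))
            (Real.rpow_le_rpow hD0 d2 hθ0.le) (by positivity) (by positivity)
      _ = X * Real.exp (-(κ * s) * (1 - θ) + M * s * θ) * |u| ^ (α * θ) := by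
          rw [Real.mul_rpow hX0 (Real.exp_pos _).le, Real.mul_rpow hX0 (by positivity),
            Real.mul_rpow (Real.exp_pos _).le (by positivity), ← Real.exp_mul, ← Real.exp_mul,
            ← Real.rpow_mul (abs_nonneg _), Real.exp_add]
          have : X = X ^ (1 - θ) * X ^ θ := by
            rcases hX0.eq_or_lt with h0 | h0
            · rw [← h0, Real.zero_rpow hθ0.ne', mul_zero]
            · rw [← Real.rpow_add h0]; simp
          conv_rhs => rw [this]
          ring
      _ ≤ X * Real.exp (-(γ * s)) * |u| ^ (α * θ) := by
          refine mul_le_mul_of_nonneg_right (mul_le_mul_of_nonneg_left (Real.exp_le_exp.2 ?_) hX0)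
            (by positivity)
          have := mul_le_mul_of_nonneg_right hθM hs
          nlinarith
  refine ⟨C₁ + X + Real.exp |a| * |a| * C₁, by positivity, fun s hs => ?_, fun s u hs hu => ?_⟩
  · have e2 := size s 0 hs (by simp)
    rw [add_zero] at e2
    rw [logPullback, norm_mul, Complex.norm_real, Real.norm_of_nonneg (Real.exp_pos _).le]
    refine e2.trans ((mul_le_mul_of_nonneg_left (hκγs s hs) hC₁0).trans ?_)
    refine mul_le_mul_of_nonneg_right ?_ (Real.exp_pos _).le
    have : 0 ≤ Real.exp |a| * |a| * C₁ := by positivity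
    linarith
  · have e : logPullback a b f (s + u) - logPullback a b f s =
        ((Real.exp (a * u) - 1 : ℝ) : ℂ) * ((Real.exp (a * s) : ℂ) * f (Real.exp (b * (s + u)))) +
        (Real.exp (a * s) : ℂ) * (f (Real.exp (b * (s + u))) - f (Real.exp (b * s))) := by
      have : Real.exp (a * (s + u)) = Real.exp (a * s) * Real.exp (a * u) := by
        rw [← Real.exp_add]; ring_nf
      rw [logPullback, logPullback, this]; push_cast; ring
    rw [e]
    refine (norm_add_le _ _).trans ?_
    rw [norm_mul, norm_mul, norm_mul, Complex.norm_real, Complex.norm_real,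
      Real.norm_of_nonneg (Real.exp_pos _).le, Real.norm_eq_abs]
    have k1 := diff s u hs hu
    have k2 : |Real.exp (a * u) - 1| ≤ Real.exp |a| * |a| * |u| := by
      have hau : |a * u| ≤ |a| := by
        rw [abs_mul]; exact mul_le_of_le_one_right (abs_nonneg _) hu
      have := abs_exp_sub_one_le_exp_mul hau
      rwa [abs_mul, ← mul_assoc] at this
    have k3 := (size s u hs hu).trans (mul_le_mul_of_nonneg_left (hκγs s hs) hC₁0)
    have k4 := mul_le_mul k2 k3 (by positivity) (by positivity)
    have k5 := le_rpow_of_le_one (abs_nonneg u) hu hα'0 (hα'α.trans hα1)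
    have k6 : Real.exp |a| * |a| * |u| * (C₁ * Real.exp (-(γ * s))) ≤
        Real.exp |a| * |a| * |u| ^ (α * θ) * (C₁ * Real.exp (-(γ * s))) := by gcongr
    have k7 : 0 ≤ C₁ * Real.exp (-(γ * s)) * |u| ^ (α * θ) := by positivity
    calc _ ≤ Real.exp |a| * |a| * |u| ^ (α * θ) * (C₁ * Real.exp (-(γ * s))) +
          X * Real.exp (-(γ * s)) * |u| ^ (α * θ) := add_le_add (k4.trans k6) k1
      _ ≤ _ := by nlinarith

/-- The bounds at small momenta. -/
theorem exists_tame_left (hQ : 0 ≤ Q) (hα : 0 < α) (hα1 : α ≤ 1) (hb : b ∈ Ioc 0 1) {f : ℝ → ℂ}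
    (hf : IsSymbol P Q α f) {d : ℕ} {c : ℂ} (hd : HasLead d f c) :
    ∃ C, 0 ≤ C ∧ (∀ s, s ≤ 0 → ‖logPullback a b f s‖ ≤ C * Real.exp ((a + b * d) * s)) ∧
      (∀ s u, s ≤ 0 → |u| ≤ 1 → ‖logPullback a b f (s + u) - logPullback a b f s‖ ≤
        C * Real.exp ((a + b * d) * s) * |u| ^ α) ∧
      ∀ s, s ≤ 0 → ‖logPullback a b f s - Real.exp ((a + b * d) * s) * c‖ ≤
        C * Real.exp ((a + b * d) * s) * Real.exp (α * b * s) := by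
  obtain ⟨C, hC, h1, h2, h3⟩ := exists_holder_quotient hQ hα hα1 hf hd
  set r := a + b * d with hr
  set G : ℝ → ℂ := fun k => f k / (k : ℂ) ^ d with hG
  -- Splitting k^d off f collects all powers of k in e^{rs} and leaves a quotient that is bounded
  -- and Hölder on (0, 3].
  have hphi : ∀ s, logPullback a b f s = Real.exp (r * s) * G (Real.exp (b * s)) := by
    intro s
    have h0 : ((Real.exp (b * s) : ℝ) : ℂ) ^ d ≠ 0 :=
      pow_ne_zero d (by exact_mod_cast (Real.exp_pos _).ne')
    have : Real.exp (r * s) = Real.exp (a * s) * Real.exp (b * s) ^ d := by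
      rw [← Real.exp_nat_mul, ← Real.exp_add, hr]; ring_nf
    rw [logPullback, this, hG]; push_cast at h0 ⊢; field_simp
  have hmem : ∀ s u, s ≤ 0 → |u| ≤ 1 → Real.exp (b * (s + u)) ∈ Ioc (0 : ℝ) 3 := by
    intro s u hs hu
    refine ⟨Real.exp_pos _, ?_⟩
    have : b * (s + u) ≤ 1 := by nlinarith [hb.1, hb.2, (abs_le.1 hu).2]
    linarith [Real.exp_le_exp.2 this, Real.exp_one_lt_d9]
  have hmem0 : ∀ s, s ≤ 0 → Real.exp (b * s) ∈ Ioc (0 : ℝ) 3 := fun s hs => by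
    simpa using hmem s 0 hs (by simp)
  refine ⟨C + Real.exp |r| * |r| * C + 3 * C, by positivity, fun s hs => ?_, fun s u hs hu => ?_,
    fun s hs => ?_⟩
  · rw [hphi, norm_mul, Complex.norm_real, Real.norm_of_nonneg (Real.exp_pos _).le, mul_comm]
    refine mul_le_mul_of_nonneg_right ((h1 _ (hmem0 s hs)).trans ?_) (Real.exp_pos _).le
    have : 0 ≤ Real.exp |r| * |r| * C := by positivity
    linarith
  · have e : logPullback a b f (s + u) - logPullback a b f s = (Real.exp (r * s) : ℂ) *
        (((Real.exp (r * u) - 1 : ℝ) : ℂ) * G (Real.exp (b * (s + u))) +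
        (G (Real.exp (b * (s + u))) - G (Real.exp (b * s)))) := by
      have : Real.exp (r * (s + u)) = Real.exp (r * s) * Real.exp (r * u) := by
        rw [← Real.exp_add]; ring_nf
      rw [hphi, hphi, this]; push_cast; ring
    rw [e, norm_mul, Complex.norm_real, Real.norm_of_nonneg (Real.exp_pos _).le, mul_comm,
      mul_right_comm]
    refine mul_le_mul_of_nonneg_right ((norm_add_le _ _).trans ?_) (Real.exp_pos _).le
    rw [norm_mul, Complex.norm_real, Real.norm_eq_abs]
    have k2 : |Real.exp (r * u) - 1| ≤ Real.exp |r| * |r| * |u| ^ α := by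
      have hau : |r * u| ≤ |r| := by
        rw [abs_mul]; exact mul_le_of_le_one_right (abs_nonneg _) hu
      have := abs_exp_sub_one_le_exp_mul hau
      rw [abs_mul, ← mul_assoc] at this
      exact this.trans (mul_le_mul_of_nonneg_left (le_rpow_of_le_one (abs_nonneg u) hu hα hα1)
        (by positivity))
    have k3 := mul_le_mul k2 (h1 _ (hmem s u hs hu)) (norm_nonneg _) (by positivity)
    have k4 := h2 _ (hmem s u hs hu) _ (hmem0 s hs)
    have k5 : |Real.exp (b * (s + u)) - Real.exp (b * s)| ^ α ≤ 3 * |u| ^ α := by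
      have hbu : |b * u| ≤ |u| := by
        rw [abs_mul, abs_of_pos hb.1]; exact mul_le_of_le_one_left (abs_nonneg _) hb.2
      have e2 : |Real.exp (b * (s + u)) - Real.exp (b * s)| ≤ 3 * |u| := by
        have : Real.exp (b * (s + u)) - Real.exp (b * s) =
            Real.exp (b * s) * (Real.exp (b * u) - 1) := by
          rw [mul_sub, ← Real.exp_add]; ring_nf
        rw [this, abs_mul, abs_of_pos (Real.exp_pos _)]
        have h5 := abs_exp_sub_one_le_three (hbu.trans hu)
        have h6 : Real.exp (b * s) ≤ 1 := Real.exp_le_one_iff.2 (by nlinarith [hb.1])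
        have h7 := mul_le_mul h6 h5 (abs_nonneg _) zero_le_one
        linarith
      refine (Real.rpow_le_rpow (abs_nonneg _) e2 hα.le).trans ?_
      rw [Real.mul_rpow (by norm_num) (abs_nonneg _)]
      refine mul_le_mul_of_nonneg_right ?_ (by positivity)
      calc (3 : ℝ) ^ α ≤ 3 ^ (1 : ℝ) := Real.rpow_le_rpow_of_exponent_le (by norm_num) hα1
        _ = 3 := Real.rpow_one 3
    have k6 := mul_le_mul_of_nonneg_left k5 hC
    have k7 : 0 ≤ C * |u| ^ α := by positivity
    nlinarith
  · have e : logPullback a b f s - Real.exp (r * s) * c =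
        (Real.exp (r * s) : ℂ) * (G (Real.exp (b * s)) - c) := by
      rw [hphi]; ring
    rw [e, norm_mul, Complex.norm_real, Real.norm_of_nonneg (Real.exp_pos _).le]
    have k1 := h3 _ (hmem0 s hs)
    have k2 : Real.exp (b * s) ^ α = Real.exp (α * b * s) := by
      rw [← Real.exp_mul]; ring_nf
    rw [k2] at k1
    have k3 := mul_le_mul_of_nonneg_left k1 (Real.exp_pos (r * s)).le
    have k4 : 0 ≤ (Real.exp |r| * |r| * C + 3 * C) *
        (Real.exp (r * s) * Real.exp (α * b * s)) := by positivity
    calc _ ≤ _ := k3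
      _ ≤ _ := by nlinarith

/-- Large momenta fix α' and γ, small momenta fix β. The exponent α' is chosen before f, so that all
products of couplings share it. -/
theorem exists_tame_logPullback (hQ : 0 ≤ Q) (hα : 0 < α) (hα1 : α ≤ 1) (hb : b ∈ Ioc 0 1)
    (hP : a + b * P < -γ) :
    ∃ α', 0 < α' ∧ α' ≤ α ∧ ∀ f d c β, IsSymbol P Q α f → HasLead d f c →
      -(a + b * (d : ℝ)) ≤ β → ∃ C, Tame α' β γ C (logPullback a b f) := by
  obtain ⟨α', hα', hα'α, H⟩ := exists_tame_right hQ hα hα1 hb hP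
  refine ⟨α', hα', hα'α, fun f d c β hf hd hβ => ?_⟩
  obtain ⟨C, hC, h1, h2⟩ := H f hf
  obtain ⟨D, hD, h3, h4, -⟩ := exists_tame_left (a := a) hQ hα hα1 hb hf hd
  have hexp : ∀ s : ℝ, s ≤ 0 → Real.exp ((a + b * d) * s) ≤ Real.exp (-(β * s)) := fun s hs =>
    Real.exp_le_exp.2 (by nlinarith)
  have wR : ∀ s, C * Real.exp (-(γ * s)) ≤ (C + D) * expWeight β γ s := by
    intro s
    have p1 := Real.exp_pos (-(γ * s))
    have p2 := Real.exp_pos (-(β * s))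
    rw [expWeight]
    exact mul_le_mul (by linarith) (by linarith) p1.le (by linarith)
  have wL : ∀ s, s ≤ 0 → D * Real.exp ((a + b * d) * s) ≤ (C + D) * expWeight β γ s := by
    intro s hs
    have p1 := Real.exp_pos (-(γ * s))
    rw [expWeight]
    exact mul_le_mul (by linarith) (by linarith [hexp s hs]) (Real.exp_pos _).le (by linarith)
  refine ⟨C + D, fun s => ?_, fun s u hu => ?_⟩
  · rcases le_total 0 s with h | h
    · exact (h1 s h).trans (wR s)
    · exact (h3 s h).trans (wL s h)
  · rcases le_total 0 s with h | h
    · exact (h2 s u h hu).trans (mul_le_mul_of_nonneg_right (wR s) (by positivity))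
    · refine (h4 s u h hu).trans (mul_le_mul (wL s h) ?_ (by positivity)
        (mul_nonneg (by linarith) (expWeight_pos _ _ _).le))
      rcases (abs_nonneg u).eq_or_lt with h0 | h0
      · rw [← h0, Real.zero_rpow hα'.ne', Real.zero_rpow hα.ne']
      · exact Real.rpow_le_rpow_of_exponent_ge h0 hu hα'α

theorem tendsto_logPullback (hQ : 0 ≤ Q) (hα : 0 < α) (hα1 : α ≤ 1) (hb : b ∈ Ioc 0 1) {f : ℝ → ℂ}
    (hf : IsSymbol P Q α f) {d : ℕ} {c : ℂ} (hd : HasLead d f c) :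
    Tendsto (fun s => logPullback a b f s / expModel (-(a + b * d)) s) atBot (𝓝 c) := by
  obtain ⟨D, hD, -, -, h5⟩ := exists_tame_left (a := a) hQ hα hα1 hb hf hd
  rw [tendsto_iff_norm_sub_tendsto_zero]
  have h6 : Tendsto (fun s => D * Real.exp (α * b * s)) atBot (𝓝 0) := by
    have h7 : Tendsto (fun s : ℝ => α * b * s) atBot atBot :=
      tendsto_id.const_mul_atBot (mul_pos hα hb.1)
    simpa using (Real.tendsto_exp_atBot.comp h7).const_mul D
  refine squeeze_zero' (Eventually.of_forall fun _ => norm_nonneg _) ?_ h6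
  filter_upwards [eventually_le_atBot 0] with s hs
  have e1 : expModel (-(a + b * d)) s = Real.exp ((a + b * d) * s) := by
    rw [expModel]; push_cast; ring_nf
  have h0 : (Real.exp ((a + b * d) * s) : ℂ) ≠ 0 := by exact_mod_cast (Real.exp_pos _).ne'
  have e2 : logPullback a b f s / expModel (-(a + b * d)) s - c =
      (logPullback a b f s - Real.exp ((a + b * d) * s) * c) / Real.exp ((a + b * d) * s) := by
    rw [e1]; field_simp
  rw [e2, norm_div, Complex.norm_real, Real.norm_of_nonneg (Real.exp_pos _).le,
    div_le_iff₀ (Real.exp_pos _)]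
  linarith [h5 s hs]

end master

/-- The density `k ^ (1 - m) f k / m` of `f k dk` with respect to `d (k ^ m)`, in the variable
`s = log (k ^ m)`. -/
noncomputable def logDensity (m : ℝ) (f : ℝ → ℂ) : ℝ → ℂ :=
  logPullback (1 / m - 1) (1 / m) fun k => (m : ℂ)⁻¹ * f k

/-- A model exponent β above the true one makes the limit 0. This is needed when the true exponent
falls outside (0, 1). -/
theorem exists_tendsto_logPullback {a b P Q α β : ℝ} (hQ : 0 ≤ Q) (hα : 0 < α) (hα1 : α ≤ 1)
    (hb : b ∈ Ioc 0 1) {f : ℝ → ℂ} (hf : IsSymbol P Q α f) {d : ℕ} {c : ℂ} (hd : HasLead d f c)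
    (hβ : -(a + b * d) ≤ β) :
    ∃ ℓ, (-(a + b * d) < β → ℓ = 0) ∧
      Tendsto (fun s => logPullback a b f s / expModel β s) atBot (𝓝 ℓ) := by
  have h1 := tendsto_logPullback (a := a) hQ hα hα1 hb hf hd
  rcases hβ.eq_or_lt with h | h
  · exact ⟨c, fun h' => absurd h h'.ne, by rwa [h] at h1⟩
  · refine ⟨0, fun _ => rfl, ?_⟩
    have h2 : Tendsto (fun s : ℝ => ((Real.exp ((β + (a + b * d)) * s) : ℝ) : ℂ)) atBot (𝓝 0) := by
      have h3 : Tendsto (fun s : ℝ => (β + (a + b * d)) * s) atBot atBot :=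
        tendsto_id.const_mul_atBot (by linarith)
      have := (Complex.continuous_ofReal.tendsto 0).comp (Real.tendsto_exp_atBot.comp h3)
      rw [Complex.ofReal_zero] at this
      exact this
    have h3 := h1.mul h2
    rw [mul_zero] at h3
    refine h3.congr fun s => ?_
    rw [div_mul_eq_mul_div, expModel, expModel,
      div_eq_div_iff (Complex.exp_ne_zero _) (Complex.exp_ne_zero _), mul_assoc, Complex.ofReal_exp, ← Complex.exp_add]
    congr 2; push_cast; ring

/-! ### Threshold behaviour of the transform on one half-line, by the order d of the density -/

section density

variable {m P Q α : ℝ} {f : ℝ → ℂ} {d : ℕ} {c : ℂ}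

theorem one_div_mem_Ioc (hm : 1 < m) : 1 / m ∈ Ioc (0 : ℝ) 1 :=
  ⟨by positivity, by rw [div_le_one (by linarith)]; exact hm.le⟩

theorem exists_tame_logDensity (hm : 1 < m) (hP : P < m - 1) (hQ : 0 ≤ Q) (hα : 0 < α)
    (hα1 : α ≤ 1) {β : ℝ} (hβ : β ∈ Ioo 0 1) :
    ∃ α' γ, α' ≤ α ∧ TameExponents α' β γ ∧ ∀ f d c, IsSymbol P Q α f → HasLead d f c →
      1 - ((d : ℝ) + 1) / m ≤ β → ∃ C, Tame α' β γ C (logDensity m f) := by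
  have hm0 : 0 < m := by linarith
  have hκ : 0 < 1 - (P + 1) / m := by
    rw [sub_pos, div_lt_one hm0]; linarith
  -- 1 - (P + 1)/m is the decay rate of the density at s → +∞, positive by P < m - 1. Half of it
  -- leaves room for the interpolation, and the minimum ensures γ ≤ β.
  set γ := min ((1 - (P + 1) / m) / 2) β with hγ
  have h1 : γ ≤ (1 - (P + 1) / m) / 2 := min_le_left _ _
  have hγ0 : 0 < γ := lt_min (half_pos hκ) hβ.1
  have hγβ : γ ≤ β := min_le_right _ _
  obtain ⟨α', hα', hα'α, H⟩ := exists_tame_logPullback (a := 1 / m - 1) (b := 1 / m) (P := P) (γ := γ)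
    hQ hα hα1 (one_div_mem_Ioc hm) (by
      have : 1 / m - 1 + 1 / m * P = -(1 - (P + 1) / m) := by field_simp; ring
      rw [this]; linarith)
  refine ⟨α', γ, hα'α, ⟨hα', hα'α.trans hα1, hβ, ⟨hγ0, hγβ.trans_lt hβ.2⟩, hγβ⟩, ?_⟩
  intro f d c hf hd hdβ
  refine H _ d _ β (hf.const_mul _) (hd.const_mul _) ?_
  have : -(1 / m - 1 + 1 / m * (d : ℝ)) = 1 - ((d : ℝ) + 1) / m := by field_simp; ring
  rwa [this]

/-- Only analyticity at 0, that is order d = 0, is used. One choice of exponents therefore serves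
all entries of the matrix and their linear combinations. -/
theorem exists_tame_logDensity_of_analyticAt (hm : 1 < m) (hP : P < m - 1) (hQ : 0 ≤ Q) (hα : 0 < α)
    (hα1 : α ≤ 1) :
    ∃ α' β γ, TameExponents α' β γ ∧ ∀ f, IsSymbol P Q α f → AnalyticAt ℝ f 0 →
      ∃ C, Tame α' β γ C (logDensity m f) := by
  have hm0 : 0 < m := by linarith
  have hβ : 1 - 1 / m ∈ Ioo (0 : ℝ) 1 :=
    ⟨by rw [sub_pos, div_lt_one hm0]; exact hm, by linarith [one_div_pos.2 hm0]⟩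
  obtain ⟨α', γ, hα'α, hE, H⟩ := exists_tame_logDensity hm hP hQ hα hα1 hβ
  exact ⟨α', _, γ, hE, fun f hf h0 => H f 0 _ hf (hasLead_zero h0) (by simp)⟩

theorem tendsto_exp_mul_logCauchy_logDensity (hm : 1 < m) (hP : P < m - 1) (hQ : 0 ≤ Q)
    (hα : 0 < α) (hα1 : α ≤ 1) (hf : IsSymbol P Q α f) (hd : HasLead d f c) (hdm : (d : ℝ) + 1 < m)
    {L : ℝ} (hL : L ≤ 2 * Real.pi) :
    Tendsto (fun w => Complex.exp ((1 - ((d : ℝ) + 1) / m : ℝ) * w) * logCauchy (logDensity m f) w)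
      (leftEnd L) (𝓝 ((m : ℂ)⁻¹ * c * modelConst (1 - ((d : ℝ) + 1) / m))) := by
  have hm0 : 0 < m := by linarith
  have hβ : 1 - ((d : ℝ) + 1) / m ∈ Ioo (0 : ℝ) 1 :=
    ⟨by rw [sub_pos, div_lt_one hm0]; exact hdm, by
      have : 0 < ((d : ℝ) + 1) / m := by positivity
      linarith⟩
  obtain ⟨α', γ, hα'α, hE, H⟩ := exists_tame_logDensity hm hP hQ hα hα1 hβ
  obtain ⟨C, hC⟩ := H f d c hf hd le_rfl
  refine tendsto_exp_mul_logCauchy hE hC ?_ hL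
  have := tendsto_logPullback (a := 1 / m - 1) hQ hα hα1 (one_div_mem_Ioc hm)
    (hf.const_mul (m : ℂ)⁻¹) (hd.const_mul (m : ℂ)⁻¹)
  rwa [show -(1 / m - 1 + 1 / m * (d : ℝ)) = 1 - ((d : ℝ) + 1) / m by field_simp; ring] at this

theorem tendsto_exp_mul_logCauchy_logDensity_zero (hm : 1 < m) (hP : P < m - 1) (hQ : 0 ≤ Q)
    (hα : 0 < α) (hα1 : α ≤ 1) (hf : IsSymbol P Q α f) (hd : HasLead d f c) {r : ℝ} (hr : 0 < r)
    (hdr : 1 - ((d : ℝ) + 1) / m < r) {L : ℝ} (hL : L ≤ 2 * Real.pi) :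
    Tendsto (fun w => Complex.exp (r * w) * logCauchy (logDensity m f) w) (leftEnd L) (𝓝 0) := by
  have hm0 : 0 < m := by linarith
  have h1 : 1 - ((d : ℝ) + 1) / m < 1 := by
    have : 0 < ((d : ℝ) + 1) / m := by positivity
    linarith
  -- The true exponent may be nonpositive and r may exceed 1. An intermediate β in (0, 1) is
  -- admissible and still smaller than r.
  obtain ⟨β, hβ0, hβ1⟩ := exists_between
    (show max 0 (1 - ((d : ℝ) + 1) / m) < min r 1 from
      max_lt (lt_min hr one_pos) (lt_min hdr h1))
  have hβ : β ∈ Ioo (0 : ℝ) 1 := ⟨(le_max_left _ _).trans_lt hβ0, hβ1.trans_le (min_le_right _ _)⟩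
  have hβd : 1 - ((d : ℝ) + 1) / m < β := (le_max_right _ _).trans_lt hβ0
  obtain ⟨α', γ, hα'α, hE, H⟩ := exists_tame_logDensity hm hP hQ hα hα1 hβ
  obtain ⟨C, hC⟩ := H f d c hf hd hβd.le
  obtain ⟨ℓ, -, hℓ⟩ := exists_tendsto_logPullback (a := 1 / m - 1) (β := β) hQ hα hα1
    (one_div_mem_Ioc hm) (hf.const_mul (m : ℂ)⁻¹) (hd.const_mul (m : ℂ)⁻¹) (by
      rw [show -(1 / m - 1 + 1 / m * (d : ℝ)) = 1 - ((d : ℝ) + 1) / m by field_simp; ring]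
      exact hβd.le)
  exact tendsto_exp_mul_logCauchy_zero hE hC hℓ hL (hβ1.trans_le (min_le_left _ _))

theorem exists_tendsto_logCauchy_logDensity (hm : 1 < m) (hP : P < m - 1) (hQ : 0 ≤ Q)
    (hα : 0 < α) (hα1 : α ≤ 1) (hf : IsSymbol P Q α f) (hd : HasLead d f c) (hdm : m < (d : ℝ) + 1)
    {L : ℝ} (hL : L ≤ 2 * Real.pi) :
    ∃ ℓ, Tendsto (logCauchy (logDensity m f)) (leftEnd L) (𝓝 ℓ) := by
  have hm0 : 0 < m := by linarith
  obtain ⟨α₁, γ₁, -, hE, H⟩ := exists_tame_logDensity hm hP hQ hα hα1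
    (show (1 / 2 : ℝ) ∈ Ioo (0 : ℝ) 1 by norm_num)
  have hd1 : 1 < ((d : ℝ) + 1) / m := by rwa [one_lt_div hm0]
  obtain ⟨C, hC⟩ := H f d c hf hd (by linarith)
  -- The density times e^{-s} has exponent 2 - (d + 1)/m, which is below 1 exactly because d + 1 >
  -- m. The maximum with 1/2 makes it positive.
  set β' := max (1 / 2) (2 - ((d : ℝ) + 1) / m) with hβ'
  have hb1 : 1 / 2 ≤ β' := le_max_left _ _
  have hb2 : 2 - ((d : ℝ) + 1) / m ≤ β' := le_max_right _ _
  have hb3 : β' < 1 := max_lt (by norm_num) (by linarith)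
  have hPm : (P + 1) / m < 1 := by rw [div_lt_one hm0]; linarith
  obtain ⟨α', hα', hα'α, H'⟩ := exists_tame_logPullback (a := 1 / m - 2) (b := 1 / m) (P := P)
    (γ := 1 / 2) hQ hα hα1 (one_div_mem_Ioc hm) (by
      have : 1 / m - 2 + 1 / m * P = (P + 1) / m - 2 := by field_simp; ring
      rw [this]; linarith)
  have hdβ' : -(1 / m - 2 + 1 / m * (d : ℝ)) ≤ β' := by
    rwa [show -(1 / m - 2 + 1 / m * (d : ℝ)) = 2 - ((d : ℝ) + 1) / m by field_simp; ring]
  obtain ⟨C', hC'⟩ := H' _ d _ β' (hf.const_mul (m : ℂ)⁻¹) (hd.const_mul (m : ℂ)⁻¹) hdβ'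
  obtain ⟨ℓ, -, hℓ⟩ := exists_tendsto_logPullback (a := 1 / m - 2) hQ hα hα1
    (one_div_mem_Ioc hm) (hf.const_mul (m : ℂ)⁻¹) (hd.const_mul (m : ℂ)⁻¹) hdβ'
  have e : logPullback (1 / m - 2) (1 / m) (fun k => (m : ℂ)⁻¹ * f k) =
      fun s => logDensity m f s * Complex.exp (-s) := by
    funext s
    rw [logDensity, logPullback, logPullback, mul_right_comm, Complex.ofReal_exp, Complex.ofReal_exp,
      ← Complex.exp_add]
    congr 2; push_cast; ring
  rw [e] at hC' hℓ
  exact ⟨_, tendsto_logCauchy_leftEnd hE hC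
    ⟨hα', hα'α.trans hα1, ⟨by linarith, hb3⟩, by norm_num, hb1⟩ hC' hℓ hL⟩

theorem tendsto_logDensity (hm : 1 < m) (hQ : 0 ≤ Q) (hα : 0 < α) (hα1 : α ≤ 1)
    (hf : IsSymbol P Q α f) (hd : HasLead d f c) (hdm : (d : ℝ) + 1 = m) :
    Tendsto (logDensity m f) atBot (𝓝 ((m : ℂ)⁻¹ * c)) := by
  have hm0 : 0 < m := by linarith
  have := tendsto_logPullback (a := 1 / m - 1) hQ hα hα1 (one_div_mem_Ioc hm)
    (hf.const_mul (m : ℂ)⁻¹) (hd.const_mul (m : ℂ)⁻¹)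
  rw [show -(1 / m - 1 + 1 / m * (d : ℝ)) = 1 - ((d : ℝ) + 1) / m by field_simp; ring, hdm,
    div_self hm0.ne', sub_self] at this
  refine this.congr fun s => ?_
  simp [logDensity, expModel]

/-- In the borderline case d + 1 = m the density tends to a constant. The rescaled density φ(t/2)
e^{-t/2} is the same pullback with m replaced by 2m in the exponents, and its exponent at -∞ is 1/2.
-/
theorem tendsto_logCauchy_logDensity_sub (hm : 1 < m) (hP : P < m - 1) (hQ : 0 ≤ Q)
    (hα : 0 < α) (hα1 : α ≤ 1) (hf : IsSymbol P Q α f) (hd : HasLead d f c)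
    (hdm : (d : ℝ) + 1 = m) :
    Tendsto (fun w => logCauchy (logDensity m f) w -
      logCauchy (logDensity m f) (w + Real.pi * Complex.I)) (leftEnd Real.pi)
      (𝓝 ((m : ℂ)⁻¹ * c * modelConst (1 / 2))) := by
  have hm0 : 0 < m := by linarith
  obtain ⟨α₁, γ₁, -, hE, H⟩ := exists_tame_logDensity hm hP hQ hα hα1
    (show (1 / 2 : ℝ) ∈ Ioo (0 : ℝ) 1 by norm_num)
  obtain ⟨C, hC⟩ := H f d c hf hd (by rw [hdm, div_self hm0.ne']; norm_num)
  have hPm : (P + 1) / m < 1 := by rw [div_lt_one hm0]; linarith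
  have hb : 1 / (2 * m) ∈ Ioc (0 : ℝ) 1 :=
    ⟨by positivity, by rw [div_le_one (by linarith)]; linarith⟩
  obtain ⟨α', hα', hα'α, H'⟩ := exists_tame_logPullback (a := 1 / (2 * m) - 1) (b := 1 / (2 * m))
    (P := P) (γ := 1 / 2) hQ hα hα1 hb (by
      have : 1 / (2 * m) - 1 + 1 / (2 * m) * P = (P + 1) / m / 2 - 1 := by field_simp; ring
      rw [this]; linarith)
  obtain ⟨C', hC'⟩ := H' _ d _ (1 / 2) (hf.const_mul (m : ℂ)⁻¹) (hd.const_mul (m : ℂ)⁻¹) (by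
    rw [show -(1 / (2 * m) - 1 + 1 / (2 * m) * (d : ℝ)) = 1 - ((d : ℝ) + 1) / m / 2 by
      field_simp; ring, hdm, div_self hm0.ne']; norm_num)
  have e : logPullback (1 / (2 * m) - 1) (1 / (2 * m)) (fun k => (m : ℂ)⁻¹ * f k) =
      fun t => logDensity m f (t / 2) * Complex.exp (-(t / 2)) := by
    funext t
    rw [logDensity, logPullback, logPullback, mul_right_comm, Complex.ofReal_exp, Complex.ofReal_exp,
      ← Complex.exp_add, show 1 / (2 * m) * t = 1 / m * (t / 2) by field_simp]
    congr 2; push_cast; field_simp; ring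
  rw [e] at hC'
  exact tendsto_logCauchy_sub_logCauchy_add_pi hE hC
    ⟨hα', hα'α.trans hα1, by norm_num, by norm_num, le_rfl⟩ hC'
    (tendsto_logDensity hm hQ hα hα1 hf hd hdm)

/-- At d + 1 = m the power e^{rs} of the small-momentum bounds is 1, which leaves unweighted Hölder
bounds and convergence to the constant at rate α/m. -/
theorem tendsto_logCauchy_logDensity_div_re (hm : 1 < m) (hP : P < m - 1) (hQ : 0 ≤ Q)
    (hα : 0 < α) (hα1 : α ≤ 1) (hf : IsSymbol P Q α f) (hd : HasLead d f c)
    (hdm : (d : ℝ) + 1 = m) (L : ℝ) :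
    Tendsto (fun w : ℂ => (((-w.re)⁻¹ : ℝ) : ℂ) * logCauchy (logDensity m f) w) (leftEnd L)
      (𝓝 (-((m : ℂ)⁻¹ * c))) := by
  have hm0 : 0 < m := by linarith
  have hb := one_div_mem_Ioc hm
  obtain ⟨α', γ, hα'α, hE, H⟩ := exists_tame_logDensity hm hP hQ hα hα1
    (show (1 / 2 : ℝ) ∈ Ioo (0 : ℝ) 1 by norm_num)
  obtain ⟨C, hC⟩ := H f d c hf hd (by rw [hdm, div_self hm0.ne']; norm_num)
  obtain ⟨D, hD, h1, h2, h3⟩ := exists_tame_left (a := 1 / m - 1) hQ hα hα1 hb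
    (hf.const_mul (m : ℂ)⁻¹) (hd.const_mul (m : ℂ)⁻¹)
  have h0 : 1 / m - 1 + 1 / m * (d : ℝ) = 0 := by
    rw [show 1 / m - 1 + 1 / m * (d : ℝ) = ((d : ℝ) + 1) / m - 1 by field_simp; ring, hdm,
      div_self hm0.ne', sub_self]
  simp only [h0, zero_mul, Real.exp_zero, mul_one, Complex.ofReal_one, one_mul] at h1 h2 h3
  have hC0 := hC.nonneg
  refine tendsto_logCauchy_div_re hE hC (C₀ := 2 * C + D) (c := α * (1 / m)) (fun s => ?_)
    (fun s hs u hu => ?_) (mul_pos hα hb.1) (fun s hs => ?_) L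
  · rcases le_total 0 s with h | h
    · refine (hC.norm_le s).trans ?_
      have h5 : expWeight (1 / 2) γ s ≤ 2 := by
        have e1 : Real.exp (-(1 / 2 * s)) ≤ 1 := Real.exp_le_one_iff.2 (by linarith)
        have e2 : Real.exp (-(γ * s)) ≤ 1 :=
          Real.exp_le_one_iff.2 (by linarith [mul_nonneg hE.hγ.1.le h])
        rw [expWeight]; linarith
      have := mul_le_mul_of_nonneg_left h5 hC0
      linarith
    · exact (h1 s h).trans (by linarith)
  · refine (h2 s u hs hu).trans (mul_le_mul (by linarith) ?_ (by positivity) (by linarith))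
    rcases (abs_nonneg u).eq_or_lt with h0 | h0
    · rw [← h0, Real.zero_rpow hE.hα.ne', Real.zero_rpow hα.ne']
    · exact Real.rpow_le_rpow_of_exponent_ge h0 hu hα'α
  · exact (h3 s hs).trans (mul_le_mul_of_nonneg_right (by linarith) (Real.exp_pos _).le)

end density

/-! ### The self-energy in logarithmic coordinates -/

section halfLine

variable {m α β γ C : ℝ} {f : ℝ → ℂ}

theorem image_exp_div (hm : 0 < m) : (fun s : ℝ => Real.exp (1 / m * s)) '' univ = Ioi 0 := by
  ext k
  simp only [image_univ, mem_range, mem_Ioi]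
  constructor
  · rintro ⟨s, rfl⟩; exact Real.exp_pos _
  · intro hk
    refine ⟨m * Real.log k, ?_⟩
    rw [← mul_assoc, one_div_mul_cancel hm.ne', one_mul, Real.exp_log hk]

/-- The substitution k = e^{s/m} turns the denominator into e^w - e^s; a factor e^s taken out of it
makes the integral a convolution. -/
theorem integral_halfLine (hm : 0 < m) (hE : TameExponents α β γ)
    (h : Tame α β γ C (logDensity m f)) {w : ℂ} (hw : w ∈ openStrip (2 * Real.pi)) :
    IntegrableOn (fun k : ℝ => f k / (Complex.exp w - ((k ^ m : ℝ) : ℂ))) (Ioi 0) ∧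
      ∫ k in Ioi (0 : ℝ), f k / (Complex.exp w - ((k ^ m : ℝ) : ℂ)) =
        logCauchy (logDensity m f) w := by
  have hderiv : ∀ s ∈ (univ : Set ℝ), HasDerivWithinAt (fun s : ℝ => Real.exp (1 / m * s))
      (Real.exp (1 / m * s) * (1 / m)) univ s := by
    intro s _
    have := ((hasDerivAt_id s).const_mul (1 / m)).exp
    rw [mul_one] at this
    exact this.hasDerivWithinAt
  have hinj : InjOn (fun s : ℝ => Real.exp (1 / m * s)) univ := by
    intro s _ t _ hst
    have := Real.exp_injective hst
    exact mul_left_cancel₀ (one_div_ne_zero hm.ne') this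
  have hcongr : ∀ s : ℝ, |Real.exp (1 / m * s) * (1 / m)| • (f (Real.exp (1 / m * s)) /
      (Complex.exp w - ((Real.exp (1 / m * s) ^ m : ℝ) : ℂ))) =
      logDensity m f s * expKernel (w - s) := by
    intro s
    have e1 : Real.exp (1 / m * s) ^ m = Real.exp s := by
      rw [← Real.exp_mul]; congr 1; field_simp
    have e2 : Real.exp (1 / m * s) = Real.exp ((1 / m - 1) * s) * Real.exp s := by
      rw [← Real.exp_add]; congr 1; ring
    have h0 : (Real.exp s : ℂ) ≠ 0 := by exact_mod_cast (Real.exp_pos s).ne'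
    rw [e1, abs_of_pos (by positivity), Complex.real_smul, logDensity, logPullback, expKernel,
      Complex.exp_sub, ← Complex.ofReal_exp s, div_sub_one h0, inv_div, e2]
    push_cast
    ring
  rw [← image_exp_div hm, integrableOn_image_iff_integrableOn_abs_deriv_smul MeasurableSet.univ
    hderiv hinj, integral_image_eq_integral_abs_deriv_smul MeasurableSet.univ hderiv hinj]
  simp only [hcongr, integrableOn_univ, setIntegral_univ]
  exact ⟨h.integrable_mul_expKernel hE hw, (logCauchy_eq_integral hE h hw).symm⟩

theorem integral_eq_add_comp_neg {g : ℝ → ℂ} (h1 : IntegrableOn g (Ioi 0))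
    (h2 : IntegrableOn (fun k => g (-k)) (Ioi 0)) :
    Integrable g ∧ ∫ k, g k = (∫ k in Ioi 0, g k) + ∫ k in Ioi 0, g (-k) := by
  have h3 : IntegrableOn g (Iic 0) := by
    rw [integrableOn_Iic_iff_integrableOn_Iio, ← (Measure.measurePreserving_neg
      (volume : Measure ℝ)).integrableOn_comp_preimage (Homeomorph.neg ℝ).measurableEmbedding]
    simpa [Function.comp_def] using h2
  have h4 : Integrable g := by
    rw [← integrableOn_univ, ← Iic_union_Ioi (a := (0 : ℝ))]
    exact h3.union h1
  refine ⟨h4, ?_⟩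
  rw [integral_comp_neg_Ioi, neg_zero, add_comm, ← setIntegral_union (by
    rw [Set.disjoint_left]; intro x hx hx'; exact absurd (mem_Iic.1 hx) (not_le.2 (mem_Ioi.1 hx'))) measurableSet_Ioi h3 h1,
    Iic_union_Ioi, setIntegral_univ]

end halfLine

/-- The transform `f ↦ ∫ f k / (ω - ε k) dk` in the variable `w = log ω`: `σ = 1`, `θ = 0` for
symmetric and `σ = -1`, `θ = π` for antisymmetric dispersion. -/
noncomputable def dispersionTransform (σ θ m : ℝ) (f : ℝ → ℂ) (w : ℂ) : ℂ :=
  logCauchy (logDensity m f) w + σ * logCauchy (logDensity m fun k => f (-k)) (w + θ * Complex.I)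

/-! ### Both half-lines together -/

section transform

variable {σ θ L m α β γ C C' : ℝ} {f : ℝ → ℂ}

theorem add_mem_openStrip (hθ : 0 ≤ θ) (hL : L + θ ≤ 2 * Real.pi) {w : ℂ} (hw : w ∈ openStrip L) :
    w ∈ openStrip (2 * Real.pi) ∧ w + θ * Complex.I ∈ openStrip (2 * Real.pi) := by
  obtain ⟨h1, h2⟩ : 0 < w.im ∧ w.im < L := hw
  refine ⟨⟨h1, by linarith⟩, ?_⟩
  simp only [openStrip, mem_preimage, Complex.add_im, Complex.mul_im, Complex.ofReal_re,
    Complex.I_im, mul_one, Complex.ofReal_im, Complex.I_re, mul_zero, add_zero, mem_Ioo]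
  constructor <;> linarith

theorem continuous_dispersionTransform (hE : TameExponents α β γ)
    (h : Tame α β γ C (logDensity m f)) (h' : Tame α β γ C' (logDensity m fun k => f (-k))) :
    Continuous (dispersionTransform σ θ m f) :=
  (continuous_logCauchy hE h).add
    (continuous_const.mul ((continuous_logCauchy hE h').comp (by fun_prop)))

theorem differentiableOn_dispersionTransform (hθ : 0 ≤ θ) (hL : L + θ ≤ 2 * Real.pi)
    (hE : TameExponents α β γ)
    (h : Tame α β γ C (logDensity m f)) (h' : Tame α β γ C' (logDensity m fun k => f (-k))) :
    DifferentiableOn ℂ (dispersionTransform σ θ m f) (openStrip L) := by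
  refine ((differentiableOn_logCauchy hE h).mono fun w hw => (add_mem_openStrip hθ hL hw).1).add
    (DifferentiableOn.const_mul ?_ _)
  exact (differentiableOn_logCauchy hE h').comp (by fun_prop)
    fun w hw => (add_mem_openStrip hθ hL hw).2

theorem tendsto_add_rightEnd (hθ : 0 ≤ θ) (hL : L + θ ≤ 2 * Real.pi) :
    Tendsto (fun w : ℂ => w + θ * Complex.I) (rightEnd L) (rightEnd (2 * Real.pi)) := by
  refine tendsto_inf.2 ⟨tendsto_comap_iff.2 ?_, tendsto_principal.2 ?_⟩
  · refine (tendsto_re_rightEnd (L := L)).congr fun w => ?_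
    simp
  · filter_upwards [closedStrip_mem_rightEnd] with w hw
    obtain ⟨h1, h2⟩ : 0 ≤ w.im ∧ w.im ≤ L := hw
    simp only [closedStrip, mem_preimage, Complex.add_im, Complex.mul_im, Complex.ofReal_re,
      Complex.I_im, mul_one, Complex.ofReal_im, Complex.I_re, mul_zero, add_zero, mem_Icc]
    constructor <;> linarith

theorem tendsto_add_leftEnd (hθ : 0 ≤ θ) (hL : L + θ ≤ 2 * Real.pi) :
    Tendsto (fun w : ℂ => w + θ * Complex.I) (leftEnd L) (leftEnd (2 * Real.pi)) := by
  refine tendsto_inf.2 ⟨tendsto_comap_iff.2 ?_, tendsto_principal.2 ?_⟩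
  · refine (tendsto_re_leftEnd (L := L)).congr fun w => ?_
    simp
  · filter_upwards [closedStrip_mem_leftEnd] with w hw
    obtain ⟨h1, h2⟩ : 0 ≤ w.im ∧ w.im ≤ L := hw
    simp only [closedStrip, mem_preimage, Complex.add_im, Complex.mul_im, Complex.ofReal_re,
      Complex.I_im, mul_one, Complex.ofReal_im, Complex.I_re, mul_zero, add_zero, mem_Icc]
    constructor <;> linarith

theorem tendsto_dispersionTransform_rightEnd (hθ : 0 ≤ θ) (hL : L + θ ≤ 2 * Real.pi)
    (hE : TameExponents α β γ)
    (h : Tame α β γ C (logDensity m f)) (h' : Tame α β γ C' (logDensity m fun k => f (-k))) :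
    Tendsto (dispersionTransform σ θ m f) (rightEnd L) (𝓝 0) := by
  have h1 := tendsto_logCauchy_rightEnd hE h L
  have h2 := ((tendsto_logCauchy_rightEnd hE h' (2 * Real.pi)).comp
    (tendsto_add_rightEnd hθ hL)).const_mul (σ : ℂ)
  have h3 := h1.add h2
  rw [mul_zero, add_zero] at h3
  exact h3

theorem logDensity_sum {ι : Type*} (s : Finset ι) (c : ι → ℂ) (g : ι → ℝ → ℂ) :
    (logDensity m fun k => ∑ i ∈ s, c i * g i k) = fun x => ∑ i ∈ s, c i * logDensity m (g i) x := by
  funext x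
  simp only [logDensity, logPullback, Finset.mul_sum]
  exact Finset.sum_congr rfl fun i _ => by ring

theorem dispersionTransform_sum {ι : Type*} (s : Finset ι) (c : ι → ℂ) (g : ι → ℝ → ℂ)
    (hE : TameExponents α β γ) {C : ι → ℝ} (h : ∀ i ∈ s, Tame α β γ (C i) (logDensity m (g i)))
    {C' : ι → ℝ} (h' : ∀ i ∈ s, Tame α β γ (C' i) (logDensity m fun k => g i (-k))) (w : ℂ) :
    dispersionTransform σ θ m (fun k => ∑ i ∈ s, c i * g i k) w =
      ∑ i ∈ s, c i * dispersionTransform σ θ m (g i) w := by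
  have h1 := (exists_logCauchy_sum s c _ C hE h).2
  have h2 := (exists_logCauchy_sum s c _ C' hE h').2
  simp only [dispersionTransform, logDensity_sum, h1, h2]
  rw [Finset.mul_sum, ← Finset.sum_add_distrib]
  refine Finset.sum_congr rfl fun i _ => ?_
  ring

theorem dispersionTransform_sym (hm : 0 < m) (hE : TameExponents α β γ)
    (h : Tame α β γ C (logDensity m f)) (h' : Tame α β γ C' (logDensity m fun k => f (-k)))
    {w : ℂ} (hw : w ∈ openStrip (2 * Real.pi)) :
    Integrable (fun k => f k / (Complex.exp w - (symDispersion m k : ℂ))) ∧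
      ∫ k, f k / (Complex.exp w - (symDispersion m k : ℂ)) = dispersionTransform 1 0 m f w := by
  obtain ⟨i1, e1⟩ := integral_halfLine hm hE h hw
  obtain ⟨i2, e2⟩ := integral_halfLine hm hE h' hw
  have c1 : EqOn (fun k : ℝ => f k / (Complex.exp w - ((k ^ m : ℝ) : ℂ)))
      (fun k => f k / (Complex.exp w - (symDispersion m k : ℂ))) (Ioi 0) := fun k hk => by
    simp only [symDispersion, abs_of_pos (mem_Ioi.1 hk)]
  have c2 : EqOn (fun k : ℝ => f (-k) / (Complex.exp w - ((k ^ m : ℝ) : ℂ)))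
      (fun k => f (-k) / (Complex.exp w - (symDispersion m (-k) : ℂ))) (Ioi 0) := fun k hk => by
    simp only [symDispersion, abs_neg, abs_of_pos (mem_Ioi.1 hk)]
  obtain ⟨i3, e3⟩ := integral_eq_add_comp_neg (i1.congr_fun c1 measurableSet_Ioi)
    (i2.congr_fun c2 measurableSet_Ioi)
  refine ⟨i3, e3.trans ?_⟩
  rw [← setIntegral_congr_fun measurableSet_Ioi c1, ← setIntegral_congr_fun measurableSet_Ioi c2,
    e1, e2, dispersionTransform]
  simp

/-- On the negative half-line ε = -|k|^m, and 1/(ω + |k|^m) = -1/(-ω - |k|^m) with -ω = e^{w + πi}.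
Hence the sign -1, the shift π, and a strip of width only π. -/
theorem dispersionTransform_anti (hm : 0 < m) (hE : TameExponents α β γ)
    (h : Tame α β γ C (logDensity m f)) (h' : Tame α β γ C' (logDensity m fun k => f (-k)))
    {w : ℂ} (hw : w ∈ openStrip Real.pi) :
    Integrable (fun k => f k / (Complex.exp w - (antiDispersion m k : ℂ))) ∧
      ∫ k, f k / (Complex.exp w - (antiDispersion m k : ℂ)) =
        dispersionTransform (-1) Real.pi m f w := by
  obtain ⟨hw1, hw2⟩ := add_mem_openStrip Real.pi_pos.le (by linarith) hw
  obtain ⟨i1, e1⟩ := integral_halfLine hm hE h hw1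
  obtain ⟨i2, e2⟩ := integral_halfLine hm hE h' hw2
  have c1 : EqOn (fun k : ℝ => f k / (Complex.exp w - ((k ^ m : ℝ) : ℂ)))
      (fun k => f k / (Complex.exp w - (antiDispersion m k : ℂ))) (Ioi 0) := fun k hk => by
    simp only [antiDispersion, abs_of_pos (mem_Ioi.1 hk), Real.sign_of_pos (mem_Ioi.1 hk), one_mul]
  have c2 : EqOn (fun k : ℝ => -(f (-k) / (Complex.exp (w + Real.pi * Complex.I) - ((k ^ m : ℝ) : ℂ))))
      (fun k => f (-k) / (Complex.exp w - (antiDispersion m (-k) : ℂ))) (Ioi 0) := fun k hk => by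
    have : -k < 0 := neg_lt_zero.2 hk
    simp only [antiDispersion, abs_neg, abs_of_pos (mem_Ioi.1 hk), Real.sign_of_neg this,
      Complex.exp_add, Complex.exp_pi_mul_I]
    rw [← div_neg]; congr 1; push_cast; ring
  obtain ⟨i3, e3⟩ := integral_eq_add_comp_neg (i1.congr_fun c1 measurableSet_Ioi)
    (i2.neg.congr_fun c2 measurableSet_Ioi)
  refine ⟨i3, e3.trans ?_⟩
  rw [← setIntegral_congr_fun measurableSet_Ioi c1, ← setIntegral_congr_fun measurableSet_Ioi c2,
    e1, integral_neg, e2, dispersionTransform]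
  simp

/-- The value of the transform at the power `k ^ d`. -/
noncomputable def leadConst (σ θ m : ℝ) (d : ℕ) : ℂ :=
  (m : ℂ)⁻¹ * (1 + σ * (-1) ^ d * Complex.exp (-((1 - ((d : ℝ) + 1) / m : ℝ) * (θ * Complex.I)))) *
    modelConst (1 - ((d : ℝ) + 1) / m)

theorem logDensity_pow (hm : 0 < m) (d : ℕ) (c : ℂ) :
    logDensity m (fun k => c * (k : ℂ) ^ d) =
      fun s => (m : ℂ)⁻¹ * c * expModel (1 - ((d : ℝ) + 1) / m) s := by
  funext s
  rw [logDensity, logPullback, expModel]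
  have : ((Real.exp (1 / m * s) : ℝ) : ℂ) ^ d = Complex.exp (d / m * s) := by
    rw [Complex.ofReal_exp, ← Complex.exp_nat_mul]; congr 1; push_cast; ring
  rw [this, Complex.ofReal_exp, mul_left_comm, mul_left_comm (Complex.exp _) c, ← Complex.exp_add,
    ← mul_assoc]
  congr 2; push_cast
  have : (m : ℂ) ≠ 0 := by exact_mod_cast hm.ne'
  field_simp; ring

theorem tame_pow (hm : 0 < m) {d : ℕ} (hd : (d : ℝ) + 1 < m) (c : ℂ) :
    ∃ α β γ C C', TameExponents α β γ ∧ Tame α β γ C (logDensity m fun k => c * (k : ℂ) ^ d) ∧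
      Tame α β γ C' (logDensity m fun k => c * ((-k : ℝ) : ℂ) ^ d) := by
  have hβ : 1 - ((d : ℝ) + 1) / m ∈ Ioo (0 : ℝ) 1 :=
    ⟨by rw [sub_pos, div_lt_one hm]; exact hd, by
      have : 0 < ((d : ℝ) + 1) / m := by positivity
      linarith⟩
  have hE : TameExponents 1 (1 - ((d : ℝ) + 1) / m) (1 - ((d : ℝ) + 1) / m) :=
    ⟨one_pos, le_rfl, hβ, hβ, le_rfl⟩
  have h2 : (fun k : ℝ => c * ((-k : ℝ) : ℂ) ^ d) = fun k : ℝ => ((-1) ^ d * c) * (k : ℂ) ^ d := by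
    funext k; push_cast; rw [neg_pow]; ring
  have h3 := (tame_expModel hE).const_mul ((m : ℂ)⁻¹ * c)
  have h4 := (tame_expModel hE).const_mul ((m : ℂ)⁻¹ * ((-1) ^ d * c))
  rw [← logDensity_pow hm] at h3 h4
  rw [← h2] at h4
  exact ⟨_, _, _, _, _, hE, h3, h4⟩

/-- For pure powers the asymptotic law is an identity at every w. Evaluated at one convenient point,
it identifies `leadConst` with a moment. -/
theorem exp_mul_dispersionTransform_pow (hm : 0 < m) {d : ℕ} (hd : (d : ℝ) + 1 < m) (hθ : 0 ≤ θ)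
    (hL : L + θ ≤ 2 * Real.pi) {w : ℂ} (hw : w ∈ openStrip L) :
    Complex.exp ((1 - ((d : ℝ) + 1) / m : ℝ) * w) *
      dispersionTransform σ θ m (fun k => (k : ℂ) ^ d) w = leadConst σ θ m d := by
  obtain ⟨hw1, hw2⟩ := add_mem_openStrip hθ hL hw
  have hβ : 1 - ((d : ℝ) + 1) / m ∈ Ioo (0 : ℝ) 1 :=
    ⟨by rw [sub_pos, div_lt_one hm]; exact hd, by
      have : 0 < ((d : ℝ) + 1) / m := by positivity
      linarith⟩
  have hE : TameExponents 1 (1 - ((d : ℝ) + 1) / m) (1 - ((d : ℝ) + 1) / m) :=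
    ⟨one_pos, le_rfl, hβ, hβ, le_rfl⟩
  have h1 : (fun k : ℝ => (k : ℂ) ^ d) = fun k : ℝ => 1 * (k : ℂ) ^ d := by simp
  have h2 : (fun k : ℝ => ((-k : ℝ) : ℂ) ^ d) = fun k : ℝ => (-1) ^ d * (k : ℂ) ^ d := by
    funext k; push_cast; rw [neg_pow]
  have m1 := exp_mul_logCauchy_expModel hE (w := w) (openStrip_subset _ hw1)
  have m2 := exp_mul_logCauchy_expModel hE (w := w + θ * Complex.I) (openStrip_subset _ hw2)
  rw [dispersionTransform, h2, h1, logDensity_pow hm, logDensity_pow hm, logCauchy_const_mul,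
    logCauchy_const_mul, leadConst]
  set β := 1 - ((d : ℝ) + 1) / m
  have e : Complex.exp (β * w) =
      Complex.exp (β * (w + θ * Complex.I)) * Complex.exp (-(β * (θ * Complex.I))) := by
    rw [← Complex.exp_add]; congr 1; ring
  rw [mul_add]
  have e1 : Complex.exp (β * w) * ((m : ℂ)⁻¹ * 1 * logCauchy (expModel β) w) =
      (m : ℂ)⁻¹ * modelConst β := by rw [← m1]; ring
  have e2 : Complex.exp (β * w) * (σ * ((m : ℂ)⁻¹ * (-1) ^ d *
      logCauchy (expModel β) (w + θ * Complex.I))) =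
      σ * (-1) ^ d * (m : ℂ)⁻¹ * Complex.exp (-(β * (θ * Complex.I))) * modelConst β := by
    rw [← m2, e]; ring
  rw [e1, e2]; ring

variable {P Q : ℝ} {d : ℕ} {c : ℂ}

theorem tendsto_exp_mul_dispersionTransform (hm : 1 < m) (hP : P < m - 1) (hQ : 0 ≤ Q)
    (hα : 0 < α) (hα1 : α ≤ 1) (hf : IsSymbol P Q α f) (hd : HasLead d f c) (hdm : (d : ℝ) + 1 < m)
    (hθ : 0 ≤ θ) (hL : L + θ ≤ 2 * Real.pi) :
    Tendsto (fun w => Complex.exp ((1 - ((d : ℝ) + 1) / m : ℝ) * w) * dispersionTransform σ θ m f w)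
      (leftEnd L) (𝓝 (c * leadConst σ θ m d)) := by
  have h1 := tendsto_exp_mul_logCauchy_logDensity hm hP hQ hα hα1 hf hd hdm
    (L := L) (by linarith)
  have h2 := (tendsto_exp_mul_logCauchy_logDensity hm hP hQ hα hα1 hf.comp_neg hd.comp_neg hdm
    le_rfl).comp (tendsto_add_leftEnd hθ hL)
  have h3 := h1.add (h2.const_mul
    (σ * Complex.exp (-((1 - ((d : ℝ) + 1) / m : ℝ) * (θ * Complex.I)))))
  refine (h3.congr fun w => ?_).trans (le_of_eq ?_)
  · rw [dispersionTransform, mul_add, Function.comp_apply, mul_assoc (σ : ℂ), ← mul_assoc (Complex.exp _)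
      (Complex.exp _), ← Complex.exp_add]
    rw [mul_left_comm _ (σ : ℂ)]
    congr 4; ring
  · rw [leadConst]; congr 1; ring

theorem tendsto_exp_mul_dispersionTransform_zero (hm : 1 < m) (hP : P < m - 1) (hQ : 0 ≤ Q)
    (hα : 0 < α) (hα1 : α ≤ 1) (hf : IsSymbol P Q α f) (hd : HasLead d f c) {r : ℝ} (hr : 0 < r)
    (hdr : 1 - ((d : ℝ) + 1) / m < r) (hθ : 0 ≤ θ) (hL : L + θ ≤ 2 * Real.pi) :
    Tendsto (fun w => Complex.exp (r * w) * dispersionTransform σ θ m f w) (leftEnd L) (𝓝 0) := by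
  have h1 := tendsto_exp_mul_logCauchy_logDensity_zero hm hP hQ hα hα1 hf hd hr hdr
    (L := L) (by linarith)
  have h2 := (tendsto_exp_mul_logCauchy_logDensity_zero hm hP hQ hα hα1 hf.comp_neg hd.comp_neg hr
    hdr le_rfl).comp (tendsto_add_leftEnd hθ hL)
  have h3 := h1.add (h2.const_mul (σ * Complex.exp (-(r * (θ * Complex.I)))))
  rw [mul_zero, add_zero] at h3
  refine h3.congr fun w => ?_
  rw [dispersionTransform, mul_add, Function.comp_apply, mul_assoc (σ : ℂ), ← mul_assoc (Complex.exp _)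
      (Complex.exp _), ← Complex.exp_add]
  rw [mul_left_comm _ (σ : ℂ)]
  congr 4; ring

theorem exists_tendsto_dispersionTransform (hm : 1 < m) (hP : P < m - 1) (hQ : 0 ≤ Q)
    (hα : 0 < α) (hα1 : α ≤ 1) (hf : IsSymbol P Q α f) (hd : HasLead d f c) (hdm : m < (d : ℝ) + 1)
    (hθ : 0 ≤ θ) (hL : L + θ ≤ 2 * Real.pi) :
    ∃ ℓ, Tendsto (dispersionTransform σ θ m f) (leftEnd L) (𝓝 ℓ) := by
  obtain ⟨ℓ, h1⟩ := exists_tendsto_logCauchy_logDensity hm hP hQ hα hα1 hf hd hdm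
    (L := L) (by linarith)
  obtain ⟨ℓ', h2⟩ := exists_tendsto_logCauchy_logDensity hm hP hQ hα hα1 hf.comp_neg hd.comp_neg
    hdm le_rfl
  exact ⟨_, h1.add ((h2.comp (tendsto_add_leftEnd hθ hL)).const_mul _)⟩

theorem tendsto_dispersionTransform_sym_div_re (hm : 1 < m) (hP : P < m - 1) (hQ : 0 ≤ Q)
    (hα : 0 < α) (hα1 : α ≤ 1) (hf : IsSymbol P Q α f) (hd : HasLead d f c) (hdm : (d : ℝ) + 1 = m)
    (hdE : Even d) (L : ℝ) :
    Tendsto (fun w : ℂ => (((-w.re)⁻¹ : ℝ) : ℂ) * dispersionTransform 1 0 m f w) (leftEnd L)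
      (𝓝 (c * -(2 * (m : ℂ)⁻¹))) := by
  have h1 := tendsto_logCauchy_logDensity_div_re hm hP hQ hα hα1 hf hd hdm L
  have h2 := tendsto_logCauchy_logDensity_div_re hm hP hQ hα hα1 hf.comp_neg hd.comp_neg hdm L
  refine ((h1.add h2).congr fun w => ?_).trans (le_of_eq ?_)
  · simp [dispersionTransform, mul_add]
  · rw [hdE.neg_one_pow]; congr 1; ring

/-- Write the transform as the transform of f at w minus that of f at w + πi, plus the transform of
f(k) - f(-k) at w + πi. The first difference converges in the borderline case. In the second, the
leading even power cancels, so the order rises and the convergent case applies. -/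
theorem exists_tendsto_dispersionTransform_anti (hm : 1 < m) (hP : P < m - 1) (hQ : 0 ≤ Q)
    (hα : 0 < α) (hα1 : α ≤ 1) (hf : IsSymbol P Q α f) (hd : HasLead d f c) (hdm : (d : ℝ) + 1 = m)
    (hdE : Even d) :
    ∃ ℓ, Tendsto (dispersionTransform (-1) Real.pi m f) (leftEnd Real.pi) (𝓝 ℓ) := by
  have h1 := tendsto_logCauchy_logDensity_sub hm hP hQ hα hα1 hf hd hdm
  have hodd : HasLead d (fun k => f k + -1 * f (-k)) 0 := by
    have := hd.add (hd.comp_neg.const_mul (-1))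
    rw [hdE.neg_one_pow] at this
    simpa using this
  obtain ⟨b, hb⟩ := hasLead_succ_of_zero hodd
  have hs := hf.add (hf.comp_neg.const_mul (-1))
  obtain ⟨ℓ, h2⟩ := exists_tendsto_logCauchy_logDensity hm hP hQ hα hα1 hs hb
    (by push_cast; linarith) le_rfl
  have h3 := h2.comp (tendsto_add_leftEnd (θ := Real.pi) (L := Real.pi) Real.pi_pos.le (by linarith))
  refine ⟨_, (h1.add h3).congr fun w => ?_⟩
  obtain ⟨α', γ, -, hE, H⟩ := exists_tame_logDensity hm hP hQ hα hα1
    (show (1 / 2 : ℝ) ∈ Ioo (0 : ℝ) 1 by norm_num)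
  have hle : 1 - ((d : ℝ) + 1) / m ≤ 1 / 2 := by
    rw [hdm, div_self (by linarith)]; norm_num
  obtain ⟨C₁, hC₁⟩ := H f d c hf hd hle
  obtain ⟨C₂, hC₂⟩ := H _ d _ hf.comp_neg hd.comp_neg hle
  have e : (logDensity m fun k => f k + -1 * f (-k)) =
      fun s => logDensity m f s + -1 * logDensity m (fun k => f (-k)) s := by
    funext s; simp only [logDensity, logPullback]; ring
  rw [Function.comp_apply, e, logCauchy_add hE hC₁ (hC₂.const_mul (-1)), logCauchy_const_mul,
    dispersionTransform]
  push_cast; ring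

end transform

/-! ### Coordinates adapted to the Taylor coefficients -/

open Classical in
/-- The indices below `e` at which a sequence of vectors leaves the span of the earlier ones. -/
noncomputable def jumpSet {V : Type*} [AddCommGroup V] [Module ℂ V] (c : ℕ → V) (e : ℕ) : Finset ℕ :=
  (Finset.range e).filter fun n => c n ∉ Submodule.span ℂ (c '' Iio n)

section jumps

universe u

variable {V : Type u} [AddCommGroup V] [Module ℂ V] (c : ℕ → V)

theorem mem_jumpSet {e n : ℕ} :
    n ∈ jumpSet c e ↔ n < e ∧ c n ∉ Submodule.span ℂ (c '' Iio n) := by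
  classical
  simp [jumpSet]

/-- Greedy selection of a basis: the vectors skipped already lie in the span of those kept. -/
theorem linearIndepOn_jumpSet (e : ℕ) :
    LinearIndepOn ℂ c (jumpSet c e : Set ℕ) ∧
      Submodule.span ℂ (c '' (jumpSet c e : Set ℕ)) = Submodule.span ℂ (c '' Iio e) := by
  induction e with
  | zero =>
    have : (jumpSet c 0 : Set ℕ) = ∅ := by ext n; simp [mem_jumpSet]
    rw [this]
    exact ⟨linearIndepOn_empty _ _, by congr 1; ext; simp⟩
  | succ e ih =>
    have hI : Iio (e + 1) = insert e (Iio e) := by ext n; simp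
    by_cases h : c e ∈ Submodule.span ℂ (c '' Iio e)
    · have : (jumpSet c (e + 1) : Set ℕ) = jumpSet c e := by
        ext n
        simp only [Finset.mem_coe, mem_jumpSet]
        constructor
        · rintro ⟨h1, h2⟩
          rcases (Nat.lt_succ_iff_lt_or_eq.1 h1) with h3 | rfl
          · exact ⟨h3, h2⟩
          · exact absurd h h2
        · rintro ⟨h1, h2⟩; exact ⟨h1.trans (Nat.lt_succ_self e), h2⟩
      rw [this, hI, image_insert_eq, Submodule.span_insert_eq_span h]
      exact ih
    · have : (jumpSet c (e + 1) : Set ℕ) = insert e (jumpSet c e : Set ℕ) := by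
        ext n
        simp only [Finset.mem_coe, mem_jumpSet, mem_insert_iff]
        constructor
        · rintro ⟨h1, h2⟩
          rcases (Nat.lt_succ_iff_lt_or_eq.1 h1) with h3 | rfl
          · exact Or.inr ⟨h3, h2⟩
          · exact Or.inl rfl
        · rintro (rfl | ⟨h1, h2⟩)
          · exact ⟨Nat.lt_succ_self _, h⟩
          · exact ⟨h1.trans (Nat.lt_succ_self e), h2⟩
      rw [this, hI, image_insert_eq, image_insert_eq, Submodule.span_insert, Submodule.span_insert,
        ih.2]
      exact ⟨ih.1.insert (by rwa [ih.2]), rfl⟩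

/-- A basis that extends the family of the jumps. -/
theorem exists_basis_jumpSet [FiniteDimensional ℂ V] (e : ℕ) :
    ∃ (C : Type u) (_ : Fintype C) (b : Module.Basis (jumpSet c e ⊕ C) ℂ V),
      (∀ n : jumpSet c e, b (Sum.inl n) = c n) ∧
      (∀ (n : jumpSet c e) (j : ℕ), j < n → b.coord (Sum.inl n) (c j) = 0) ∧
      (∀ (i : C) (j : ℕ), j < e → b.coord (Sum.inr i) (c j) = 0) := by
  obtain ⟨hli, hspan⟩ := linearIndepOn_jumpSet c e
  have hli' : LinearIndependent ℂ fun n : jumpSet c e => c n := hli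
  obtain ⟨W', hW'⟩ := Submodule.exists_isCompl
    (Submodule.span ℂ (range fun n : jumpSet c e => c n))
  let b : Module.Basis (jumpSet c e ⊕ Module.Basis.ofVectorSpaceIndex ℂ W') ℂ V :=
    ((Module.Basis.span hli').prod (Module.Basis.ofVectorSpace ℂ W')).map
      (Submodule.prodEquivOfIsCompl _ _ hW')
  have hb : ∀ n : jumpSet c e, b (Sum.inl n) = c n := by
    intro n
    simp [b, Module.Basis.span_apply]
  -- c j is in the span of the jumps up to j, so a coordinate belonging to none of these jumps
  -- annihilates it.
  have key : ∀ j, j < e → ∀ i, (∀ n : jumpSet c e, (n : ℕ) ≤ j → i ≠ Sum.inl n) →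
      b.coord i (c j) = 0 := by
    intro j hj i hi
    have h1 : c j ∈ Submodule.span ℂ (c '' (jumpSet c (j + 1) : Set ℕ)) := by
      rw [(linearIndepOn_jumpSet c (j + 1)).2]
      exact Submodule.subset_span ⟨j, Nat.lt_succ_self j, rfl⟩
    have h2 : Submodule.span ℂ (c '' (jumpSet c (j + 1) : Set ℕ)) ≤ LinearMap.ker (b.coord i) := by
      rw [Submodule.span_le]
      rintro _ ⟨n, hn, rfl⟩
      rw [Finset.mem_coe, mem_jumpSet] at hn
      have hn' : n ∈ jumpSet c e := (mem_jumpSet c).2 ⟨by omega, hn.2⟩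
      rw [SetLike.mem_coe, LinearMap.mem_ker, ← hb ⟨n, hn'⟩, Module.Basis.coord_apply,
        Module.Basis.repr_self]
      exact Finsupp.single_eq_of_ne (hi ⟨n, hn'⟩ (by simp; omega))
    exact h2 h1
  refine ⟨_, inferInstance, b, hb, fun n j hj => ?_, fun i j hj => ?_⟩
  · refine key j (hj.trans ((mem_jumpSet c).1 n.2).1) _ fun n' hn' h => ?_
    rw [Sum.inl.inj h] at hj
    omega
  · exact key j hj _ fun n' _ h => by cases h

end jumps

theorem exists_hasLead {f : ℝ → ℂ} (hf : AnalyticAt ℝ f 0) {d : ℕ}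
    (h : ∀ j < d, iteratedDeriv j f 0 = 0) :
    ∃ a, HasLead d f a ∧ (iteratedDeriv d f 0 ≠ 0 → a ≠ 0) := by
  have h1 := (natCast_le_analyticOrderAt_iff_iteratedDeriv_eq_zero hf).2 h
  obtain ⟨F, hF, hfF⟩ := (natCast_le_analyticOrderAt hf).1 h1
  have hL : HasLead d f (F 0) := ⟨F, hF, rfl, by
    filter_upwards [hfF] with k hk
    rw [hk]; simp⟩
  refine ⟨F 0, hL, fun hd h0 => hd ?_⟩
  rw [h0] at hL
  obtain ⟨b, G, hG, -, hfG⟩ := hasLead_succ_of_zero hL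
  have h2 : ((d + 1 : ℕ) : ℕ∞) ≤ analyticOrderAt f 0 := by
    rw [natCast_le_analyticOrderAt hf]
    refine ⟨G, hG, ?_⟩
    filter_upwards [hfG] with k hk
    rw [hk]; simp
  exact (natCast_le_analyticOrderAt_iff_iteratedDeriv_eq_zero hf).1 h2 d (Nat.lt_succ_self d)

theorem iteratedDeriv_clm_comp {E F : Type*} [NormedAddCommGroup E] [NormedSpace ℝ E]
    [CompleteSpace E]
    [NormedAddCommGroup F] [NormedSpace ℝ F] (T : E →L[ℝ] F) {v : ℝ → E} (hv : AnalyticAt ℝ v 0)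
    (n : ℕ) : iteratedDeriv n (fun k => T (v k)) 0 = T (iteratedDeriv n v 0) := by
  have := T.iteratedFDeriv_comp_left (hv.contDiffAt (n := n)) (i := n) le_rfl
  rw [iteratedDeriv_eq_iteratedFDeriv, iteratedDeriv_eq_iteratedFDeriv]
  have h2 := congrArg (fun M => M fun _ => (1 : ℝ)) this
  simpa [Function.comp_def] using h2

/-- Coordinates in which the components of `v` vanish at `0` to different orders in the jump set,
and to order `e` otherwise. -/
theorem exists_adapted_coordinates {N : ℕ} {v : ℝ → EuclideanSpace ℂ (Fin N)}
    (hv : AnalyticAt ℝ v 0) (e : ℕ)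
    {s : Finset ℕ} (hs : s = jumpSet (fun n => iteratedDeriv n v 0) e) :
    ∃ (C : Type) (_ : Fintype C) (_ : DecidableEq C)
      (φ : s ⊕ C ≃ Fin N) (B : Matrix (s ⊕ C) (s ⊕ C) ℂ), IsUnit B.det ∧
      (∀ n : s, ∃ a ≠ 0,
        HasLead n (fun k => ∑ j, B (Sum.inl n) j * v k (φ j)) a) ∧
      (∀ i : C, ∃ a, HasLead e (fun k => ∑ j, B (Sum.inr i) j * v k (φ j)) a) := by
  classical
  subst hs
  obtain ⟨C, hC, b, hb, hA, hCe⟩ := exists_basis_jumpSet (fun n => iteratedDeriv n v 0) e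
  set b₀ := (EuclideanSpace.basisFun (Fin N) ℂ).toBasis with hb₀
  let φ := b.indexEquiv b₀
  set b₁ := b₀.reindex φ.symm with hb₁
  have hrepr : ∀ x j, b₁.repr x j = x (φ j) := by
    intro x j
    simp [hb₁, hb₀]
  have hsum : ∀ i k, ∑ j, b.toMatrix b₁ i j * v k (φ j) = b.coord i (v k) := by
    intro i k
    have := congrFun (Module.Basis.toMatrix_mulVec_repr b₁ b (v k)) i
    rw [Module.Basis.coord_apply, ← this]
    simp only [Matrix.mulVec, dotProduct, hrepr]
  let T : ∀ i, EuclideanSpace ℂ (Fin N) →L[ℝ] ℂ := fun i =>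
    (LinearMap.toContinuousLinearMap (b.coord i)).restrictScalars ℝ
  have hT : ∀ i x, T i x = b.coord i x := fun i x => rfl
  have han : ∀ i, AnalyticAt ℝ (fun k => b.coord i (v k)) 0 := fun i =>
    ((T i).analyticAt _).comp hv
  have hder : ∀ i n, iteratedDeriv n (fun k => b.coord i (v k)) 0 =
      b.coord i (iteratedDeriv n v 0) := fun i n => iteratedDeriv_clm_comp (T i) hv n
  refine ⟨C, hC, inferInstance, φ, b.toMatrix b₁, ?_, fun n => ?_, fun i => ?_⟩
  · exact Matrix.isUnit_det_of_right_inverse (Module.Basis.toMatrix_mul_toMatrix_flip b b₁)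
  · obtain ⟨a, ha, ha0⟩ := exists_hasLead (d := n) (han (Sum.inl n)) fun j hj => by
      rw [hder]; exact hA n j hj
    refine ⟨a, ha0 ?_, by simpa only [hsum] using ha⟩
    have := hb n
    rw [hder]
    rw [← this]; simp
  · obtain ⟨a, ha, -⟩ := exists_hasLead (d := e) (han (Sum.inr i)) fun j hj => by
      rw [hder]; exact hCe i j hj
    exact ⟨a, by simpa only [hsum] using ha⟩

/-! ### Linear algebra near the threshold -/

theorem tendsto_matrix_inv {X n : Type*} [Fintype n] [DecidableEq n] {l : Filter X}
    {M : X → Matrix n n ℂ} {M₀ : Matrix n n ℂ} (h : Tendsto M l (𝓝 M₀)) (h0 : M₀.det ≠ 0) :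
    Tendsto (fun x => (M x)⁻¹) l (𝓝 M₀⁻¹) := by
  have h1 : Tendsto (fun x => (M x).det) l (𝓝 M₀.det) :=
    ((continuous_id.matrix_det (R := ℂ) (n := n)).tendsto M₀).comp h
  have h2 : Tendsto (fun x => (M x).adjugate) l (𝓝 M₀.adjugate) :=
    ((continuous_id.matrix_adjugate (R := ℂ) (n := n)).tendsto M₀).comp h
  simp only [Matrix.inv_def, Ring.inverse_eq_inv']
  exact (h1.inv₀ h0).smul h2

theorem tendsto_matrix_mul {X p q s : Type*} [Fintype q] {l : Filter X} {F : X → Matrix p q ℂ}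
    {G : X → Matrix q s ℂ} {F₀ : Matrix p q ℂ} {G₀ : Matrix q s ℂ} (hF : Tendsto F l (𝓝 F₀))
    (hG : Tendsto G l (𝓝 G₀)) : Tendsto (fun x => F x * G x) l (𝓝 (F₀ * G₀)) := by
  refine tendsto_pi_nhds.2 fun i => tendsto_pi_nhds.2 fun k => ?_
  simp only [Matrix.mul_apply]
  exact tendsto_finsetSum _ fun j _ =>
    (((continuous_id.matrix_elem i j).tendsto F₀).comp hF).mul
      (((continuous_id.matrix_elem j k).tendsto G₀).comp hG)

/-- The Schur complement of the first diagonal block. -/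
noncomputable def schurComplement {A C : Type*} [Fintype A] [DecidableEq A]
    (R : Matrix (A ⊕ C) (A ⊕ C) ℂ) : Matrix C C ℂ :=
  R.toBlocks₂₂ - R.toBlocks₂₁ * R.toBlocks₁₁⁻¹ * R.toBlocks₁₂

section schur

variable {X A C : Type*} [Fintype A] [DecidableEq A] {l : Filter X}

theorem tendsto_schurComplement {N : X → Matrix (A ⊕ C) (A ⊕ C) ℂ} {M : Matrix (A ⊕ C) (A ⊕ C) ℂ}
    (hN : Tendsto N l (𝓝 M)) (h11 : M.toBlocks₁₁.det ≠ 0) :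
    Tendsto (fun x => schurComplement (N x)) l (𝓝 (schurComplement M)) := by
  have hent : ∀ i j, Tendsto (fun x => N x i j) l (𝓝 (M i j)) := fun i j =>
    ((continuous_id.matrix_elem i j).tendsto M).comp hN
  have t11 : Tendsto (fun x => (N x).toBlocks₁₁) l (𝓝 M.toBlocks₁₁) :=
    tendsto_pi_nhds.2 fun i => tendsto_pi_nhds.2 fun j => hent _ _
  have t12 : Tendsto (fun x => (N x).toBlocks₁₂) l (𝓝 M.toBlocks₁₂) :=
    tendsto_pi_nhds.2 fun i => tendsto_pi_nhds.2 fun j => hent _ _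
  have t21 : Tendsto (fun x => (N x).toBlocks₂₁) l (𝓝 M.toBlocks₂₁) :=
    tendsto_pi_nhds.2 fun i => tendsto_pi_nhds.2 fun j => hent _ _
  have t22 : Tendsto (fun x => (N x).toBlocks₂₂) l (𝓝 M.toBlocks₂₂) :=
    tendsto_pi_nhds.2 fun i => tendsto_pi_nhds.2 fun j => hent _ _
  exact t22.sub (tendsto_matrix_mul (tendsto_matrix_mul t21 (tendsto_matrix_inv t11 h11)) t12)

variable [Fintype C] [DecidableEq C]

theorem det_eq_det_mul_det_schurComplement {R : Matrix (A ⊕ C) (A ⊕ C) ℂ}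
    (hR : R.toBlocks₁₁.det ≠ 0) : R.det = R.toBlocks₁₁.det * (schurComplement R).det := by
  have := Matrix.invertibleOfIsUnitDet _ (isUnit_iff_ne_zero.2 hR)
  conv_lhs => rw [← Matrix.fromBlocks_toBlocks R]
  rw [Matrix.det_fromBlocks₁₁, Matrix.invOf_eq_nonsing_inv, schurComplement]

/-- Changing only the lower right block shifts the Schur complement by the same amount, so it can be
given any prescribed value D. -/
theorem det_add_schurComplement_sub {N : Matrix (A ⊕ C) (A ⊕ C) ℂ} {D : Matrix C C ℂ}
    (h11 : N.toBlocks₁₁.det ≠ 0) (hD : D.det = 0) :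
    (N + Matrix.fromBlocks 0 0 0 (D - schurComplement N)).det = 0 := by
  set Δ : Matrix (A ⊕ C) (A ⊕ C) ℂ := Matrix.fromBlocks 0 0 0 (D - schurComplement N) with hΔ
  have b11 : (N + Δ).toBlocks₁₁ = N.toBlocks₁₁ := by
    ext i j; simp [Matrix.toBlocks₁₁, hΔ]
  have b12 : (N + Δ).toBlocks₁₂ = N.toBlocks₁₂ := by
    ext i j; simp [Matrix.toBlocks₁₂, hΔ]
  have b21 : (N + Δ).toBlocks₂₁ = N.toBlocks₂₁ := by
    ext i j; simp [Matrix.toBlocks₂₁, hΔ]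
  have b22 : (N + Δ).toBlocks₂₂ = N.toBlocks₂₂ + (D - schurComplement N) := by
    ext i j; simp [Matrix.toBlocks₂₂, hΔ]
  have hS : schurComplement (N + Δ) = D := by
    rw [schurComplement, b11, b12, b21, b22, schurComplement]
    abel
  rw [det_eq_det_mul_det_schurComplement (by rwa [b11]), hS, hD, mul_zero]

/-- If a rescaled matrix converges to a singular limit whose first diagonal block is invertible,
then a perturbation that tends to zero makes the matrix singular. -/
theorem exists_singular_perturbation {J : X → Matrix (A ⊕ C) (A ⊕ C) ℂ} {r : X → A ⊕ C → ℂ}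
    (hr : ∀ᶠ x in l, ∀ i, r x i ≠ 0) (hrC : ∀ x i, r x (Sum.inr i) = 1)
    {M : Matrix (A ⊕ C) (A ⊕ C) ℂ}
    (hM : Tendsto (fun x => Matrix.diagonal (r x) * J x * Matrix.diagonal (r x)) l (𝓝 M))
    (h11 : M.toBlocks₁₁.det ≠ 0) (h0 : M.det = 0) :
    ∃ δ : X → Matrix (A ⊕ C) (A ⊕ C) ℂ, Tendsto δ l (𝓝 0) ∧ ∀ᶠ x in l, (J x + δ x).det = 0 := by
  set N := fun x => Matrix.diagonal (r x) * J x * Matrix.diagonal (r x) with hN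
  have hc11 : Continuous fun R : Matrix (A ⊕ C) (A ⊕ C) ℂ => R.toBlocks₁₁.det :=
    Continuous.matrix_det (continuous_pi fun i => continuous_pi fun j =>
      continuous_id.matrix_elem _ _)
  have d11 := ((hc11.tendsto M).comp hM).eventually_ne h11
  have hSM : (schurComplement M).det = 0 := by
    have := det_eq_det_mul_det_schurComplement h11
    rw [h0] at this
    exact (mul_eq_zero.1 this.symm).resolve_left h11
  refine ⟨fun x => Matrix.fromBlocks 0 0 0 (schurComplement M - schurComplement (N x)), ?_, ?_⟩
  · have t0 : Tendsto (fun x => schurComplement M - schurComplement (N x)) l (𝓝 0) := by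
      have := (tendsto_schurComplement hM h11).const_sub (schurComplement M)
      rwa [sub_self] at this
    have hc : Continuous fun D : Matrix C C ℂ =>
        Matrix.fromBlocks (0 : Matrix A A ℂ) (0 : Matrix A C ℂ) (0 : Matrix C A ℂ) D :=
      Continuous.matrix_fromBlocks continuous_const continuous_const continuous_const continuous_id
    have := (hc.tendsto 0).comp t0
    rwa [Matrix.fromBlocks_zero] at this
  · filter_upwards [hr, d11] with x hx hx11
    have e2 := det_add_schurComplement_sub (N := N x) hx11 hSM
    set Δ : Matrix (A ⊕ C) (A ⊕ C) ℂ :=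
      Matrix.fromBlocks 0 0 0 (schurComplement M - schurComplement (N x)) with hΔ
    -- The rescaling is trivial on the block where the perturbation lives. The perturbation of the
    -- rescaled matrix is therefore one of J itself, of the same size.
    have e1 : Matrix.diagonal (r x) * (J x + Δ) * Matrix.diagonal (r x) = N x + Δ := by
      rw [mul_add, add_mul]
      congr 1
      ext i j
      rw [Matrix.mul_diagonal, Matrix.diagonal_mul]
      rcases i with i | i <;> rcases j with j | j <;> simp [hΔ, hrC]
    rw [← e1, Matrix.det_mul, Matrix.det_mul, Matrix.det_diagonal] at e2
    have h3 : ∏ i, r x i ≠ 0 := Finset.prod_ne_zero_iff.2 fun i _ => hx i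
    exact (mul_eq_zero.1 ((mul_eq_zero.1 e2).resolve_right h3)).resolve_left h3

end schur

/-- The moment form of a complex weight with positive real part is definite on polynomials. -/
theorem eq_zero_of_moment_form_eq_zero {h : ℝ → ℂ} (hh : ∀ k, 0 < (h k).re) (s : Finset ℕ)
    (hi : ∀ i ∈ s, ∀ j ∈ s, Integrable fun k : ℝ => (k : ℂ) ^ (i + j) * h k) (c : ℕ → ℂ)
    (h0 : ∑ i ∈ s, ∑ j ∈ s, c i * (starRingEnd ℂ) (c j) * ∫ k : ℝ, (k : ℂ) ^ (i + j) * h k = 0) :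
    ∀ i ∈ s, c i = 0 := by
  classical
  set p : Polynomial ℂ := ∑ i ∈ s, Polynomial.C (c i) * Polynomial.X ^ i with hp
  have heval : ∀ k : ℝ, p.eval (k : ℂ) = ∑ i ∈ s, c i * (k : ℂ) ^ i := by
    intro k
    rw [hp, Polynomial.eval_finsetSum]
    simp
  have hexp : ∀ k : ℝ, ((Complex.normSq (p.eval (k : ℂ)) : ℝ) : ℂ) * h k =
      ∑ i ∈ s, ∑ j ∈ s, c i * (starRingEnd ℂ) (c j) * ((k : ℂ) ^ (i + j) * h k) := by
    intro k
    rw [← Complex.mul_conj, heval, map_sum, Finset.sum_mul_sum, Finset.sum_mul]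
    refine Finset.sum_congr rfl fun i _ => ?_
    rw [Finset.sum_mul]
    refine Finset.sum_congr rfl fun j _ => ?_
    rw [map_mul, map_pow, Complex.conj_ofReal, pow_add]; ring
  have hint : Integrable fun k : ℝ => ((Complex.normSq (p.eval (k : ℂ)) : ℝ) : ℂ) * h k := by
    simp only [hexp]
    exact integrable_finsetSum _ fun i hi' => integrable_finsetSum _ fun j hj =>
      (hi i hi' j hj).const_mul _
  have hzero : ∫ k : ℝ, ((Complex.normSq (p.eval (k : ℂ)) : ℝ) : ℂ) * h k = 0 := by
    simp only [hexp]
    rw [integral_finsetSum _ fun i hi' => integrable_finsetSum _ fun j hj =>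
      (hi i hi' j hj).const_mul _, ← h0]
    refine Finset.sum_congr rfl fun i hi' => ?_
    rw [integral_finsetSum _ fun j hj => (hi i hi' j hj).const_mul _]
    exact Finset.sum_congr rfl fun j _ => integral_const_mul _ _
  have hre : ∫ k : ℝ, Complex.normSq (p.eval (k : ℂ)) * (h k).re = 0 := by
    have h1 := integral_re hint
    have h2 : ∫ k : ℝ, Complex.normSq (p.eval (k : ℂ)) * (h k).re =
        ∫ k : ℝ, RCLike.re (((Complex.normSq (p.eval (k : ℂ)) : ℝ) : ℂ) * h k) := by
      congr 1; ext k; simp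
    rw [h2, h1, hzero]; simp
  have hint2 : Integrable fun k : ℝ => Complex.normSq (p.eval (k : ℂ)) * (h k).re := by
    refine hint.re.congr (Eventually.of_forall fun k => ?_)
    simp
  -- The form is ∫ |p|² h with p = ∑ c_i k^i. Its real part is the integral of a nonnegative
  -- function, so p vanishes almost everywhere on the line and hence identically.
  have hae := (integral_eq_zero_iff_of_nonneg (fun k =>
    mul_nonneg (Complex.normSq_nonneg _) (hh k).le) hint2).1 hre
  have hp0 : p = 0 := by
    by_contra hne
    have hfin : {k : ℝ | p.eval (k : ℂ) = 0}.Finite := by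
      refine Set.Finite.of_finite_image (f := fun k : ℝ => (k : ℂ)) ?_
        Complex.ofReal_injective.injOn
      refine (p.roots.toFinset.finite_toSet).subset ?_
      rintro _ ⟨k, hk, rfl⟩
      simpa [hne] using hk
    have h1 : ∀ᵐ k : ℝ, k ∈ {k : ℝ | p.eval (k : ℂ) = 0} := by
      filter_upwards [hae] with k hk
      have := (mul_eq_zero.1 hk).resolve_right (hh k).ne'
      exact Complex.normSq_eq_zero.1 this
    have h2 : ∀ᵐ k : ℝ, k ∉ {k : ℝ | p.eval (k : ℂ) = 0} :=
      measure_eq_zero_iff_ae_notMem.1 (hfin.measure_zero volume)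
    obtain ⟨k, hk1, hk2⟩ := (h1.and h2).exists
    exact hk2 hk1
  intro i hi'
  have := congrArg (fun q => Polynomial.coeff q i) hp0
  simpa [hp, Polynomial.finsetSum_coeff, Polynomial.coeff_C_mul, Polynomial.coeff_X_pow, hi'] using this

/-! ### The threshold -/

/-- The matrix of transforms of the products `y_i (y_j)^*`. -/
noncomputable def transformMatrix {ι : Type*} (σ θ m : ℝ) (y : ℝ → ι → ℂ) (w : ℂ) : Matrix ι ι ℂ :=
  Matrix.of fun i j => dispersionTransform σ θ m (fun k => y k i * (starRingEnd ℂ) (y k j)) w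

/-- What distinguishes the two dispersion relations at the threshold; `e` is the order from which
on the couplings need no rescaling. -/
structure ThresholdCase (σ θ L m : ℝ) (e : ℕ) : Prop where
  one_lt : 1 < m
  angle_nonneg : 0 ≤ θ
  width_pos : 0 < L
  width_add_le : L + θ ≤ 2 * Real.pi
  le_order : m ≤ 2 * (e : ℝ) + 1
  order_le : ∀ n < e, 2 * (n : ℝ) + 1 ≤ m
  border_below : ∀ n < e, 2 * (n : ℝ) + 1 = m → σ = 1 ∧ θ = 0
  border_at : 2 * (e : ℝ) + 1 = m → σ = -1 ∧ θ = Real.pi ∧ L = Real.pi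
  definite : ∃ w₀ ∈ openStrip L, ∃ (μ : ℂ) (h : ℝ → ℂ), (∀ k, 0 < (μ * h k).re) ∧
    ∀ d : ℕ, (d : ℝ) + 1 < m → Integrable (fun k : ℝ => (k : ℂ) ^ d * h k) ∧
      dispersionTransform σ θ m (fun k => (k : ℂ) ^ d) w₀ = ∫ k : ℝ, (k : ℂ) ^ d * h k

/-- The modulus factor of the rescaling of a component of order `n`. -/
noncomputable def thresholdModulus (m : ℝ) (n : ℕ) (w : ℂ) : ℝ :=
  if 2 * (n : ℝ) + 1 = m then (Real.sqrt (-w.re))⁻¹ else 1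

/-- The rescaling of a component of order `n`. -/
noncomputable def thresholdRatio (m : ℝ) (n : ℕ) (w : ℂ) : ℂ :=
  thresholdModulus m n w * Complex.exp (((1 - (2 * (n : ℝ) + 1) / m) / 2 : ℝ) * w)

/-- The limits of the rescaled entries, up to the leading coefficients. -/
noncomputable def thresholdLimit (σ θ m : ℝ) (i j : ℕ) : ℂ :=
  if 2 * (i : ℝ) + 1 = m ∨ 2 * (j : ℝ) + 1 = m then (if i = j then -(2 * (m : ℂ)⁻¹) else 0)
  else leadConst σ θ m (i + j)

theorem tendsto_inv_sqrt_leftEnd (L : ℝ) :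
    Tendsto (fun w : ℂ => (((Real.sqrt (-w.re))⁻¹ : ℝ) : ℂ)) (leftEnd L) (𝓝 0) := by
  have h1 : Tendsto (fun x : ℝ => (Real.sqrt (-x))⁻¹) atBot (𝓝 0) :=
    tendsto_inv_atTop_zero.comp (Real.tendsto_sqrt_atTop.comp tendsto_neg_atBot_atTop)
  have := (Complex.continuous_ofReal.tendsto 0).comp (h1.comp (tendsto_re_leftEnd (L := L)))
  rwa [Complex.ofReal_zero] at this

section threshold

variable {σ θ L m : ℝ} {e : ℕ}

/-- A borderline order gives a diagonal row with nonzero entry. On the other orders the entries are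
moments up to nonzero row and column factors, and positivity of the weight rules out a kernel
vector. -/
theorem thresholdLimit_det_ne_zero (H : ThresholdCase σ θ L m e) {s : Finset ℕ} (hs : ∀ n ∈ s, n < e)
    {a : ℕ → ℂ} (ha : ∀ n ∈ s, a n ≠ 0) :
    (Matrix.of fun i j : s => a i * (starRingEnd ℂ) (a j) * thresholdLimit σ θ m i j).det ≠ 0 := by
  classical
  have hm0 : 0 < m := by linarith [H.one_lt]
  intro hdet
  obtain ⟨x, hx0, hx⟩ := Matrix.exists_mulVec_eq_zero_iff.2 hdet
  apply hx0
  have hrow : ∀ i : s, ∑ j : s, a i * (starRingEnd ℂ) (a j) * thresholdLimit σ θ m i j * x j = 0 :=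
    fun i => congrFun hx i
  have hborder : ∀ i : s, 2 * ((i : ℕ) : ℝ) + 1 = m → x i = 0 := by
    intro i hi
    have h1 := hrow i
    rw [Finset.sum_eq_single i (fun j _ hj => by
      have : (i : ℕ) ≠ j := fun h => hj (Subtype.ext h.symm)
      simp [thresholdLimit, hi, this]) (by simp)] at h1
    have h2 : thresholdLimit σ θ m i i ≠ 0 := by
      simp [thresholdLimit, hi, hm0.ne']
    have h3 : (starRingEnd ℂ) (a i) ≠ 0 := by simpa using ha i i.2
    simpa [h2, h3, ha i i.2] using h1
  obtain ⟨w₀, hw₀, μ, h, hh, hI⟩ := H.definite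
  -- The power e^{(1 - (i+j+1)/m) w₀} factors over i and j and can be absorbed into the unknown
  -- vector.
  set Ω : ℕ → ℂ := fun n => Complex.exp (((1 - (2 * (n : ℝ) + 1) / m) / 2 : ℝ) * w₀) with hΩ
  have hlead : ∀ i j : ℕ, (((i + j : ℕ) : ℝ) + 1 < m) →
      leadConst σ θ m (i + j) = Ω i * Ω j * ∫ k : ℝ, (k : ℂ) ^ (i + j) * h k := by
    intro i j hij
    rw [← exp_mul_dispersionTransform_pow hm0 hij H.angle_nonneg H.width_add_le hw₀, (hI _ hij).2]
    simp only [hΩ]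
    rw [← Complex.exp_add]
    congr 2; push_cast; field_simp; ring
  set X : ℕ → ℂ := fun n => if hn : n ∈ s then x ⟨n, hn⟩ else 0 with hX
  have hXx : ∀ i : s, X i = x i := fun i => by simp [hX]
  set t : ℕ → ℂ := fun n => (starRingEnd ℂ) (a n) * X n * Ω n with ht
  set s' := s.filter fun n : ℕ => 2 * (n : ℝ) + 1 < m with hs'
  have hlt : ∀ i ∈ s', ∀ j ∈ s', ((i + j : ℕ) : ℝ) + 1 < m := by
    intro i hi j hj
    have h1 := (Finset.mem_filter.1 hi).2
    have h2 := (Finset.mem_filter.1 hj).2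
    push_cast; linarith
  have hrow' : ∀ i ∈ s', ∑ j ∈ s', t j * ∫ k : ℝ, (k : ℂ) ^ (i + j) * h k = 0 := by
    intro i hi
    have hi' := Finset.mem_filter.1 hi
    have h1 := hrow ⟨i, hi'.1⟩
    have h2 : ∑ j : s, a i * (starRingEnd ℂ) (a j) * thresholdLimit σ θ m i j * X j = 0 := by
      rw [← h1]
      exact Finset.sum_congr rfl fun j _ => by rw [hXx]
    rw [Finset.sum_coe_sort s fun j : ℕ =>
      a i * (starRingEnd ℂ) (a j) * thresholdLimit σ θ m i j * X j] at h2
    have h3 : ∑ j ∈ s', a i * (starRingEnd ℂ) (a j) * thresholdLimit σ θ m i j * X j = 0 := by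
      rw [← h2]
      refine Finset.sum_subset (Finset.filter_subset _ _) fun j hj hj' => ?_
      have h4 : 2 * (j : ℝ) + 1 = m := by
        refine le_antisymm (H.order_le j (hs j hj)) (not_lt.1 fun h5 => hj' ?_)
        exact Finset.mem_filter.2 ⟨hj, h5⟩
      have h5 : X j = 0 := by rw [hXx ⟨j, hj⟩]; exact hborder ⟨j, hj⟩ h4
      rw [h5, mul_zero]
    have h4 : a i * Ω i * ∑ j ∈ s', t j * ∫ k : ℝ, (k : ℂ) ^ (i + j) * h k = 0 := by
      rw [← h3, Finset.mul_sum]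
      refine Finset.sum_congr rfl fun j hj => ?_
      have h5 : thresholdLimit σ θ m i j = leadConst σ θ m (i + j) := by
        have h6 := (Finset.mem_filter.1 hj).2
        simp [thresholdLimit, hi'.2.ne, h6.ne]
      rw [h5, hlead i j (hlt i hi j hj), ht]
      ring
    exact (mul_eq_zero.1 h4).resolve_left (mul_ne_zero (ha i hi'.1) (Complex.exp_ne_zero _))
  -- The moment matrix is symmetric in i and j but the form is sesquilinear, hence the conjugate of
  -- t as coefficient vector.
  have hzero := eq_zero_of_moment_form_eq_zero (h := fun k => μ * h k) hh s'
    (fun i hi j hj => by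
      refine ((hI _ (hlt i hi j hj)).1.const_mul μ).congr (Eventually.of_forall fun k => ?_)
      simp only; ring) (fun n => (starRingEnd ℂ) (t n)) (by
      refine Finset.sum_eq_zero fun i hi => ?_
      have : ∑ j ∈ s', (starRingEnd ℂ) (t i) * (starRingEnd ℂ) ((starRingEnd ℂ) (t j)) *
          ∫ k : ℝ, (k : ℂ) ^ (i + j) * (μ * h k) =
          (starRingEnd ℂ) (t i) * μ * ∑ j ∈ s', t j * ∫ k : ℝ, (k : ℂ) ^ (i + j) * h k := by
        rw [Finset.mul_sum]
        refine Finset.sum_congr rfl fun j _ => ?_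
        rw [Complex.conj_conj]
        have : ∫ k : ℝ, (k : ℂ) ^ (i + j) * (μ * h k) = μ * ∫ k : ℝ, (k : ℂ) ^ (i + j) * h k := by
          rw [← integral_const_mul]; congr 1; ext k; ring
        rw [this]; ring
      rw [this, hrow' i hi, mul_zero])
  funext i
  rcases (H.order_le i (hs i i.2)).eq_or_lt with hi | hi
  · exact hborder i hi
  · have h1 : t i = 0 := by
      simpa using hzero i (Finset.mem_filter.2 ⟨i.2, hi⟩)
    have h3 : (starRingEnd ℂ) (a i) ≠ 0 := by simpa using ha i i.2
    rw [← hXx]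
    have h2 := (mul_eq_zero.1 h1).resolve_right (Complex.exp_ne_zero _)
    exact (mul_eq_zero.1 h2).resolve_left h3

variable {P Q α : ℝ} {f : ℝ → ℂ} {c : ℂ}

theorem tendsto_thresholdRatio (H : ThresholdCase σ θ L m e) {n : ℕ} (hn : n < e) :
    Tendsto (thresholdRatio m n) (leftEnd L) (𝓝 0) := by
  have hm0 : 0 < m := by linarith [H.one_lt]
  rcases (H.order_le n hn).eq_or_lt with h | h
  · refine (tendsto_inv_sqrt_leftEnd L).congr fun w => ?_
    simp [thresholdRatio, thresholdModulus, h, hm0.ne']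
  · have hr : 0 < (1 - (2 * (n : ℝ) + 1) / m) / 2 := by
      have : (2 * (n : ℝ) + 1) / m < 1 := by rwa [div_lt_one hm0]
      linarith
    refine (tendsto_exp_leftEnd (L := L) hr).congr fun w => ?_
    simp [thresholdRatio, thresholdModulus, h.ne]

variable (hP : P < m - 1) (hQ : 0 ≤ Q) (hα : 0 < α) (hα1 : α ≤ 1)
include hP hQ hα hα1

/-- The two half exponents add up to 1 - (i + j + 1)/m, the exact divergence of a product of order i
+ j. On the borderline diagonal the two square roots combine to 1/(-Re w), which balances the
logarithm. -/
theorem tendsto_rescaled_entry (H : ThresholdCase σ θ L m e) {i j : ℕ} (hi : i < e) (hj : j < e)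
    (hf : IsSymbol P Q α f) (hd : HasLead (i + j) f c) :
    Tendsto (fun w => thresholdRatio m i w * thresholdRatio m j w * dispersionTransform σ θ m f w)
      (leftEnd L) (𝓝 (c * thresholdLimit σ θ m i j)) := by
  have hm := H.one_lt
  have hm0 : 0 < m := by linarith
  have hratio : ∀ w, thresholdRatio m i w * thresholdRatio m j w =
      (thresholdModulus m i w * thresholdModulus m j w : ℝ) *
        Complex.exp ((1 - (((i + j : ℕ) : ℝ) + 1) / m : ℝ) * w) := by
    intro w
    rw [thresholdRatio, thresholdRatio, mul_mul_mul_comm, ← Complex.exp_add]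
    push_cast
    congr 2; field_simp; ring
  by_cases hb : 2 * (i : ℝ) + 1 = m ∨ 2 * (j : ℝ) + 1 = m
  · by_cases hij : i = j
    · subst hij
      have hb' : 2 * (i : ℝ) + 1 = m := by simpa using hb
      obtain ⟨rfl, rfl⟩ := H.border_below i hi hb'
      have h1 := tendsto_dispersionTransform_sym_div_re hm hP hQ hα hα1 hf hd
        (by push_cast; linarith) (Even.add_self i) L
      rw [thresholdLimit, if_pos hb, if_pos rfl]
      refine h1.congr' ?_
      filter_upwards [eventually_leftEnd_re (eventually_lt_atBot 0)] with w hw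
      rw [hratio]
      have e1 : thresholdModulus m i w * thresholdModulus m i w = (-w.re)⁻¹ := by
        rw [thresholdModulus, if_pos hb', ← mul_inv, Real.mul_self_sqrt (by linarith)]
      have e2 : (((i + i : ℕ) : ℝ) + 1) / m = 1 := by
        rw [div_eq_one_iff_eq hm0.ne']; push_cast; linarith
      rw [e1, e2]; simp
    -- A borderline order paired with a different one: the entry has a power law without logarithm,
    -- so the surplus factor (-Re w)^{-1/2} sends it to 0.
    · have hlt : ((i + j : ℕ) : ℝ) + 1 < m := by
        have h1 := H.order_le i hi
        have h2 := H.order_le j hj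
        have h3 : (i : ℝ) ≠ j := by exact_mod_cast hij
        push_cast
        rcases lt_or_gt_of_ne h3 with h | h <;> linarith
      have h1 := tendsto_exp_mul_dispersionTransform (σ := σ) hm hP hQ hα hα1 hf hd hlt
        H.angle_nonneg H.width_add_le
      have hmod : Tendsto (fun w => ((thresholdModulus m i w * thresholdModulus m j w : ℝ) : ℂ))
          (leftEnd L) (𝓝 0) := by
        refine (tendsto_inv_sqrt_leftEnd L).congr fun w => ?_
        rcases hb with hb | hb
        · have : 2 * (j : ℝ) + 1 ≠ m := fun h => hij (by
            have : (i : ℝ) = j := by linarith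
            exact_mod_cast this)
          simp [thresholdModulus, hb, this]
        · have : 2 * (i : ℝ) + 1 ≠ m := fun h => hij (by
            have : (i : ℝ) = j := by linarith
            exact_mod_cast this)
          simp [thresholdModulus, hb, this]
      rw [thresholdLimit, if_pos hb, if_neg hij, mul_zero]
      have h2 := hmod.mul h1
      rw [zero_mul] at h2
      refine h2.congr fun w => ?_
      rw [hratio, mul_assoc]
  · rw [thresholdLimit, if_neg hb]
    rw [not_or] at hb
    have hlt : ((i + j : ℕ) : ℝ) + 1 < m := by
      have h1 := (H.order_le i hi).lt_of_ne hb.1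
      have h2 := (H.order_le j hj).lt_of_ne hb.2
      push_cast; linarith
    have h1 := tendsto_exp_mul_dispersionTransform (σ := σ) hm hP hQ hα hα1 hf hd hlt
      H.angle_nonneg H.width_add_le
    refine h1.congr fun w => ?_
    rw [hratio]
    simp [thresholdModulus, hb.1, hb.2]

/-- The half exponent of n exceeds the divergence of the entry by (2e + 1 - m)/(2m) ≥ 0. If n is
borderline, then n + e + 1 > m and the entry converges by itself. -/
theorem exists_tendsto_rescaled_mixed (H : ThresholdCase σ θ L m e) {n : ℕ} (hn : n < e)
    (hf : IsSymbol P Q α f) (hd : HasLead (n + e) f c) :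
    ∃ ℓ, Tendsto (fun w => thresholdRatio m n w * dispersionTransform σ θ m f w) (leftEnd L)
      (𝓝 ℓ) := by
  have hm := H.one_lt
  have hm0 : 0 < m := by linarith
  have hne : (n : ℝ) + 1 ≤ e := by exact_mod_cast hn
  rcases (H.order_le n hn).eq_or_lt with hb | hb
  · obtain ⟨ℓ, h1⟩ := exists_tendsto_dispersionTransform (σ := σ) hm hP hQ hα hα1 hf hd
      (by push_cast; linarith) H.angle_nonneg H.width_add_le
    exact ⟨_, (tendsto_thresholdRatio H hn).mul h1⟩
  · have hratio : ∀ w, thresholdRatio m n w =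
        Complex.exp (((1 - (2 * (n : ℝ) + 1) / m) / 2 : ℝ) * w) := by
      intro w; simp [thresholdRatio, thresholdModulus, hb.ne]
    simp only [hratio]
    rcases H.le_order.eq_or_lt with he | he
    · have h1 := tendsto_exp_mul_dispersionTransform (σ := σ) hm hP hQ hα hα1 hf hd
        (by push_cast; linarith) H.angle_nonneg H.width_add_le
      refine ⟨_, h1.congr fun w => ?_⟩
      have : 1 - (((n + e : ℕ) : ℝ) + 1) / m = (1 - (2 * (n : ℝ) + 1) / m) / 2 := by
        push_cast; field_simp; linarith
      rw [this]
    · refine ⟨0, tendsto_exp_mul_dispersionTransform_zero hm hP hQ hα hα1 hf hd ?_ ?_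
        H.angle_nonneg H.width_add_le⟩
      · have : (2 * (n : ℝ) + 1) / m < 1 := by rwa [div_lt_one hm0]
        linarith
      · push_cast
        rw [← sub_pos]
        have : (1 - (2 * (n : ℝ) + 1) / m) / 2 - (1 - ((n : ℝ) + e + 1) / m) =
            (2 * (e : ℝ) + 1 - m) / (2 * m) := by field_simp; ring
        rw [this]
        exact div_pos (by linarith) (by linarith)

/-- Since 2e + 1 ≥ m the entry converges. Equality is only allowed for antisymmetric dispersion,
where the two half-lines cancel each other's logarithm. -/
theorem exists_tendsto_regular_entry (H : ThresholdCase σ θ L m e)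
    (hf : IsSymbol P Q α f) (hd : HasLead (e + e) f c) :
    ∃ ℓ, Tendsto (dispersionTransform σ θ m f) (leftEnd L) (𝓝 ℓ) := by
  rcases H.le_order.eq_or_lt with he | he
  · obtain ⟨rfl, rfl, rfl⟩ := H.border_at he.symm
    exact exists_tendsto_dispersionTransform_anti H.one_lt hP hQ hα hα1 hf hd
      (by push_cast; linarith) (Even.add_self e)
  · exact exists_tendsto_dispersionTransform H.one_lt hP hQ hα hα1 hf hd
      (by push_cast; linarith) H.angle_nonneg H.width_add_le

end threshold

/-- The matrix `J` in the variable `w = log ω`, with constant part `R` and energy term `τ ω`. -/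
noncomputable def scatterMatrix {N : ℕ} (σ θ m : ℝ) (v : ℝ → EuclideanSpace ℂ (Fin N))
    (R : Matrix (Fin N) (Fin N) ℂ) (τ w : ℂ) : Matrix (Fin N) (Fin N) ℂ :=
  transformMatrix σ θ m (fun k i => v k i) w + R - (τ * Complex.exp w) • 1

theorem phaseLike_of_tendsto {G : ℂ → ℂ} {a : ℝ} {l : Filter ℂ} {p : ℂ → ℝ} {κ : ℂ} (hκ : κ ≠ 0)
    (hp : ∀ᶠ w in l, 0 < p w)
    (h : Tendsto (fun w : ℂ => (p w : ℂ) * Complex.exp (-(a * w.im) * Complex.I) * G w) l (𝓝 κ)) :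
    PhaseLike G a l := by
  refine ⟨κ / ‖κ‖, div_ne_zero hκ (by exact_mod_cast norm_ne_zero_iff.2 hκ), ?_⟩
  have h1 := h.div ((Complex.continuous_ofReal.tendsto _).comp h.norm)
    (by exact_mod_cast norm_ne_zero_iff.2 hκ)
  refine h1.congr' ?_
  filter_upwards [hp] with w hw
  have e1 : ‖Complex.exp (-(a * w.im) * Complex.I)‖ = 1 := by
    rw [Complex.norm_exp]; simp
  have e2 : (p w : ℂ) ≠ 0 := by exact_mod_cast hw.ne'
  simp only [Pi.div_apply, Function.comp_apply, norm_mul, e1, mul_one, Complex.norm_real,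
    Real.norm_of_nonneg hw.le, Complex.ofReal_mul]
  rw [mul_assoc, mul_div_mul_left _ _ e2]
  ring

/-- The data shared by the two dispersion relations: all products of components of the coupling are
symbols. -/
structure CouplingSymbols {N : ℕ} (m P Q α : ℝ) (v : ℝ → EuclideanSpace ℂ (Fin N)) : Prop where
  analytic : AnalyticAt ℝ v 0
  lt : P < m - 1
  nonneg : 0 ≤ Q
  pos : 0 < α
  le_one : α ≤ 1
  symbol : ∀ {f g : ℝ → ℂ},
    (∃ T : EuclideanSpace ℂ (Fin N) →L[ℝ] ℂ, f = fun k => T (v k)) →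
    (∃ T : EuclideanSpace ℂ (Fin N) →L[ℝ] ℂ, g = fun k => T (v k)) →
    IsSymbol P Q α fun k => f k * (starRingEnd ℂ) (g k)

theorem exists_couplingSymbols {N : ℕ} {m : ℝ} {v : ℝ → EuclideanSpace ℂ (Fin N)}
    (hv : AdmissibleCoupling m v) : ∃ P Q α, CouplingSymbols m P Q α v := by
  obtain ⟨p, Q, α, hp, hQ, hα, hα1, H⟩ := exists_isSymbol_of_admissible hv
  refine ⟨2 * p, Q + |p|, α, hv.1, hp, by positivity, hα, hα1, ?_⟩
  rintro f g ⟨T, rfl⟩ ⟨T', rfl⟩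
  exact (H T).mul_conj (H T')

section coupling

variable {N : ℕ} {σ θ L m P Q α : ℝ} {v : ℝ → EuclideanSpace ℂ (Fin N)}

/-- Linear forms on `ℂ ^ N` as real-linear maps. -/
theorem exists_clm_sum {ι : Type*} [Fintype ι] (φ : ι → Fin N) (b : ι → ℂ) :
    ∃ T : EuclideanSpace ℂ (Fin N) →L[ℝ] ℂ, ∀ x, T x = ∑ j, b j * x (φ j) := by
  refine ⟨(∑ j, b j • (EuclideanSpace.proj (φ j) :
    EuclideanSpace ℂ (Fin N) →L[ℂ] ℂ)).restrictScalars ℝ, fun x => ?_⟩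
  simp

theorem exists_clm_apply (i : Fin N) :
    ∃ T : EuclideanSpace ℂ (Fin N) →L[ℝ] ℂ, ∀ x, T x = x i :=
  ⟨(EuclideanSpace.proj i : EuclideanSpace ℂ (Fin N) →L[ℂ] ℂ).restrictScalars ℝ, fun _ => rfl⟩

theorem CouplingSymbols.entry (hv : CouplingSymbols m P Q α v) (i j : Fin N) :
    IsSymbol P Q α (fun k => v k i * (starRingEnd ℂ) (v k j)) ∧
      AnalyticAt ℝ (fun k => v k i * (starRingEnd ℂ) (v k j)) 0 := by
  obtain ⟨T, hT⟩ := exists_clm_apply i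
  obtain ⟨T', hT'⟩ := exists_clm_apply j
  refine ⟨hv.symbol ⟨T, by simp only [hT]⟩ ⟨T', by simp only [hT']⟩, ?_⟩
  have h1 : AnalyticAt ℝ (fun k => T (v k)) 0 := (T.analyticAt _).comp hv.analytic
  have h2 : AnalyticAt ℝ (fun k => T' (v k)) 0 := (T'.analyticAt _).comp hv.analytic
  simp only [hT, hT'] at h1 h2
  exact h1.mul (analyticAt_conj_comp h2)

theorem CouplingSymbols.exists_tame (hm : 1 < m) (hv : CouplingSymbols m P Q α v) :
    ∃ α' β γ, TameExponents α' β γ ∧ ∀ i j,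
      (∃ C, Tame α' β γ C (logDensity m fun k => v k i * (starRingEnd ℂ) (v k j))) ∧
      ∃ C, Tame α' β γ C (logDensity m fun k => v (-k) i * (starRingEnd ℂ) (v (-k) j)) := by
  obtain ⟨α', β, γ, hE, H⟩ := exists_tame_logDensity_of_analyticAt hm hv.lt hv.nonneg hv.pos hv.le_one
  refine ⟨α', β, γ, hE, fun i j => ?_⟩
  obtain ⟨h1, h2⟩ := hv.entry i j
  exact ⟨H _ h1 h2, H _ h1.comp_neg (analyticAt_comp_neg h2)⟩

/-- The transform is linear in the product y_i (y_j)^*, so a change of coordinates acts by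
congruence B · B†. -/
theorem transformMatrix_congr {ι : Type*} [Fintype ι] (hm : 1 < m) (hv : CouplingSymbols m P Q α v)
    (φ : ι → Fin N) (B : Matrix ι ι ℂ) (w : ℂ) :
    transformMatrix σ θ m (fun k i => ∑ j, B i j * v k (φ j)) w =
      B * (transformMatrix σ θ m (fun k i => v k i) w).submatrix φ φ * B.conjTranspose := by
  obtain ⟨α', β, γ, hE, H⟩ := hv.exists_tame hm
  choose C hC using fun i j => (H i j).1
  choose C' hC' using fun i j => (H i j).2
  ext i j
  have hexp : (fun k => (∑ a, B i a * v k (φ a)) * (starRingEnd ℂ) (∑ b, B j b * v k (φ b))) =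
      fun k => ∑ x : ι × ι, (B i x.1 * (starRingEnd ℂ) (B j x.2)) *
        (v k (φ x.1) * (starRingEnd ℂ) (v k (φ x.2))) := by
    funext k
    rw [map_sum, Finset.sum_mul_sum, Fintype.sum_prod_type]
    refine Finset.sum_congr rfl fun a _ => Finset.sum_congr rfl fun b _ => ?_
    rw [map_mul]; ring
  rw [transformMatrix, Matrix.of_apply, hexp,
    dispersionTransform_sum Finset.univ (fun x : ι × ι => B i x.1 * (starRingEnd ℂ) (B j x.2))
      (fun x k => v k (φ x.1) * (starRingEnd ℂ) (v k (φ x.2))) hE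
      (fun x _ => hC (φ x.1) (φ x.2)) (fun x _ => hC' (φ x.1) (φ x.2)),
    Fintype.sum_prod_type, Finset.sum_comm, Matrix.mul_apply]
  refine Finset.sum_congr rfl fun b _ => ?_
  rw [Matrix.mul_apply, Finset.sum_mul]
  refine Finset.sum_congr rfl fun a _ => ?_
  simp only [Matrix.submatrix_apply, transformMatrix, Matrix.of_apply, Matrix.conjTranspose_apply,
    Complex.star_def]
  ring

/-- The rescaled matrix in adapted coordinates converges to a matrix M. Its block over the jump set
is invertible, and noncriticality makes M itself invertible. The phase of det J is then that of det
M divided by the phase of the rescaling, which is an explicit power of ω. -/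
theorem phaseLike_leftEnd_det {e : ℕ} (H : ThresholdCase σ θ L m e)
    (hv : CouplingSymbols m P Q α v) (R : Matrix (Fin N) (Fin N) ℂ) (τ : ℂ)
    (hnc : ∀ δ : ℂ → Matrix (Fin N) (Fin N) ℂ, Tendsto δ (leftEnd L) (𝓝 0) →
      ¬ ∀ᶠ w in leftEnd L, (scatterMatrix σ θ m v R τ w + δ w).det = 0) :
    PhaseLike (fun w => (scatterMatrix σ θ m v R τ w).det)
      (-∑ n ∈ jumpSet (fun n => iteratedDeriv n v 0) e, (1 - (2 * (n : ℝ) + 1) / m))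
      (leftEnd L) := by
  classical
  have := leftEnd_neBot H.width_pos.le
  have hm := H.one_lt
  obtain ⟨s, hs⟩ : ∃ s, s = jumpSet (fun n => iteratedDeriv n v 0) e := ⟨_, rfl⟩
  obtain ⟨C, _, _, φ, B, hB, hA, hCe⟩ := exists_adapted_coordinates hv.analytic e hs
  have hse : ∀ n ∈ s, n < e := fun n hn => ((mem_jumpSet _).1 (hs ▸ hn)).1
  rw [← hs]
  choose a₀ ha₀ hlead using hA
  choose b₀ hleadC using hCe
  set a : ℕ → ℂ := fun n => if hn : n ∈ s then a₀ ⟨n, hn⟩ else 0 with ha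
  have haa : ∀ n : s, a n = a₀ n := fun n => by simp [ha]
  have ha0 : ∀ n ∈ s, a n ≠ 0 := fun n hn => by rw [haa ⟨n, hn⟩]; exact ha₀ _
  set y : ℝ → s ⊕ C → ℂ := fun k i => ∑ j, B i j * v k (φ j) with hy
  have hsym : ∀ i j, IsSymbol P Q α fun k => y k i * (starRingEnd ℂ) (y k j) := by
    intro i j
    obtain ⟨T, hT⟩ := exists_clm_sum φ (B i)
    obtain ⟨T', hT'⟩ := exists_clm_sum φ (B j)
    exact hv.symbol (f := fun k => y k i) (g := fun k => y k j) ⟨T, by simp only [hT, hy]⟩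
      ⟨T', by simp only [hT', hy]⟩
  set r : ℂ → s ⊕ C → ℂ := fun w i => Sum.elim (fun n : s => thresholdRatio m n w) (fun _ => 1) i
    with hr
  set Jφ : ℂ → Matrix (s ⊕ C) (s ⊕ C) ℂ :=
    fun w => (scatterMatrix σ θ m v R τ w).submatrix φ φ with hJφ
  set R' := B * R.submatrix φ φ * B.conjTranspose with hR'
  set J' : ℂ → Matrix (s ⊕ C) (s ⊕ C) ℂ := fun w => B * Jφ w * B.conjTranspose with hJ'
  have hJ'eq : ∀ w, J' w = transformMatrix σ θ m y w + R' -
      (τ * Complex.exp w) • (B * B.conjTranspose) := by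
    intro w
    have h1 := transformMatrix_congr (σ := σ) (θ := θ) hm hv φ B w
    have h2 : Jφ w = (transformMatrix σ θ m (fun k i => v k i) w).submatrix φ φ +
        R.submatrix φ φ - (τ * Complex.exp w) • 1 := by
      ext i j
      simp [hJφ, scatterMatrix, Matrix.one_apply]
    simp only [hJ', h2, hy, h1, hR', mul_add, add_mul, mul_sub, sub_mul, Matrix.mul_smul,
      Matrix.smul_mul, mul_one]
  -- limits of the entries
  have hexp0 : Tendsto (fun w : ℂ => Complex.exp w) (leftEnd L) (𝓝 0) := by
    simpa using tendsto_exp_leftEnd (L := L) one_pos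
  -- The rescaling tends to 0 on the jump set and is 1 on the rest, so the constant and energy terms
  -- do not affect the block over the jump set.
  have hrlim : ∀ i, ∃ ℓ, Tendsto (fun w => r w i) (leftEnd L) (𝓝 ℓ) := by
    rintro (n | i)
    · exact ⟨0, tendsto_thresholdRatio H (hse n n.2)⟩
    · exact ⟨1, tendsto_const_nhds⟩
  have hrA : ∀ n : s, Tendsto (fun w => r w (Sum.inl n)) (leftEnd L) (𝓝 0) := fun n =>
    tendsto_thresholdRatio H (hse n n.2)
  have hconst : ∀ i j, Tendsto (fun w => R' i j - τ * Complex.exp w * (B * B.conjTranspose) i j)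
      (leftEnd L) (𝓝 (R' i j)) := by
    intro i j
    have := ((hexp0.const_mul τ).mul_const ((B * B.conjTranspose) i j)).const_sub (R' i j)
    simpa using this
  have hentry : ∀ w i j, (Matrix.diagonal (r w) * J' w * Matrix.diagonal (r w)) i j =
      r w i * r w j * transformMatrix σ θ m y w i j +
      r w i * r w j * (R' i j - τ * Complex.exp w * (B * B.conjTranspose) i j) := by
    intro w i j
    rw [Matrix.mul_diagonal, Matrix.diagonal_mul, hJ'eq]
    simp only [Matrix.sub_apply, Matrix.add_apply, Matrix.smul_apply, smul_eq_mul]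
    ring
  have hAA : ∀ n n' : s, Tendsto (fun w => r w (Sum.inl n) * r w (Sum.inl n') *
      transformMatrix σ θ m y w (Sum.inl n) (Sum.inl n')) (leftEnd L)
      (𝓝 (a n * (starRingEnd ℂ) (a n') * thresholdLimit σ θ m n n')) := by
    intro n n'
    have := tendsto_rescaled_entry hv.lt hv.nonneg hv.pos hv.le_one H (hse n n.2) (hse n' n'.2)
      (hsym (Sum.inl n) (Sum.inl n')) ((hlead n).mul_conj (hlead n'))
    rw [haa, haa]
    exact this
  have hT : ∀ i j, ∃ ℓ, Tendsto (fun w => r w i * r w j * transformMatrix σ θ m y w i j)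
      (leftEnd L) (𝓝 ℓ) := by
    rintro (n | i) (n' | j)
    · exact ⟨_, hAA n n'⟩
    · obtain ⟨ℓ, h⟩ := exists_tendsto_rescaled_mixed hv.lt hv.nonneg hv.pos hv.le_one H (hse n n.2)
        (hsym (Sum.inl n) (Sum.inr j)) ((hlead n).mul_conj (hleadC j))
      refine ⟨ℓ, h.congr fun w => ?_⟩
      simp [hr, transformMatrix]
    · have h1 := (hleadC i).mul_conj (hlead n')
      rw [add_comm] at h1
      obtain ⟨ℓ, h⟩ := exists_tendsto_rescaled_mixed hv.lt hv.nonneg hv.pos hv.le_one H (hse n' n'.2)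
        (hsym (Sum.inr i) (Sum.inl n')) h1
      refine ⟨ℓ, h.congr fun w => ?_⟩
      simp [hr, transformMatrix]
    · obtain ⟨ℓ, h⟩ := exists_tendsto_regular_entry hv.lt hv.nonneg hv.pos hv.le_one H
        (hsym (Sum.inr i) (Sum.inr j)) ((hleadC i).mul_conj (hleadC j))
      refine ⟨ℓ, h.congr fun w => ?_⟩
      simp [hr, transformMatrix]
  have hex : ∀ i j, ∃ ℓ, Tendsto (fun w => (Matrix.diagonal (r w) * J' w *
      Matrix.diagonal (r w)) i j) (leftEnd L) (𝓝 ℓ) := by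
    intro i j
    obtain ⟨ℓ, h⟩ := hT i j
    obtain ⟨ρ, hρ⟩ := hrlim i
    obtain ⟨ρ', hρ'⟩ := hrlim j
    exact ⟨_, (h.add ((hρ.mul hρ').mul (hconst i j))).congr fun w => (hentry w i j).symm⟩
  choose M hM using hex
  have hMt : Tendsto (fun w => Matrix.diagonal (r w) * J' w * Matrix.diagonal (r w)) (leftEnd L)
      (𝓝 (Matrix.of M)) := tendsto_pi_nhds.2 fun i => tendsto_pi_nhds.2 fun j => hM i j
  have h11 : (Matrix.of M).toBlocks₁₁ =
      Matrix.of fun n n' : s => a n * (starRingEnd ℂ) (a n') * thresholdLimit σ θ m n n' := by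
    ext n n'
    have h1 := (hAA n n').add (((hrA n).mul (hrA n')).mul (hconst (Sum.inl n) (Sum.inl n')))
    rw [mul_zero, zero_mul, add_zero] at h1
    exact tendsto_nhds_unique (hM (Sum.inl n) (Sum.inl n'))
      (h1.congr fun w => (hentry w _ _).symm)
  have hdet11 : (Matrix.of M).toBlocks₁₁.det ≠ 0 := by
    rw [h11]; exact thresholdLimit_det_ne_zero H hse ha0
  have hmod : ∀ᶠ w in leftEnd L, ∀ n : s, 0 < thresholdModulus m n w := by
    filter_upwards [eventually_leftEnd_re (eventually_lt_atBot 0)] with w hw n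
    rw [thresholdModulus]
    split_ifs
    · exact inv_pos.2 (Real.sqrt_pos.2 (by linarith))
    · exact one_pos
  have hr0 : ∀ᶠ w in leftEnd L, ∀ i, r w i ≠ 0 := by
    filter_upwards [hmod] with w hw
    rintro (n | i)
    · exact mul_ne_zero (by exact_mod_cast (hw n).ne') (Complex.exp_ne_zero _)
    · exact one_ne_zero
  have hBH : IsUnit B.conjTranspose.det := by rw [Matrix.det_conjTranspose]; exact hB.star
  -- A singular M yields a vanishing perturbation that makes the matrix singular in adapted
  -- coordinates. Transported back by B⁻¹ and (B†)⁻¹, it still tends to 0 and contradicts the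
  -- hypothesis `hnc`.
  have hMdet : (Matrix.of M).det ≠ 0 := by
    intro h0
    obtain ⟨δ, hδ, hdet⟩ := exists_singular_perturbation hr0 (fun w i => rfl) hMt hdet11 h0
    refine hnc (fun w => (B⁻¹ * δ w * B.conjTranspose⁻¹).submatrix φ.symm φ.symm) ?_ ?_
    · have h1 := tendsto_matrix_mul (tendsto_matrix_mul
        (tendsto_const_nhds (x := B⁻¹) (f := leftEnd L)) hδ)
        (tendsto_const_nhds (x := B.conjTranspose⁻¹) (f := leftEnd L))
      rw [mul_zero, zero_mul] at h1
      refine tendsto_pi_nhds.2 fun i => tendsto_pi_nhds.2 fun j => ?_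
      exact tendsto_pi_nhds.1 (tendsto_pi_nhds.1 h1 (φ.symm i)) (φ.symm j)
    · filter_upwards [hdet] with w hw
      rw [← Matrix.det_submatrix_equiv_self φ]
      have e1 : (scatterMatrix σ θ m v R τ w + (B⁻¹ * δ w * B.conjTranspose⁻¹).submatrix
          φ.symm φ.symm).submatrix φ φ = Jφ w + B⁻¹ * δ w * B.conjTranspose⁻¹ := by
        ext i j; simp [hJφ]
      have e2 : J' w + δ w = B * (Jφ w + B⁻¹ * δ w * B.conjTranspose⁻¹) * B.conjTranspose := by
        simp only [hJ']
        rw [mul_add, add_mul, mul_assoc B⁻¹, Matrix.mul_nonsing_inv_cancel_left _ _ hB,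
          mul_assoc (δ w), Matrix.nonsing_inv_mul _ hBH, mul_one]
      rw [e2, Matrix.det_mul, Matrix.det_mul] at hw
      rw [e1]
      exact (mul_eq_zero.1 ((mul_eq_zero.1 hw).resolve_right hBH.ne_zero)).resolve_left hB.ne_zero
  -- the phase
  set μ : ℕ → ℝ := fun n => 1 - (2 * (n : ℝ) + 1) / m with hμ
  -- Positive factors are separated from the unimodular one, since only the phase matters: |det B|²,
  -- the squared moduli and e^{μ Re w} are positive, with μ the sum of the exponents.
  have hdetN : ∀ w, (Matrix.diagonal (r w) * J' w * Matrix.diagonal (r w)).det =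
      ((Complex.normSq B.det * (∏ n : s, thresholdModulus m n w) ^ 2 *
        Real.exp ((∑ n ∈ s, μ n) * w.re) : ℝ) : ℂ) *
      Complex.exp (-((-∑ n ∈ s, μ n : ℝ) * w.im) * Complex.I) *
        (scatterMatrix σ θ m v R τ w).det := by
    intro w
    have e1 : (J' w).det = (Complex.normSq B.det : ℂ) * (scatterMatrix σ θ m v R τ w).det := by
      rw [hJ', Matrix.det_mul, Matrix.det_mul, Matrix.det_conjTranspose, hJφ,
        Matrix.det_submatrix_equiv_self, ← Complex.mul_conj, Complex.star_def]
      ring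
    have e2 : ∏ i, r w i = ((∏ n : s, thresholdModulus m n w : ℝ) : ℂ) *
        Complex.exp (((∑ n ∈ s, μ n) / 2 : ℝ) * w) := by
      rw [Fintype.prod_sum_type]
      simp only [hr, Sum.elim_inl, Sum.elim_inr, Finset.prod_const_one, mul_one, thresholdRatio]
      rw [Finset.prod_mul_distrib, ← Complex.exp_sum]
      congr 1
      · push_cast; rfl
      · congr 1
        rw [← Finset.sum_mul]
        congr 1
        rw [← Finset.sum_coe_sort s, Finset.sum_div]
        push_cast
        refine Finset.sum_congr rfl fun n _ => ?_
        rw [hμ]; push_cast; ring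
    have e3 : Complex.exp (((∑ n ∈ s, μ n) / 2 : ℝ) * w) * Complex.exp (((∑ n ∈ s, μ n) / 2 : ℝ) * w) =
        (Real.exp ((∑ n ∈ s, μ n) * w.re) : ℂ) *
          Complex.exp (-((-∑ n ∈ s, μ n : ℝ) * w.im) * Complex.I) := by
      rw [Complex.ofReal_exp, ← Complex.exp_add, ← Complex.exp_add]
      congr 1
      conv_lhs => rw [← Complex.re_add_im w]
      push_cast; ring
    rw [Matrix.det_mul, Matrix.det_mul, Matrix.det_diagonal, e1, e2]
    rw [show ∀ x E N G : ℂ, x * E * (N * G) * (x * E) = N * x ^ 2 * (E * E) * G by intros; ring, e3]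
    push_cast; ring
  have hdetlim : Tendsto (fun w => (Matrix.diagonal (r w) * J' w * Matrix.diagonal (r w)).det)
      (leftEnd L) (𝓝 (Matrix.of M).det) :=
    ((continuous_id.matrix_det).tendsto _).comp hMt
  refine phaseLike_of_tendsto hMdet ?_ (hdetlim.congr hdetN)
  filter_upwards [hmod] with w hw
  have h1 : 0 < Complex.normSq B.det := Complex.normSq_pos.2 hB.ne_zero
  have h2 : 0 < ∏ n : s, thresholdModulus m n w := Finset.prod_pos fun n _ => hw n
  positivity

end coupling

/-! ### The argument principle for the Jost function -/

theorem differentiableOn_det {n : Type*} [Fintype n] [DecidableEq n] {M : ℂ → Matrix n n ℂ}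
    {s : Set ℂ} (h : ∀ i j, DifferentiableOn ℂ (fun w => M w i j) s) :
    DifferentiableOn ℂ (fun w => (M w).det) s := by
  simp only [Matrix.det_apply']
  exact DifferentiableOn.fun_sum fun σ _ =>
    (DifferentiableOn.fun_finsetProd fun i _ => h _ _).const_mul _

section scatter

variable {N : ℕ} {σ θ L m P Q α : ℝ} {v : ℝ → EuclideanSpace ℂ (Fin N)}
  {R : Matrix (Fin N) (Fin N) ℂ} {τ : ℂ}

theorem CouplingSymbols.continuous_scatterMatrix (hm : 1 < m) (hv : CouplingSymbols m P Q α v) :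
    Continuous (scatterMatrix σ θ m v R τ) := by
  obtain ⟨α', β, γ, hE, H⟩ := hv.exists_tame hm
  refine continuous_pi fun i => continuous_pi fun j => ?_
  obtain ⟨⟨C, hC⟩, C', hC'⟩ := H i j
  have h1 := continuous_dispersionTransform (σ := σ) (θ := θ) hE hC hC'
  simp only [scatterMatrix, Matrix.sub_apply, Matrix.add_apply, Matrix.smul_apply, transformMatrix,
    Matrix.of_apply]
  exact (h1.add continuous_const).sub
    ((continuous_const.mul Complex.continuous_exp).smul continuous_const)

theorem CouplingSymbols.differentiableOn_scatterMatrix (hm : 1 < m)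
    (hv : CouplingSymbols m P Q α v) (hθ : 0 ≤ θ) (hL : L + θ ≤ 2 * Real.pi) (i j : Fin N) :
    DifferentiableOn ℂ (fun w => scatterMatrix σ θ m v R τ w i j) (openStrip L) := by
  obtain ⟨α', β, γ, hE, H⟩ := hv.exists_tame hm
  obtain ⟨⟨C, hC⟩, C', hC'⟩ := H i j
  have h1 := differentiableOn_dispersionTransform (σ := σ) hθ hL hE hC hC'
  simp only [scatterMatrix, Matrix.sub_apply, Matrix.add_apply, Matrix.smul_apply, transformMatrix,
    Matrix.of_apply, smul_eq_mul]
  exact (h1.add_const _).sub (by fun_prop)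

theorem CouplingSymbols.tendsto_transformMatrix_rightEnd (hm : 1 < m)
    (hv : CouplingSymbols m P Q α v) (hθ : 0 ≤ θ) (hL : L + θ ≤ 2 * Real.pi) :
    Tendsto (transformMatrix σ θ m fun k i => v k i) (rightEnd L) (𝓝 0) := by
  obtain ⟨α', β, γ, hE, H⟩ := hv.exists_tame hm
  refine tendsto_pi_nhds.2 fun i => tendsto_pi_nhds.2 fun j => ?_
  obtain ⟨⟨C, hC⟩, C', hC'⟩ := H i j
  exact tendsto_dispersionTransform_rightEnd hθ hL hE hC hC'

/-- At infinity only the constant matrix R survives, so the determinant has a constant phase. -/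
theorem phaseLike_rightEnd_separable (hm : 1 < m) (hv : CouplingSymbols m P Q α v) (hθ : 0 ≤ θ)
    (hL : L + θ ≤ 2 * Real.pi) (hR : R.det ≠ 0) :
    PhaseLike (fun w => (scatterMatrix σ θ m v R 0 w).det) 0 (rightEnd L) := by
  have h1 := (hv.tendsto_transformMatrix_rightEnd (σ := σ) hm hθ hL).add_const R
  rw [zero_add] at h1
  have h2 := ((continuous_id.matrix_det).tendsto R).comp h1
  refine phaseLike_of_tendsto (p := fun _ => 1) hR (Eventually.of_forall fun _ => one_pos)
    (h2.congr fun w => ?_)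
  simp [scatterMatrix]

/-- Divided by ω the matrix tends to -1, so the determinant behaves like (-ω)^N. -/
theorem phaseLike_rightEnd_emitters (hm : 1 < m) (hv : CouplingSymbols m P Q α v) (hθ : 0 ≤ θ)
    (hL : L + θ ≤ 2 * Real.pi) :
    PhaseLike (fun w => (scatterMatrix σ θ m v R 1 w).det) N (rightEnd L) := by
  have h1 := (hv.tendsto_transformMatrix_rightEnd (σ := σ) hm hθ hL).add_const R
  have hexp : Tendsto (fun w : ℂ => Complex.exp (-w)) (rightEnd L) (𝓝 0) := by
    rw [tendsto_zero_iff_norm_tendsto_zero]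
    refine (Real.tendsto_exp_neg_atTop_nhds_zero.comp (tendsto_re_rightEnd (L := L))).congr
      fun w => ?_
    simp [Complex.norm_exp]
  have h2 := (hexp.smul h1).sub_const (1 : Matrix (Fin N) (Fin N) ℂ)
  rw [zero_smul, zero_sub] at h2
  have h3 := ((continuous_id.matrix_det).tendsto _).comp h2
  have h0 : (-1 : Matrix (Fin N) (Fin N) ℂ).det ≠ 0 := by
    rw [Matrix.det_neg]; simp
  refine phaseLike_of_tendsto (p := fun w => Real.exp (-(N * w.re))) h0
    (Eventually.of_forall fun _ => Real.exp_pos _) (h3.congr fun w => ?_)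
  have e1 : Complex.exp (-w) • (transformMatrix σ θ m (fun k i => v k i) w + R) - 1 =
      Complex.exp (-w) • scatterMatrix σ θ m v R 1 w := by
    rw [scatterMatrix, smul_sub, smul_smul, one_mul, ← Complex.exp_add, neg_add_cancel,
      Complex.exp_zero, one_smul]
  have e2 : Complex.exp (-w) ^ N =
      (Real.exp (-(N * w.re)) : ℂ) * Complex.exp (-((N : ℝ) * w.im) * Complex.I) := by
    rw [← Complex.exp_nat_mul, Complex.ofReal_exp, ← Complex.exp_add]
    congr 1
    conv_lhs => rw [← Complex.re_add_im w]
    push_cast; ring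
  simp only [Function.comp_apply, id_eq]
  rw [e1, Matrix.det_smul, Fintype.card_fin, e2]

/-- The winding of the Jost function along the edges of the strip. -/
theorem hasStripPhases_scatterMatrix {e : ℕ} (H : ThresholdCase σ θ L m e)
    (hv : CouplingSymbols m P Q α v) {a : ℝ}
    (hτ : (τ = 1 ∧ a = N) ∨ (τ = 0 ∧ a = 0 ∧ R.det ≠ 0))
    (hnc : ∀ δ : ℂ → Matrix (Fin N) (Fin N) ℂ, Tendsto δ (leftEnd L) (𝓝 0) →
      ¬ ∀ᶠ w in leftEnd L, (scatterMatrix σ θ m v R τ w + δ w).det = 0)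
    (hb : ∀ x : ℝ, (scatterMatrix σ θ m v R τ x).det ≠ 0)
    (ht : ∀ x : ℝ, (scatterMatrix σ θ m v R τ (x + L * Complex.I)).det ≠ 0) :
    {w | w ∈ openStrip L ∧ (scatterMatrix σ θ m v R τ w).det = 0}.Finite ∧
    HasStripPhases L (fun w => (scatterMatrix σ θ m v R τ w).det)
      ((a + ∑ n ∈ jumpSet (fun n => iteratedDeriv n v 0) e, (1 - (2 * (n : ℝ) + 1) / m)) * L -
        2 * Real.pi * (∑ᶠ w ∈ openStrip L,
          analyticOrderNatAt (fun w => (scatterMatrix σ θ m v R τ w).det) w : ℕ)) := by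
  have hm := H.one_lt
  have hl := phaseLike_leftEnd_det H hv R τ hnc
  have hr : PhaseLike (fun w => (scatterMatrix σ θ m v R τ w).det) a (rightEnd L) := by
    rcases hτ with ⟨rfl, rfl⟩ | ⟨rfl, rfl, hR⟩
    · exact phaseLike_rightEnd_emitters hm hv H.angle_nonneg H.width_add_le
    · exact phaseLike_rightEnd_separable hm hv H.angle_nonneg H.width_add_le hR
  have hc : ContinuousOn (fun w => (scatterMatrix σ θ m v R τ w).det) (closedStrip L) :=
    (hv.continuous_scatterMatrix hm).matrix_det.continuousOn
  have hd := differentiableOn_det fun i j =>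
    hv.differentiableOn_scatterMatrix (σ := σ) (R := R) (τ := τ) hm H.angle_nonneg H.width_add_le i j
  refine ⟨finite_zeros_openStrip H.width_pos hc hd hb ht hr hl, ?_⟩
  have := strip_phases H.width_pos hc hd hb ht hr hl
  rwa [sub_neg_eq_add] at this

end scatter

/-! ### The two dispersion relations -/

/-- The coefficient of the energy in the J-matrix. -/
def WaveguideScattering.Scatterer.energyCoeff {N : ℕ} : Scatterer N → ℂ
  | .emitters _ => 1
  | .separable _ => 0

theorem WaveguideScattering.Scatterer.energyTerm_eq {N : ℕ} (X : Scatterer N) (ω : ℂ) :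
    X.energyTerm ω = (X.energyCoeff * ω) • 1 := by
  cases X <;> simp [Scatterer.energyTerm, Scatterer.energyCoeff]

theorem WaveguideScattering.Scatterer.energyCoeff_cases {N : ℕ} (X : Scatterer N) :
    (X.energyCoeff = 1 ∧ (X.bareBoundStates : ℝ) = N) ∨
      (X.energyCoeff = 0 ∧ (X.bareBoundStates : ℝ) = 0 ∧ X.KR.det ≠ 0) := by
  cases X with
  | emitters KR => exact Or.inl ⟨rfl, rfl⟩
  | separable U =>
    refine Or.inr ⟨rfl, by simp [Scatterer.bareBoundStates], ?_⟩
    have h1 : IsUnit (U⁻¹ : Matrix.GeneralLinearGroup (Fin N) ℂ).val.det :=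
      (Matrix.isUnit_iff_isUnit_det _).1 (Units.isUnit _)
    simp only [Scatterer.KR, Matrix.det_neg]
    exact mul_ne_zero (by simp) h1.ne_zero

/-! ### From vanishing perturbations on the strip to criticality -/

section critical

variable {N : ℕ} {ε : ℝ → ℝ} {v : ℝ → EuclideanSpace ℂ (Fin N)} {X : Scatterer N}

theorem continuous_toEuclideanCLM :
    Continuous fun M : Matrix (Fin N) (Fin N) ℂ => Matrix.toEuclideanCLM (𝕜 := ℂ) M := by
  let T : Matrix (Fin N) (Fin N) ℂ →ₗ[ℂ]
      (EuclideanSpace ℂ (Fin N) →L[ℂ] EuclideanSpace ℂ (Fin N)) :=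
    { toFun := fun M => Matrix.toEuclideanCLM (𝕜 := ℂ) M
      map_add' := fun A B => map_add _ A B
      map_smul' := fun c A => map_smul _ c A }
  exact T.continuous_of_finiteDimensional

/-- Sampling along the midline of the strip at Re w = -n gives a sequence of energies off the
spectrum that tends to 0. The factor c covers the sign in the lower half-plane. -/
theorem isCritical_of_eventually_det_eq_zero {L : ℝ} (hL : 0 < L) {E : ℂ → ℂ}
    (hE : Tendsto E (leftEnd L) (𝓝 0)) {S δ : ℂ → Matrix (Fin N) (Fin N) ℂ} {c : ℂ}
    (hS : ∀ w ∈ openStrip L, E w ∉ range (fun k : ℝ => (ε k : ℂ)) ∧ JMatrix ε v X (E w) = c • S w)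
    (hδ : Tendsto δ (leftEnd L) (𝓝 0)) (h0 : ∀ᶠ w in leftEnd L, (S w + δ w).det = 0) :
    IsCritical ε v X := by
  set u : ℕ → ℂ := fun n => ((-(n : ℝ) : ℝ) : ℂ) + (L / 2 : ℝ) * Complex.I with hu
  have hu_im : ∀ n, u n ∈ openStrip L := by
    intro n
    have h1 : (u n).im = L / 2 := by simp [hu]
    rw [openStrip, mem_preimage, h1]
    constructor <;> linarith
  have hut : Tendsto u atTop (leftEnd L) :=
    (tendsto_line_leftEnd (L := L) (y := L / 2) ⟨by linarith, by linarith⟩).comp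
      (tendsto_neg_atTop_atBot.comp tendsto_natCast_atTop_atTop)
  obtain ⟨n₀, hn₀⟩ := eventually_atTop.1 (hut.eventually h0)
  have hut' : Tendsto (fun n => u (n + n₀)) atTop (leftEnd L) := hut.comp (tendsto_add_atTop_nat n₀)
  refine ⟨fun n => c • δ (u (n + n₀)), fun n => E (u (n + n₀)), ?_, hE.comp hut', fun n => ?_⟩
  · have h1 : Tendsto (fun n => c • δ (u (n + n₀))) atTop (𝓝 0) := by
      have := (hδ.comp hut').const_smul c
      rwa [smul_zero] at this
    have h2 := ((continuous_toEuclideanCLM (N := N)).norm.tendsto 0).comp h1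
    simp only [map_zero, norm_zero] at h2
    exact h2
  · obtain ⟨h1, h2⟩ := hS _ (hu_im (n + n₀))
    refine ⟨h1, ?_⟩
    rw [h2, ← smul_add, Matrix.det_smul, hn₀ _ (Nat.le_add_left _ _), mul_zero]

end critical

/-! ### Boundary values on the real energy axis -/

section boundary

theorem tendsto_log_boundary {a : ℝ} (ha : a ≠ 0) :
    Tendsto (fun η : ℝ => Complex.log (a + η * Complex.I)) (𝓝[>] 0) (𝓝 (Complex.log a)) := by
  have h1 : Tendsto (fun η : ℝ => (a : ℂ) + η * Complex.I) (𝓝[>] 0) (𝓝 a) := by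
    have : Continuous fun η : ℝ => (a : ℂ) + η * Complex.I := by fun_prop
    have h2 := this.tendsto 0
    simp only [Complex.ofReal_zero, zero_mul, add_zero] at h2
    exact h2.mono_left nhdsWithin_le_nhds
  rcases lt_or_gt_of_ne ha with h | h
  · have h2 := Complex.continuousWithinAt_log_of_re_neg_of_im_zero (z := a) (by simpa using h) (by simp)
    refine h2.tendsto.comp (tendsto_nhdsWithin_iff.2 ⟨h1, ?_⟩)
    filter_upwards [self_mem_nhdsWithin] with η hη
    simpa using (mem_Ioi.1 hη).le
  · exact (continuousAt_clog (Or.inl (by simpa using h))).tendsto.comp h1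

theorem log_mem_openStrip (a : ℝ) {η : ℝ} (hη : 0 < η) :
    Complex.log (a + η * Complex.I) ∈ openStrip Real.pi ∧
      Complex.exp (Complex.log (a + η * Complex.I)) = a + η * Complex.I := by
  have him : ((a : ℂ) + η * Complex.I).im = η := by simp
  constructor
  · rw [openStrip, mem_preimage, Complex.log_im]
    constructor
    · refine lt_of_le_of_ne (Complex.arg_nonneg_iff.2 (by rw [him]; exact hη.le)) fun h => ?_
      have := (Complex.arg_eq_zero_iff.1 h.symm).2
      rw [him] at this; exact hη.ne' this
    · refine lt_of_le_of_ne (Complex.arg_le_pi _) fun h => ?_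
      have := (Complex.arg_eq_pi_iff.1 h).2
      rw [him] at this; exact hη.ne' this
  · refine Complex.exp_log fun h => ?_
    have := congrArg Complex.im h
    rw [him] at this; exact hη.ne' this

/-- The principal logarithm is continuous up to the real axis from above, at negative energies as
well, and S is continuous up to the edges. Thus E + i0 is read off on the edge point log E. -/
theorem tendsto_boundary {N : ℕ} {F S : ℂ → Matrix (Fin N) (Fin N) ℂ} {κ c : ℂ}
    (hS : ∀ w ∈ openStrip Real.pi, F (κ * Complex.exp w) = c • S w) (hc : Continuous S) {a : ℝ}
    (ha : a ≠ 0) :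
    Tendsto (fun η : ℝ => F (κ * (a + η * Complex.I))) (𝓝[>] 0) (𝓝 (c • S (Complex.log a))) := by
  have h1 := ((hc.tendsto _).comp (tendsto_log_boundary ha)).const_smul c
  refine h1.congr' ?_
  filter_upwards [self_mem_nhdsWithin] with η hη
  obtain ⟨h2, h3⟩ := log_mem_openStrip a (mem_Ioi.1 hη)
  rw [Function.comp_apply, ← hS _ h2, h3]

end boundary

/-! ### Multiplicities under the change of variable -/

section orders

theorem analyticOrderNatAt_const_mul {G : ℂ → ℂ} {z c : ℂ} (hc : c ≠ 0) (hG : AnalyticAt ℂ G z) :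
    analyticOrderNatAt (fun w => c * G w) z = analyticOrderNatAt G z := by
  have h1 : analyticOrderAt (fun _ : ℂ => c) z = 0 :=
    (analyticAt_const.analyticOrderAt_eq_zero).2 hc
  have h2 := analyticOrderAt_mul (analyticAt_const (v := c)) hG
  rw [h1, zero_add] at h2
  rw [analyticOrderNatAt, analyticOrderNatAt, ← h2]
  rfl

/-- An injective analytic map with nonzero derivative preserves the orders of zeros, and so does a
nonzero constant factor. -/
theorem finsum_analyticOrderNatAt_image {G J E : ℂ → ℂ} {U : Set ℂ} (hU : IsOpen U) {c : ℂ}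
    (hc : c ≠ 0) (hE : ∀ w ∈ U, AnalyticAt ℂ E w ∧ deriv E w ≠ 0) (hinj : InjOn E U)
    (hG : DifferentiableOn ℂ G U) (hJ : ∀ w ∈ U, J (E w) = c * G w) :
    ∑ᶠ w ∈ U, analyticOrderNatAt G w = ∑ᶠ ω ∈ E '' U, analyticOrderNatAt J ω := by
  refine finsum_mem_eq_of_bijOn E hinj.bijOn_image fun w hw => ?_
  rw [← analyticOrderNatAt_const_mul hc (hG.analyticAt (hU.mem_nhds hw)), analyticOrderNatAt,
    analyticOrderNatAt, ← analyticOrderAt_comp_of_deriv_ne_zero (hE w hw).1 (hE w hw).2]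
  congr 1
  refine analyticOrderAt_congr ?_
  filter_upwards [hU.mem_nhds hw] with z hz
  exact (hJ z hz).symm

theorem injOn_exp_openStrip {L : ℝ} (hL : L ≤ 2 * Real.pi) : InjOn Complex.exp (openStrip L) := by
  intro z hz w hw h
  obtain ⟨h1, h2⟩ : 0 < z.im ∧ z.im < L := hz
  obtain ⟨h3, h4⟩ : 0 < w.im ∧ w.im < L := hw
  obtain ⟨n, hn⟩ := Complex.exp_eq_exp_iff_exists_int.1 h
  have him := congrArg Complex.im hn
  simp only [Complex.add_im, Complex.mul_im, Complex.intCast_re, Complex.intCast_im,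
    Complex.re_ofNat, Complex.im_ofNat, Complex.ofReal_re, Complex.ofReal_im, Complex.I_re,
    Complex.I_im, Complex.mul_re] at him
  have hpi := Real.pi_pos
  have hn0 : n = 0 := by
    have e : z.im = w.im + n * (2 * Real.pi) := by rw [him]; ring
    have a1 : (n : ℝ) < 1 := by
      by_contra h5
      rw [not_lt] at h5
      nlinarith
    have a2 : (-1 : ℝ) < n := by
      by_contra h5
      rw [not_lt] at h5
      nlinarith
    have a3 : n < 1 := by exact_mod_cast a1
    have a4 : -1 < n := by exact_mod_cast a2
    omega
  rw [hn, hn0]; simp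

end orders

/-! ### Independence of the choice of phase -/

section phases

/-- Two phases of the same function differ by an integer multiple of π at each energy, and on a
connected set the integer is constant. One explicit phase therefore suffices, with a separate
constant on each half-line. -/
theorem exists_const_of_isScatteringPhase {S : ℝ → ℂ} {s : Set ℝ} (hs : IsPreconnected s)
    (hne : s.Nonempty) (h0 : ∀ E ∈ s, S E ≠ 0) {δ δ' : ℝ → ℝ} (hδ : IsScatteringPhase S s δ)
    (hδ' : IsScatteringPhase S s δ') : ∃ c, ∀ E ∈ s, δ' E = δ E + c := by
  obtain ⟨E₀, hE₀⟩ := hne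
  have hint : ∀ E ∈ s, ∃ n : ℤ, δ' E - δ E = n * Real.pi := by
    intro E hE
    have h1 := hδ.2 E hE
    rw [hδ'.2 E hE] at h1
    have hn : (‖S E‖ : ℂ) ≠ 0 := by exact_mod_cast norm_ne_zero_iff.2 (h0 E hE)
    have hn' : ‖(‖S E‖ : ℂ) * Complex.exp (2 * Complex.I * (δ' E : ℂ))‖ = ‖S E‖ := by
      rw [← hδ'.2 E hE]
    rw [hn'] at h1
    have h2 := mul_left_cancel₀ hn h1
    obtain ⟨n, hn⟩ := Complex.exp_eq_exp_iff_exists_int.1 h2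
    refine ⟨n, ?_⟩
    have h3 : ((δ' E - δ E : ℝ) : ℂ) = ((n * Real.pi : ℝ) : ℂ) := by
      have h4 : 2 * Complex.I * (δ' E - δ E : ℂ) = 2 * Complex.I * (n * Real.pi) := by
        linear_combination hn
      push_cast
      exact mul_left_cancel₀ (by simp) h4
    exact_mod_cast h3
  have hT : IsDiscrete (range ((↑) : ℤ → ℝ)) :=
    isDiscrete_iff_discreteTopology.2 (by
      exact Int.isClosedEmbedding_coe_real.isEmbedding.toHomeomorph.symm.isEmbedding.discreteTopology)
  refine ⟨δ' E₀ - δ E₀, fun E hE => ?_⟩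
  have hpi := Real.pi_pos
  have := hs.constant_of_mapsTo hT (f := fun E => (δ' E - δ E) / Real.pi)
    ((hδ'.1.sub hδ.1).div_const _) (fun E hE => by
      obtain ⟨n, hn⟩ := hint E hE
      refine ⟨n, ?_⟩
      simp only [hn]; field_simp) hE hE₀
  rw [div_left_inj' hpi.ne'] at this
  linarith

theorem hasPhaseChange_congr_add_const {δ δ' : ℝ → ℝ} {l₁ l₂ : Filter ℝ} {Δ c : ℝ} {s : Set ℝ}
    (h : HasPhaseChange δ l₁ l₂ Δ) (hs₁ : s ∈ l₁) (hs₂ : s ∈ l₂) (hc : ∀ E ∈ s, δ' E = δ E + c) :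
    HasPhaseChange δ' l₁ l₂ Δ := by
  obtain ⟨a, b, ha, hb, rfl⟩ := h
  refine ⟨a + c, b + c, (ha.add_const c).congr' ?_, (hb.add_const c).congr' ?_, by ring⟩
  · filter_upwards [hs₁] with E hE using (hc E hE).symm
  · filter_upwards [hs₂] with E hE using (hc E hE).symm

theorem hasTotalWindingSym_of_phase {S : ℝ → ℂ} {δ : ℝ → ℝ} {Δ : ℝ} (h0 : ∀ E, 0 < E → S E ≠ 0)
    (hδ : IsScatteringPhase S (Ioi 0) δ) (h : HasPhaseChange δ (𝓝[>] 0) atTop Δ) :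
    HasTotalWindingSym S Δ := by
  refine ⟨⟨δ, hδ⟩, fun δ' hδ' => ?_⟩
  obtain ⟨c, hc⟩ := exists_const_of_isScatteringPhase isPreconnected_Ioi nonempty_Ioi h0 hδ hδ'
  exact hasPhaseChange_congr_add_const h self_mem_nhdsWithin (Ioi_mem_atTop 0) hc

theorem hasTotalWindingAnti_of_phase {S : ℝ → ℂ} {δ : ℝ → ℝ} {Δ₁ Δ₂ : ℝ} (h0 : ∀ E, E ≠ 0 → S E ≠ 0)
    (hδ : IsScatteringPhase S (Iio 0 ∪ Ioi 0) δ) (h₁ : HasPhaseChange δ atBot (𝓝[<] 0) Δ₁)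
    (h₂ : HasPhaseChange δ (𝓝[>] 0) atTop Δ₂) : HasTotalWindingAnti S (Δ₁ + Δ₂) := by
  have hmono : ∀ {δ : ℝ → ℝ}, IsScatteringPhase S (Iio 0 ∪ Ioi 0) δ →
      IsScatteringPhase S (Iio 0) δ ∧ IsScatteringPhase S (Ioi 0) δ := fun h =>
    ⟨⟨h.1.mono subset_union_left, fun E hE => h.2 E (Or.inl hE)⟩,
      ⟨h.1.mono subset_union_right, fun E hE => h.2 E (Or.inr hE)⟩⟩
  refine ⟨⟨δ, hδ⟩, fun δ' hδ' => ⟨Δ₁, Δ₂, ?_, ?_, rfl⟩⟩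
  · obtain ⟨c, hc⟩ := exists_const_of_isScatteringPhase isPreconnected_Iio nonempty_Iio
      (fun E hE => h0 E (mem_Iio.1 hE).ne) (hmono hδ).1 (hmono hδ').1
    exact hasPhaseChange_congr_add_const h₁ (Iio_mem_atBot 0) self_mem_nhdsWithin hc
  · obtain ⟨c, hc⟩ := exists_const_of_isScatteringPhase isPreconnected_Ioi nonempty_Ioi
      (fun E hE => h0 E (mem_Ioi.1 hE).ne') (hmono hδ).2 (hmono hδ').2
    exact hasPhaseChange_congr_add_const h₂ self_mem_nhdsWithin (Ioi_mem_atTop 0) hc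

end phases

/-! ### Threshold data of the two dispersion relations -/

section cases

variable {m : ℝ}

theorem natFloor_half_bounds (hm : 1 < m) :
    2 * ((⌊(m - 1) / 2⌋₊ : ℕ) : ℝ) + 1 ≤ m ∧ m < 2 * ((⌊(m - 1) / 2⌋₊ : ℕ) : ℝ) + 3 := by
  have h1 := Nat.floor_le (show 0 ≤ (m - 1) / 2 by linarith)
  have h2 := Nat.lt_floor_add_one ((m - 1) / 2)
  constructor <;> linarith

/-- All orders with 2n + 1 ≤ m are rescaled, the borderline one by the square root of the logarithm.
Definiteness is checked at ω = -1, where -1/(ω - |k|^m) is positive. -/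
theorem thresholdCase_sym (hm : 1 < m) :
    ThresholdCase 1 0 (2 * Real.pi) m (⌊(m - 1) / 2⌋₊ + 1) := by
  obtain ⟨h1, h2⟩ := natFloor_half_bounds hm
  have hm0 : 0 < m := by linarith
  have hpi := Real.pi_pos
  refine ⟨hm, le_rfl, by positivity, by simp, by push_cast; linarith, fun n hn => ?_,
    fun _ _ _ => ⟨rfl, rfl⟩, fun h => ?_, ?_⟩
  · have : (n : ℝ) ≤ (⌊(m - 1) / 2⌋₊ : ℕ) := by exact_mod_cast Nat.lt_succ_iff.1 hn
    linarith
  · push_cast at h; linarith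
  · have hw : (Real.pi * Complex.I) ∈ openStrip (2 * Real.pi) := by
      simp only [openStrip, mem_preimage, Complex.mul_im, Complex.ofReal_re, Complex.I_im, mul_one,
        Complex.ofReal_im, Complex.I_re, mul_zero, add_zero, mem_Ioo]
      constructor <;> linarith
    refine ⟨_, hw, -1, fun k => (-1 - (symDispersion m k : ℂ))⁻¹, fun k => ?_, fun d hd => ?_⟩
    · have h3 : 0 ≤ symDispersion m k := Real.rpow_nonneg (abs_nonneg k) m
      have : -1 * (-1 - (symDispersion m k : ℂ))⁻¹ = (((1 + symDispersion m k)⁻¹ : ℝ) : ℂ) := by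
        rw [neg_one_mul, ← inv_neg]; push_cast; ring_nf
      rw [this, Complex.ofReal_re]
      positivity
    · obtain ⟨α, β, γ, C, C', hE, hC, hC'⟩ := tame_pow hm0 hd 1
      simp only [one_mul] at hC hC'
      obtain ⟨i1, i2⟩ := dispersionTransform_sym hm0 hE hC hC' hw
      simp only [Complex.exp_pi_mul_I, div_eq_mul_inv] at i1 i2
      exact ⟨i1, i2.symm⟩

/-- A borderline order 2n + 1 = m is left out of the rescaling, because its diagonal entry
converges. Definiteness is checked at ω = i, where the real part of i/(i - ε) is 1/(1 + ε²). -/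
theorem exists_thresholdCase_anti (hm : 1 < m) :
    ∃ e, ThresholdCase (-1) Real.pi Real.pi m e ∧ e ≤ ⌊(m - 1) / 2⌋₊ + 1 ∧
      ∀ n, e ≤ n → n < ⌊(m - 1) / 2⌋₊ + 1 → 2 * (n : ℝ) + 1 = m := by
  obtain ⟨h1, h2⟩ := natFloor_half_bounds hm
  have hm0 : 0 < m := by linarith
  have hpi := Real.pi_pos
  have hdef : ∃ w₀ ∈ openStrip Real.pi, ∃ (μ : ℂ) (h : ℝ → ℂ), (∀ k, 0 < (μ * h k).re) ∧
      ∀ d : ℕ, (d : ℝ) + 1 < m → Integrable (fun k : ℝ => (k : ℂ) ^ d * h k) ∧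
        dispersionTransform (-1) Real.pi m (fun k => (k : ℂ) ^ d) w₀ =
          ∫ k : ℝ, (k : ℂ) ^ d * h k := by
    have hw : (Real.pi / 2 * Complex.I) ∈ openStrip Real.pi := by
      have : ((Real.pi : ℂ) / 2 * Complex.I) = ((Real.pi / 2 : ℝ) : ℂ) * Complex.I := by push_cast; rfl
      rw [this]
      simp only [openStrip, mem_preimage, Complex.mul_im, Complex.ofReal_re, Complex.I_im, mul_one,
        Complex.ofReal_im, Complex.I_re, mul_zero, add_zero, mem_Ioo]
      constructor <;> linarith
    refine ⟨_, hw, Complex.I, fun k => (Complex.I - (antiDispersion m k : ℂ))⁻¹, fun k => ?_,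
      fun d hd => ?_⟩
    · have h3 : (Complex.I * (Complex.I - (antiDispersion m k : ℂ))⁻¹).re =
          (1 + antiDispersion m k ^ 2)⁻¹ := by
        simp only [Complex.mul_re, Complex.I_re, Complex.I_im, Complex.inv_im, Complex.normSq_apply,
          Complex.sub_re, Complex.sub_im, Complex.ofReal_re, Complex.ofReal_im]
        rw [inv_eq_one_div]
        ring_nf
      rw [h3]; positivity
    · obtain ⟨α, β, γ, C, C', hE, hC, hC'⟩ := tame_pow hm0 hd 1
      simp only [one_mul] at hC hC'
      obtain ⟨i1, i2⟩ := dispersionTransform_anti hm0 hE hC hC' hw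
      rw [Complex.exp_pi_div_two_mul_I] at i1 i2
      simp only [div_eq_mul_inv] at i1 i2 ⊢
      exact ⟨i1, i2.symm⟩
  by_cases hb : 2 * ((⌊(m - 1) / 2⌋₊ : ℕ) : ℝ) + 1 = m
  · refine ⟨⌊(m - 1) / 2⌋₊, ⟨hm, hpi.le, hpi, by linarith, hb.ge, fun n hn => ?_, fun n hn h => ?_,
      fun _ => ⟨rfl, rfl, rfl⟩, hdef⟩, Nat.le_succ _, fun n h3 h4 => ?_⟩
    · have : (n : ℝ) + 1 ≤ (⌊(m - 1) / 2⌋₊ : ℕ) := by exact_mod_cast hn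
      linarith
    · have : (n : ℝ) + 1 ≤ (⌊(m - 1) / 2⌋₊ : ℕ) := by exact_mod_cast hn
      linarith
    · rw [show n = ⌊(m - 1) / 2⌋₊ by omega]; exact hb
  · have hle : ∀ n : ℕ, n < ⌊(m - 1) / 2⌋₊ + 1 → (n : ℝ) ≤ (⌊(m - 1) / 2⌋₊ : ℕ) := fun n hn => by
      exact_mod_cast Nat.lt_succ_iff.1 hn
    refine ⟨⌊(m - 1) / 2⌋₊ + 1, ⟨hm, hpi.le, hpi, by linarith, by push_cast; linarith,
      fun n hn => by linarith [hle n hn], fun n hn h => ?_, fun _ => ⟨rfl, rfl, rfl⟩, hdef⟩, le_rfl,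
      fun n h3 h4 => by omega⟩
    have := (h1.lt_of_ne hb)
    linarith [hle n hn]

variable {N : ℕ} {v : ℝ → EuclideanSpace ℂ (Fin N)}

theorem integerSet_eq_jumpSet :
    integerSet m v = jumpSet (fun n => iteratedDeriv n v 0) (⌊(m - 1) / 2⌋₊ + 1) := rfl

theorem sum_integerSet (hm : 1 < m) :
    ∑ n ∈ integerSet m v, (1 - (2 * (n : ℝ) + 1) / m) = antiNR m v / m := by
  have hm0 : m ≠ 0 := by linarith
  rw [Finset.sum_sub_distrib, antiNR, orderSum, sub_div, mul_div_assoc, div_self hm0,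
    ← Finset.sum_div]
  simp

theorem symNR_eq_antiNR : symNR m v = antiNR m v := by
  have h1 : (integerSet m v).filter (fun n => Odd n) =
      (integerSet m v).filter fun n => ¬ Even n := by
    ext n; simp
  have h2 := Finset.sum_filter_add_sum_filter_not (integerSet m v) (fun n => Even n)
    fun n => 2 * n + 1
  rw [symNR, antiNR, h1, sub_sub]
  congr 1
  rw [← Nat.cast_add]
  congr 1

/-- The borderline order that was left out would contribute 1 - (2n + 1)/m = 0. -/
theorem sum_jumpSet_anti (hm : 1 < m) {e : ℕ} (he : e ≤ ⌊(m - 1) / 2⌋₊ + 1)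
    (hb : ∀ n, e ≤ n → n < ⌊(m - 1) / 2⌋₊ + 1 → 2 * (n : ℝ) + 1 = m) :
    ∑ n ∈ jumpSet (fun n => iteratedDeriv n v 0) e, (1 - (2 * (n : ℝ) + 1) / m) =
      antiNR m v / m := by
  have hm0 : m ≠ 0 := by linarith
  rw [← sum_integerSet hm, integerSet_eq_jumpSet]
  refine Finset.sum_subset (fun n hn => ?_) fun n hn hn' => ?_
  · rw [mem_jumpSet] at hn ⊢
    exact ⟨hn.1.trans_le he, hn.2⟩
  · rw [mem_jumpSet] at hn hn'
    have h1 : e ≤ n := by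
      by_contra h
      exact hn' ⟨not_le.1 h, hn.2⟩
    rw [hb n h1 hn.1, div_self hm0, sub_self]

/-- Reflection multiplies the Taylor coefficient of order n by (-1)^n and leaves all spans
unchanged, so the two half-planes have the same threshold exponent. -/
theorem jumpSet_comp_neg (e : ℕ) :
    jumpSet (fun n => iteratedDeriv n (fun k => v (-k)) 0) e =
      jumpSet (fun n => iteratedDeriv n v 0) e := by
  have h1 : ∀ n, iteratedDeriv n (fun k => v (-k)) 0 = ((-1 : ℂ) ^ n) • iteratedDeriv n v 0 := by
    intro n
    rw [iteratedDeriv_comp_neg, neg_zero]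
    rcases Nat.even_or_odd n with h | h <;> simp [h.neg_one_pow]
  have hu : ∀ n, IsUnit ((-1 : ℂ) ^ n) := fun n => IsUnit.pow n (by simp)
  have h2 : ∀ n, Submodule.span ℂ ((fun j => iteratedDeriv j (fun k => v (-k)) 0) '' Iio n) =
      Submodule.span ℂ ((fun j => iteratedDeriv j v 0) '' Iio n) := by
    intro n
    refine le_antisymm (Submodule.span_le.2 ?_) (Submodule.span_le.2 ?_)
    · rintro _ ⟨j, hj, rfl⟩
      simp only [h1]
      exact Submodule.smul_mem _ _ (Submodule.subset_span ⟨j, hj, rfl⟩)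
    · rintro _ ⟨j, hj, rfl⟩
      rw [SetLike.mem_coe, ← Submodule.smul_mem_iff_of_isUnit _ (hu j)]
      exact Submodule.subset_span ⟨j, hj, h1 j⟩
  ext n
  rw [mem_jumpSet, mem_jumpSet, h2, h1, Submodule.smul_mem_iff_of_isUnit _ (hu n)]

theorem CouplingSymbols.comp_neg {P Q α : ℝ} (hv : CouplingSymbols m P Q α v) :
    CouplingSymbols m P Q α fun k => v (-k) := by
  refine ⟨?_, hv.lt, hv.nonneg, hv.pos, hv.le_one, ?_⟩
  · have h1 : AnalyticAt ℝ (fun k : ℝ => -k) 0 := by fun_prop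
    exact AnalyticAt.comp (g := v) (f := fun k : ℝ => -k) (by simpa using hv.analytic) h1
  · rintro f g ⟨T, rfl⟩ ⟨T', rfl⟩
    exact (hv.symbol ⟨T, rfl⟩ ⟨T', rfl⟩).comp_neg

end cases

/-! ### Symmetric dispersion -/

theorem boundStateCount_eq_finsum_compl {N : ℕ} (ε : ℝ → ℝ) (v : ℝ → EuclideanSpace ℂ (Fin N))
    (X : Scatterer N) : boundStateCount ε v X =
      ∑ᶠ ω ∈ (range fun k : ℝ => (ε k : ℂ))ᶜ, analyticOrderNatAt (jost ε v X) ω := by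
  refine finsum_mem_inter_support_eq' _ _ _ fun ω hω => ⟨fun h => h.1, fun h => ⟨h, ?_⟩⟩
  exact apply_eq_zero_of_analyticOrderNatAt_ne_zero hω

theorem div_eq_norm_mul_exp {z w : ℂ} {a b : ℝ} (hz : z = ‖z‖ * Complex.exp (a * Complex.I))
    (hw : w = ‖w‖ * Complex.exp (b * Complex.I)) :
    w / z = ‖w / z‖ * Complex.exp (2 * Complex.I * (((b - a) / 2 : ℝ) : ℂ)) := by
  have e : Complex.exp (2 * Complex.I * (((b - a) / 2 : ℝ) : ℂ)) =
      Complex.exp (b * Complex.I) / Complex.exp (a * Complex.I) := by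
    rw [← Complex.exp_sub]; congr 1; push_cast; ring
  rw [e, norm_div, Complex.ofReal_div, div_mul_div_comm, ← hz, ← hw]

section sym

variable {N : ℕ} {m P Q α : ℝ} {v : ℝ → EuclideanSpace ℂ (Fin N)}

theorem compl_range_symDispersion (hm : 0 < m) :
    (range fun k : ℝ => (symDispersion m k : ℂ))ᶜ = Complex.exp '' openStrip (2 * Real.pi) := by
  have h1 : (range fun k : ℝ => (symDispersion m k : ℂ)) = ((↑) : ℝ → ℂ) '' Ici (0 : ℝ) := by
    ext ω
    constructor
    · rintro ⟨k, rfl⟩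
      exact ⟨_, Real.rpow_nonneg (abs_nonneg k) m, rfl⟩
    · rintro ⟨x, hx, rfl⟩
      refine ⟨x ^ (1 / m), ?_⟩
      have hx' : 0 ≤ x := hx
      simp only [symDispersion]
      rw [abs_of_nonneg (Real.rpow_nonneg hx' _), ← Real.rpow_mul hx', one_div_mul_cancel hm.ne',
        Real.rpow_one]
  rw [h1]
  ext ω
  constructor
  · intro hω
    have h0 : ω ≠ 0 := fun h => hω ⟨0, self_mem_Ici, by simp [h]⟩
    -- This is the branch of the logarithm cut along [0, ∞), with imaginary part in (0, 2π).
    refine ⟨Complex.log (-ω) + Real.pi * Complex.I, ?_, ?_⟩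
    · have him : (Complex.log (-ω) + Real.pi * Complex.I).im = (-ω).arg + Real.pi := by
        simp [Complex.log_im]
      rw [openStrip, mem_preimage, him]
      refine ⟨by linarith [Complex.neg_pi_lt_arg (-ω)], ?_⟩
      have : (-ω).arg < Real.pi := by
        refine lt_of_le_of_ne (Complex.arg_le_pi _) fun h => hω ?_
        obtain ⟨h2, h3⟩ := Complex.arg_eq_pi_iff.1 h
        simp only [Complex.neg_re, Complex.neg_im] at h2 h3
        exact ⟨ω.re, mem_Ici.2 (by linarith), Complex.ext (by simp) (by simp; linarith)⟩
      linarith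
    · rw [Complex.exp_add, Complex.exp_log (neg_ne_zero.2 h0), Complex.exp_pi_mul_I]; ring
  · rintro ⟨w, hw, rfl⟩
    exact exp_mem_compl_Ici hw

theorem CouplingSymbols.JMatrix_sym_exp (hm : 1 < m) (hv : CouplingSymbols m P Q α v)
    (X : Scatterer N) {w : ℂ} (hw : w ∈ openStrip (2 * Real.pi)) :
    JMatrix (symDispersion m) v X (Complex.exp w) =
      scatterMatrix 1 0 m v X.KR X.energyCoeff w := by
  obtain ⟨α', β, γ, hE, H⟩ := hv.exists_tame hm
  rw [JMatrix, X.energyTerm_eq, scatterMatrix]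
  congr 2
  ext i j
  obtain ⟨⟨C, hC⟩, C', hC'⟩ := H i j
  exact (dispersionTransform_sym (by linarith) hE hC hC' hw).2

theorem CouplingSymbols.JPlus_sym (hm : 1 < m) (hv : CouplingSymbols m P Q α v)
    (X : Scatterer N) {E : ℝ} (hE : 0 < E) : JPlus (symDispersion m) v X E =
      scatterMatrix 1 0 m v X.KR X.energyCoeff (Real.log E) := by
  have h1 := tendsto_boundary (F := JMatrix (symDispersion m) v X) (κ := 1) (c := 1)
    (S := scatterMatrix 1 0 m v X.KR X.energyCoeff) (fun w hw => by
      rw [one_mul, one_smul, hv.JMatrix_sym_exp hm X ⟨hw.1, hw.2.trans (by linarith [Real.pi_pos])⟩])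
    (hv.continuous_scatterMatrix hm) hE.ne'
  simp only [one_mul, one_smul] at h1
  rw [JPlus, h1.limUnder_eq, Complex.ofReal_log hE.le]

/-- Each half-line contributes its Plemelj jump 2πi ρ(E) v(±k_E) v(±k_E)†. The parity combinations
have the same sum of rank-one matrices, which exhibits the jump as a product of an N × 2 and a 2 × N
matrix. -/
theorem scatterMatrix_add_two_pi (R : Matrix (Fin N) (Fin N) ℂ) (τ : ℂ) {E : ℝ}
    (hE : 0 < E) : scatterMatrix 1 0 m v R τ (Real.log E + (2 * Real.pi : ℝ) * Complex.I) =
      scatterMatrix 1 0 m v R τ (Real.log E) +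
        ((2 * Real.pi * Complex.I * ((|E| ^ (1 / m - 1) / m : ℝ) : ℂ)) •
          Matrix.of fun i a => parityCoupling v (|E| ^ (1 / m)) a i) *
            (Matrix.of fun i a => parityCoupling v (|E| ^ (1 / m)) a i).conjTranspose := by
  have e1 : ∀ c : ℝ, Real.exp (c * Real.log E) = |E| ^ c := fun c => by
    rw [abs_of_pos hE, Real.rpow_def_of_pos hE, mul_comm]
  have e2 : (Real.log E + (2 * Real.pi : ℝ) * Complex.I : ℂ) =
      Real.log E + 2 * Real.pi * Complex.I := by push_cast; ring
  have h2 : ((Real.sqrt 2 : ℝ) : ℂ) * (Real.sqrt 2 : ℝ) = 2 := by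
    rw [← Complex.ofReal_mul, Real.mul_self_sqrt (by norm_num)]; norm_num
  have h20 : ((Real.sqrt 2 : ℝ) : ℂ) ≠ 0 := by
    intro h; rw [h] at h2; norm_num at h2
  ext i j
  simp only [scatterMatrix, Matrix.add_apply, Matrix.sub_apply, transformMatrix, Matrix.of_apply,
    dispersionTransform, e2, Complex.ofReal_zero, zero_mul, add_zero, logCauchy_add_two_pi,
    Complex.ofReal_re, Matrix.smul_mul, Matrix.smul_apply, Matrix.mul_apply, Fin.sum_univ_two,
    Matrix.conjTranspose_apply, logDensity, logPullback, e1, parityCoupling, Complex.exp_add,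
    Complex.exp_two_pi_mul_I]
  simp only [Fin.val_zero, Fin.val_one, pow_zero, pow_one, one_mul, smul_eq_mul, star_div₀, star_add,
    star_mul', star_neg, star_one, Complex.star_def, Complex.conj_ofReal, Complex.ofReal_div,
    Complex.ofReal_one, mul_one]
  have key : ∀ a b c d s : ℂ, s * s = 2 → s ≠ 0 → (a + b) / s * ((c + d) / s) +
      (a + -1 * b) / s * ((c + -1 * d) / s) = a * c + b * d := by
    intro a b c d s hs hs0
    rw [div_mul_div_comm, div_mul_div_comm, hs]; ring
  rw [key _ _ _ _ _ h2 h20]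
  ring

/-- The identity det(A + UV) = det A det(1 + V A⁻¹ U) reduces the quotient of N × N determinants to
a 2 × 2 one, which is the transpose of the S-matrix. -/
theorem CouplingSymbols.det_symSMatrix (hm : 1 < m) (hv : CouplingSymbols m P Q α v)
    (X : Scatterer N) {E : ℝ} (hE : 0 < E)
    (h0 : (scatterMatrix 1 0 m v X.KR X.energyCoeff (Real.log E)).det ≠ 0) :
    (symSMatrix m v X E).det =
      (scatterMatrix 1 0 m v X.KR X.energyCoeff (Real.log E + (2 * Real.pi : ℝ) * Complex.I)).det /
        (scatterMatrix 1 0 m v X.KR X.energyCoeff (Real.log E)).det := by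
  rw [scatterMatrix_add_two_pi _ _ hE, Matrix.det_add_mul _ _ (isUnit_iff_ne_zero.2 h0),
    mul_div_cancel_left₀ _ h0, ← Matrix.det_transpose]
  congr 1
  ext a b
  simp only [symSMatrix, hv.JPlus_sym hm X hE, Matrix.transpose_apply, Matrix.of_apply,
    Matrix.add_apply, Matrix.mul_smul, Matrix.smul_apply, smul_eq_mul, Matrix.mul_assoc]
  rw [← Matrix.transpose_apply (1 : Matrix (Fin 2) (Fin 2) ℂ), Matrix.transpose_one]
  rfl

/-- The absence of bound states in the continuum says that det J has no zero on the lower edge, and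
S ≠ 0 adds the upper edge. The phase δ is half the difference of the two edge phases at log E. -/
theorem levinson_sym (hm : 1 < m) (hv : AdmissibleCoupling m v) (X : Scatterer N)
    (hnc : ¬ IsCritical (symDispersion m) v X)
    (hbic : ∀ E : ℝ, 0 < E → ¬ IsBoundStateInContinuum (symDispersion m) v X E)
    (hS : ∀ E : ℝ, 0 < E → (symSMatrix m v X E).det ≠ 0) :
    (boundStates (symDispersion m) v X).Finite ∧
      HasTotalWindingSym (fun E => (symSMatrix m v X E).det)
        (Real.pi * (deltaN (symDispersion m) v X : ℝ) + Real.pi * (symNR m v / m)) := by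
  obtain ⟨P, Q, α, hv⟩ := exists_couplingSymbols hv
  have hm0 : 0 < m := by linarith
  have hpi := Real.pi_pos
  have hb : ∀ x : ℝ, (scatterMatrix 1 0 m v X.KR X.energyCoeff x).det ≠ 0 := fun x => by
    have h1 := hbic _ (Real.exp_pos x)
    rwa [IsBoundStateInContinuum, hv.JPlus_sym hm X (Real.exp_pos x), Real.log_exp] at h1
  have hquot := fun {E : ℝ} (hE : 0 < E) => hv.det_symSMatrix hm X hE (hb (Real.log E))
  have ht : ∀ x : ℝ, (scatterMatrix 1 0 m v X.KR X.energyCoeff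
      (x + (2 * Real.pi : ℝ) * Complex.I)).det ≠ 0 := fun x => by
    have h1 := hS _ (Real.exp_pos x)
    rw [hquot (Real.exp_pos x), Real.log_exp] at h1
    exact (div_ne_zero_iff.1 h1).1
  have hE : Tendsto Complex.exp (leftEnd (2 * Real.pi)) (𝓝 0) := by
    simpa using tendsto_exp_leftEnd (L := 2 * Real.pi) one_pos
  have hcompl := compl_range_symDispersion hm0
  have hcrit : ∀ δ : ℂ → Matrix (Fin N) (Fin N) ℂ, Tendsto δ (leftEnd (2 * Real.pi)) (𝓝 0) →
      ¬ ∀ᶠ w in leftEnd (2 * Real.pi),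
        (scatterMatrix 1 0 m v X.KR X.energyCoeff w + δ w).det = 0 := fun δ hδ h =>
    hnc (isCritical_of_eventually_det_eq_zero (c := 1) (by positivity) hE (fun w hw =>
      ⟨by rw [← mem_compl_iff, hcompl]; exact mem_image_of_mem _ hw,
        by rw [one_smul]; exact hv.JMatrix_sym_exp hm X hw⟩) hδ h)
  obtain ⟨a, ha, hτ⟩ : ∃ a : ℝ, (X.bareBoundStates : ℝ) = a ∧
      ((X.energyCoeff = 1 ∧ a = N) ∨ (X.energyCoeff = 0 ∧ a = 0 ∧ X.KR.det ≠ 0)) :=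
    ⟨_, rfl, X.energyCoeff_cases⟩
  obtain ⟨hfin, θ₀, θ₁, a₀, b₀, a₁, b₁, hc₀, hc₁, hp₀, hp₁, la₀, lb₀, la₁, lb₁, hT⟩ :=
    hasStripPhases_scatterMatrix (thresholdCase_sym hm) hv hτ hcrit hb ht
  have hdet : ∀ w ∈ openStrip (2 * Real.pi), jost (symDispersion m) v X (Complex.exp w) =
      1 * (scatterMatrix 1 0 m v X.KR X.energyCoeff w).det := fun w hw => by
    rw [one_mul, jost, hv.JMatrix_sym_exp hm X hw]
  have hcount := finsum_analyticOrderNatAt_image (isOpen_openStrip _) one_ne_zero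
    (fun w _ => ⟨Complex.differentiable_exp.analyticAt w, by
      rw [Complex.deriv_exp]; exact Complex.exp_ne_zero w⟩) (injOn_exp_openStrip le_rfl)
    (differentiableOn_det fun i j => hv.differentiableOn_scatterMatrix (σ := 1) (R := X.KR)
      (τ := X.energyCoeff) hm le_rfl (by simp) i j) hdet
  rw [← hcompl, ← boundStateCount_eq_finsum_compl] at hcount
  refine ⟨(hfin.image Complex.exp).subset ?_, ?_⟩
  · rintro ω ⟨h1, h2⟩
    rw [← mem_compl_iff, hcompl] at h1
    obtain ⟨w, hw, rfl⟩ := h1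
    refine ⟨w, ⟨hw, ?_⟩, rfl⟩
    rwa [hdet w hw, one_mul] at h2
  · refine hasTotalWindingSym_of_phase hS (δ := fun E => (θ₁ (Real.log E) - θ₀ (Real.log E)) / 2)
      ⟨?_, fun E hE => ?_⟩ ⟨(a₁ - a₀) / 2, (b₁ - b₀) / 2, ?_, ?_, ?_⟩
    · have hl : ContinuousOn Real.log (Ioi 0) := Real.continuousOn_log.mono fun x hx =>
        (mem_Ioi.1 hx).ne'
      exact ((hc₁.comp_continuousOn hl).sub (hc₀.comp_continuousOn hl)).div_const 2
    · simp only [hquot hE]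
      exact div_eq_norm_mul_exp (hp₀ _) (hp₁ _)
    · exact ((la₁.comp Real.tendsto_log_nhdsGT_zero).sub
        (la₀.comp Real.tendsto_log_nhdsGT_zero)).div_const 2
    · exact ((lb₁.comp Real.tendsto_log_atTop).sub (lb₀.comp Real.tendsto_log_atTop)).div_const 2
    -- With width 2π, half the total winding is π times the sum of both exponents minus π times the
    -- number of zeros.
    · rw [← integerSet_eq_jumpSet, sum_integerSet hm, hcount] at hT
      rw [symNR_eq_antiNR, deltaN]
      push_cast
      rw [ha]
      linear_combination hT / 2

end sym

/-! ### Antisymmetric dispersion -/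

section anti

variable {N : ℕ} {m P Q α : ℝ} {v : ℝ → EuclideanSpace ℂ (Fin N)}

theorem antiDispersion_neg (m k : ℝ) : antiDispersion m (-k) = -antiDispersion m k := by
  rw [antiDispersion, antiDispersion, abs_neg, Real.sign_neg, neg_mul]

theorem range_antiDispersion (hm : 0 < m) :
    (range fun k : ℝ => (antiDispersion m k : ℂ)) = {ω | ω.im = 0} := by
  have hpos : ∀ x : ℝ, 0 < x → antiDispersion m (x ^ (1 / m)) = x := fun x hx => by
    have h1 := Real.rpow_pos_of_pos hx (1 / m)
    rw [antiDispersion, Real.sign_of_pos h1, one_mul, abs_of_pos h1, ← Real.rpow_mul hx.le,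
      one_div_mul_cancel hm.ne', Real.rpow_one]
  ext ω
  constructor
  · rintro ⟨k, rfl⟩; simp
  · intro h
    obtain ⟨k, hk⟩ : ∃ k, antiDispersion m k = ω.re := by
      rcases lt_trichotomy ω.re 0 with h0 | h0 | h0
      · refine ⟨-(-ω.re) ^ (1 / m), ?_⟩
        rw [antiDispersion_neg, hpos _ (by linarith), neg_neg]
      · exact ⟨0, by simp [antiDispersion, h0]⟩
      · exact ⟨_, hpos _ h0⟩
    exact ⟨k, Complex.ext (by simp [hk]) (by simpa using h.symm)⟩

theorem image_exp_openStrip_pi : Complex.exp '' openStrip Real.pi = {ω | 0 < ω.im} := by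
  ext ω
  constructor
  · rintro ⟨w, ⟨h1, h2⟩, rfl⟩
    rw [mem_ofPred_eq, Complex.exp_im]
    exact mul_pos (Real.exp_pos _) (Real.sin_pos_of_pos_of_lt_pi h1 h2)
  · intro h
    obtain ⟨h1, h2⟩ := log_mem_openStrip ω.re h
    exact ⟨_, h1, by rw [h2, Complex.re_add_im]⟩

theorem image_mul_exp_openStrip_pi (κ : ℂ) :
    (fun w => κ * Complex.exp w) '' openStrip Real.pi = (fun ω => κ * ω) '' {ω | 0 < ω.im} := by
  rw [← image_exp_openStrip_pi, image_image]

theorem compl_range_antiDispersion (hm : 0 < m) :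
    (range fun k : ℝ => (antiDispersion m k : ℂ))ᶜ =
      (fun w => 1 * Complex.exp w) '' openStrip Real.pi ∪
        (fun w => -1 * Complex.exp w) '' openStrip Real.pi := by
  rw [range_antiDispersion hm, image_mul_exp_openStrip_pi, image_mul_exp_openStrip_pi]
  ext ω
  simp only [mem_compl_iff, mem_ofPred_eq, mem_union, mem_image]
  constructor
  · intro h
    rcases lt_or_gt_of_ne h with h | h
    · exact Or.inr ⟨-ω, by simpa using h, by ring⟩
    · exact Or.inl ⟨ω, h, by ring⟩
  · rintro (⟨z, hz, rfl⟩ | ⟨z, hz, rfl⟩)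
    · simpa using hz.ne'
    · simpa using hz.ne'

theorem disjoint_image_exp_openStrip_pi :
    Disjoint ((fun w => 1 * Complex.exp w) '' openStrip Real.pi)
      ((fun w => -1 * Complex.exp w) '' openStrip Real.pi) := by
  rw [image_mul_exp_openStrip_pi, image_mul_exp_openStrip_pi, Set.disjoint_left]
  rintro _ ⟨z, hz, rfl⟩ ⟨z', hz', h⟩
  have := congrArg Complex.im h
  simp only [one_mul, neg_mul, Complex.neg_im] at this
  rw [mem_ofPred_eq] at hz hz'
  linarith

theorem CouplingSymbols.JMatrix_anti_exp (hm : 1 < m) (hv : CouplingSymbols m P Q α v)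
    (X : Scatterer N) {w : ℂ} (hw : w ∈ openStrip Real.pi) :
    JMatrix (antiDispersion m) v X (1 * Complex.exp w) =
      (1 : ℂ) • scatterMatrix (-1) Real.pi m v X.KR X.energyCoeff w := by
  obtain ⟨α', β, γ, hE, H⟩ := hv.exists_tame hm
  rw [JMatrix, X.energyTerm_eq, scatterMatrix, one_mul, one_smul]
  congr 2
  ext i j
  obtain ⟨⟨C, hC⟩, C', hC'⟩ := H i j
  exact (dispersionTransform_anti (by linarith) hE hC hC' hw).2

/-- The substitution k ↦ -k changes the sign of ε, so the lower half-plane problem at -e^w is, up to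
an overall sign, the upper half-plane problem for v(-k) and -K^R. -/
theorem CouplingSymbols.JMatrix_anti_neg_exp (hm : 1 < m) (hv : CouplingSymbols m P Q α v)
    (X : Scatterer N) {w : ℂ} (hw : w ∈ openStrip Real.pi) :
    JMatrix (antiDispersion m) v X (-1 * Complex.exp w) =
      (-1 : ℂ) • scatterMatrix (-1) Real.pi m (fun k => v (-k)) (-X.KR) X.energyCoeff w := by
  obtain ⟨α', β, γ, hE, H⟩ := hv.comp_neg.exists_tame hm
  have h1 : selfEnergy (antiDispersion m) v (-1 * Complex.exp w) =
      -transformMatrix (-1) Real.pi m (fun k i => v (-k) i) w := by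
    ext i j
    obtain ⟨⟨C, hC⟩, C', hC'⟩ := H i j
    have h2 := (dispersionTransform_anti (by linarith) hE hC hC' hw).2
    rw [Matrix.neg_apply, transformMatrix, Matrix.of_apply, ← h2, ← integral_neg, selfEnergy,
      Matrix.of_apply, ← integral_neg_eq_self]
    congr 1 with k
    rw [antiDispersion_neg, ← div_neg]
    congr 1
    push_cast; ring
  rw [JMatrix, X.energyTerm_eq, scatterMatrix, h1, neg_one_smul]
  have h3 : (X.energyCoeff * (-1 * Complex.exp w)) • (1 : Matrix (Fin N) (Fin N) ℂ) =
      -((X.energyCoeff * Complex.exp w) • 1) := by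
    rw [← neg_smul]; congr 1; ring
  rw [h3]; abel

theorem CouplingSymbols.JPlus_anti (hm : 1 < m) (hv : CouplingSymbols m P Q α v)
    (X : Scatterer N) {E : ℝ} (hE : E ≠ 0) : JPlus (antiDispersion m) v X E =
      scatterMatrix (-1) Real.pi m v X.KR X.energyCoeff (Complex.log E) := by
  have h1 := tendsto_boundary (fun w hw => hv.JMatrix_anti_exp hm X hw)
    (hv.continuous_scatterMatrix hm) hE
  simp only [one_mul, one_smul] at h1
  rw [JPlus, h1.limUnder_eq]

theorem CouplingSymbols.JMinus_anti (hm : 1 < m) (hv : CouplingSymbols m P Q α v)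
    (X : Scatterer N) {E : ℝ} (hE : E ≠ 0) : JMinus (antiDispersion m) v X E = (-1 : ℂ) •
      scatterMatrix (-1) Real.pi m (fun k => v (-k)) (-X.KR) X.energyCoeff
        (Complex.log (-E : ℝ)) := by
  have h1 := tendsto_boundary (fun w hw => hv.JMatrix_anti_neg_exp hm X hw)
    (hv.comp_neg.continuous_scatterMatrix hm) (neg_ne_zero.2 hE)
  rw [JMinus, ← h1.limUnder_eq]
  congr 1 with η
  congr 1
  push_cast; ring

theorem log_ofReal_of_neg {E : ℝ} (hE : E < 0) :
    Complex.log E = Real.log E + Real.pi * Complex.I := by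
  rw [Complex.log, Complex.arg_ofReal_of_neg hE, Complex.norm_real, Real.norm_eq_abs, Real.log_abs]

/-- The winding of the Jost function along the boundary of one of the two half-planes `κ Im ω > 0`,
with `κ = ± 1`. -/
theorem hasStripPhases_halfPlane (hm : 1 < m) {X : Scatterer N}
    (hnc : ¬ IsCritical (antiDispersion m) v X) {κ : ℂ} (hκ : κ ≠ 0)
    (hrange : ∀ w ∈ openStrip Real.pi,
      κ * Complex.exp w ∉ range fun k : ℝ => (antiDispersion m k : ℂ))
    {u : ℝ → EuclideanSpace ℂ (Fin N)} (hu : CouplingSymbols m P Q α u)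
    (hjump : ∀ e, jumpSet (fun n => iteratedDeriv n u 0) e =
      jumpSet (fun n => iteratedDeriv n v 0) e)
    {R : Matrix (Fin N) (Fin N) ℂ} {τ : ℂ} {a : ℝ}
    (hτ : (τ = 1 ∧ a = N) ∨ (τ = 0 ∧ a = 0 ∧ R.det ≠ 0))
    (hJ : ∀ w ∈ openStrip Real.pi, JMatrix (antiDispersion m) v X (κ * Complex.exp w) =
      κ • scatterMatrix (-1) Real.pi m u R τ w)
    (hb : ∀ x : ℝ, (scatterMatrix (-1) Real.pi m u R τ x).det ≠ 0)
    (ht : ∀ x : ℝ, (scatterMatrix (-1) Real.pi m u R τ (x + Real.pi * Complex.I)).det ≠ 0) :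
    ((fun w => κ * Complex.exp w) '' openStrip Real.pi ∩
        {ω | jost (antiDispersion m) v X ω = 0}).Finite ∧
      HasStripPhases Real.pi (fun w => (scatterMatrix (-1) Real.pi m u R τ w).det)
        ((a + antiNR m v / m) * Real.pi - 2 * Real.pi *
          (∑ᶠ ω ∈ (fun w => κ * Complex.exp w) '' openStrip Real.pi,
            analyticOrderNatAt (jost (antiDispersion m) v X) ω : ℕ)) := by
  have hpi := Real.pi_pos
  obtain ⟨e, He, he, hborder⟩ := exists_thresholdCase_anti hm
  have hE : Tendsto (fun w => κ * Complex.exp w) (leftEnd Real.pi) (𝓝 0) := by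
    have := (tendsto_exp_leftEnd (L := Real.pi) one_pos).const_mul κ
    simpa using this
  have hcrit : ∀ δ : ℂ → Matrix (Fin N) (Fin N) ℂ, Tendsto δ (leftEnd Real.pi) (𝓝 0) →
      ¬ ∀ᶠ w in leftEnd Real.pi, (scatterMatrix (-1) Real.pi m u R τ w + δ w).det = 0 :=
    fun δ hδ h => hnc (isCritical_of_eventually_det_eq_zero hpi hE
      (fun w hw => ⟨hrange w hw, hJ w hw⟩) hδ h)
  obtain ⟨hfin, hphase⟩ := hasStripPhases_scatterMatrix He hu hτ hcrit hb ht
  have hκN : κ ^ N ≠ 0 := pow_ne_zero N hκ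
  have hdet : ∀ w ∈ openStrip Real.pi, jost (antiDispersion m) v X (κ * Complex.exp w) =
      κ ^ N * (scatterMatrix (-1) Real.pi m u R τ w).det := fun w hw => by
    rw [jost, hJ w hw, Matrix.det_smul, Fintype.card_fin]
  have hcount := finsum_analyticOrderNatAt_image (E := fun w => κ * Complex.exp w)
    (isOpen_openStrip _) hκN
    (fun w _ => ⟨(Complex.differentiable_exp.const_mul κ).analyticAt w, by
      rw [deriv_const_mul_field, Complex.deriv_exp]
      exact mul_ne_zero hκ (Complex.exp_ne_zero w)⟩)
    (fun z hz w hw h => injOn_exp_openStrip (by linarith) hz hw (mul_left_cancel₀ hκ h))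
    (differentiableOn_det fun i j => hu.differentiableOn_scatterMatrix (σ := -1) (R := R)
      (τ := τ) hm hpi.le (by linarith) i j) hdet
  rw [hjump, sum_jumpSet_anti hm he hborder, hcount] at hphase
  refine ⟨(hfin.image fun w => κ * Complex.exp w).subset ?_, hphase⟩
  rintro _ ⟨⟨w, hw, rfl⟩, h⟩
  rw [mem_ofPred_eq, hdet w hw] at h
  exact ⟨w, ⟨hw, (mul_eq_zero.1 h).resolve_left hκN⟩, rfl⟩

theorem neg_one_pow_mul_eq {w : ℂ} {b : ℝ} (n : ℕ) (hw : w = ‖w‖ * Complex.exp (b * Complex.I)) :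
    (-1) ^ n * w = ‖(-1) ^ n * w‖ * Complex.exp ((b + n * Real.pi : ℝ) * Complex.I) := by
  have h1 : Complex.exp ((b + n * Real.pi : ℝ) * Complex.I) =
      Complex.exp (b * Complex.I) * (-1) ^ n := by
    rw [← Complex.exp_pi_mul_I, ← Complex.exp_nat_mul, ← Complex.exp_add]
    congr 1; push_cast; ring
  rw [h1, norm_mul, norm_pow, norm_neg, norm_one, one_pow, one_mul, ← mul_assoc, ← hw, mul_comm]

/-- Each half-plane gives one strip of width π with the same exponents. For E > 0, S compares the
upper edge of the reflected strip with the lower edge of the direct one; for E < 0 it compares the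
lower edge of the former with the upper edge of the latter. The two changes add up to half the sum
of the two strip windings. -/
theorem levinson_anti (hm : 1 < m) (hv : AdmissibleCoupling m v) (X : Scatterer N)
    (hnc : ¬ IsCritical (antiDispersion m) v X)
    (hbic : ∀ E : ℝ, E ≠ 0 → ¬ IsBoundStateInContinuum (antiDispersion m) v X E)
    (hS : ∀ E : ℝ, E ≠ 0 → antiS m v X E ≠ 0) :
    (boundStates (antiDispersion m) v X).Finite ∧
      HasTotalWindingAnti (antiS m v X)
        (Real.pi * (deltaN (antiDispersion m) v X : ℝ) + Real.pi * (antiNR m v / m)) := by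
  obtain ⟨P, Q, α, hv⟩ := exists_couplingSymbols hv
  have hm0 : 0 < m := by linarith
  have hcompl := compl_range_antiDispersion hm0
  obtain ⟨a, ha, hτ⟩ : ∃ a : ℝ, (X.bareBoundStates : ℝ) = a ∧
      ((X.energyCoeff = 1 ∧ a = N) ∨ (X.energyCoeff = 0 ∧ a = 0 ∧ X.KR.det ≠ 0)) :=
    ⟨_, rfl, X.energyCoeff_cases⟩
  have hτ' : (X.energyCoeff = 1 ∧ a = N) ∨ (X.energyCoeff = 0 ∧ a = 0 ∧ (-X.KR).det ≠ 0) :=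
    hτ.imp_right fun h => ⟨h.1, h.2.1, by rw [Matrix.det_neg]; exact mul_ne_zero (by simp) h.2.2⟩
  set up : ℂ → ℂ := fun w =>
    (scatterMatrix (-1) Real.pi m v X.KR X.energyCoeff w).det with hup
  set dn : ℂ → ℂ := fun w =>
    (scatterMatrix (-1) Real.pi m (fun k => v (-k)) (-X.KR) X.energyCoeff w).det with hdn
  have hplus : ∀ E : ℝ, E ≠ 0 → (JPlus (antiDispersion m) v X E).det = up (Complex.log E) :=
    fun E hE => by rw [hv.JPlus_anti hm X hE]
  have hminus : ∀ E : ℝ, E ≠ 0 → (JMinus (antiDispersion m) v X E).det =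
      (-1) ^ N * dn (Complex.log (-E : ℝ)) := fun E hE => by
    rw [hv.JMinus_anti hm X hE, Matrix.det_smul, Fintype.card_fin]
  have hup0 : ∀ E : ℝ, E ≠ 0 → up (Complex.log E) ≠ 0 := fun E hE => by
    rw [← hplus E hE]; exact hbic E hE
  have hdn0 : ∀ E : ℝ, E ≠ 0 → dn (Complex.log (-E : ℝ)) ≠ 0 := fun E hE => by
    have h1 := hS E hE
    rw [antiS, hminus E hE] at h1
    exact right_ne_zero_of_mul (div_ne_zero_iff.1 h1).1
  have hlog : ∀ x : ℝ, Complex.log (Real.exp x : ℝ) = x ∧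
      Complex.log (-Real.exp x : ℝ) = x + Real.pi * Complex.I := fun x => by
    constructor
    · rw [← Complex.ofReal_log (Real.exp_pos x).le, Real.log_exp]
    · rw [log_ofReal_of_neg (neg_lt_zero.2 (Real.exp_pos x)), Real.log_neg_eq_log, Real.log_exp]
  have hexp : ∀ x : ℝ, Real.exp x ≠ 0 := Real.exp_ne_zero
  obtain ⟨hfu, θ₀, θ₁, a₀, b₀, a₁, b₁, hc₀, hc₁, hp₀, hp₁, la₀, lb₀, la₁, lb₁, hT⟩ :=
    hasStripPhases_halfPlane hm hnc one_ne_zero (fun w hw => by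
      rw [← mem_compl_iff, hcompl]; exact Or.inl ⟨w, hw, rfl⟩) hv (fun _ => rfl) hτ
      (fun w hw => hv.JMatrix_anti_exp hm X hw)
      (fun x => by have := hup0 _ (hexp x); rwa [(hlog x).1] at this)
      (fun x => by have := hup0 _ (neg_ne_zero.2 (hexp x)); rwa [(hlog x).2] at this)
  obtain ⟨hfd, φ₀, φ₁, c₀, d₀, c₁, d₁, hk₀, hk₁, hq₀, hq₁, lc₀, ld₀, lc₁, ld₁, hT'⟩ :=
    hasStripPhases_halfPlane hm hnc (neg_ne_zero.2 one_ne_zero) (fun w hw => by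
      rw [← mem_compl_iff, hcompl]; exact Or.inr ⟨w, hw, rfl⟩) hv.comp_neg jumpSet_comp_neg hτ'
      (fun w hw => hv.JMatrix_anti_neg_exp hm X hw)
      (fun x => by
        have := hdn0 _ (neg_ne_zero.2 (hexp x)); rwa [neg_neg, (hlog x).1] at this)
      (fun x => by have := hdn0 _ (hexp x); rwa [(hlog x).2] at this)
  have hcount : boundStateCount (antiDispersion m) v X =
      (∑ᶠ ω ∈ (fun w => 1 * Complex.exp w) '' openStrip Real.pi,
        analyticOrderNatAt (jost (antiDispersion m) v X) ω) +
      ∑ᶠ ω ∈ (fun w => -1 * Complex.exp w) '' openStrip Real.pi,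
        analyticOrderNatAt (jost (antiDispersion m) v X) ω := by
    rw [boundStateCount_eq_finsum_compl, hcompl]
    refine finsum_mem_union' disjoint_image_exp_openStrip_pi (hfu.subset ?_) (hfd.subset ?_) <;>
    exact fun ω h => ⟨h.1, apply_eq_zero_of_analyticOrderNatAt_ne_zero h.2⟩
  have hSpos : ∀ E : ℝ, 0 < E → antiS m v X E =
      ((-1) ^ N * dn (Real.log E + Real.pi * Complex.I)) / up (Real.log E) := fun E hE => by
    rw [antiS, hminus E hE.ne', hplus E hE.ne', log_ofReal_of_neg (neg_lt_zero.2 hE),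
      Real.log_neg_eq_log, ← Complex.ofReal_log hE.le]
  have hSneg : ∀ E : ℝ, E < 0 → antiS m v X E =
      ((-1) ^ N * dn (Real.log E)) / up (Real.log E + Real.pi * Complex.I) := fun E hE => by
    rw [antiS, hminus E hE.ne, hplus E hE.ne, log_ofReal_of_neg hE,
      ← Complex.ofReal_log (neg_pos.2 hE).le, Real.log_neg_eq_log]
  -- The term Nπ accounts for the factor (-1)^N that the overall sign of J in the lower half-plane
  -- produces in the determinant. It cancels in the phase changes.
  set δ : ℝ → ℝ := fun E => if 0 < E then (φ₁ (Real.log E) + N * Real.pi - θ₀ (Real.log E)) / 2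
    else (φ₀ (Real.log E) + N * Real.pi - θ₁ (Real.log E)) / 2 with hδ
  have hδpos : ∀ E : ℝ, 0 < E →
      (φ₁ (Real.log E) + N * Real.pi - θ₀ (Real.log E)) / 2 = δ E := fun E hE => (if_pos hE).symm
  have hδneg : ∀ E : ℝ, E < 0 →
      (φ₀ (Real.log E) + N * Real.pi - θ₁ (Real.log E)) / 2 = δ E := fun E hE =>
    (if_neg hE.le.not_gt).symm
  have hlogn : Tendsto Real.log (𝓝[<] 0) atBot :=
    Real.tendsto_log_nhdsNE_zero.mono_left (nhdsWithin_mono _ fun x hx => (mem_Iio.1 hx).ne)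
  have hlogb : Tendsto Real.log atBot atTop :=
    (Real.tendsto_log_atTop.comp tendsto_neg_atBot_atTop).congr fun x => by simp
  have hdiff : ∀ {f g : ℝ → ℝ} {x y : ℝ} {l l' : Filter ℝ}, Tendsto f l (𝓝 x) →
      Tendsto g l (𝓝 y) → Tendsto Real.log l' l → Tendsto (fun E : ℝ =>
        (f (Real.log E) + N * Real.pi - g (Real.log E)) / 2) l' (𝓝 ((x + N * Real.pi - y) / 2)) :=
    fun hf hg hl => (((hf.comp hl).add_const _).sub (hg.comp hl)).div_const 2
  refine ⟨(hfu.union hfd).subset ?_, ?_⟩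
  · rintro ω ⟨h1, h2⟩
    rw [← mem_compl_iff, hcompl] at h1
    exact h1.imp (fun h => ⟨h, h2⟩) fun h => ⟨h, h2⟩
  -- On the negative half-line E → -∞ is the right end of the strips and E → 0⁻ the left end, so the
  -- difference runs from the d, b limits to the c, a limits.
  · have hΔ : Real.pi * (deltaN (antiDispersion m) v X : ℝ) + Real.pi * (antiNR m v / m) =
        ((c₀ + N * Real.pi - a₁) / 2 - (d₀ + N * Real.pi - b₁) / 2) +
          ((d₁ + N * Real.pi - b₀) / 2 - (c₁ + N * Real.pi - a₀) / 2) := by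
      rw [deltaN, hcount]
      push_cast
      rw [ha]
      linear_combination -hT / 2 - hT' / 2
    rw [hΔ]
    refine hasTotalWindingAnti_of_phase hS (δ := δ) ⟨?_, ?_⟩ ⟨_, _, ?_, ?_, rfl⟩ ⟨_, _, ?_, ?_, rfl⟩
    · have hcont : ∀ {f g : ℝ → ℝ} {s : Set ℝ}, Continuous f → Continuous g → (∀ x ∈ s, x ≠ 0) →
          ContinuousOn (fun E : ℝ =>
            (f (Real.log E) + N * Real.pi - g (Real.log E)) / 2) s := fun hf hg hs => by
        have hl := Real.continuousOn_log.mono hs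
        exact (((hf.comp_continuousOn hl).add continuousOn_const).sub
          (hg.comp_continuousOn hl)).div_const 2
      refine ContinuousOn.union_of_isOpen ?_ ?_ isOpen_Iio isOpen_Ioi
      · exact (hcont hk₀ hc₁ fun x hx => (mem_Iio.1 hx).ne).congr fun E hE => (hδneg E hE).symm
      · exact (hcont hk₁ hc₀ fun x hx => (mem_Ioi.1 hx).ne').congr fun E hE => (hδpos E hE).symm
    · rintro E (hE | hE)
      · rw [hSneg E hE, ← hδneg E hE]
        exact div_eq_norm_mul_exp (hp₁ _) (neg_one_pow_mul_eq N (hq₀ _))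
      · rw [hSpos E hE, ← hδpos E hE]
        exact div_eq_norm_mul_exp (hp₀ _) (neg_one_pow_mul_eq N (hq₁ _))
    · exact (hdiff ld₀ lb₁ hlogb).congr' ((eventually_lt_atBot 0).mono hδneg)
    · exact (hdiff lc₀ la₁ hlogn).congr' (eventually_mem_nhdsWithin.mono hδneg)
    · exact (hdiff lc₁ la₀ Real.tendsto_log_nhdsGT_zero).congr'
        (eventually_mem_nhdsWithin.mono hδpos)
    · exact (hdiff ld₁ lb₀ Real.tendsto_log_atTop).congr' ((eventually_gt_atTop 0).mono hδpos)

end anti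

/-- The generalized Levinson theorem for both dispersion relations. -/
theorem mainTheorem3 {N : ℕ} (m : ℝ) (hm : 1 < m)
    (v : ℝ → EuclideanSpace ℂ (Fin N)) (hv : AdmissibleCoupling m v) (X : Scatterer N) :
    (¬ IsCritical (antiDispersion m) v X →
      (∀ E : ℝ, E ≠ 0 → ¬ IsBoundStateInContinuum (antiDispersion m) v X E) →
      (∀ E : ℝ, E ≠ 0 → antiS m v X E ≠ 0) →
        (boundStates (antiDispersion m) v X).Finite ∧
        HasTotalWindingAnti (antiS m v X)
          (Real.pi * (deltaN (antiDispersion m) v X : ℝ) + Real.pi * (antiNR m v / m))) ∧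
    (¬ IsCritical (symDispersion m) v X →
      (∀ E : ℝ, 0 < E → ¬ IsBoundStateInContinuum (symDispersion m) v X E) →
      (∀ E : ℝ, 0 < E → (symSMatrix m v X E).det ≠ 0) →
        (boundStates (symDispersion m) v X).Finite ∧
        HasTotalWindingSym (fun E => (symSMatrix m v X E).det)
          (Real.pi * (deltaN (symDispersion m) v X : ℝ) + Real.pi * (symNR m v / m))) :=
  ⟨levinson_anti hm hv X, levinson_sym hm hv X⟩
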